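/- **Setting.** Let $d\in\mathbb N$, let $\mathcal I$ be a set of convolution kernels with regularities $\kappa_G\in\mathbb R$ ($G\in\mathcal I$), and let $\Xi$ be a set of noises, where $\alpha_X\in\mathbb R$ is the regularity of the path of the noise $X\in\Xi$. Let $\mathfrak T$ be the real vector space with basis the planar rooted trees whose vertices $x$ carry decorations $n_x\in\mathbb N^d$ and whose edges carry decorations in $(\mathcal I\cup\Xi)\times\mathbb N^d$, such that each vertex has at most one outgoing noise edge (an edge decorated by some $X\in\Xi$) and each noise vertex (a vertex with an incoming noise edge) has no outgoing edge. The regularity $|\tau|$ of a tree is the sum of the components of all its vertex decorations, plus the sum over its edges of $\kappa_G-\sum_i a_i$ for an edge $(G,a)$ and $\alpha_X-1-\sum_i a_i$ for an edge $(X,a)$. Let $\mathfrak T^-\subset\mathfrak T$ be spanned by the trees with $|\tau|<0$, and let $S(\mathfrak T^-)$ be its symmetric algebra. Multi-index factorials are taken componentwise. **Deformed insertion.** For trees $\sigma$ of negative regularity and $\tau\in\mathfrak T$, let $\sigma\,\hat\diamond\,\tau$ be the sum, over the vertices $v$ of $\tau$ that are not adjacent to a noise edge, of all trees obtained by replacing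 $v$ by $\sigma$ in the following ways. Each edge $e$ going out of $v$ is attached to a non-noise vertex $f(e)$ of $\sigma$, to the left of the edges of $\sigma$ there, edges attached to the same vertex keeping their order. The $\mathbb N^d$-parts of the decoration of $e$ and of the decoration of $f(e)$ are both lowered by some $\ell_e\in\mathbb N^d$ (all results having to be nonnegative). Then the decoration of $v$ is written as $n_v=\sum_x\delta_x$ over the non-noise vertices $x$ of $\sigma$, and $\delta_x$ is added to the decoration of $x$. Such a tree has the coefficient $$\frac{n_v!}{\prod_x\delta_x!}\;\prod_x\frac{n_x!}{\bigl(n_x-\sum_{f(e)=x}\ell_e\bigr)!\,\prod_{f(e)=x}\ell_e!},$$ where $n_x$ is the decoration of $x$ in $\sigma$. This product on $\mathfrak T^-$ has a unique Guin–Oudom extension to a bilinear product $\hat\diamond$ on $S(\mathfrak T^-)$ with $1\hat\diamond\omega=\omega$, $(\tau_1\omega)\hat\diamond\tau_2=\tau_1\hat\diamond(\omega\hat\diamond\tau_2)-(\tau_1\hat\diamond\omega)\hat\diamond\tau_2$ and $\omega_1\hat\diamond(\omega_2\omega_3)=((\omega_1)_{(1)}\hat\diamond\omega_2)((\omega_1)_{(2)}\hat\diamond\omega_3)$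 for $\tau_1,\tau_2\in\mathfrak T^-$ and $\omega,\omega_i\in S(\mathfrak T^-)$, where Sweedler's notation is for the coproduct for which $\mathfrak T^-$ is primitive. The insertion of $\mathfrak T^-$ into $\mathfrak T$ extends uniquely to a bilinear map $\hat\diamond:S(\mathfrak T^-)\otimes\mathfrak T\to\mathfrak T$ satisfying $1\hat\diamond\tau=\tau$ and the second of these rules with $\tau_2\in\mathfrak T$. There is a unique linear map $\Delta^-:\mathfrak T\to S(\mathfrak T^-)\otimes\mathfrak T$ dual to it, i.e. with $\langle\Delta^-\tau,\omega\otimes\sigma\rangle=\langle\tau,\omega\,\hat\diamond\,\sigma\rangle$; here trees are orthonormal in $\mathfrak T$, and in $S(\mathfrak T^-)$ the monomials in trees are orthogonal with $\langle\prod_t t^{k_t},\prod_t t^{k_t}\rangle=\prod_t k_t!$. **Admissible families.** Let $\tau\in\mathfrak T$ be a tree. Consider finite, possibly empty, unordered families $\tau_1,\dots,\tau_n$ of pairwise vertex-disjoint subtrees (nonempty connected sets of vertices, with the edges between them) such that 1. if $e$ is an edge of $\tau_i$ and $e'$ is an edge of $\tau$ going out of the same vertex and to the right of $e$, then $e'$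 is in $\tau_i$; 2. for every noise edge of $\tau$, either both its ends belong to the same $\tau_i$, or neither end belongs to any $\tau_j$. A redistribution of decorations along such a family consists of $\delta_x\in\mathbb N^d$ for the vertices $x$ of the $\tau_i$, with $\delta_x\le n_x$ and $\delta_x=0$ if $x$ is a noise vertex, and of $\ell_e\in\mathbb N^d$ for the edges $e$ of $\tau$ going out of some $\tau_i$ (source in $\tau_i$, target not in $\tau_i$), such that 3. each $\tau_i$ has negative regularity after the decoration of each of its vertices $x$ has been replaced by $m_x:=n_x-\delta_x+\sum_{e\text{ out of }x}\ell_e$. The terms $\tau_1\cdots\tau_n\otimes\tau/\tau_1\cdots\tau_n$ are given by the following rules. In the left factor $\tau_i$ has the decorations $m_x$. In the right factor each $\tau_i$ is contracted into one vertex decorated by $\sum_{x\in\tau_i}\delta_x$, and the decorations of the outgoing edges $e$ are raised by $\ell_e$; one sums over all planar orders of the edges going out of $\tau_i$ that preserve the order of edges going out of the same vertex (shuffles). One sums over all redistributions, with the weight $$\prod_{i=1}^n\;\frac{\bigl(\sum_{x\in\tau_i}\delta_x\bigr)!}{\prod_{x\in\tau_i}\delta_x!}\;\prod_{x\in\tau_i}\frac{\bigl(n_x-\delta_x+\sum_{e}\ell_e\bigr)!}{(n_x-\delta_x)!\,\prod_{e}\ell_e!},$$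 the inner sums and products being over the edges $e$ going out of $x$ and out of $\tau_i$. **Proposition.** For every tree $\tau\in\mathfrak T$, each family satisfying 1 and 2 has only finitely many redistributions satisfying 3, and $$\Delta^-(\tau)=\sum_{\tau_1,\dots,\tau_n\ \mathfrak T^-\text{-admissible}}\tau_1\cdots\tau_n\otimes\tau/\tau_1\cdots\tau_n .$$ -/

import Mathlib

open scoped TensorProduct Nat

universe u v

noncomputable section

namespace PlanarReg

attribute [local instance 10] Classical.propDecidable

/-! ## Decorated planar rooted trees -/

/-- Multi-indices in `ℕ^d`. -/
abbrev MIdx (d : ℕ) := Fin d → ℕ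

/-- Factorial of a multi-index, as a real number. -/
def mfact {d : ℕ} (n : MIdx d) : ℝ := ∏ i, ((n i)! : ℝ)

/-- Edge decorations: a convolution kernel (in `K`) or a noise (in `N`), with a multi-index. -/
abbrev ELabel (K : Type u) (N : Type v) (d : ℕ) := (K ⊕ N) × MIdx d

/-- The edge decoration is a noise. -/
def ELabel.IsNoise {K : Type u} {N : Type v} {d : ℕ} (e : ELabel K N d) : Prop :=
  e.1.isRight = true

/-- Lowering the multi-index part of an edge decoration. -/
def ELabel.lower {K : Type u} {N : Type v} {d : ℕ} (e : ELabel K N d) (l : MIdx d) :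
    ELabel K N d := (e.1, e.2 - l)

/-- Raising the multi-index part of an edge decoration. -/
def ELabel.raise {K : Type u} {N : Type v} {d : ℕ} (e : ELabel K N d) (l : MIdx d) :
    ELabel K N d := (e.1, e.2 + l)

/-- An ordered list of branches above a common base vertex: `cons e n s r` has a leftmost branch
made of an edge decorated by `e` leading to a vertex decorated by `n` that carries the branches `s`;
the branches further right are `r`. -/
inductive Forest (K : Type u) (N : Type v) (d : ℕ) : Type (max u v)
  | nil : Forest K N d
  | cons (e : ELabel K N d) (n : MIdx d) (s r : Forest K N d) : Forest K N d

/-- A planar rooted tree with decorated vertices and edges: the root decoration and the ordered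
branches above the root. -/
structure PTree (K : Type u) (N : Type v) (d : ℕ) : Type (max u v) where
  dec : MIdx d
  branches : Forest K N d

variable {K : Type u} {N : Type v} {d : ℕ}

namespace Forest

/-- The vertices of a forest, other than the base vertex. Each of them is identified with its
unique incoming edge. -/
inductive Vert : Forest K N d → Type (max u v)
  | head {e : ELabel K N d} {n : MIdx d} {s r : Forest K N d} : Vert (cons e n s r)
  | up {e : ELabel K N d} {n : MIdx d} {s r : Forest K N d} (x : Vert s) : Vert (cons e n s r)
  | right {e : ELabel K N d} {n : MIdx d} {s r : Forest K N d} (x : Vert r) : Vert (cons e n s r)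

theorem finite_vert (F : Forest K N d) : Finite F.Vert := by
  induction F with
  | nil => exact @Finite.of_fintype _ ⟨∅, fun x => nomatch x⟩
  | cons e n s r hs hr =>
    refine Finite.of_surjective
      (fun x : Option (s.Vert ⊕ r.Vert) =>
        (match x with
        | none => Vert.head
        | some (Sum.inl y) => Vert.up y
        | some (Sum.inr y) => Vert.right y : (cons e n s r).Vert)) ?_
    intro x
    cases x with
    | head => exact ⟨none, rfl⟩
    | up y => exact ⟨some (Sum.inl y), rfl⟩
    | right y => exact ⟨some (Sum.inr y), rfl⟩

instance (F : Forest K N d) : Fintype F.Vert :=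
  @Fintype.ofFinite _ F.finite_vert

/-- Decoration of an edge. -/
def label : {F : Forest K N d} → F.Vert → ELabel K N d
  | cons e _ _ _, Vert.head => e
  | cons _ _ _ _, Vert.up x => label x
  | cons _ _ _ _, Vert.right x => label x

/-- Decoration of a vertex. -/
def vdec : {F : Forest K N d} → F.Vert → MIdx d
  | cons _ n _ _, Vert.head => n
  | cons _ _ _ _, Vert.up x => vdec x
  | cons _ _ _ _, Vert.right x => vdec x

/-- The parent of a vertex, `none` being the base vertex. -/
def parent : {F : Forest K N d} → F.Vert → Option F.Vert
  | cons _ _ _ _, Vert.head => none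
  | cons _ _ _ _, Vert.up x =>
    match parent x with
    | none => some Vert.head
    | some y => some (Vert.up y)
  | cons _ _ _ _, Vert.right x => (parent x).map Vert.right

/-- `RightOf x y`: the edges `x` and `y` go out of the same vertex and `y` is strictly to the right
of `x`. -/
def RightOf : {F : Forest K N d} → F.Vert → F.Vert → Prop
  | cons _ _ _ _, Vert.head, Vert.head => False
  | cons _ _ _ _, Vert.head, Vert.up _ => False
  | cons _ _ _ _, Vert.head, Vert.right y => parent y = none
  | cons _ _ _ _, Vert.up _, Vert.head => False
  | cons _ _ _ _, Vert.up x, Vert.up y => RightOf x y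
  | cons _ _ _ _, Vert.up _, Vert.right _ => False
  | cons _ _ _ _, Vert.right _, Vert.head => False
  | cons _ _ _ _, Vert.right _, Vert.up _ => False
  | cons _ _ _ _, Vert.right x, Vert.right y => RightOf x y

/-- The branches above a vertex. -/
def above : {F : Forest K N d} → F.Vert → Forest K N d
  | cons _ _ s _, Vert.head => s
  | cons _ _ _ _, Vert.up x => above x
  | cons _ _ _ _, Vert.right x => above x

/-- Concatenation of branches above the same base vertex. -/
def append : Forest K N d → Forest K N d → Forest K N d
  | nil, G => G
  | cons e n s r, G => cons e n s (append r G)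

/-- The list of the branches at the base vertex, from left to right. -/
def toList : Forest K N d → List (ELabel K N d × PTree K N d)
  | nil => []
  | cons e n s r => (e, ⟨n, s⟩) :: toList r

/-- The forest with a given list of branches at the base vertex. -/
def ofList : List (ELabel K N d × PTree K N d) → Forest K N d
  | [] => nil
  | (e, t) :: L => cons e t.dec t.branches (ofList L)

/-- Replace the vertex `x`, with everything above it, by the tree `t`. -/
def replace : (F : Forest K N d) → F.Vert → PTree K N d → Forest K N d
  | cons e _ _ r, Vert.head, t => cons e t.dec t.branches r
  | cons e n s r, Vert.up x, t => cons e n (replace s x t) r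
  | cons e n s r, Vert.right x, t => cons e n s (replace r x t)

/-- Give each vertex `x` the new decoration `m x` and attach the branches `pre x` to it, to the left
of the branches already present. -/
def leftGraft : (F : Forest K N d) → (F.Vert → Forest K N d) → (F.Vert → MIdx d) → Forest K N d
  | nil, _, _ => nil
  | cons e _ s r, pre, m =>
    cons e (m Vert.head)
      (append (pre Vert.head) (leftGraft s (fun x => pre (Vert.up x)) (fun x => m (Vert.up x))))
      (leftGraft r (fun x => pre (Vert.right x)) (fun x => m (Vert.right x)))

/-- The part of the forest that is connected to the base vertex through vertices of `S`, with new
vertex decorations `m`. -/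
def restrict : (F : Forest K N d) → (F.Vert → Prop) → (F.Vert → MIdx d) → Forest K N d
  | nil, _, _ => nil
  | cons e _ s r, S, m =>
    if S Vert.head then
      cons e (m Vert.head) (restrict s (fun x => S (Vert.up x)) (fun x => m (Vert.up x)))
        (restrict r (fun x => S (Vert.right x)) (fun x => m (Vert.right x)))
    else restrict r (fun x => S (Vert.right x)) (fun x => m (Vert.right x))

/-- The tree carried by a connected set `S` of vertices, with new vertex decorations `m`
(`none` if `S` is empty). -/
def component : (F : Forest K N d) → (F.Vert → Prop) → (F.Vert → MIdx d) → Option (PTree K N d)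
  | nil, _, _ => none
  | cons _ _ s r, S, m =>
    if S Vert.head then
      some ⟨m Vert.head, restrict s (fun x => S (Vert.up x)) (fun x => m (Vert.up x))⟩
    else
      match component s (fun x => S (Vert.up x)) (fun x => m (Vert.up x)) with
      | some t => some t
      | none => component r (fun x => S (Vert.right x)) (fun x => m (Vert.right x))

/-- Adding a leftmost branch, extended bilinearly to formal sums of forests. -/
def consLin (e : ELabel K N d) (n : MIdx d) (a b : Forest K N d →₀ ℝ) : Forest K N d →₀ ℝ :=
  a.sum fun s x => b.sum fun r y => Finsupp.single (cons e n s r) (x * y)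

/-- Shuffle product of two ordered lists of branches. -/
def shuffle : Forest K N d → Forest K N d → (Forest K N d →₀ ℝ)
  | nil, G => Finsupp.single G 1
  | cons e n s r, nil => Finsupp.single (cons e n s r) 1
  | cons e n s r, cons e' n' s' r' =>
    consLin e n (Finsupp.single s 1) (shuffle r (cons e' n' s' r')) +
      consLin e' n' (Finsupp.single s' 1) (shuffle (cons e n s r) r')

/-- Shuffle product, extended bilinearly. -/
def shuffleLin (a b : Forest K N d →₀ ℝ) : Forest K N d →₀ ℝ :=
  a.sum fun F x => b.sum fun G y => (x * y) • shuffle F G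

/-- Contraction of the edges satisfying `inn`, with new edge decorations `lab`; every vertex `x`
whose incoming edge is not contracted (so that `x` becomes a vertex of the result) gets the
decoration `m x`. Into the base vertex are contracted the vertices that are joined to it by edges
in `inn`. The first component of the result is the ordered list of the remaining branches that go out
of the base vertex itself, the second one the shuffle of the lists of remaining branches that go out
of the other vertices contracted into the base vertex. -/
def contractAux : (F : Forest K N d) → (F.Vert → Prop) → (F.Vert → ELabel K N d) →
    (F.Vert → MIdx d) → (Forest K N d →₀ ℝ) × (Forest K N d →₀ ℝ)
  | nil, _, _, _ => (Finsupp.single nil 1, Finsupp.single nil 1)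
  | cons _ _ s r, inn, lab, m =>
    let p := contractAux s (fun x => inn (Vert.up x)) (fun x => lab (Vert.up x))
      (fun x => m (Vert.up x))
    let q := contractAux r (fun x => inn (Vert.right x)) (fun x => lab (Vert.right x))
      (fun x => m (Vert.right x))
    if inn Vert.head then (q.1, shuffleLin (shuffleLin p.1 p.2) q.2)
    else (consLin (lab Vert.head) (m Vert.head) (shuffleLin p.1 p.2) q.1, q.2)

end Forest

namespace PTree

/-- The vertices of a tree; `none` is the root. -/
abbrev Vert (τ : PTree K N d) := Option τ.branches.Vert

/-- The edges of a tree, each identified with its upper end. -/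
abbrev Edge (τ : PTree K N d) := τ.branches.Vert

def source {τ : PTree K N d} (e : τ.Edge) : τ.Vert := Forest.parent e

def target {τ : PTree K N d} (e : τ.Edge) : τ.Vert := some e

def vdec (τ : PTree K N d) : τ.Vert → MIdx d
  | none => τ.dec
  | some x => Forest.vdec x

/-- The edge is a noise edge. -/
def NoiseEdge {τ : PTree K N d} (e : τ.Edge) : Prop := (Forest.label e).IsNoise

/-- Noise vertices: those with an incoming noise edge. -/
def NoiseVert {τ : PTree K N d} (x : τ.Vert) : Prop := ∃ e : τ.Edge, NoiseEdge e ∧ target e = x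

/-- Each vertex has at most one outgoing noise edge, and noise vertices have no outgoing edges. -/
def Valid (τ : PTree K N d) : Prop :=
  (∀ e e' : τ.Edge, NoiseEdge e → NoiseEdge e' → source e = source e' → e = e') ∧
    ∀ e e' : τ.Edge, NoiseEdge e → source e' ≠ target e

/-- Regularity of an edge decoration, given the regularities `κ` of the kernels and the
regularities `α` of the paths. -/
def edgeReg (κ : K → ℝ) (α : N → ℝ) (e : ELabel K N d) : ℝ :=
  (match e.1 with
    | Sum.inl i => κ i
    | Sum.inr j => α j - 1) - ∑ i, (e.2 i : ℝ)

/-- Regularity of a tree. -/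
def reg (κ : K → ℝ) (α : N → ℝ) (τ : PTree K N d) : ℝ :=
  ∑ e : τ.Edge, edgeReg κ α (Forest.label e) + ∑ x : τ.Vert, ∑ i, (τ.vdec x i : ℝ)

/-! ## Deformed insertion -/

/-- The branches above a vertex. -/
def above (τ : PTree K N d) : τ.Vert → Forest K N d
  | none => τ.branches
  | some x => Forest.above x

/-- Replace the vertex `x`, with everything above it, by the tree `t`. -/
def replace (τ : PTree K N d) (x : τ.Vert) (t : PTree K N d) : PTree K N d :=
  match x with
  | none => t
  | some y => ⟨τ.dec, τ.branches.replace y t⟩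

/-- Give each vertex `x` the new decoration `m x` and attach the branches `pre x` to it, to the left
of the branches already present. -/
def leftGraft (τ : PTree K N d) (pre : τ.Vert → Forest K N d) (m : τ.Vert → MIdx d) :
    PTree K N d :=
  ⟨m none, Forest.append (pre none)
    (τ.branches.leftGraft (fun x => pre (some x)) (fun x => m (some x)))⟩

/-- Non-noise vertices. -/
abbrev NVert (τ : PTree K N d) := {x : τ.Vert // ¬ NoiseVert x}

/-- Vertices that are not adjacent to a noise edge. -/
abbrev FreeVert (τ : PTree K N d) :=
  {x : τ.Vert // ∀ e : τ.Edge, NoiseEdge e → source e ≠ x ∧ target e ≠ x}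

/-- The total amount `∑ ℓ_i` by which the decoration of `x` is lowered, when the branch `i` is
grafted onto the vertex `f i` with deformation `ℓ_i`. -/
def loss {t : PTree K N d} {k : ℕ} (f : Fin k → t.NVert) (l : Fin k → MIdx d) (x : t.Vert) :
    MIdx d :=
  ∑ i ∈ Finset.univ.filter (fun i => (f i : t.Vert) = x), l i

/-- The branches of `L` that are grafted onto `x`, in their original order, with lowered edge
decorations. -/
def graftedAt {t : PTree K N d} (L : List (ELabel K N d × PTree K N d))
    (f : Fin L.length → t.NVert) (l : Fin L.length → MIdx d) (x : t.Vert) : Forest K N d :=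
  Forest.ofList (((List.finRange L.length).filter (fun i => decide ((f i : t.Vert) = x))).map
    fun i => ((L.get i).1.lower (l i), (L.get i).2))

/-- Deformed insertion of `t` in place of a vertex with decoration `n` and branches `L`, as a formal
sum of trees. The branch `i` is left-grafted onto the non-noise vertex `f i` of `t`, the decorations
of the grafted edge and of that vertex being lowered by `l i`; the decoration `n` is distributed over
the non-noise vertices of `t` (`del`). The coefficient is
`∏_x (n_x choose the l_i with f i = x) * (n choose (del_x)_x)`. -/
def insertTop (t : PTree K N d) (n : MIdx d) (L : List (ELabel K N d × PTree K N d))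
    (g : PTree K N d → PTree K N d) : PTree K N d →₀ ℝ :=
  ∑ f : Fin L.length → t.NVert,
    ∑ l ∈ (Fintype.piFinset fun i => Finset.Iic (L.get i).1.2).filter
        (fun l => ∀ x, loss f l x ≤ t.vdec x),
      ∑ del ∈ (Fintype.piFinset fun _ : t.Vert => Finset.Iic n).filter
          (fun del => ∑ x, del x = n ∧ ∀ x, NoiseVert x → del x = 0),
        Finsupp.single
          (g (t.leftGraft (graftedAt L f l) (fun x => t.vdec x - loss f l x + del x)))
          (((∏ x, mfact (t.vdec x) / mfact (t.vdec x - loss f l x)) / ∏ i, mfact (l i)) *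
            (mfact n / ∏ x, mfact (del x)))

/-- Deformed insertion of `t` into `τ`: the sum over the vertices `x` of `τ` that are not adjacent to
a noise edge of the deformed insertions of `t` in place of `x`. -/
def insertion (t τ : PTree K N d) : PTree K N d →₀ ℝ :=
  ∑ x : τ.FreeVert,
    insertTop t (τ.vdec x) (Forest.toList (τ.above x)) (fun s => τ.replace x s)

/-! ## Admissible families and their contraction -/

/-- A nonempty connected set of vertices: every vertex of `S` other than its lowest vertex `r` has
its parent in `S`. -/
def IsSubtree {τ : PTree K N d} (S : Finset τ.Vert) : Prop :=
  ∃ r ∈ S, ∀ x ∈ S, x ≠ r → ∃ e : τ.Edge, target e = x ∧ source e ∈ S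

/-- The edge belongs to the subtree with vertex set `S`. -/
def EdgeIn {τ : PTree K N d} (e : τ.Edge) (S : Finset τ.Vert) : Prop := source e ∈ S ∧ target e ∈ S

/-- Families of disjoint subtrees that are closed to the right in the planar order and respect the
noise edges. (The negativity of the subtrees depends on the redistribution of the decorations: see
`Redistribution`.) -/
structure IsAdmissible (τ : PTree K N d) (𝓕 : Finset (Finset τ.Vert)) : Prop where
  subtree : ∀ S ∈ 𝓕, IsSubtree S
  disjoint : ∀ S ∈ 𝓕, ∀ S' ∈ 𝓕, S ≠ S' → Disjoint S S'
  right_closed : ∀ S ∈ 𝓕, ∀ e e' : τ.Edge, EdgeIn e S → Forest.RightOf e e' → EdgeIn e' S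
  noise : ∀ e : τ.Edge, NoiseEdge e →
    (∃ S ∈ 𝓕, source e ∈ S ∧ target e ∈ S) ∨ ∀ S ∈ 𝓕, source e ∉ S ∧ target e ∉ S

/-- The tree carried by the subtree `S`, with vertex decorations `m`. -/
def extract (τ : PTree K N d) (S : Finset τ.Vert) (m : τ.Vert → MIdx d) : PTree K N d :=
  if none ∈ S then ⟨m none, τ.branches.restrict (fun x => some x ∈ S) (fun x => m (some x))⟩
  else (τ.branches.component (fun x => some x ∈ S) (fun x => m (some x))).getD ⟨0, Forest.nil⟩

/-- Decorations of the vertices of the extracted subtrees: `n_x - del_x + ∑ l_e`, the sum being over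
the edges `e` going out of `x`. -/
def newDec (τ : PTree K N d) (del : τ.Vert → MIdx d) (l : τ.Edge → MIdx d) (x : τ.Vert) : MIdx d :=
  τ.vdec x - del x + ∑ e ∈ Finset.univ.filter (fun e : τ.Edge => source e = x), l e

/-- A redistribution of decorations along the family `𝓕`: the decoration of each non-noise vertex `x`
of the subtrees is lowered by `del x`, and for every edge `e` going out of a subtree the decorations
of `e` and of its source are raised by `l e`, in such a way that all the extracted subtrees have
negative regularity. -/
structure Redistribution (κ : K → ℝ) (α : N → ℝ) (τ : PTree K N d)
    (𝓕 : Finset (Finset τ.Vert)) where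
  del : τ.Vert → MIdx d
  l : τ.Edge → MIdx d
  del_le : ∀ x, del x ≤ τ.vdec x
  del_supp : ∀ x, del x ≠ 0 → (∃ S ∈ 𝓕, x ∈ S) ∧ ¬ NoiseVert x
  l_supp : ∀ e, l e ≠ 0 → ∃ S ∈ 𝓕, source e ∈ S ∧ target e ∉ S
  negative : ∀ S ∈ 𝓕, (τ.extract S (τ.newDec del l)).reg κ α < 0

namespace Redistribution

variable {κ : K → ℝ} {α : N → ℝ} {τ : PTree K N d} {𝓕 : Finset (Finset τ.Vert)}

/-- The combinatorial factor: for each subtree, the multinomial coefficient of the `del x`, and for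
each of its vertices the multinomial coefficient
`(n_x - del_x + ∑ l_e)! / ((n_x - del_x)! ∏ l_e!)`. -/
def coeff (D : Redistribution κ α τ 𝓕) : ℝ :=
  ∏ S ∈ 𝓕, ((mfact (∑ x ∈ S, D.del x) / ∏ x ∈ S, mfact (D.del x)) *
    ∏ x ∈ S, (mfact (τ.newDec D.del D.l x) / (mfact (τ.vdec x - D.del x) *
      ∏ e ∈ Finset.univ.filter (fun e : τ.Edge => source e = x), mfact (D.l e))))

/-- The commutative product `τ_1 ⋯ τ_n` of the extracted subtrees. -/
def extracted (D : Redistribution κ α τ 𝓕) : MvPolynomial (PTree K N d) ℝ :=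
  ∏ S ∈ 𝓕, MvPolynomial.X (τ.extract S (τ.newDec D.del D.l))

/-- Decorations of the vertices after contraction: a contracted subtree `S` gives a vertex decorated
by `∑_{x ∈ S} del x`, the other vertices keep their decoration. -/
def contractedDec (D : Redistribution κ α τ 𝓕) (x : τ.Vert) : MIdx d :=
  if ∃ S ∈ 𝓕, x ∈ S then ∑ S ∈ 𝓕.filter (fun S => x ∈ S), ∑ y ∈ S, D.del y else τ.vdec x

/-- The contraction `τ / τ_1 ⋯ τ_n`: each subtree is contracted into a single vertex. The edges going
out of a subtree from the same vertex keep their order and those from different vertices are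
shuffled. -/
def contracted (D : Redistribution κ α τ 𝓕) : PTree K N d →₀ ℝ :=
  let p := τ.branches.contractAux (fun e => ∃ S ∈ 𝓕, EdgeIn (τ := τ) e S)
    (fun e => (Forest.label e).raise (D.l e)) (fun x => D.contractedDec (some x))
  (Forest.shuffleLin p.1 p.2).mapDomain fun F => ⟨D.contractedDec none, F⟩

end Redistribution

end PTree

/-! ## The spaces, the extension of the insertion and the dual coaction -/

/-- The basis of the model space: the trees that satisfy the constraints on noise edges. -/
abbrev ModelTree (K : Type u) (N : Type v) (d : ℕ) := {τ : PTree K N d // τ.Valid}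

/-- The trees of negative regularity. -/
abbrev NegTree (d : ℕ) (κ : K → ℝ) (α : N → ℝ) :=
  {τ : PTree K N d // τ.Valid ∧ τ.reg κ α < 0}

/-- The model space, with the trees as a basis. -/
abbrev ModelSpace (K : Type u) (N : Type v) (d : ℕ) := ModelTree K N d →₀ ℝ

/-- The symmetric algebra of the space spanned by the negative trees. -/
abbrev SymNeg (d : ℕ) (κ : K → ℝ) (α : N → ℝ) := MvPolynomial (NegTree d κ α) ℝ

/-- The inclusion of the model space into the span of all decorated planar trees. -/
def inclT : ModelSpace K N d →ₗ[ℝ] (PTree K N d →₀ ℝ) := Finsupp.lmapDomain ℝ ℝ Subtype.val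

/-- The inclusion of the symmetric algebra on negative trees into that on all decorated planar
trees. -/
def inclS (κ : K → ℝ) (α : N → ℝ) : SymNeg d κ α →ₐ[ℝ] MvPolynomial (PTree K N d) ℝ :=
  MvPolynomial.rename Subtype.val

/-- Formal sums of trees as elements of degree one of the symmetric algebra. -/
def toSym : (PTree K N d →₀ ℝ) →ₗ[ℝ] MvPolynomial (PTree K N d) ℝ :=
  Finsupp.linearCombination ℝ MvPolynomial.X

variable (κ : K → ℝ) (α : N → ℝ)

/-- The cocommutative coproduct for which the trees are primitive. -/
def deshuffle : SymNeg d κ α →ₐ[ℝ] SymNeg d κ α ⊗[ℝ] SymNeg d κ α :=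
  MvPolynomial.aeval fun t => MvPolynomial.X t ⊗ₜ 1 + 1 ⊗ₜ MvPolynomial.X t

variable {κ α}

open MvPolynomial in
/-- `B` is the Guin–Oudom extension to the symmetric algebra of the deformed insertion product on
negative trees. -/
structure IsGuinOudomExtension (B : SymNeg d κ α →ₗ[ℝ] SymNeg d κ α →ₗ[ℝ] SymNeg d κ α) : Prop where
  extend : ∀ t s : NegTree d κ α, inclS κ α (B (X t) (X s)) = toSym (PTree.insertion t.1 s.1)
  one_left : ∀ w, B 1 w = w
  mul_left : ∀ (t : NegTree d κ α) (w : SymNeg d κ α) (s : NegTree d κ α),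
    B (X t * w) (X s) = B (X t) (B w (X s)) - B (B (X t) w) (X s)
  mul_right : ∀ w w₁ w₂ : SymNeg d κ α, B w (w₁ * w₂) =
    LinearMap.mul' ℝ (SymNeg d κ α) (TensorProduct.map (B.flip w₁) (B.flip w₂) (deshuffle κ α w))

open MvPolynomial in
/-- `A` is the extension, to an action of the symmetric algebra, of the deformed insertion of
negative trees into the trees of the model space. -/
structure IsInsertionAction (B : SymNeg d κ α →ₗ[ℝ] SymNeg d κ α →ₗ[ℝ] SymNeg d κ α)
    (A : SymNeg d κ α →ₗ[ℝ] ModelSpace K N d →ₗ[ℝ] ModelSpace K N d) : Prop where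
  extend : ∀ (t : NegTree d κ α) (s : ModelTree K N d),
    inclT (A (X t) (Finsupp.single s 1)) = PTree.insertion t.1 s.1
  one_left : ∀ x, A 1 x = x
  mul_left : ∀ (t : NegTree d κ α) (w : SymNeg d κ α) (x : ModelSpace K N d),
    A (X t * w) x = A (X t) (A w x) - A (B (X t) w) x

/-- The pairing on the model space for which the trees are orthonormal. -/
def pairT : LinearMap.BilinForm ℝ (ModelSpace K N d) :=
  Finsupp.linearCombination ℝ fun τ => Finsupp.lapply τ

/-- The pairing on the symmetric algebra induced by the pairing of trees: monomials are orthogonal,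
and `⟨∏ t^{k_t}, ∏ t^{k_t}⟩ = ∏ k_t!`. -/
def pairS : LinearMap.BilinForm ℝ (SymNeg d κ α) :=
  (MvPolynomial.basisMonomials (NegTree d κ α) ℝ).constr ℝ fun w =>
    (w.prod fun _ k => (k ! : ℝ)) • MvPolynomial.lcoeff ℝ w

/-- The map `Δ` is dual to the action `A`. -/
def IsDualCoaction (A : SymNeg d κ α →ₗ[ℝ] ModelSpace K N d →ₗ[ℝ] ModelSpace K N d)
    (Δ : ModelSpace K N d →ₗ[ℝ] SymNeg d κ α ⊗[ℝ] ModelSpace K N d) : Prop :=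
  ∀ (x : ModelSpace K N d) (w : SymNeg d κ α) (y : ModelSpace K N d),
    (LinearMap.BilinForm.tmul pairS pairT) (Δ x) (w ⊗ₜ y) = pairT x (A w y)

/-- The sum `∑ τ_1 ⋯ τ_n ⊗ τ / τ_1 ⋯ τ_n` over the admissible families of subtrees of `τ` and over
the redistributions of decorations along them. -/
def admissibleSum (κ : K → ℝ) (α : N → ℝ) (τ : PTree K N d) :
    MvPolynomial (PTree K N d) ℝ ⊗[ℝ] (PTree K N d →₀ ℝ) :=
  ∑ 𝓕 : {𝓕 : Finset (Finset τ.Vert) // τ.IsAdmissible 𝓕},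
    ∑ᶠ D : PTree.Redistribution κ α τ 𝓕.1, D.coeff • (D.extracted ⊗ₜ[ℝ] D.contracted)

end PlanarReg

end

noncomputable section

namespace PlanarReg

attribute [local instance 10] Classical.propDecidable

variable {K : Type u} {N : Type v} {d : ℕ}

open Forest

/-! ## Convolution along a linear coproduct -/

section Convolution

variable {C M M' P Q : Type*} [AddCommGroup C] [Module ℝ C] [AddCommGroup M] [Module ℝ M]
  [AddCommGroup M'] [Module ℝ M'] [AddCommGroup P] [Module ℝ P] [AddCommGroup Q] [Module ℝ Q]

/-- The convolution of `f` and `g` along the coproduct `c` and the bilinear map `β`. -/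
def cv (c : C →ₗ[ℝ] C ⊗[ℝ] C) (β : M →ₗ[ℝ] M' →ₗ[ℝ] P) (f : C →ₗ[ℝ] M) (g : C →ₗ[ℝ] M') :
    C →ₗ[ℝ] P :=
  TensorProduct.lift β ∘ₗ TensorProduct.map f g ∘ₗ c

/-- `x` is a coderivation of the coproduct `c`. -/
def IsCoder (c : C →ₗ[ℝ] C ⊗[ℝ] C) (x : C →ₗ[ℝ] C) : Prop :=
  ∀ a, c (x a) = TensorProduct.map x LinearMap.id (c a) + TensorProduct.map LinearMap.id x (c a)

variable {c : C →ₗ[ℝ] C ⊗[ℝ] C}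

theorem cv_comp {x : C →ₗ[ℝ] C} (h : IsCoder c x) (β : M →ₗ[ℝ] M' →ₗ[ℝ] P) (f : C →ₗ[ℝ] M)
    (g : C →ₗ[ℝ] M') : cv c β f g ∘ₗ x = cv c β (f ∘ₗ x) g + cv c β f (g ∘ₗ x) := by
  ext a
  simp only [cv, LinearMap.comp_apply, h a, map_add, LinearMap.add_apply]
  congr 2
  · rw [← LinearMap.comp_apply, ← TensorProduct.map_comp, LinearMap.comp_id]
  · rw [← LinearMap.comp_apply, ← TensorProduct.map_comp, LinearMap.comp_id]

theorem comp_cv_of_leibniz {β : M →ₗ[ℝ] M' →ₗ[ℝ] P} {y : P →ₗ[ℝ] P} {y₁ : M →ₗ[ℝ] M}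
    {y₂ : M' →ₗ[ℝ] M'} (h : ∀ a b, y (β a b) = β (y₁ a) b + β a (y₂ b)) (f : C →ₗ[ℝ] M)
    (g : C →ₗ[ℝ] M') : y ∘ₗ cv c β f g = cv c β (y₁ ∘ₗ f) g + cv c β f (y₂ ∘ₗ g) := by
  have : y ∘ₗ TensorProduct.lift β ∘ₗ TensorProduct.map f g =
      TensorProduct.lift β ∘ₗ TensorProduct.map (y₁ ∘ₗ f) g +
        TensorProduct.lift β ∘ₗ TensorProduct.map f (y₂ ∘ₗ g) := by
    ext a b
    simp [h]
  ext a
  exact LinearMap.congr_fun this (c a)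

theorem comp_cv (β : M →ₗ[ℝ] M' →ₗ[ℝ] P) (y : P →ₗ[ℝ] Q) (f : C →ₗ[ℝ] M)
    (g : C →ₗ[ℝ] M') : y ∘ₗ cv c β f g = cv c (β.compr₂ y) f g := by
  have : y ∘ₗ TensorProduct.lift β ∘ₗ TensorProduct.map f g =
      TensorProduct.lift (β.compr₂ y) ∘ₗ TensorProduct.map f g := by
    ext a b
    simp
  ext a
  exact LinearMap.congr_fun this (c a)

theorem cv_congr {M₂ M₂' : Type*} [AddCommGroup M₂] [Module ℝ M₂] [AddCommGroup M₂'] [Module ℝ M₂']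
    {β : M →ₗ[ℝ] M' →ₗ[ℝ] P} {β₂ : M₂ →ₗ[ℝ] M₂' →ₗ[ℝ] P} {f : C →ₗ[ℝ] M}
    {g : C →ₗ[ℝ] M'} {f₂ : C →ₗ[ℝ] M₂} {g₂ : C →ₗ[ℝ] M₂'}
    (h : ∀ a b, β (f a) (g b) = β₂ (f₂ a) (g₂ b)) : cv c β f g = cv c β₂ f₂ g₂ := by
  have : TensorProduct.lift β ∘ₗ TensorProduct.map f g =
      TensorProduct.lift β₂ ∘ₗ TensorProduct.map f₂ g₂ := by
    ext a b
    simp [h]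
  ext a
  exact LinearMap.congr_fun this (c a)

theorem cv_add_left (β : M →ₗ[ℝ] M' →ₗ[ℝ] P) (f f' : C →ₗ[ℝ] M) (g : C →ₗ[ℝ] M') :
    cv c β (f + f') g = cv c β f g + cv c β f' g := by
  ext a; simp [cv, TensorProduct.map_add_left]

theorem cv_add_right (β : M →ₗ[ℝ] M' →ₗ[ℝ] P) (f : C →ₗ[ℝ] M) (g g' : C →ₗ[ℝ] M') :
    cv c β f (g + g') = cv c β f g + cv c β f g' := by
  ext a; simp [cv, TensorProduct.map_add_right]

theorem cv_neg_right (β : M →ₗ[ℝ] M' →ₗ[ℝ] P) (f : C →ₗ[ℝ] M) (g : C →ₗ[ℝ] M') :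
    cv c β f (-g) = -cv c β f g := by
  rw [eq_neg_iff_add_eq_zero, ← cv_add_right, neg_add_cancel]
  ext a; simp [cv]

theorem cv_sub_right (β : M →ₗ[ℝ] M' →ₗ[ℝ] P) (f : C →ₗ[ℝ] M) (g g' : C →ₗ[ℝ] M') :
    cv c β f (g - g') = cv c β f g - cv c β f g' := by
  rw [sub_eq_add_neg, cv_add_right, cv_neg_right, ← sub_eq_add_neg]

theorem cv_sub_left (β : M →ₗ[ℝ] M' →ₗ[ℝ] P) (f f' : C →ₗ[ℝ] M) (g : C →ₗ[ℝ] M') :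
    cv c β (f - f') g = cv c β f g - cv c β f' g := by
  rw [eq_sub_iff_add_eq, ← cv_add_left, sub_add_cancel]

/-- The convolution, linear in the right factor. -/
def cvR (c : C →ₗ[ℝ] C ⊗[ℝ] C) (β : M →ₗ[ℝ] M' →ₗ[ℝ] P) (f : C →ₗ[ℝ] M) :
    (C →ₗ[ℝ] M') →ₗ[ℝ] (C →ₗ[ℝ] P) where
  toFun g := cv c β f g
  map_add' := cv_add_right β f
  map_smul' r g := by ext a; simp [cv, TensorProduct.map_smul_right]

/-- The convolution, linear in the left factor. -/
def cvL (c : C →ₗ[ℝ] C ⊗[ℝ] C) (β : M →ₗ[ℝ] M' →ₗ[ℝ] P) (g : C →ₗ[ℝ] M') :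
    (C →ₗ[ℝ] M) →ₗ[ℝ] (C →ₗ[ℝ] P) where
  toFun f := cv c β f g
  map_add' f f' := cv_add_left β f f' g
  map_smul' r f := by ext a; simp [cv, TensorProduct.map_smul_left]

theorem IsCoder.add {x y : C →ₗ[ℝ] C} (hx : IsCoder c x) (hy : IsCoder c y) :
    IsCoder c (x + y) := by
  intro a
  simp only [LinearMap.add_apply, map_add, hx a, hy a, TensorProduct.map_add_left,
    TensorProduct.map_add_right]
  abel

end Convolution

/-! ## Multi-index binomial coefficients -/

/-- Binomial coefficient of multi-indices. -/
def mchoose (n l : MIdx d) : ℕ := ∏ i, (n i).choose (l i)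

theorem mchoose_zero_right (n : MIdx d) : mchoose n 0 = 1 := by simp [mchoose]

theorem mchoose_eq_zero {n l : MIdx d} (h : ¬ l ≤ n) : mchoose n l = 0 := by
  simp only [Pi.le_def, not_forall, not_le] at h
  obtain ⟨i, hi⟩ := h
  exact Finset.prod_eq_zero (Finset.mem_univ i) (Nat.choose_eq_zero_of_lt hi)

theorem mfact_pos (n : MIdx d) : 0 < mfact n :=
  Finset.prod_pos fun i _ => by exact_mod_cast Nat.factorial_pos _

theorem mfact_ne_zero (n : MIdx d) : mfact n ≠ 0 := (mfact_pos n).ne'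

@[simp] theorem mfact_zero : mfact (0 : MIdx d) = 1 := by simp [mfact]

theorem mchoose_eq {n l : MIdx d} (h : l ≤ n) :
    (mchoose n l : ℝ) = mfact n / (mfact (n - l) * mfact l) := by
  rw [eq_div_iff (mul_ne_zero (mfact_ne_zero _) (mfact_ne_zero _))]
  simp only [mchoose, mfact, Nat.cast_prod, ← Finset.prod_mul_distrib]
  refine Finset.prod_congr rfl fun i _ => ?_
  have := Nat.choose_mul_factorial_mul_factorial (h i)
  rw [Pi.sub_apply, ← this]
  push_cast
  ring

theorem mchoose_add_single (n l : MIdx d) (i : Fin d) :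
    mchoose (n + Pi.single i 1) l =
      mchoose n l + if 1 ≤ l i then mchoose n (l - Pi.single i 1) else 0 := by
  have key : ∀ n l : MIdx d, mchoose n l =
      (n i).choose (l i) * ∏ j ∈ Finset.univ.erase i, (n j).choose (l j) := fun n l =>
    (Finset.mul_prod_erase _ (fun j => (n j).choose (l j)) (Finset.mem_univ i)).symm
  have h1 : ∏ j ∈ Finset.univ.erase i, ((n + Pi.single i 1 : MIdx d) j).choose (l j) =
      ∏ j ∈ Finset.univ.erase i, (n j).choose (l j) := by
    refine Finset.prod_congr rfl fun j hj => ?_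
    simp [Finset.ne_of_mem_erase hj]
  have h2 : ∏ j ∈ Finset.univ.erase i, (n j).choose ((l - Pi.single i 1 : MIdx d) j) =
      ∏ j ∈ Finset.univ.erase i, (n j).choose (l j) := by
    refine Finset.prod_congr rfl fun j hj => ?_
    simp [Finset.ne_of_mem_erase hj]
  rw [key, key, key, h1, h2]
  obtain h | h := Nat.eq_zero_or_pos (l i)
  · simp [h]
  · obtain ⟨m, hm⟩ := Nat.exists_eq_succ_of_ne_zero h.ne'
    simp [hm, Nat.choose_succ_succ]
    ring

theorem single_le_of_pos {a : MIdx d} {i : Fin d} (h : 1 ≤ a i) : Pi.single i 1 ≤ a := by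
  intro j
  by_cases hj : j = i
  · subst hj; simpa using h
  · simp [hj]

/-- Pascal's rule under a sum. -/
theorem sum_Iic_mchoose_add_single {M : Type*} [AddCommMonoid M] [Module ℝ M] (n a : MIdx d)
    (i : Fin d) (ψ : MIdx d → M) :
    ∑ l ∈ Finset.Iic a, (mchoose (n + Pi.single i 1) l : ℝ) • ψ l =
      ∑ l ∈ Finset.Iic a, (mchoose n l : ℝ) • ψ l +
        if 1 ≤ a i then ∑ l ∈ Finset.Iic (a - Pi.single i 1),
          (mchoose n l : ℝ) • ψ (l + Pi.single i 1) else 0 := by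
  simp only [mchoose_add_single, Nat.cast_add, add_smul, Finset.sum_add_distrib]
  congr 1
  split_ifs with h
  · have : ∀ l : MIdx d, (((if 1 ≤ l i then mchoose n (l - Pi.single i 1) else 0 : ℕ) : ℝ) • ψ l) =
        if 1 ≤ l i then (mchoose n (l - Pi.single i 1) : ℝ) • ψ l else 0 := by
      intro l; split_ifs <;> simp
    simp only [this]
    rw [← Finset.sum_filter]
    refine Finset.sum_nbij' (fun l => l - Pi.single i 1) (fun l => l + Pi.single i 1) ?_ ?_ ?_ ?_ ?_
    · intro l hl
      simp only [Finset.mem_filter, Finset.mem_Iic] at hl ⊢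
      exact tsub_le_tsub_right hl.1 _
    · intro l hl
      simp only [Finset.mem_filter, Finset.mem_Iic] at hl ⊢
      refine ⟨(add_le_add_left hl _).trans_eq (tsub_add_cancel_of_le (single_le_of_pos h)), by simp⟩
    · intro l hl
      simp only [Finset.mem_filter] at hl
      exact tsub_add_cancel_of_le (single_le_of_pos hl.2)
    · intro l _
      exact add_tsub_cancel_right _ _
    · intro l hl
      simp only [Finset.mem_filter] at hl
      rw [tsub_add_cancel_of_le (single_le_of_pos hl.2)]
  · refine Finset.sum_eq_zero fun l hl => ?_
    have : ¬ 1 ≤ l i := fun h' => h (h'.trans (Finset.mem_Iic.1 hl i))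
    simp [this]

/-! ## Operators on formal sums of trees -/

/-- Formal sums of trees. -/
abbrev TV (K : Type u) (N : Type v) (d : ℕ) := PTree K N d →₀ ℝ

/-- Formal sums of forests. -/
abbrev FV (K : Type u) (N : Type v) (d : ℕ) := Forest K N d →₀ ℝ

/-- A tree as a formal sum. -/
abbrev tr (n : MIdx d) (F : Forest K N d) : TV K N d := Finsupp.single ⟨n, F⟩ 1

theorem single_eq_smul {ι : Type*} (a : ι) (c : ℝ) :
    Finsupp.single a c = c • Finsupp.single a (1 : ℝ) := by
  simp

/-- Put a root decorated by `n` below a forest. -/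
def treeL (n : MIdx d) : FV K N d →ₗ[ℝ] TV K N d := Finsupp.lmapDomain ℝ ℝ (PTree.mk n)

@[simp] theorem treeL_single (n : MIdx d) (F : Forest K N d) (x : ℝ) :
    treeL n (Finsupp.single F x) = Finsupp.single ⟨n, F⟩ x := by
  simp [treeL]

/-- Add a leftmost branch. -/
def consB (e : ELabel K N d) : TV K N d →ₗ[ℝ] FV K N d →ₗ[ℝ] FV K N d :=
  Finsupp.linearCombination ℝ fun t => Finsupp.lmapDomain ℝ ℝ fun r => cons e t.dec t.branches r

@[simp] theorem consB_single (e : ELabel K N d) (t : PTree K N d) (r : Forest K N d) (x y : ℝ) :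
    consB e (Finsupp.single t x) (Finsupp.single r y) =
      Finsupp.single (cons e t.dec t.branches r) (x * y) := by
  simp [consB]

/-- Add `n` to the decoration of the root. -/
def dAdd (n : MIdx d) : TV K N d →ₗ[ℝ] TV K N d :=
  Finsupp.lmapDomain ℝ ℝ fun t => ⟨n + t.dec, t.branches⟩

@[simp] theorem dAdd_single (n : MIdx d) (t : PTree K N d) (x : ℝ) :
    dAdd n (Finsupp.single t x) = Finsupp.single ⟨n + t.dec, t.branches⟩ x := by
  simp [dAdd]

/-- Deformed grafting of the branch `(e, t)` at the left of the root. -/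
def gB (e : ELabel K N d) (t : PTree K N d) : TV K N d →ₗ[ℝ] TV K N d :=
  Finsupp.linearCombination ℝ fun v => ∑ l ∈ Finset.Iic e.2,
    (mchoose v.dec l : ℝ) • tr (v.dec - l) (cons (e.lower l) t.dec t.branches v.branches)

theorem gB_single (e : ELabel K N d) (t : PTree K N d) (n : MIdx d) (F : Forest K N d) :
    gB e t (tr n F) = ∑ l ∈ Finset.Iic e.2,
      (mchoose n l : ℝ) • tr (n - l) (cons (e.lower l) t.dec t.branches F) := by
  simp [gB]

/-- Deformed grafting, linear in the tree carried by the grafted branch. -/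
def gBL (e : ELabel K N d) : TV K N d →ₗ[ℝ] TV K N d →ₗ[ℝ] TV K N d :=
  Finsupp.linearCombination ℝ (gB e)

@[simp] theorem gBL_single (e : ELabel K N d) (t : PTree K N d) :
    gBL e (Finsupp.single t 1) = gB e t := by
  simp [gBL]

/-- Agreement of linear maps on formal sums of trees. -/
theorem TV_ext {M : Type*} [AddCommMonoid M] [Module ℝ M] {f g : TV K N d →ₗ[ℝ] M}
    (h : ∀ n F, f (tr n F) = g (tr n F)) : f = g := by
  refine Finsupp.lhom_ext' fun t => LinearMap.ext_ring ?_
  exact h t.dec t.branches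

theorem FV_ext {M : Type*} [AddCommMonoid M] [Module ℝ M] {f g : FV K N d →ₗ[ℝ] M}
    (h : ∀ F, f (Finsupp.single F 1) = g (Finsupp.single F 1)) : f = g :=
  Finsupp.lhom_ext' fun F => LinearMap.ext_ring (h F)

theorem lower_zero (e : ELabel K N d) : e.lower 0 = e := by simp [ELabel.lower]

theorem lower_lower (e : ELabel K N d) (l m : MIdx d) :
    (e.lower l).lower m = e.lower (l + m) := by
  simp [ELabel.lower, tsub_add_eq_tsub_tsub]

theorem gB_zero (e : ELabel K N d) (t : PTree K N d) (F : Forest K N d) :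
    gB e t (tr 0 F) = tr 0 (cons e t.dec t.branches F) := by
  rw [gB_single, Finset.sum_eq_single 0]
  · simp [mchoose, lower_zero]
  · intro l _ hl
    rw [mchoose_eq_zero]
    · simp
    · intro h
      exact hl (le_antisymm h zero_le)
  · simp

theorem gB_dAdd (e : ELabel K N d) (t : PTree K N d) (i : Fin d) :
    gB e t ∘ₗ dAdd (Pi.single i 1) = dAdd (Pi.single i 1) ∘ₗ gB e t +
      if 1 ≤ e.2 i then gB (e.lower (Pi.single i 1)) t else 0 := by
  refine TV_ext fun n F => ?_
  simp only [LinearMap.comp_apply, LinearMap.add_apply, dAdd_single, gB_single, map_sum, map_smul]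
  rw [add_comm (Pi.single i 1) n, sum_Iic_mchoose_add_single]
  congr 1
  · refine Finset.sum_congr rfl fun l _ => ?_
    by_cases h : l ≤ n
    · rw [add_comm (Pi.single i 1), tsub_add_eq_add_tsub h]
    · simp [mchoose_eq_zero h]
  · split_ifs
    · rw [gB_single]
      refine Finset.sum_congr rfl fun l _ => ?_
      rw [add_tsub_add_eq_tsub_right, lower_lower, add_comm l]
    · simp

theorem dAdd_dAdd (n m : MIdx d) (v : TV K N d) : dAdd n (dAdd m v) = dAdd (n + m) v := by
  have : (dAdd n ∘ₗ dAdd m : TV K N d →ₗ[ℝ] _) = dAdd (n + m) :=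
    TV_ext fun k F => by simp [add_assoc]
  exact LinearMap.congr_fun this v

@[simp] theorem dAdd_zero (v : TV K N d) : dAdd 0 v = v := by
  have : (dAdd 0 : TV K N d →ₗ[ℝ] _) = LinearMap.id := TV_ext fun k F => by simp
  rw [this]; rfl

/-- Induction over multi-indices, by adding units. -/
theorem midx_induction {p : MIdx d → Prop} (zero : p 0)
    (raise : ∀ i n, p n → p (Pi.single i 1 + n)) (n : MIdx d) : p n := by
  have : ∀ k : ℕ, ∀ n : MIdx d, ∑ i, n i = k → p n := by
    intro k
    induction k with
    | zero =>
      intro n hn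
      have : n = 0 := by
        funext i
        have := Finset.sum_eq_zero_iff.1 hn i (Finset.mem_univ i)
        simpa using this
      rwa [this]
    | succ k ih =>
      intro n hn
      obtain ⟨i, hi⟩ : ∃ i, 1 ≤ n i := by
        by_contra! h
        have : ∑ i, n i = 0 := Finset.sum_eq_zero fun i _ => by have := h i; omega
        omega
      have h1 : Pi.single i 1 + (n - Pi.single i 1) = n :=
        add_tsub_cancel_of_le (single_le_of_pos hi)
      rw [← h1]
      refine raise i _ (ih _ ?_)
      have h2 : ∑ j, (Pi.single i 1 + (n - Pi.single i 1) : MIdx d) j = ∑ j, n j := by rw [h1]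
      simp only [Pi.add_apply, Finset.sum_add_distrib, Pi.single_apply,
        Finset.sum_ite_eq', Finset.mem_univ, if_true] at h2
      simp only [Pi.sub_apply, Pi.single_apply] at h2 ⊢
      omega
  exact this _ n rfl

/-- Induction over words: every tree is obtained from the single vertex by grafting branches at the
left of the root and raising the decoration of the root. -/
theorem word_induction {p : MIdx d → Forest K N d → Prop} (nil : p 0 nil)
    (graft : ∀ e (t : PTree K N d) F, p 0 F → p 0 (cons e t.dec t.branches F))
    (raise : ∀ i n F, p n F → p (Pi.single i 1 + n) F) (n F) : p n F := by
  refine midx_induction ?_ (fun i n => raise i n F) n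
  induction F with
  | nil => exact nil
  | cons e m s r _ hr => exact graft e ⟨m, s⟩ r hr

/-! ## Words at a vertex: product and coproduct -/

theorem dAdd_tr (n m : MIdx d) (F : Forest K N d) : dAdd n (tr m F) = tr (n + m) F := by simp

/-- Graft the branches of a forest, from right to left. -/
def gL : Forest K N d → (TV K N d →ₗ[ℝ] TV K N d)
  | nil => LinearMap.id
  | cons e n s r => gB e ⟨n, s⟩ ∘ₗ gL r

/-- The product of words, a tree being identified with the word that raises the decoration of the
root after having grafted its branches. -/
def mulE : TV K N d →ₗ[ℝ] TV K N d →ₗ[ℝ] TV K N d :=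
  Finsupp.linearCombination ℝ fun u => dAdd u.dec ∘ₗ gL u.branches

theorem mulE_tr (n : MIdx d) (F : Forest K N d) : mulE (tr n F) = dAdd n ∘ₗ gL F := by
  simp [mulE]

theorem mulE_one (v : TV K N d) : mulE (tr 0 nil) v = v := by simp [mulE_tr, gL]

theorem mulE_dAdd (n : MIdx d) (u v : TV K N d) : mulE (dAdd n u) v = dAdd n (mulE u v) := by
  have : mulE ∘ₗ dAdd n = (mulE (K := K) (N := N) (d := d)).compr₂ (dAdd n) := by
    refine TV_ext fun k F => LinearMap.ext fun w => ?_
    simp only [LinearMap.comp_apply, LinearMap.compr₂_apply, dAdd_tr, mulE_tr, dAdd_dAdd]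
  exact LinearMap.congr_fun (LinearMap.congr_fun this u) v

theorem mulE_gB (e : ELabel K N d) (t : PTree K N d) (u v : TV K N d) :
    mulE (gB e t u) v = gB e t (mulE u v) := by
  have : mulE ∘ₗ gB e t = (mulE (K := K) (N := N) (d := d)).compr₂ (gB e t) := by
    refine TV_ext fun k F => ?_
    revert e
    induction k using midx_induction with
    | zero =>
      intro e
      refine LinearMap.ext fun w => ?_
      simp only [LinearMap.comp_apply, LinearMap.compr₂_apply, gB_zero, mulE_tr, gL, dAdd_zero]
    | raise i k ih =>
      intro e
      refine LinearMap.ext fun w => ?_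
      have h1 := LinearMap.congr_fun (gB_dAdd e t i) (tr k F)
      have h2 := LinearMap.congr_fun (gB_dAdd e t i) (mulE (tr k F) w)
      have h3 := LinearMap.congr_fun (ih e) w
      have h4 := LinearMap.congr_fun (ih (e.lower (Pi.single i 1))) w
      simp only [LinearMap.comp_apply, LinearMap.compr₂_apply, LinearMap.add_apply] at h1 h2 h3 h4 ⊢
      rw [← dAdd_tr, h1, mulE_dAdd, h2, map_add, LinearMap.add_apply, mulE_dAdd, h3]
      split_ifs
      · rw [h4]
      · simp
  exact LinearMap.congr_fun (LinearMap.congr_fun this u) v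

/-- The coproduct of the powers of the operators that raise the decoration. -/
def coD (n : MIdx d) : TV K N d ⊗[ℝ] TV K N d →ₗ[ℝ] TV K N d ⊗[ℝ] TV K N d :=
  ∑ m ∈ Finset.Iic n, (mchoose n m : ℝ) • TensorProduct.map (dAdd m) (dAdd (n - m))

/-- The unshuffle coproduct of a list of branches. -/
def coL : Forest K N d → TV K N d ⊗[ℝ] TV K N d
  | nil => tr 0 nil ⊗ₜ tr 0 nil
  | cons e n s r => TensorProduct.map (gB e ⟨n, s⟩) LinearMap.id (coL r) +
      TensorProduct.map LinearMap.id (gB e ⟨n, s⟩) (coL r)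

/-- The coproduct of words. -/
def co : TV K N d →ₗ[ℝ] TV K N d ⊗[ℝ] TV K N d :=
  Finsupp.linearCombination ℝ fun u => coD u.dec (coL u.branches)

theorem co_tr (n : MIdx d) (F : Forest K N d) : co (tr n F) = coD n (coL F) := by simp [co]

@[simp] theorem coD_zero (z : TV K N d ⊗[ℝ] TV K N d) : coD 0 z = z := by
  have h : (dAdd 0 : TV K N d →ₗ[ℝ] _) = LinearMap.id := LinearMap.ext fun v => by simp
  have : Finset.Iic (0 : MIdx d) = {0} := by
    ext m
    simp
  simp [coD, this, mchoose_zero_right, h]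

theorem co_one : co (tr 0 nil : TV K N d) = tr 0 nil ⊗ₜ tr 0 nil := by simp [co_tr, coL]

theorem coD_add_single (n : MIdx d) (i : Fin d) (z : TV K N d ⊗[ℝ] TV K N d) :
    coD (Pi.single i 1 + n) z = TensorProduct.map (dAdd (Pi.single i 1)) LinearMap.id (coD n z) +
      TensorProduct.map LinearMap.id (dAdd (Pi.single i 1)) (coD n z) := by
  have hd : ∀ n m : MIdx d, dAdd (n + m) = (dAdd n ∘ₗ dAdd m : TV K N d →ₗ[ℝ] _) := fun n m =>
    LinearMap.ext fun v => (dAdd_dAdd n m v).symm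
  rw [add_comm (Pi.single i 1) n]
  simp only [coD]
  simp only [LinearMap.sum_apply, LinearMap.smul_apply, map_sum, map_smul]
  refine (sum_Iic_mchoose_add_single n (n + Pi.single i 1) i (fun m =>
    TensorProduct.map (dAdd m) (dAdd (n + Pi.single i 1 - m)) z)).trans ?_
  rw [if_pos (by simp), add_tsub_cancel_right, add_comm]
  congr 1
  · refine Finset.sum_congr rfl fun m _ => ?_
    rw [add_tsub_add_eq_tsub_right, add_comm m, hd, ← LinearMap.comp_apply, ← TensorProduct.map_comp]
    rfl
  · symm
    refine Finset.sum_subset_zero_on_sdiff (fun m hm => ?_) (fun m hm => ?_) (fun m hm => ?_)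
    · rw [Finset.mem_Iic] at hm ⊢
      exact hm.trans (le_add_of_nonneg_right zero_le)
    · rw [Finset.mem_sdiff, Finset.mem_Iic, Finset.mem_Iic] at hm
      simp [mchoose_eq_zero hm.2]
    · rw [Finset.mem_Iic] at hm
      rw [tsub_add_eq_add_tsub hm |>.symm, add_comm (n - m), hd, ← LinearMap.comp_apply,
        ← TensorProduct.map_comp]
      rfl

theorem isCoder_of_tr {x : TV K N d →ₗ[ℝ] TV K N d}
    (h : ∀ n F, co (x (tr n F)) = TensorProduct.map x LinearMap.id (co (tr n F)) +
      TensorProduct.map LinearMap.id x (co (tr n F))) : IsCoder co x := by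
  have : co ∘ₗ x = (TensorProduct.map x LinearMap.id + TensorProduct.map LinearMap.id x) ∘ₗ co :=
    TV_ext h
  exact fun a => LinearMap.congr_fun this a

theorem isCoder_dAdd (i : Fin d) :
    IsCoder co (dAdd (Pi.single i 1) : TV K N d →ₗ[ℝ] TV K N d) :=
  isCoder_of_tr fun n F => by rw [dAdd_tr, co_tr, co_tr, coD_add_single]

/-- `x ⊗ 1` and `1 ⊗ y` commute. -/
theorem map_id_map_id (x y : TV K N d →ₗ[ℝ] TV K N d) (z : TV K N d ⊗[ℝ] TV K N d) :
    TensorProduct.map x LinearMap.id (TensorProduct.map LinearMap.id y z) =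
      TensorProduct.map LinearMap.id y (TensorProduct.map x LinearMap.id z) := by
  rw [← LinearMap.comp_apply, ← LinearMap.comp_apply, ← TensorProduct.map_comp,
    ← TensorProduct.map_comp]
  rfl

/-- Coderivations `x`, `y` and `z` with `x D = D x + y` remain so after composition. -/
theorem coder_step {x x' y D : TV K N d →ₗ[ℝ] TV K N d} (hD : IsCoder co D)
    (hc : x ∘ₗ D = D ∘ₗ x' + y) (hx' : x' = x) {v : TV K N d}
    (hx : co (x v) = TensorProduct.map x LinearMap.id (co v) +
      TensorProduct.map LinearMap.id x (co v))
    (hy : co (y v) = TensorProduct.map y LinearMap.id (co v) +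
      TensorProduct.map LinearMap.id y (co v)) :
    co (x (D v)) = TensorProduct.map x LinearMap.id (co (D v)) +
      TensorProduct.map LinearMap.id x (co (D v)) := by
  subst hx'
  have h1 : x' (D v) = D (x' v) + y v := LinearMap.congr_fun hc v
  have hl : ∀ z, TensorProduct.map x' (LinearMap.id : TV K N d →ₗ[ℝ] TV K N d)
      (TensorProduct.map D LinearMap.id z) = TensorProduct.map D LinearMap.id
        (TensorProduct.map x' LinearMap.id z) + TensorProduct.map y LinearMap.id z := fun z => by
    rw [← LinearMap.comp_apply, ← TensorProduct.map_comp, hc, LinearMap.id_comp,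
      TensorProduct.map_add_left, LinearMap.add_apply, ← LinearMap.comp_apply (TensorProduct.map D _),
      ← TensorProduct.map_comp, LinearMap.id_comp]
  have hr : ∀ z, TensorProduct.map (LinearMap.id : TV K N d →ₗ[ℝ] TV K N d) x'
      (TensorProduct.map LinearMap.id D z) = TensorProduct.map LinearMap.id D
        (TensorProduct.map LinearMap.id x' z) + TensorProduct.map LinearMap.id y z := fun z => by
    rw [← LinearMap.comp_apply, ← TensorProduct.map_comp, hc, LinearMap.id_comp,
      TensorProduct.map_add_right, LinearMap.add_apply,
      ← LinearMap.comp_apply (TensorProduct.map _ D), ← TensorProduct.map_comp, LinearMap.id_comp]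
  rw [h1, map_add, hD, hx, hy, hD v]
  simp only [map_add, hl, hr, map_id_map_id]
  abel

theorem isCoder_gB (e : ELabel K N d) (t : PTree K N d) : IsCoder co (gB e t) := by
  refine isCoder_of_tr fun n F => ?_
  revert e
  induction n using midx_induction with
  | zero =>
    intro e
    rw [gB_zero, co_tr, co_tr, coD_zero, coD_zero, coL]
  | raise i n ih =>
    intro e
    rw [← dAdd_tr]
    refine coder_step (isCoder_dAdd i) (gB_dAdd e t i) rfl (ih e) ?_
    split_ifs
    · exact ih _
    · simp

/-! ## The action of words on trees -/

/-- The counit of words. -/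
def epsV : TV K N d →ₗ[ℝ] FV K N d := Finsupp.lsingle nil ∘ₗ Finsupp.lapply ⟨0, nil⟩

/-- Action of words on the top vertex of an edge decorated by `e` and on the vertices above, given
the action on the latter. -/
def rootA (e : ELabel K N d) (n : MIdx d) (f : TV K N d →ₗ[ℝ] FV K N d) :
    TV K N d →ₗ[ℝ] TV K N d :=
  if e.IsNoise then treeL n ∘ₗ f else cv co mulE LinearMap.id (treeL n ∘ₗ f)

/-- Action of words on forests: the word is distributed over the vertices that are not noise
vertices, and multiplies the words at these vertices from the left. -/
def actF : Forest K N d → (TV K N d →ₗ[ℝ] FV K N d)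
  | nil => epsV
  | cons e n s r => cv co (consB e) (rootA e n (actF s)) (actF r)

/-- Action of words on trees. -/
def actT (t : PTree K N d) : TV K N d →ₗ[ℝ] TV K N d :=
  cv co mulE LinearMap.id (treeL t.dec ∘ₗ actF t.branches)

/-! ## Infinitesimal actions -/

/-- The infinitesimal action on a forest of an operator `x` on the words at the vertices. -/
def infF (x : TV K N d →ₗ[ℝ] TV K N d) : Forest K N d → FV K N d
  | nil => 0
  | cons e n s r =>
    consB e (if e.IsNoise then treeL n (infF x s) else x (tr n s) + treeL n (infF x s))
      (Finsupp.single r 1) + consB e (tr n s) (infF x r)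

/-- The infinitesimal action on forests, extended linearly. -/
def infL (x : TV K N d →ₗ[ℝ] TV K N d) : FV K N d →ₗ[ℝ] FV K N d :=
  Finsupp.linearCombination ℝ (infF x)

/-- The infinitesimal action on the vertices of trees other than the root. -/
def infO (x : TV K N d →ₗ[ℝ] TV K N d) : TV K N d →ₗ[ℝ] TV K N d :=
  Finsupp.linearCombination ℝ fun t => treeL t.dec (infF x t.branches)

/-- The infinitesimal action on trees. -/
def infV (x : TV K N d →ₗ[ℝ] TV K N d) : TV K N d →ₗ[ℝ] TV K N d := x + infO x

/-- The infinitesimal action on the tree above an edge decorated by `e`. -/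
def infE (e : ELabel K N d) (x : TV K N d →ₗ[ℝ] TV K N d) : TV K N d →ₗ[ℝ] TV K N d :=
  if e.IsNoise then infO x else infV x

variable (x y : TV K N d →ₗ[ℝ] TV K N d)

@[simp] theorem infL_single (F : Forest K N d) : infL x (Finsupp.single F 1) = infF x F := by
  simp [infL]

theorem infO_tr (n : MIdx d) (F : Forest K N d) : infO x (tr n F) = treeL n (infF x F) := by
  simp [infO]

theorem infF_cons (e : ELabel K N d) (n : MIdx d) (s r : Forest K N d) :
    infF x (cons e n s r) = consB e (infE e x (tr n s)) (Finsupp.single r 1) +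
      consB e (tr n s) (infF x r) := by
  simp only [infF, infE]
  split_ifs
  · rw [infO_tr]
  · rw [infV, LinearMap.add_apply, infO_tr]

theorem infL_consB (e : ELabel K N d) (a : TV K N d) (b : FV K N d) :
    infL x (consB e a b) = consB e (infE e x a) b + consB e a (infL x b) := by
  have : (consB e).compr₂ (infL x) = consB e ∘ₗ infE e x + (consB e).compl₂ (infL x) := by
    refine TV_ext fun n s => FV_ext fun r => ?_
    simp [infF_cons]
  exact LinearMap.congr_fun (LinearMap.congr_fun this a) b

theorem infO_treeL (n : MIdx d) (a : FV K N d) : infO x (treeL n a) = treeL n (infL x a) := by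
  have : infO x ∘ₗ treeL n = treeL n ∘ₗ infL x :=
    FV_ext fun F => by simp [infO_tr]
  exact LinearMap.congr_fun this a

theorem dAdd_treeL (m n : MIdx d) (a : FV K N d) : dAdd m (treeL n a) = treeL (m + n) a := by
  have : dAdd m ∘ₗ treeL n = treeL (K := K) (N := N) (m + n) := FV_ext fun F => by simp
  exact LinearMap.congr_fun this a

theorem infO_dAdd (m : MIdx d) (a : TV K N d) : infO x (dAdd m a) = dAdd m (infO x a) := by
  have : infO x ∘ₗ dAdd m = dAdd m ∘ₗ infO x :=
    TV_ext fun n F => by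
      rw [LinearMap.comp_apply, dAdd_tr, infO_tr, LinearMap.comp_apply, infO_tr, dAdd_treeL]
  exact LinearMap.congr_fun this a

theorem lower_isNoise (e : ELabel K N d) (l : MIdx d) : (e.lower l).IsNoise ↔ e.IsNoise := Iff.rfl

theorem gBL_treeL (e : ELabel K N d) (a : TV K N d) (n : MIdx d) (b : FV K N d) :
    gBL e a (treeL n b) = ∑ l ∈ Finset.Iic e.2,
      (mchoose n l : ℝ) • treeL (n - l) (consB (e.lower l) a b) := by
  have : (gBL e).compl₂ (treeL n) = ∑ l ∈ Finset.Iic e.2,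
      (mchoose n l : ℝ) • (consB (e.lower l)).compr₂ (treeL (n - l)) := by
    refine TV_ext fun m s => FV_ext fun F => ?_
    simp [gB_single, LinearMap.sum_apply]
  have h := LinearMap.congr_fun (LinearMap.congr_fun this a) b
  simpa [LinearMap.sum_apply] using h

theorem infO_gBL (e : ELabel K N d) (a v : TV K N d) :
    infO x (gBL e a v) = gBL e a (infO x v) + gBL e (infE e x a) v := by
  have : (gBL e).compr₂ (infO x) = (gBL e).compl₂ (infO x) + gBL e ∘ₗ infE e x := by
    refine LinearMap.ext fun a => TV_ext fun n F => ?_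
    simp only [LinearMap.compr₂_apply, LinearMap.add_apply, LinearMap.compl₂_apply,
      LinearMap.comp_apply, infO_tr]
    have hF : tr n F = treeL n (Finsupp.single F 1) := by simp
    rw [hF]
    simp only [gBL_treeL, map_sum, map_smul, infO_treeL, infL_consB, infL_single, map_add, smul_add,
      Finset.sum_add_distrib]
    rw [add_comm]
    rfl
  exact LinearMap.congr_fun (LinearMap.congr_fun this a) v

theorem infO_gB (e : ELabel K N d) (t : PTree K N d) (v : TV K N d) :
    infO x (gB e t v) = gB e t (infO x v) + gBL e (infE e x (Finsupp.single t 1)) v := by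
  rw [← gBL_single, infO_gBL]

theorem mulE_gBL (e : ELabel K N d) (a u v : TV K N d) :
    mulE (gBL e a u) v = gBL e a (mulE u v) := by
  induction a using Finsupp.induction_linear with
  | zero => simp
  | add a b ha hb => simp [ha, hb]
  | single t c =>
    rw [single_eq_smul]
    simp only [map_smul, LinearMap.smul_apply, gBL_single, mulE_gB]

theorem isCoder_gBL (e : ELabel K N d) (a : TV K N d) : IsCoder co (gBL e a) := by
  induction a using Finsupp.induction_linear with
  | zero => intro v; simp
  | add a b ha hb => rw [map_add]; exact ha.add hb
  | single t c =>
    intro v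
    rw [single_eq_smul, map_smul, gBL_single]
    simp [isCoder_gB e t v, TensorProduct.map_smul_left, TensorProduct.map_smul_right]

/-- The infinitesimal action on the branches is a derivation of the product of words. -/
theorem infO_mulE (u v : TV K N d) :
    infO x (mulE u v) = mulE (infO x u) v + mulE u (infO x v) := by
  have : (mulE (K := K) (N := N) (d := d)).compr₂ (infO x) =
      mulE ∘ₗ infO x + mulE.compl₂ (infO x) := by
    refine TV_ext fun n F => LinearMap.ext fun v => ?_
    simp only [LinearMap.compr₂_apply, LinearMap.add_apply, LinearMap.compl₂_apply,
      LinearMap.comp_apply]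
    induction n, F using word_induction with
    | nil => simp [mulE_one, infO_tr, infF]
    | graft e t F ih =>
      rw [← gB_zero, mulE_gB, mulE_gB, infO_gB, infO_gB, ih, map_add, map_add, LinearMap.add_apply,
        mulE_gB, mulE_gBL]
      abel
    | raise i n F ih =>
      rw [← dAdd_tr, mulE_dAdd, mulE_dAdd, infO_dAdd, infO_dAdd, ih, map_add, mulE_dAdd]
  exact LinearMap.congr_fun (LinearMap.congr_fun this u) v

theorem isCoder_infO : IsCoder co (infO x) := by
  refine isCoder_of_tr fun n F => ?_
  induction n, F using word_induction with
  | nil => simp [co_one, infO_tr, infF]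
  | graft e t F ih =>
    rw [← gB_zero]
    exact coder_step (isCoder_gB e t) (LinearMap.ext fun v => infO_gB x e t v) rfl ih
      (isCoder_gBL e _ _)
  | raise i n F ih =>
    rw [← dAdd_tr]
    refine coder_step (y := 0) (isCoder_dAdd i) (LinearMap.ext fun v => ?_) rfl ih (by simp)
    simp [infO_dAdd]

theorem epsV_comp {x : TV K N d →ₗ[ℝ] TV K N d} (h : ∀ n F, x (tr n F) ⟨0, nil⟩ = 0) :
    epsV ∘ₗ x = 0 :=
  TV_ext fun n F => by simp [epsV, h]

theorem gB_apply_one (e : ELabel K N d) (t : PTree K N d) (v : TV K N d) :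
    gB e t v ⟨0, nil⟩ = 0 := by
  have : Finsupp.lapply ⟨0, nil⟩ ∘ₗ gB e t = 0 := TV_ext fun n F => by
    simp [gB_single]
  exact LinearMap.congr_fun this v

theorem gBL_apply_one (e : ELabel K N d) (a : TV K N d) (v : TV K N d) :
    gBL e a v ⟨0, nil⟩ = 0 := by
  have : (gBL e).compr₂ (Finsupp.lapply ⟨0, nil⟩) = 0 := TV_ext fun n F =>
    LinearMap.ext fun v => by simp [gB_apply_one]
  exact LinearMap.congr_fun (LinearMap.congr_fun this a) v

theorem dAdd_single_apply_one (i : Fin d) (v : TV K N d) :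
    dAdd (Pi.single i 1) v ⟨0, nil⟩ = 0 := by
  have : Finsupp.lapply ⟨0, nil⟩ ∘ₗ (dAdd (Pi.single i 1) : TV K N d →ₗ[ℝ] _) = 0 :=
    TV_ext fun n F => by
      simp only [LinearMap.comp_apply, dAdd_tr, Finsupp.lapply_apply, LinearMap.zero_apply]
      rw [Finsupp.single_eq_of_ne]
      intro h
      have := congrFun (congrArg PTree.dec h) i
      simp at this
      omega
  exact LinearMap.congr_fun this v

theorem infO_apply_one (n : MIdx d) (F : Forest K N d) : infO x (tr n F) ⟨0, nil⟩ = 0 := by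
  induction n, F using word_induction with
  | nil => simp [infO_tr, infF]
  | graft e t F ih =>
    rw [← gB_zero, infO_gB, Finsupp.add_apply, gB_apply_one, gBL_apply_one, add_zero]
  | raise i n F ih => rw [← dAdd_tr, infO_dAdd, dAdd_single_apply_one]

/-- The operators of left multiplication by primitive words. -/
structure IsPrim (x : TV K N d →ₗ[ℝ] TV K N d) : Prop where
  mul : ∀ u v, mulE (x u) v = x (mulE u v)
  coder : IsCoder co x
  eps : epsV ∘ₗ x = 0

theorem isPrim_gB (e : ELabel K N d) (t : PTree K N d) : IsPrim (gB e t) :=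
  ⟨mulE_gB e t, isCoder_gB e t, epsV_comp fun _ _ => gB_apply_one e t _⟩

theorem isPrim_dAdd (i : Fin d) : IsPrim (dAdd (Pi.single i 1) : TV K N d →ₗ[ℝ] _) :=
  ⟨mulE_dAdd _, isCoder_dAdd i, epsV_comp fun _ _ => dAdd_single_apply_one i _⟩

variable {x}

theorem cv_mulE_comp (hx : IsPrim x) {f : TV K N d →ₗ[ℝ] FV K N d}
    (hf : f ∘ₗ x = infL x ∘ₗ f - f ∘ₗ infO x) (n : MIdx d) :
    cv co mulE LinearMap.id (treeL n ∘ₗ f) ∘ₗ x =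
      infV x ∘ₗ cv co mulE LinearMap.id (treeL n ∘ₗ f) -
        cv co mulE LinearMap.id (treeL n ∘ₗ f) ∘ₗ infO x := by
  have h1 : x ∘ₗ cv co mulE LinearMap.id (treeL n ∘ₗ f) =
      cv co mulE (LinearMap.id ∘ₗ x) (treeL n ∘ₗ f) := by
    rw [comp_cv]
    exact cv_congr fun a b => by simp [hx.mul]
  have h2 : infO x ∘ₗ cv co mulE LinearMap.id (treeL n ∘ₗ f) =
      cv co mulE (LinearMap.id ∘ₗ infO x) (treeL n ∘ₗ f) +
        cv co mulE LinearMap.id (treeL n ∘ₗ infL x ∘ₗ f) := by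
    rw [comp_cv_of_leibniz (infO_mulE x)]
    congr 2
    exact LinearMap.ext fun v => infO_treeL x n _
  rw [cv_comp hx.coder, cv_comp (isCoder_infO x), infV, LinearMap.add_comp, h1, h2,
    LinearMap.comp_assoc, hf, LinearMap.comp_sub, cv_sub_right, LinearMap.comp_assoc]
  abel

theorem rootA_comp (hx : IsPrim x) (e : ELabel K N d) {f : TV K N d →ₗ[ℝ] FV K N d}
    (hf : f ∘ₗ x = infL x ∘ₗ f - f ∘ₗ infO x) (n : MIdx d) :
    rootA e n f ∘ₗ x = infE e x ∘ₗ rootA e n f - rootA e n f ∘ₗ infO x := by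
  simp only [rootA, infE]
  split_ifs
  · rw [LinearMap.comp_assoc, hf, LinearMap.comp_sub, LinearMap.comp_assoc]
    congr 1
    exact LinearMap.ext fun v => (infO_treeL x n _).symm
  · exact cv_mulE_comp hx hf n

theorem actF_comp (hx : IsPrim x) (F : Forest K N d) :
    actF F ∘ₗ x = infL x ∘ₗ actF F - actF F ∘ₗ infO x := by
  induction F with
  | nil =>
    simp only [actF]
    rw [hx.eps, epsV_comp (infO_apply_one x)]
    refine LinearMap.ext fun v => ?_
    simp [epsV, infL, infF]
  | cons e n s r hs hr =>
    simp only [actF]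
    rw [cv_comp hx.coder, cv_comp (isCoder_infO x), comp_cv_of_leibniz (infL_consB x e),
      rootA_comp hx e hs, hr, cv_sub_right, cv_sub_left]
    abel

/-- The action of `x u`, for `x` primitive, in terms of the infinitesimal action of `x`. -/
theorem actT_comp (hx : IsPrim x) (t : PTree K N d) :
    actT t ∘ₗ x = infV x ∘ₗ actT t - actT t ∘ₗ infO x :=
  cv_mulE_comp hx (actF_comp hx _) _

/-! ## Commutation of infinitesimal actions -/

section Commutator

variable {x y z : TV K N d →ₗ[ℝ] TV K N d}

theorem infF_comm
    (h : ∀ v, y (infV x v) + infO y (x v) = x (infV y v) + infO x (y v) + z v) (F : Forest K N d) :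
    infL y (infF x F) = infL x (infF y F) + infF z F := by
  induction F with
  | nil => simp [infF]
  | cons e n s r hs hr =>
    have key : infE e y (infE e x (tr n s)) =
        infE e x (infE e y (tr n s)) + infE e z (tr n s) := by
      simp only [infE]
      split_ifs
      · simp only [infO_tr, infO_treeL, hs, map_add]
      · have h' := h (tr n s)
        have h1 : ∀ w w' : TV K N d →ₗ[ℝ] TV K N d, infV w (infV w' (tr n s)) =
            w (infV w' (tr n s)) + infO w (w' (tr n s)) + treeL n (infL w (infF w' s)) :=
          fun w w' => by
            rw [infV, LinearMap.add_apply]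
            conv_lhs => rw [infV, LinearMap.add_apply, map_add (infO w), infO_tr w', infO_treeL]
            rw [infV, LinearMap.add_apply, infO_tr, add_assoc]
        have h2 : infV z (tr n s) = z (tr n s) + treeL n (infF z s) := by
          rw [infV, LinearMap.add_apply, infO_tr]
        rw [h1, h1, h', hs, map_add, h2]
        abel
    simp only [infF_cons, map_add, infL_consB, key, hr, infL_single, LinearMap.add_apply]
    abel

theorem infO_comm
    (h : ∀ v, y (infV x v) + infO y (x v) = x (infV y v) + infO x (y v) + z v) (v : TV K N d) :
    infO y (infO x v) = infO x (infO y v) + infO z v := by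
  have : infO y ∘ₗ infO x = infO x ∘ₗ infO y + infO z := TV_ext fun n F => by
    simp only [LinearMap.comp_apply, LinearMap.add_apply, infO_tr, infO_treeL, infF_comm h, map_add]
  exact LinearMap.congr_fun this v

theorem infV_comm
    (h : ∀ v, y (infV x v) + infO y (x v) = x (infV y v) + infO x (y v) + z v) (v : TV K N d) :
    infV y (infV x v) = infV x (infV y v) + infV z v := by
  have h' := h v
  have h1 : ∀ w w' : TV K N d →ₗ[ℝ] TV K N d, infV w (infV w' v) =
      w (infV w' v) + infO w (w' v) + infO w (infO w' v) := fun w w' => by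
    conv_lhs => rw [infV, LinearMap.add_apply, infV, LinearMap.add_apply, map_add (infO w)]
    rw [infV, LinearMap.add_apply, add_assoc]
  have h2 : infV z v = z v + infO z v := rfl
  rw [h1, h1, h', infO_comm h, h2]
  abel

end Commutator

/-! ## Supports -/

theorem map_mem_of_supported {ι M : Type*} [AddCommMonoid M] [Module ℝ M] (f : (ι →₀ ℝ) →ₗ[ℝ] M)
    {S : Set ι} {p : Submodule ℝ M} (h : ∀ a ∈ S, f (Finsupp.single a 1) ∈ p) {v : ι →₀ ℝ}
    (hv : v ∈ Finsupp.supported ℝ ℝ S) : f v ∈ p := by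
  rw [Finsupp.supported_eq_span_single] at hv
  induction hv using Submodule.span_induction with
  | mem x hx => obtain ⟨a, ha, rfl⟩ := hx; exact h a ha
  | zero => simp
  | add x y _ _ hx hy => rw [map_add]; exact p.add_mem hx hy
  | smul c x _ hx => rw [map_smul]; exact p.smul_mem c hx

theorem single_mem_supported {ι : Type*} {S : Set ι} {a : ι} (ha : a ∈ S) (c : ℝ) :
    Finsupp.single a c ∈ Finsupp.supported ℝ ℝ S :=
  Finsupp.single_mem_supported ℝ c ha

theorem treeL_mem {S : Set (Forest K N d)} {T : Set (PTree K N d)} {n : MIdx d}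
    (h : ∀ F ∈ S, PTree.mk n F ∈ T) {v : FV K N d} (hv : v ∈ Finsupp.supported ℝ ℝ S) :
    treeL n v ∈ Finsupp.supported ℝ ℝ T :=
  map_mem_of_supported _ (fun F hF => by
    rw [treeL_single]; exact single_mem_supported (h F hF) 1) hv

theorem consB_mem {P : Set (PTree K N d)} {Q R : Set (Forest K N d)} {e : ELabel K N d}
    (h : ∀ t ∈ P, ∀ F ∈ Q, cons e t.dec t.branches F ∈ R) {a : TV K N d} {b : FV K N d}
    (ha : a ∈ Finsupp.supported ℝ ℝ P) (hb : b ∈ Finsupp.supported ℝ ℝ Q) :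
    consB e a b ∈ Finsupp.supported ℝ ℝ R := by
  refine map_mem_of_supported ((consB e).flip b) (fun t ht => ?_) ha
  refine map_mem_of_supported (consB e (Finsupp.single t 1)) (fun F hF => ?_) hb
  rw [consB_single]
  exact single_mem_supported (h t ht F hF) _

/-- The decorations of the edges going out of the base vertex. -/
def topL : Forest K N d → List (ELabel K N d)
  | nil => []
  | cons e _ _ r => e :: topL r

/-- No noise edge goes out of the base vertex. -/
def NoTop (F : Forest K N d) : Prop := ∀ e ∈ topL F, ¬ e.IsNoise

@[simp] theorem noTop_nil : NoTop (nil : Forest K N d) := by simp [NoTop, topL]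

@[simp] theorem noTop_cons (e : ELabel K N d) (n : MIdx d) (s r : Forest K N d) :
    NoTop (cons e n s r) ↔ ¬ e.IsNoise ∧ NoTop r := by simp [NoTop, topL]

theorem infF_topL (x : TV K N d →ₗ[ℝ] TV K N d) (F : Forest K N d) :
    infF x F ∈ Finsupp.supported ℝ ℝ {G | topL G = topL F} := by
  induction F with
  | nil => exact Submodule.zero_mem _
  | cons e n s r _ hr =>
    refine Submodule.add_mem _ ?_ ?_
    · refine consB_mem (P := Set.univ) (Q := {r}) (fun t _ F hF => ?_) (by simp)
        (single_mem_supported (Set.mem_singleton r) 1)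
      simp only [Set.mem_ofPred_eq, topL, Set.mem_singleton_iff] at hF ⊢
      rw [hF]
    · refine consB_mem (P := Set.univ) (fun t _ F hF => ?_) (by simp) hr
      simp only [Set.mem_ofPred_eq, topL] at hF ⊢
      rw [hF]

/-! ## Insertion as an infinitesimal action -/

/-- The projection onto the words all of whose letters are kernel edges. -/
def nuV : TV K N d →ₗ[ℝ] TV K N d :=
  Finsupp.linearCombination ℝ fun t => if NoTop t.branches then Finsupp.single t 1 else 0

theorem nuV_tr (n : MIdx d) (F : Forest K N d) :
    nuV (tr n F) = if NoTop F then tr n F else 0 := by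
  simp [nuV]

theorem nuV_dAdd (n : MIdx d) (v : TV K N d) : nuV (dAdd n v) = dAdd n (nuV v) := by
  have : nuV ∘ₗ dAdd n = dAdd n ∘ₗ (nuV : TV K N d →ₗ[ℝ] _) := TV_ext fun m F => by
    simp only [LinearMap.comp_apply, dAdd_tr, nuV_tr]
    split_ifs <;> simp
  exact LinearMap.congr_fun this v

theorem nuV_gB {e : ELabel K N d} (he : ¬ e.IsNoise) (t : PTree K N d) (v : TV K N d) :
    nuV (gB e t v) = gB e t (nuV v) := by
  have : nuV ∘ₗ gB e t = gB e t ∘ₗ nuV := TV_ext fun m F => by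
    simp only [LinearMap.comp_apply, gB_single, nuV_tr, map_sum, map_smul, noTop_cons,
      lower_isNoise, he, not_false_eq_true, true_and]
    split_ifs <;> simp [gB_single]
  exact LinearMap.congr_fun this v

theorem nuV_infO (x : TV K N d →ₗ[ℝ] TV K N d) (v : TV K N d) :
    nuV (infO x v) = infO x (nuV v) := by
  have : nuV ∘ₗ infO x = infO x ∘ₗ nuV := TV_ext fun m F => by
    have hF := infF_topL x F
    simp only [LinearMap.comp_apply, nuV_tr, infO_tr]
    split_ifs with h
    · rw [infO_tr]
      have : ∀ v ∈ Finsupp.supported ℝ ℝ {G : Forest K N d | topL G = topL F},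
          ((nuV ∘ₗ treeL m - treeL m : FV K N d →ₗ[ℝ] TV K N d)) v = 0 := fun v hv => by
        rw [← Submodule.mem_bot ℝ]
        refine map_mem_of_supported _ (fun G hG => ?_) hv
        simp only [Set.mem_ofPred_eq] at hG
        have : NoTop G := by rwa [NoTop, hG]
        simp [nuV_tr, this]
      simpa [sub_eq_zero] using this _ hF
    · rw [map_zero]
      rw [← LinearMap.comp_apply, ← Submodule.mem_bot ℝ]
      refine map_mem_of_supported _ (fun G hG => ?_) hF
      simp only [Set.mem_ofPred_eq] at hG
      have : ¬ NoTop G := by rwa [NoTop, hG]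
      simp [nuV_tr, this]
  exact LinearMap.congr_fun this v

/-- The action of words, linear in the tree. -/
def actL : TV K N d →ₗ[ℝ] TV K N d →ₗ[ℝ] TV K N d := Finsupp.linearCombination ℝ actT

@[simp] theorem actL_single (t : PTree K N d) : actL (Finsupp.single t 1) = actT t := by
  simp [actL]

/-- Insertion of a tree at the root. -/
def insR (t : PTree K N d) : TV K N d →ₗ[ℝ] TV K N d := actT t ∘ₗ nuV

theorem actL_prim {x : TV K N d →ₗ[ℝ] TV K N d} (hx : IsPrim x) (s u : TV K N d) :
    actL s (x u) = infV x (actL s u) - actL s (infO x u) := by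
  induction s using Finsupp.induction_linear with
  | zero => simp
  | add a b ha hb => rw [map_add, LinearMap.add_apply, ha, hb]; simp; abel
  | single t c =>
    rw [single_eq_smul]
    have := LinearMap.congr_fun (actT_comp hx t) u
    simp only [map_smul, LinearMap.smul_apply, actL_single, LinearMap.comp_apply,
      LinearMap.sub_apply] at this ⊢
    rw [this, smul_sub]

theorem isPrim_gBL (e : ELabel K N d) (a : TV K N d) : IsPrim (gBL e a) :=
  ⟨mulE_gBL e a, isCoder_gBL e a, epsV_comp fun _ _ => gBL_apply_one e a _⟩

theorem isPrim_zero : IsPrim (0 : TV K N d →ₗ[ℝ] TV K N d) :=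
  ⟨by simp, fun a => by simp, by simp⟩

theorem insR_comm {x z : TV K N d →ₗ[ℝ] TV K N d} (hx : IsPrim x)
    (hn : ∀ v, nuV (x v) = x (nuV v)) {t : PTree K N d}
    (hz : ∀ v, infO (insR t) (x v) = x (infO (insR t) v) + z v) (v : TV K N d) :
    insR t (infV x v) + infO (insR t) (x v) =
      x (infV (insR t) v) + infO x (insR t v) + z v := by
  have h := LinearMap.congr_fun (actT_comp hx t) (nuV v)
  simp only [LinearMap.comp_apply, LinearMap.sub_apply, eq_sub_iff_add_eq] at h
  have h1 : insR t (infV x v) = infV x (insR t v) := by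
    rw [infV, LinearMap.add_apply, map_add]
    simp only [insR, LinearMap.comp_apply, hn, nuV_infO]
    exact h
  rw [h1, hz, infV, infV, LinearMap.add_apply, LinearMap.add_apply, map_add]
  abel

/-- The part of the induction step common to all primitive words. -/
theorem insert_act_step {x z : TV K N d →ₗ[ℝ] TV K N d} (hx : IsPrim x) (hz' : IsPrim z)
    (hn : ∀ v, nuV (x v) = x (nuV v)) {t : PTree K N d}
    (hz : ∀ v, infO (insR t) (x v) = x (infO (insR t) v) + z v) {u : TV K N d}
    (h1 : ∀ s, infV (insR t) (actL s u) =
      actL (infV (insR t) s) u + actL s (infO (insR t) u))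
    (h2 : ∀ s, infV (insR t) (actL s (infO x u)) =
      actL (infV (insR t) s) (infO x u) + actL s (infO (insR t) (infO x u))) (s : TV K N d) :
    infV (insR t) (actL s (x u)) =
      actL (infV (insR t) s) (x u) + actL s (infO (insR t) (x u)) := by
  rw [actL_prim hx, map_sub, infV_comm (insR_comm hx hn hz), h1, h2, map_add, hz, map_add,
    actL_prim hx, actL_prim hx, actL_prim hz', infO_comm (insR_comm hx hn hz), map_add]
  abel

theorem actF_one (F : Forest K N d) : actF F (tr 0 nil) = Finsupp.single F 1 := by
  induction F with
  | nil => simp [actF, epsV]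
  | cons e n s r hs hr =>
    rw [actF, cv, LinearMap.comp_apply, LinearMap.comp_apply, co_one, TensorProduct.map_tmul,
      TensorProduct.lift.tmul, hr, rootA]
    split_ifs
    · simp [hs]
    · simp [cv, co_one, hs, mulE_one]

theorem actL_one (s : TV K N d) : actL s (tr 0 nil) = s := by
  have : (actL.flip (tr 0 nil) : TV K N d →ₗ[ℝ] _) = LinearMap.id := TV_ext fun n F => by
    simp [actT, cv, co_one, actF_one, mulE_one]
  exact LinearMap.congr_fun this s

theorem insert_act_of_size (t : PTree K N d) (k : ℕ) : ∀ (n : MIdx d) (F : Forest K N d),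
    ∑ i, n i + (topL F).length = k → NoTop F → ∀ s,
    infV (insR t) (actL s (tr n F)) =
      actL (infV (insR t) s) (tr n F) + actL s (infO (insR t) (tr n F)) := by
  induction k with
  | zero =>
    intro n F hk _ s
    have hn : n = 0 := by
      funext i
      have : ∑ i, n i = 0 := by omega
      simpa using Finset.sum_eq_zero_iff.1 this i (Finset.mem_univ i)
    have hF : F = nil := by
      cases F with
      | nil => rfl
      | cons e n s r => simp [topL] at hk
    subst hn hF
    simp [actL_one, infO_tr, infF]
  | succ k ih =>
    have ih' : ∀ (x : TV K N d →ₗ[ℝ] TV K N d) (n : MIdx d) (F : Forest K N d),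
        ∑ i, n i + (topL F).length = k → NoTop F → ∀ s,
        infV (insR t) (actL s (infO x (tr n F))) =
          actL (infV (insR t) s) (infO x (tr n F)) +
            actL s (infO (insR t) (infO x (tr n F))) := by
      intro x n F hk hF s
      have hS := infF_topL x F
      rw [infO_tr, ← sub_eq_zero]
      have : (infV (insR t) ∘ₗ actL s ∘ₗ treeL n - (actL (infV (insR t) s) ∘ₗ treeL n +
          actL s ∘ₗ infO (insR t) ∘ₗ treeL n)) (infF x F) = 0 := by
        rw [← Submodule.mem_bot ℝ]
        refine map_mem_of_supported _ (fun G hG => ?_) hS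
        simp only [Set.mem_ofPred_eq] at hG
        have := ih n G (by rw [hG]; exact hk) (by rwa [NoTop, hG]) s
        simp only [LinearMap.sub_apply, LinearMap.comp_apply, treeL_single, LinearMap.add_apply,
          Submodule.mem_bot]
        rw [this, sub_self]
      exact this
    intro n F hk hF s
    by_cases hn : ∃ i, 1 ≤ n i
    · obtain ⟨i, hi⟩ := hn
      have h1 : Pi.single i 1 + (n - Pi.single i 1) = n :=
        add_tsub_cancel_of_le (single_le_of_pos hi)
      have hk' : ∑ j, (n - Pi.single i 1 : MIdx d) j + (topL F).length = k := by
        have h2 : ∑ j, (Pi.single i 1 + (n - Pi.single i 1) : MIdx d) j = ∑ j, n j := by rw [h1]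
        simp only [Pi.add_apply, Finset.sum_add_distrib, Pi.single_apply,
          Finset.sum_ite_eq', Finset.mem_univ, if_true] at h2
        simp only [Pi.sub_apply, Pi.single_apply] at h2 ⊢
        omega
      rw [← h1, ← dAdd_tr]
      exact insert_act_step (isPrim_dAdd i) isPrim_zero (nuV_dAdd _)
        (fun v => by rw [infO_dAdd, LinearMap.zero_apply, add_zero]) (ih _ F hk' hF)
        (ih' _ _ F hk' hF) s
    · have hn : n = 0 := by
        funext i
        by_contra h
        exact hn ⟨i, Nat.one_le_iff_ne_zero.2 h⟩
      subst hn
      cases F with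
      | nil => simp [topL] at hk
      | cons e n q r =>
        rw [noTop_cons] at hF
        have hk' : ∑ j, (0 : MIdx d) j + (topL r).length = k := by
          simp [topL] at hk ⊢
          omega
        rw [← gB_zero e ⟨n, q⟩]
        exact insert_act_step (isPrim_gB e _) (isPrim_gBL e _) (nuV_gB hF.1 _)
          (infO_gB (insR t) e _) (ih _ r hk' hF.2) (ih' _ _ r hk' hF.2) s

/-- Insertion of `t` in the result of the action of a word on a tree. -/
theorem infV_actL (t : PTree K N d) (s u : TV K N d) :
    infV (insR t) (actL s (nuV u)) =
      actL (infV (insR t) s) (nuV u) + actL s (nuV (infO (insR t) u)) := by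
  have : infV (insR t) ∘ₗ actL s ∘ₗ nuV = actL (infV (insR t) s) ∘ₗ nuV +
      actL s ∘ₗ nuV ∘ₗ infO (insR t) := TV_ext fun n F => by
    simp only [LinearMap.comp_apply, LinearMap.add_apply, nuV_infO, nuV_tr]
    split_ifs with h
    · exact insert_act_of_size t _ n F rfl h s
    · simp
  exact LinearMap.congr_fun this u

/-! ## Recursive forms of the constraints on noises and of the regularity -/

/-- The vertices of a nonempty forest. -/
def vertEquiv (e : ELabel K N d) (n : MIdx d) (s r : Forest K N d) :
    Option (s.Vert ⊕ r.Vert) ≃ (cons e n s r).Vert where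
  toFun
    | none => Vert.head
    | some (Sum.inl y) => Vert.up y
    | some (Sum.inr y) => Vert.right y
  invFun
    | Vert.head => none
    | Vert.up y => some (Sum.inl y)
    | Vert.right y => some (Sum.inr y)
  left_inv x := by rcases x with _ | _ | _ <;> rfl
  right_inv x := by cases x <;> rfl

instance : IsEmpty (nil : Forest K N d).Vert := ⟨fun x => nomatch x⟩

@[to_additive]
theorem prod_vert {M : Type*} [CommMonoid M] {e : ELabel K N d} {n : MIdx d} {s r : Forest K N d}
    (f : (cons e n s r).Vert → M) :
    ∏ x, f x = f Vert.head * ((∏ x, f (Vert.up x)) * ∏ x, f (Vert.right x)) := by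
  rw [← Fintype.prod_equiv (vertEquiv e n s r) (fun x => f (vertEquiv e n s r x)) f fun _ => rfl,
    Fintype.prod_option, Fintype.prod_sum_type]
  rfl

theorem forall_vert {e : ELabel K N d} {n : MIdx d} {s r : Forest K N d}
    {p : (cons e n s r).Vert → Prop} :
    (∀ x, p x) ↔ p Vert.head ∧ (∀ x, p (Vert.up x)) ∧ ∀ x, p (Vert.right x) :=
  ⟨fun h => ⟨h _, fun _ => h _, fun _ => h _⟩, fun h x => by
    cases x with
    | head => exact h.1
    | up x => exact h.2.1 x
    | right x => exact h.2.2 x⟩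

/-- The constraints on the noise edges of a forest. -/
def OkF : Forest K N d → Prop
  | nil => True
  | cons e _ s r => (e.IsNoise → s = nil ∧ NoTop r) ∧ OkF s ∧ OkF r

section VertLemmas

variable {e : ELabel K N d} {n : MIdx d} {s r : Forest K N d}

@[simp] theorem parent_head : parent (Vert.head : (cons e n s r).Vert) = none := rfl

@[simp] theorem parent_right (x : r.Vert) :
    parent (Vert.right x : (cons e n s r).Vert) = (parent x).map Vert.right := rfl

theorem parent_up (x : s.Vert) :
    parent (Vert.up x : (cons e n s r).Vert) = some ((parent x).elim Vert.head Vert.up) := by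
  rw [parent]
  split <;> simp_all

@[simp] theorem label_head : label (Vert.head : (cons e n s r).Vert) = e := rfl
@[simp] theorem label_up (x : s.Vert) : label (Vert.up x : (cons e n s r).Vert) = label x := rfl
@[simp] theorem label_right (x : r.Vert) :
    label (Vert.right x : (cons e n s r).Vert) = label x := rfl
@[simp] theorem vdec_head : Forest.vdec (Vert.head : (cons e n s r).Vert) = n := rfl
@[simp] theorem vdec_up (x : s.Vert) :
    Forest.vdec (Vert.up x : (cons e n s r).Vert) = Forest.vdec x := rfl
@[simp] theorem vdec_right (x : r.Vert) :
    Forest.vdec (Vert.right x : (cons e n s r).Vert) = Forest.vdec x := rfl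
@[simp] theorem above_head : Forest.above (Vert.head : (cons e n s r).Vert) = s := rfl
@[simp] theorem above_up (x : s.Vert) :
    Forest.above (Vert.up x : (cons e n s r).Vert) = Forest.above x := rfl
@[simp] theorem above_right (x : r.Vert) :
    Forest.above (Vert.right x : (cons e n s r).Vert) = Forest.above x := rfl

end VertLemmas

theorem noTop_iff (F : Forest K N d) :
    NoTop F ↔ ∀ x : F.Vert, parent x = none → ¬ (label x).IsNoise := by
  induction F with
  | nil => simp
  | cons e n s r _ hr =>
    rw [noTop_cons, hr, forall_vert]
    simp [parent_up]

theorem noTop_above_iff {F : Forest K N d} (v : F.Vert) :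
    NoTop (Forest.above v) ↔ ∀ x : F.Vert, parent x = some v → ¬ (label x).IsNoise := by
  induction F with
  | nil => exact (IsEmpty.false v).elim
  | cons e n s r hs hr =>
    rw [forall_vert]
    cases v with
    | head =>
      rw [above_head, noTop_iff]
      simp only [parent_head, parent_up, parent_right, label_up, label_right]
      refine ⟨fun h => ⟨by simp, fun x hx => h x ?_, fun x hx => ?_⟩, fun h x hx => h.2.1 x ?_⟩
      · rcases h' : parent x with _ | y
        · rfl
        · simp [h'] at hx
      · rcases h' : parent x with _ | y <;> simp [h'] at hx
      · simp [hx]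
    | up v =>
      rw [above_up, hs]
      simp only [parent_head, parent_up, parent_right, label_up, label_right]
      refine ⟨fun h => ⟨by simp, fun x hx => h x ?_, fun x hx => ?_⟩, fun h x hx => h.2.1 x ?_⟩
      · rcases h' : parent x with _ | y
        · simp [h'] at hx
        · simpa [h'] using hx
      · rcases h' : parent x with _ | y <;> simp [h'] at hx
      · simp [hx]
    | right v =>
      rw [above_right, hr]
      simp only [parent_head, parent_up, parent_right, label_up, label_right]
      refine ⟨fun h => ⟨by simp, fun x hx => ?_, fun x hx => h x ?_⟩, fun h x hx => h.2.2 x ?_⟩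
      · rcases h' : parent x with _ | y <;> simp [h'] at hx
      · rcases h' : parent x with _ | y
        · simp [h'] at hx
        · simpa [h'] using hx
      · simp [hx]

theorem exists_top_of_ne_nil {F : Forest K N d} (h : F ≠ nil) : ∃ x : F.Vert, parent x = none := by
  cases F with
  | nil => exact absurd rfl h
  | cons e n s r => exact ⟨Vert.head, rfl⟩

theorem okF_iff (F : Forest K N d) : OkF F ↔
    (∀ e e' : F.Vert, (label e).IsNoise → (label e').IsNoise → parent e = parent e' → e = e') ∧
      ∀ e e' : F.Vert, (label e).IsNoise → parent e' ≠ some e := by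
  induction F with
  | nil => simp [OkF]
  | cons l n s r hs hr =>
    rw [OkF, hs, hr]
    simp only [forall_vert (e := l) (n := n) (s := s) (r := r), parent_head, parent_up,
      parent_right, label_head, label_up, label_right]
    constructor
    · rintro ⟨h1, ⟨h2, h3⟩, h4, h5⟩
      refine ⟨⟨⟨by simp, by simp, fun x hl hx hp => ?_⟩, fun x => ⟨by simp, fun y hx hy hp => ?_,
        fun y hx hy hp => ?_⟩, fun x => ⟨fun hx hl hp => ?_, fun y hx hy hp => ?_,
        fun y hx hy hp => ?_⟩⟩, ⟨by simp, fun x hl hp => ?_, fun x hl hp => ?_⟩,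
        fun x => ⟨by simp, fun y hx hp => ?_, fun y hx hp => ?_⟩,
        fun x => ⟨by simp, fun y hx hp => ?_, fun y hx hp => ?_⟩⟩
      · rcases h' : parent x with _ | y
        · exact absurd hx ((noTop_iff r).1 (h1 hl).2 x h')
        · simp [h'] at hp
      · congr 1
        refine h2 x y hx hy ?_
        rcases h' : parent x with _ | a <;> rcases h'' : parent y with _ | b <;>
          simp [h', h''] at hp ⊢
        exact hp
      · rcases h'' : parent y with _ | b <;> simp [h''] at hp
        rcases h' : parent x with _ | a <;> simp [h'] at hp
      · rcases h' : parent x with _ | y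
        · exact absurd hx ((noTop_iff r).1 (h1 hl).2 x h')
        · simp [h'] at hp
      · rcases h'' : parent x with _ | b <;> simp [h''] at hp
        rcases h' : parent y with _ | a <;> simp [h'] at hp
      · congr 1
        refine h4 x y hx hy ?_
        rcases h' : parent x with _ | a <;> rcases h'' : parent y with _ | b <;>
          simp [h', h''] at hp ⊢
        exact hp
      · have := (h1 hl).1
        subst this
        exact IsEmpty.false x
      · rcases h' : parent x with _ | y <;> simp [h'] at hp
      · refine h3 x y hx ?_
        rcases h' : parent y with _ | a <;> simp [h'] at hp
        rw [hp]
      · rcases h' : parent y with _ | a <;> simp [h'] at hp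
      · rcases h' : parent y with _ | a <;> simp [h'] at hp
      · refine h5 x y hx ?_
        rcases h' : parent y with _ | a <;> simp [h'] at hp
        rw [hp]
    · rintro ⟨⟨⟨-, -, h1⟩, h2, h3⟩, ⟨-, h4, h4'⟩, h5, h6⟩
      refine ⟨fun hl => ⟨?_, ?_⟩, ⟨fun x y hx hy hp => ?_, fun x y hx hp => ?_⟩,
        fun x y hx hy hp => ?_, fun x y hx hp => ?_⟩
      · by_contra h
        obtain ⟨x, hx⟩ := exists_top_of_ne_nil h
        exact h4 x hl (by simp [hx])
      · rw [noTop_iff]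
        intro x hx hn
        have := h1 x hl hn (by simp [hx])
        cases this
      · have := (h2 x).2.1 y hx hy (by rw [hp])
        cases this; rfl
      · exact (h5 x).2.1 y hx (by simp [hp])
      · have := (h3 x).2.2 y hx hy (by rw [hp])
        cases this; rfl
      · exact (h6 x).2.2 y hx (by simp [hp])

theorem valid_iff (t : PTree K N d) : t.Valid ↔ OkF t.branches := by
  rw [okF_iff]
  exact Iff.rfl

/-- The regularity of a forest. -/
def regF (κ : K → ℝ) (α : N → ℝ) : Forest K N d → ℝ
  | nil => 0
  | cons e n s r => PTree.edgeReg κ α e + ∑ i, (n i : ℝ) + regF κ α s + regF κ α r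

variable (κ : K → ℝ) (α : N → ℝ)

theorem regF_eq (F : Forest K N d) : regF κ α F =
    ∑ e : F.Vert, PTree.edgeReg κ α (label e) + ∑ x : F.Vert, ∑ i, (Forest.vdec x i : ℝ) := by
  induction F with
  | nil => simp [regF]
  | cons e n s r hs hr =>
    rw [regF, hs, hr, sum_vert, sum_vert]
    simp only [label_head, label_up, label_right, vdec_head, vdec_up, vdec_right]
    ring

theorem reg_mk (n : MIdx d) (F : Forest K N d) :
    PTree.reg κ α ⟨n, F⟩ = ∑ i, (n i : ℝ) + regF κ α F := by
  rw [regF_eq]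
  change (∑ e : F.Vert, _) + (∑ x : Option F.Vert, _) = _
  rw [Fintype.sum_option]
  change _ + (∑ i, (n i : ℝ) + ∑ x : F.Vert, ∑ i, (Forest.vdec x i : ℝ)) = _
  ring

/-! ## Insertion preserves the constraints and adds the regularities -/

/-- Trees that satisfy the constraints on noises and have regularity `ρ`. -/
def okT (ρ : ℝ) : Set (PTree K N d) := {t | OkF t.branches ∧ t.reg κ α = ρ}

theorem infF_ok {x : TV K N d →ₗ[ℝ] TV K N d} {ρ : ℝ}
    (hx : ∀ n F, OkF F → x (tr n F) ∈
      Finsupp.supported ℝ ℝ (okT κ α (PTree.reg κ α ⟨n, F⟩ + ρ)))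
    {F : Forest K N d} (hF : OkF F) :
    infF x F ∈ Finsupp.supported ℝ ℝ {G | OkF G ∧ topL G = topL F ∧
      regF κ α G = regF κ α F + ρ} := by
  induction F with
  | nil => exact Submodule.zero_mem _
  | cons e n s r hs hr =>
    obtain ⟨h1, h2, h3⟩ := hF
    refine Submodule.add_mem _ ?_ ?_
    · have key : (if e.IsNoise then treeL n (infF x s) else x (tr n s) + treeL n (infF x s)) ∈
          Finsupp.supported ℝ ℝ {t | (e.IsNoise → t.branches = nil) ∧
            t ∈ okT κ α (PTree.reg κ α ⟨n, s⟩ + ρ)} := by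
        split_ifs with he
        · rw [(h1 he).1]
          simp [infF]
        · refine Submodule.add_mem _ ?_ ?_
          · refine Finsupp.supported_mono ?_ (hx n s h2)
            exact fun t ht => ⟨fun h => absurd h he, ht⟩
          · refine treeL_mem ?_ (hs h2)
            refine fun F hF => ⟨fun h => absurd h he, hF.1, ?_⟩
            rw [reg_mk, reg_mk, hF.2.2]
            ring
      refine consB_mem (Q := {r}) (fun t ht F hF => ?_) key
        (single_mem_supported (Set.mem_singleton r) 1)
      rw [Set.mem_singleton_iff] at hF
      subst hF
      have h4 := ht.2.2
      rw [show t = ⟨t.dec, t.branches⟩ from rfl, reg_mk, reg_mk] at h4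
      refine ⟨⟨fun he => ⟨ht.1 he, (h1 he).2⟩, ht.2.1, h3⟩, rfl, ?_⟩
      simp only [regF]
      linarith
    · refine consB_mem (P := {⟨n, s⟩}) (fun t ht F hF => ?_)
        (single_mem_supported (Set.mem_singleton _) 1) (hr h3)
      rw [Set.mem_singleton_iff] at ht
      subst ht
      refine ⟨⟨fun he => ⟨(h1 he).1, ?_⟩, h2, hF.1⟩, ?_, ?_⟩
      · rw [NoTop, hF.2.1]; exact (h1 he).2
      · simp [topL, hF.2.1]
      · simp only [regF, hF.2.2]; ring

theorem infV_ok {x : TV K N d →ₗ[ℝ] TV K N d} {ρ : ℝ}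
    (hx : ∀ n F, OkF F → x (tr n F) ∈
      Finsupp.supported ℝ ℝ (okT κ α (PTree.reg κ α ⟨n, F⟩ + ρ)))
    {ρ' : ℝ} {v : TV K N d} (hv : v ∈ Finsupp.supported ℝ ℝ (okT κ α ρ')) :
    infV x v ∈ Finsupp.supported ℝ ℝ (okT κ α (ρ' + ρ)) := by
  refine map_mem_of_supported _ (fun t ht => ?_) hv
  obtain ⟨n, F⟩ := t
  obtain ⟨h1, h2⟩ := ht
  rw [infV, LinearMap.add_apply, infO_tr]
  refine Submodule.add_mem _ (h2 ▸ hx n F h1) (treeL_mem ?_ (infF_ok κ α hx h1))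
  refine fun G hG => ⟨hG.1, ?_⟩
  rw [← h2, reg_mk, reg_mk, hG.2.2]
  ring

theorem word_induction' {p : MIdx d → Forest K N d → Prop} (nil : p 0 nil)
    (graft : ∀ e (t : PTree K N d) F, (∀ G, topL G = topL F → p 0 G) →
      p 0 (cons e t.dec t.branches F))
    (raise : ∀ i n F, (∀ G, topL G = topL F → p n G) → p (Pi.single i 1 + n) F) (n F) : p n F := by
  have : ∀ G, topL G = topL F → p n G := by
    induction n, F using word_induction with
    | nil =>
      intro G hG
      cases G with
      | nil => exact nil
      | cons e n s r => simp [topL] at hG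
    | graft e t F ih =>
      intro G hG
      cases G with
      | nil => simp [topL] at hG
      | cons e n s r =>
        simp only [topL, List.cons.injEq] at hG
        exact graft e ⟨n, s⟩ r fun G' hG' => ih G' (hG'.trans hG.2)
    | raise i n F ih =>
      intro G hG
      exact raise i n G fun G' hG' => ih G' (hG'.trans hG)
  exact this F rfl

theorem edgeReg_lower {e : ELabel K N d} {l : MIdx d} (h : l ≤ e.2) :
    PTree.edgeReg κ α (e.lower l) = PTree.edgeReg κ α e + ∑ i, (l i : ℝ) := by
  have : ∑ i, (((e.2 - l) i : ℕ) : ℝ) = ∑ i, (e.2 i : ℝ) - ∑ i, (l i : ℝ) := by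
    rw [← Finset.sum_sub_distrib]
    refine Finset.sum_congr rfl fun i _ => ?_
    rw [Pi.sub_apply, Nat.cast_sub (h i)]
  simp only [PTree.edgeReg, ELabel.lower, this]
  ring

theorem actT_ok {t : PTree K N d} (ht : OkF t.branches) (n : MIdx d) (F : Forest K N d) :
    OkF F → NoTop F → actT t (tr n F) ∈
      Finsupp.supported ℝ ℝ (okT κ α (PTree.reg κ α ⟨n, F⟩ + t.reg κ α)) := by
  induction n, F using word_induction' with
  | nil =>
    intro _ _
    have h := actL_one (Finsupp.single t 1)
    rw [actL_single] at h
    rw [h]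
    refine single_mem_supported ?_ 1
    exact ⟨ht, by simp [reg_mk κ α 0 nil, regF]⟩
  | graft e b F ih =>
    intro hF hn
    rw [noTop_cons] at hn
    have hx : ∀ m G, OkF G → gB e b (tr m G) ∈ Finsupp.supported ℝ ℝ
        (okT κ α (PTree.reg κ α ⟨m, G⟩ + (PTree.edgeReg κ α e + b.reg κ α))) := by
      intro m G hG
      rw [gB_single]
      refine Submodule.sum_mem _ fun l hl => ?_
      by_cases hlm : l ≤ m
      · refine Submodule.smul_mem _ _ (single_mem_supported ?_ 1)
        refine ⟨⟨fun h => absurd h hn.1, hF.2.1, hG⟩, ?_⟩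
        obtain ⟨bn, bF⟩ := b
        rw [reg_mk, reg_mk, reg_mk, regF,
          edgeReg_lower κ α (Finset.mem_Iic.1 hl)]
        have : ∑ i, (((m - l : MIdx d) i : ℕ) : ℝ) = ∑ i, (m i : ℝ) - ∑ i, (l i : ℝ) := by
          rw [← Finset.sum_sub_distrib]
          refine Finset.sum_congr rfl fun i _ => ?_
          rw [Pi.sub_apply, Nat.cast_sub (hlm i)]
        rw [this]
        ring
      · simp [mchoose_eq_zero hlm]
    have h1 := LinearMap.congr_fun (actT_comp (isPrim_gB e b) t) (tr 0 F)
    rw [LinearMap.comp_apply, gB_zero] at h1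
    have hreg : PTree.reg κ α ⟨0, cons e b.dec b.branches F⟩ + t.reg κ α =
        PTree.reg κ α ⟨0, F⟩ + t.reg κ α + (PTree.edgeReg κ α e + b.reg κ α) := by
      obtain ⟨bn, bF⟩ := b
      rw [reg_mk κ α 0 F, reg_mk κ α 0 (cons _ _ _ _), reg_mk κ α bn, regF]
      ring
    rw [h1, hreg]
    refine Submodule.sub_mem _ (infV_ok κ α hx (ih F rfl hF.2.2 hn.2)) ?_
    rw [LinearMap.comp_apply, infO_tr, ← LinearMap.comp_apply]
    refine map_mem_of_supported _ (fun G hG => ?_) (infF_ok κ α hx hF.2.2)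
    rw [LinearMap.comp_apply, treeL_single]
    have := ih G hG.2.1 hG.1 (by rw [NoTop, hG.2.1]; exact hn.2)
    rw [reg_mk, hG.2.2] at this
    rw [reg_mk]
    convert this using 3
    ring
  | raise i n F ih =>
    intro hF hn
    have hs : ∀ m : MIdx d, ∑ j, (((Pi.single i 1 + m : MIdx d) j : ℕ) : ℝ) = ∑ j, (m j : ℝ) + 1 := by
      intro m
      simp [Finset.sum_add_distrib, Pi.single_apply, add_comm]
    have hx : ∀ m G, OkF G → dAdd (Pi.single i 1) (tr m G) ∈ Finsupp.supported ℝ ℝ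
        (okT κ α (PTree.reg κ α ⟨m, G⟩ + 1)) := by
      intro m G hG
      rw [dAdd_tr]
      refine single_mem_supported ?_ 1
      refine ⟨hG, ?_⟩
      rw [reg_mk, reg_mk, hs]
      ring
    have h1 := LinearMap.congr_fun (actT_comp (isPrim_dAdd i) t) (tr n F)
    rw [LinearMap.comp_apply, dAdd_tr] at h1
    have hreg : PTree.reg κ α ⟨Pi.single i 1 + n, F⟩ + t.reg κ α =
        PTree.reg κ α ⟨n, F⟩ + t.reg κ α + 1 := by
      rw [reg_mk κ α n, reg_mk κ α (_ + n), hs]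
      ring
    rw [h1, hreg]
    refine Submodule.sub_mem _ (infV_ok κ α hx (ih F rfl hF hn)) ?_
    rw [LinearMap.comp_apply, infO_tr, ← LinearMap.comp_apply]
    refine map_mem_of_supported _ (fun G hG => ?_) (infF_ok κ α hx hF)
    rw [LinearMap.comp_apply, treeL_single]
    have := ih G hG.2.1 hG.1 (by rw [NoTop, hG.2.1]; exact hn)
    rw [reg_mk, hG.2.2] at this
    rw [reg_mk]
    convert this using 3
    ring

theorem insR_ok {t : PTree K N d} (ht : OkF t.branches) (n : MIdx d) (F : Forest K N d)
    (hF : OkF F) : insR t (tr n F) ∈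
      Finsupp.supported ℝ ℝ (okT κ α (PTree.reg κ α ⟨n, F⟩ + t.reg κ α)) := by
  rw [insR, LinearMap.comp_apply, nuV_tr]
  split_ifs with h
  · exact actT_ok κ α ht n F hF h
  · simp

theorem infV_insR_ok {t s : PTree K N d} (ht : t.Valid) (hs : s.Valid) :
    infV (insR t) (Finsupp.single s 1) ∈
      Finsupp.supported ℝ ℝ {u : PTree K N d | u.Valid ∧ u.reg κ α = s.reg κ α + t.reg κ α} := by
  rw [valid_iff] at ht hs
  refine Finsupp.supported_mono (fun u hu => ?_)
    (infV_ok κ α (insR_ok κ α ht) (single_mem_supported (S := okT κ α (s.reg κ α)) ⟨hs, rfl⟩ 1))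
  exact ⟨(valid_iff u).2 hu.1, hu.2⟩

/-! ## The symmetric algebra as a bialgebra -/

section Sym

variable {κ : K → ℝ} {α : N → ℝ}

/-- The counit of the symmetric algebra. -/
def epsS : SymNeg d κ α →ₐ[ℝ] ℝ := MvPolynomial.aeval fun _ => 0

@[simp] theorem deshuffle_X (t : NegTree d κ α) :
    deshuffle κ α (MvPolynomial.X t) = MvPolynomial.X t ⊗ₜ 1 + 1 ⊗ₜ MvPolynomial.X t := by
  simp [deshuffle]

@[simp] theorem epsS_X (t : NegTree d κ α) : epsS (MvPolynomial.X t) = 0 := by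
  simp [epsS]

instance symBialgebra : Bialgebra ℝ (SymNeg d κ α) :=
  Bialgebra.ofAlgHom (deshuffle κ α) epsS
    (by
      ext t
      simp [TensorProduct.add_tmul, TensorProduct.tmul_add, Algebra.TensorProduct.one_def, add_assoc])
    (by ext t; simp)
    (by ext t; simp)

instance symCoalgebra : Coalgebra ℝ (SymNeg d κ α) := symBialgebra.toCoalgebra

instance symCocomm : Coalgebra.IsCocomm ℝ (SymNeg d κ α) where
  comm_comp_comul := by
    have : (Algebra.TensorProduct.comm ℝ (SymNeg d κ α) (SymNeg d κ α)).toAlgHom.comp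
        (deshuffle κ α) = deshuffle κ α := by
      ext t
      simp [add_comm]
    exact LinearMap.ext fun w => AlgHom.congr_fun this w


theorem mul_conv {A : Type*} [CommRing A] [Algebra ℝ A] (f g : SymNeg d κ α →ₗ[ℝ] A) :
    WithConv.toConv f * WithConv.toConv g =
      WithConv.toConv (cv (deshuffle κ α).toLinearMap (LinearMap.mul ℝ A) f g) := rfl

/-! ## Derivations, recursion -/

section Recursion
open MvPolynomial

/-- The span of the products of `n` generators. -/
def homS (κ : K → ℝ) (α : N → ℝ) (n : ℕ) : Submodule ℝ (SymNeg d κ α) :=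
  Submodule.span ℝ {w | ∃ l : List (NegTree d κ α), l.length = n ∧ w = (l.map X).prod}

theorem X_mul_homS (t : NegTree d κ α) {n : ℕ} {w : SymNeg d κ α} (hw : w ∈ homS κ α n) :
    X t * w ∈ homS κ α (n + 1) := by
  have : homS κ α n ≤ (homS κ α (n + 1)).comap (LinearMap.mulLeft ℝ (X t : SymNeg d κ α)) := by
    refine Submodule.span_le.2 ?_
    rintro _ ⟨l, hl, rfl⟩
    exact Submodule.subset_span ⟨t :: l, by simp [hl], by simp⟩
  exact this hw

theorem homS_one_mul {v : SymNeg d κ α} (hv : v ∈ homS κ α 1) {n : ℕ} {w : SymNeg d κ α}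
    (hw : w ∈ homS κ α n) : v * w ∈ homS κ α (n + 1) := by
  have : homS κ α 1 ≤ (homS κ α (n + 1)).comap (LinearMap.mulRight ℝ w) := by
    refine Submodule.span_le.2 ?_
    rintro _ ⟨l, hl, rfl⟩
    obtain ⟨t, rfl⟩ := List.length_eq_one_iff.1 hl
    simpa using X_mul_homS t hw
  exact this hv

theorem derivation_homS {D : Derivation ℝ (SymNeg d κ α) (SymNeg d κ α)}
    (hD : ∀ s, D (X s) ∈ homS κ α 1) {n : ℕ} {w : SymNeg d κ α} (hw : w ∈ homS κ α n) :
    D w ∈ homS κ α n := by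
  have : homS κ α n ≤ (homS κ α n).comap D.toLinearMap := by
    refine Submodule.span_le.2 ?_
    rintro _ ⟨l, hl, rfl⟩
    change D _ ∈ homS κ α n
    clear hw
    induction l generalizing n with
    | nil => simp
    | cons t l ih =>
      subst hl
      simp only [List.map_cons, List.prod_cons, Derivation.leibniz, smul_eq_mul, List.length_cons]
      refine Submodule.add_mem _ (X_mul_homS t (ih rfl)) ?_
      rw [mul_comm]
      exact homS_one_mul (hD t) (Submodule.subset_span ⟨l, rfl, rfl⟩)
  exact this hw

/-- Linear maps `Φ` with `Φ (X t * w) = F t (Φ w) - Φ (D t w)` stay in the submodules that are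
stable under all `F t` and contain `Φ 1`. -/
theorem mem_of_recursion {M : Type*} [AddCommGroup M] [Module ℝ M]
    {D : NegTree d κ α → Derivation ℝ (SymNeg d κ α) (SymNeg d κ α)}
    (hD : ∀ t s, D t (X s) ∈ homS κ α 1) {F : NegTree d κ α → M → M} {p : Submodule ℝ M}
    (hF : ∀ t, ∀ v ∈ p, F t v ∈ p) {Ph : SymNeg d κ α →ₗ[ℝ] M} (h1 : Ph 1 ∈ p)
    (h : ∀ t w, Ph (X t * w) = F t (Ph w) - Ph (D t w)) (w : SymNeg d κ α) : Ph w ∈ p := by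
  have hn : ∀ n, homS κ α n ≤ p.comap Ph := by
    intro n
    induction n with
    | zero =>
      refine Submodule.span_le.2 ?_
      rintro _ ⟨l, hl, rfl⟩
      rw [List.length_eq_zero_iff] at hl
      subst hl
      simpa using h1
    | succ n ih =>
      refine Submodule.span_le.2 ?_
      rintro _ ⟨l, hl, rfl⟩
      obtain ⟨t, l, rfl⟩ := List.exists_cons_of_length_eq_add_one hl
      have hl' : (l.map X).prod ∈ homS κ α n :=
        Submodule.subset_span ⟨l, by simpa using hl, rfl⟩
      simp only [List.map_cons, List.prod_cons, SetLike.mem_coe, Submodule.mem_comap, h]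
      exact p.sub_mem (hF t _ (ih hl')) (ih (derivation_homS (hD t) hl'))
  have hw : w ∈ ⨆ n, homS κ α n := by
    induction w using MvPolynomial.induction_on with
    | C a =>
      refine Submodule.mem_iSup_of_mem 0 ?_
      rw [← mul_one (C a), ← smul_eq_C_mul]
      exact Submodule.smul_mem _ _ (Submodule.subset_span ⟨[], rfl, by simp⟩)
    | add p q hp hq => exact Submodule.add_mem _ hp hq
    | mul_X p t hp =>
      have : (⨆ n, homS κ α n) ≤
          (⨆ n, homS κ α n).comap (LinearMap.mulLeft ℝ (X t : SymNeg d κ α)) :=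
        iSup_le fun n v hv => Submodule.mem_iSup_of_mem (n + 1) (X_mul_homS t hv)
      rw [mul_comm]
      exact this hp
  exact (iSup_le hn) hw

theorem eq_of_recursion {M : Type*} [AddCommGroup M] [Module ℝ M]
    {D : NegTree d κ α → Derivation ℝ (SymNeg d κ α) (SymNeg d κ α)}
    (hD : ∀ t s, D t (X s) ∈ homS κ α 1) {F : NegTree d κ α → M →ₗ[ℝ] M}
    {f g : SymNeg d κ α →ₗ[ℝ] M} (h1 : f 1 = g 1)
    (hf : ∀ t w, f (X t * w) = F t (f w) - f (D t w))
    (hg : ∀ t w, g (X t * w) = F t (g w) - g (D t w)) : f = g := by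
  refine LinearMap.ext fun w => sub_eq_zero.1 ?_
  rw [← LinearMap.sub_apply, ← Submodule.mem_bot ℝ]
  refine mem_of_recursion hD (F := fun t v => F t v) (fun t v hv => ?_) ?_ (fun t w => ?_) w
  · rw [Submodule.mem_bot] at hv ⊢
    rw [hv, map_zero]
  · simp [h1]
  · simp only [LinearMap.sub_apply, hf, hg, map_sub]
    abel

end Recursion

/-! ## Simultaneous insertion -/

section Simultaneous
open MvPolynomial

/-- The degree one part, as a formal sum of trees. -/
def piV : SymNeg d κ α →ₗ[ℝ] TV K N d :=
  TrivSqZeroExt.sndHom ℝ (TV K N d) ∘ₗ (MvPolynomial.aeval fun t : NegTree d κ α =>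
    (TrivSqZeroExt.inr (Finsupp.single t.1 1) : TrivSqZeroExt ℝ (TV K N d))).toLinearMap

theorem piV_X (t : NegTree d κ α) : piV (X t : SymNeg d κ α) = Finsupp.single t.1 1 := by
  simp [piV]

theorem piV_one : piV (1 : SymNeg d κ α) = 0 := by
  simp [piV]

theorem piV_mul (v w : SymNeg d κ α) : piV (v * w) = epsS v • piV w + epsS w • piV v := by
  have h : ∀ w : SymNeg d κ α, (MvPolynomial.aeval (fun t : NegTree d κ α =>
      (TrivSqZeroExt.inr (Finsupp.single t.1 1) : TrivSqZeroExt ℝ (TV K N d))) w).fst =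
        epsS w := by
    intro w
    have : (TrivSqZeroExt.fstHom ℝ ℝ (TV K N d)).comp (MvPolynomial.aeval
        fun t : NegTree d κ α => (TrivSqZeroExt.inr (Finsupp.single t.1 1) :
          TrivSqZeroExt ℝ (TV K N d))) = (epsS : SymNeg d κ α →ₐ[ℝ] ℝ) := by
      ext t
      simp
    exact AlgHom.congr_fun this w
  simp [piV, h]

/-- Formal sums of trees as elements of the symmetric algebra, ignoring the trees that are not
admissible. -/
def toNeg (κ : K → ℝ) (α : N → ℝ) : TV K N d →ₗ[ℝ] SymNeg d κ α :=
  Finsupp.linearCombination ℝ fun t =>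
    if h : t.Valid ∧ t.reg κ α < 0 then X ⟨t, h⟩ else 0

theorem toNeg_single (t : NegTree d κ α) :
    toNeg κ α (Finsupp.single t.1 1) = X t := by
  simp [toNeg, t.2]

theorem toNeg_induction {p : SymNeg d κ α → Prop} (zero : p 0) (X : ∀ t, p (X t))
    (add : ∀ v w, p v → p w → p (v + w)) (smul : ∀ (c : ℝ) v, p v → p (c • v)) (v : TV K N d) :
    p (toNeg κ α v) := by
  induction v using Finsupp.induction_linear with
  | zero => simpa using zero
  | add a b ha hb => rw [map_add]; exact add _ _ ha hb
  | single t c =>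
    rw [single_eq_smul, map_smul]
    refine smul c _ ?_
    by_cases h : t.Valid ∧ t.reg κ α < 0
    · rw [toNeg_single ⟨t, h⟩]
      exact X _
    · simpa [toNeg, h] using zero

theorem toNeg_mem (v : TV K N d) : toNeg κ α v ∈ homS κ α 1 :=
  toNeg_induction (p := fun w => w ∈ homS κ α 1) (Submodule.zero_mem _)
    (fun t => Submodule.subset_span ⟨[t], rfl, by simp⟩)
    (fun _ _ => Submodule.add_mem _) (fun c _ => Submodule.smul_mem _ c) v

theorem epsS_toNeg (v : TV K N d) : epsS (toNeg κ α v) = 0 :=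
  toNeg_induction (p := fun w => epsS w = 0) (map_zero _) epsS_X
    (fun v w hv hw => by rw [map_add, hv, hw, add_zero])
    (fun c v hv => by rw [map_smul, hv, smul_zero]) v

theorem deshuffle_toNeg (v : TV K N d) :
    deshuffle κ α (toNeg κ α v) = toNeg κ α v ⊗ₜ 1 + 1 ⊗ₜ toNeg κ α v :=
  toNeg_induction (p := fun w => deshuffle κ α w = w ⊗ₜ 1 + 1 ⊗ₜ w) (by simp) deshuffle_X
    (fun v w hv hw => by
      rw [map_add, hv, hw, TensorProduct.add_tmul, TensorProduct.tmul_add]; abel)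
    (fun c v hv => by rw [map_smul, hv, smul_add, TensorProduct.smul_tmul', TensorProduct.tmul_smul]) v

/-- Trees that are admissible and have negative regularity. -/
abbrev negSet (κ : K → ℝ) (α : N → ℝ) : Set (PTree K N d) := {t | t.Valid ∧ t.reg κ α < 0}

theorem piV_toNeg {v : TV K N d} (hv : v ∈ Finsupp.supported ℝ ℝ (negSet κ α)) :
    piV (toNeg κ α v) = v := by
  rw [← LinearMap.comp_apply, ← sub_eq_zero, ← LinearMap.id_apply (R := ℝ) v,
    ← LinearMap.comp_apply, LinearMap.comp_id, ← LinearMap.sub_apply, ← Submodule.mem_bot ℝ]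
  refine map_mem_of_supported _ (fun t ht => ?_) hv
  rw [LinearMap.sub_apply, LinearMap.comp_apply, toNeg_single ⟨t, ht⟩, piV_X]
  simp

/-- Insertion of `t`. -/
abbrev insV (t : PTree K N d) : TV K N d →ₗ[ℝ] TV K N d := infV (insR t)

theorem insV_neg (t s : NegTree d κ α) :
    insV t.1 (Finsupp.single s.1 1) ∈ Finsupp.supported ℝ ℝ (negSet κ α) := by
  refine Finsupp.supported_mono ?_ (infV_insR_ok κ α t.2.1 s.2.1)
  exact fun u hu => ⟨hu.1, by rw [hu.2]; linarith [t.2.2, s.2.2]⟩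

/-- The derivation of the symmetric algebra that extends the insertion of `t`. -/
def insD (t : NegTree d κ α) : Derivation ℝ (SymNeg d κ α) (SymNeg d κ α) :=
  mkDerivation ℝ fun s => toNeg κ α (insV t.1 (Finsupp.single s.1 1))

theorem insD_X (t s : NegTree d κ α) :
    insD t (X s) = toNeg κ α (insV t.1 (Finsupp.single s.1 1)) := by
  simp [insD]

theorem insD_mem (t s : NegTree d κ α) : insD t (X s) ∈ homS κ α 1 := by
  rw [insD_X]; exact toNeg_mem _

theorem epsS_insD (t : NegTree d κ α) (w : SymNeg d κ α) : epsS (insD t w) = 0 := by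
  induction w using MvPolynomial.induction_on with
  | C a => simp [← MvPolynomial.algebraMap_eq]
  | add p q hp hq => rw [map_add, map_add, hp, hq, add_zero]
  | mul_X p s hp => simp [insD_X, epsS_toNeg]

theorem piV_insD (t : NegTree d κ α) (w : SymNeg d κ α) : piV (insD t w) = insV t.1 (piV w) := by
  induction w using MvPolynomial.induction_on with
  | C a =>
    have : (C a : SymNeg d κ α) = a • 1 := by rw [smul_eq_C_mul, mul_one]
    rw [this, map_smul piV, piV_one, ← this, ← MvPolynomial.algebraMap_eq,
      Derivation.map_algebraMap]
    simp
  | add p q hp hq => rw [map_add, map_add, map_add, map_add, hp, hq]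
  | mul_X p s hp =>
    rw [Derivation.leibniz, smul_eq_mul, smul_eq_mul, map_add, piV_mul, piV_mul, piV_mul, insD_X,
      epsS_toNeg, epsS_X, epsS_insD, piV_toNeg (insV_neg t s), piV_X]
    simp only [zero_smul, add_zero, map_smul]

/-- Multiplication by `t` plus the derivation that extends the insertion of `t`. -/
def insP (t : NegTree d κ α) : SymNeg d κ α →ₗ[ℝ] SymNeg d κ α :=
  LinearMap.mulLeft ℝ (X t) + (insD t).toLinearMap

theorem insP_apply (t : NegTree d κ α) (w : SymNeg d κ α) : insP t w = X t * w + insD t w := rfl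

theorem map_derivation_mul (D : Derivation ℝ (SymNeg d κ α) (SymNeg d κ α))
    (z z' : SymNeg d κ α ⊗[ℝ] SymNeg d κ α) :
    (TensorProduct.map D.toLinearMap LinearMap.id + TensorProduct.map LinearMap.id D.toLinearMap :
      SymNeg d κ α ⊗[ℝ] SymNeg d κ α →ₗ[ℝ] _) (z * z') =
    z * (TensorProduct.map D.toLinearMap LinearMap.id +
      TensorProduct.map LinearMap.id D.toLinearMap :
      SymNeg d κ α ⊗[ℝ] SymNeg d κ α →ₗ[ℝ] _) z' +
    z' * (TensorProduct.map D.toLinearMap LinearMap.id +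
      TensorProduct.map LinearMap.id D.toLinearMap :
      SymNeg d κ α ⊗[ℝ] SymNeg d κ α →ₗ[ℝ] _) z := by
  induction z using TensorProduct.induction_on with
  | zero => simp
  | add x y hx hy => rw [add_mul, map_add, hx, hy, map_add]; ring
  | tmul a b =>
    induction z' using TensorProduct.induction_on with
    | zero => simp
    | add x y hx hy => rw [mul_add, map_add, hx, hy, map_add]; ring
    | tmul a' b' =>
      simp only [Algebra.TensorProduct.tmul_mul_tmul, LinearMap.add_apply, TensorProduct.map_tmul,
        LinearMap.id_apply, mul_add, Derivation.coeFn_coe,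
        Derivation.leibniz, smul_eq_mul, TensorProduct.add_tmul, TensorProduct.tmul_add]
      rw [mul_comm b' b, mul_comm a' a]
      ring

theorem isCoder_insD (t : NegTree d κ α) :
    IsCoder (deshuffle κ α).toLinearMap (insD t).toLinearMap := by
  intro w
  rw [← LinearMap.add_apply]
  change deshuffle κ α (insD t w) = (_ : SymNeg d κ α ⊗[ℝ] SymNeg d κ α →ₗ[ℝ] _) (deshuffle κ α w)
  induction w using MvPolynomial.induction_on with
  | C a =>
    rw [← MvPolynomial.algebraMap_eq, Derivation.map_algebraMap, map_zero, AlgHom.commutes,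
      Algebra.TensorProduct.algebraMap_apply, LinearMap.add_apply, TensorProduct.map_tmul,
      TensorProduct.map_tmul]
    simp
  | add p q hp hq => rw [map_add, map_add, map_add, map_add, hp, hq]
  | mul_X p s hp =>
    rw [Derivation.leibniz, smul_eq_mul, smul_eq_mul, map_add, map_mul, map_mul, map_mul,
      map_derivation_mul, ← hp, insD_X, deshuffle_toNeg, deshuffle_X]
    congr 2
    simp [insD_X]

theorem tmul_one_mul (v : SymNeg d κ α) (z : SymNeg d κ α ⊗[ℝ] SymNeg d κ α) :
    (v ⊗ₜ[ℝ] (1 : SymNeg d κ α)) * z =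
      TensorProduct.map (LinearMap.mulLeft ℝ v) LinearMap.id z := by
  have : LinearMap.mulLeft ℝ (v ⊗ₜ[ℝ] (1 : SymNeg d κ α)) =
      TensorProduct.map (LinearMap.mulLeft ℝ v) LinearMap.id :=
    TensorProduct.ext' fun a b => by simp
  exact LinearMap.congr_fun this z

theorem one_tmul_mul (v : SymNeg d κ α) (z : SymNeg d κ α ⊗[ℝ] SymNeg d κ α) :
    ((1 : SymNeg d κ α) ⊗ₜ[ℝ] v) * z =
      TensorProduct.map LinearMap.id (LinearMap.mulLeft ℝ v) z := by
  have : LinearMap.mulLeft ℝ ((1 : SymNeg d κ α) ⊗ₜ[ℝ] v) =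
      TensorProduct.map LinearMap.id (LinearMap.mulLeft ℝ v) :=
    TensorProduct.ext' fun a b => by simp
  exact LinearMap.congr_fun this z

theorem isCoder_mulLeft (t : NegTree d κ α) :
    IsCoder (deshuffle κ α).toLinearMap (LinearMap.mulLeft ℝ (X t : SymNeg d κ α)) := by
  intro w
  rw [LinearMap.mulLeft_apply, AlgHom.toLinearMap_apply, map_mul, deshuffle_X, add_mul,
    tmul_one_mul, one_tmul_mul, AlgHom.toLinearMap_apply]

theorem isCoder_insP (t : NegTree d κ α) :
    IsCoder (deshuffle κ α).toLinearMap (insP t) :=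
  (isCoder_mulLeft t).add (isCoder_insD t)

variable {M M' P : Type*} [AddCommGroup M] [Module ℝ M] [AddCommGroup M'] [Module ℝ M']
  [AddCommGroup P] [Module ℝ P]

theorem cv_epsS_left (β : M →ₗ[ℝ] M' →ₗ[ℝ] P) (m : M) (f : SymNeg d κ α →ₗ[ℝ] M') :
    cv (deshuffle κ α).toLinearMap β (epsS.toLinearMap.smulRight m) f = β m ∘ₗ f := by
  refine LinearMap.ext fun w => ?_
  have : TensorProduct.lift β ∘ₗ
      TensorProduct.map ((epsS : SymNeg d κ α →ₐ[ℝ] ℝ).toLinearMap.smulRight m) f =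
      (β m ∘ₗ f) ∘ₗ (TensorProduct.lid ℝ (SymNeg d κ α)).toLinearMap ∘ₗ
        LinearMap.rTensor (SymNeg d κ α) (epsS : SymNeg d κ α →ₐ[ℝ] ℝ).toLinearMap :=
    TensorProduct.ext' fun a b => by simp
  refine (LinearMap.congr_fun this (deshuffle κ α w)).trans ?_
  change (β m ∘ₗ f) (TensorProduct.lid ℝ (SymNeg d κ α) (LinearMap.rTensor (SymNeg d κ α)
    (Coalgebra.counit (R := ℝ)) (Coalgebra.comul (R := ℝ) w))) = _
  rw [Coalgebra.rTensor_counit_comul]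
  simp

theorem cv_deshuffle_one (β : M →ₗ[ℝ] M' →ₗ[ℝ] P) (f : SymNeg d κ α →ₗ[ℝ] M)
    (g : SymNeg d κ α →ₗ[ℝ] M') :
    cv (deshuffle κ α).toLinearMap β f g 1 = β (f 1) (g 1) := by
  rw [cv, LinearMap.comp_apply, LinearMap.comp_apply, AlgHom.toLinearMap_apply, map_one,
    Algebra.TensorProduct.one_def, TensorProduct.map_tmul, TensorProduct.lift.tmul]

/-- Simultaneous insertion in a tree whose root may be replaced, given the simultaneous insertion
`f` in its branches. -/
def simR (n : MIdx d) (f : SymNeg d κ α →ₗ[ℝ] FV K N d) : SymNeg d κ α →ₗ[ℝ] TV K N d :=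
  treeL n ∘ₗ f + cv (deshuffle κ α).toLinearMap (actL.compl₂ nuV) piV (treeL n ∘ₗ f)

/-- Simultaneous insertion in the tree above an edge decorated by `e`. -/
def simE (e : ELabel K N d) (n : MIdx d) (f : SymNeg d κ α →ₗ[ℝ] FV K N d) :
    SymNeg d κ α →ₗ[ℝ] TV K N d :=
  if e.IsNoise then treeL n ∘ₗ f else simR n f

/-- Simultaneous insertion in a forest. -/
def simF (κ : K → ℝ) (α : N → ℝ) : Forest K N d → (SymNeg d κ α →ₗ[ℝ] FV K N d)
  | nil => epsS.toLinearMap.smulRight (Finsupp.single nil 1)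
  | cons e n s r => cv (deshuffle κ α).toLinearMap (consB e) (simE e n (simF κ α s)) (simF κ α r)

/-- Simultaneous insertion in a tree. -/
def simT (κ : K → ℝ) (α : N → ℝ) (t : PTree K N d) : SymNeg d κ α →ₗ[ℝ] TV K N d :=
  simR t.dec (simF κ α t.branches)

theorem simR_comm (t : NegTree d κ α) {f : SymNeg d κ α →ₗ[ℝ] FV K N d}
    (hf : infL (insR t.1) ∘ₗ f = f ∘ₗ insP t) (n : MIdx d) :
    insV t.1 ∘ₗ simR n f = simR n f ∘ₗ insP t := by
  have h1 : infO (insR t.1) ∘ₗ treeL n ∘ₗ f = treeL n ∘ₗ f ∘ₗ insP t := by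
    rw [← hf]
    exact LinearMap.ext fun w => infO_treeL _ n _
  have h2 : (piV : SymNeg d κ α →ₗ[ℝ] TV K N d) ∘ₗ insP t =
      epsS.toLinearMap.smulRight (Finsupp.single t.1 1) + insV t.1 ∘ₗ piV := by
    refine LinearMap.ext fun w => ?_
    simp [insP_apply, piV_mul, piV_X, piV_insD]
  have h3 : insV t.1 ∘ₗ cv (deshuffle κ α).toLinearMap (actL.compl₂ nuV) piV (treeL n ∘ₗ f) =
      cv (deshuffle κ α).toLinearMap (actL.compl₂ nuV) (insV t.1 ∘ₗ piV) (treeL n ∘ₗ f) +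
      cv (deshuffle κ α).toLinearMap (actL.compl₂ nuV) piV
        (infO (insR t.1) ∘ₗ treeL n ∘ₗ f) :=
    comp_cv_of_leibniz (fun a b => infV_actL t.1 a b) _ _
  have h4 : insV t.1 ∘ₗ treeL n ∘ₗ f = insR t.1 ∘ₗ treeL n ∘ₗ f + infO (insR t.1) ∘ₗ treeL n ∘ₗ f := by
    rw [insV, infV, LinearMap.add_comp]
  rw [simR, LinearMap.comp_add, LinearMap.add_comp, h3, h4, h1, cv_comp (isCoder_insP t), h2,
    cv_add_left, cv_epsS_left]
  have h5 : (actL.compl₂ nuV : TV K N d →ₗ[ℝ] _) (Finsupp.single t.1 1) = insR t.1 := by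
    refine LinearMap.ext fun v => ?_
    simp [insR]
  rw [h5]
  simp only [LinearMap.comp_assoc]
  abel

theorem simE_comm (t : NegTree d κ α) (e : ELabel K N d) {f : SymNeg d κ α →ₗ[ℝ] FV K N d}
    (hf : infL (insR t.1) ∘ₗ f = f ∘ₗ insP t) (n : MIdx d) :
    infE e (insR t.1) ∘ₗ simE e n f = simE e n f ∘ₗ insP t := by
  rw [simE, infE]
  split_ifs
  · rw [LinearMap.comp_assoc, ← hf]
    exact LinearMap.ext fun w => infO_treeL _ n _
  · exact simR_comm t hf n

theorem simF_comm (t : NegTree d κ α) (F : Forest K N d) :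
    infL (insR t.1) ∘ₗ simF κ α F = simF κ α F ∘ₗ insP t := by
  induction F with
  | nil =>
    refine LinearMap.ext fun w => ?_
    simp [simF, infL, infF, insP_apply, epsS_insD]
  | cons e n s r hs hr =>
    rw [simF, comp_cv_of_leibniz (infL_consB _ e), simE_comm t e hs, hr,
      cv_comp (isCoder_insP t)]

theorem simT_X_mul (s : PTree K N d) (t : NegTree d κ α) (w : SymNeg d κ α) :
    simT κ α s (X t * w) = insV t.1 (simT κ α s w) - simT κ α s (insD t w) := by
  have := LinearMap.congr_fun (simR_comm t (simF_comm t s.branches) s.dec) w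
  rw [eq_sub_iff_add_eq, ← map_add, ← insP_apply]
  exact this.symm

theorem simF_one (F : Forest K N d) : simF κ α F 1 = Finsupp.single F 1 := by
  induction F with
  | nil => simp [simF]
  | cons e n s r hs hr =>
    rw [simF, cv_deshuffle_one, hr, simE]
    split_ifs
    · simp [hs]
    · simp [simR, cv_deshuffle_one, hs, piV_one]

theorem simT_one (s : PTree K N d) : simT κ α s 1 = Finsupp.single s 1 := by
  simp [simT, simR, simF_one, cv_deshuffle_one, piV_one]

theorem simT_X (s : PTree K N d) (t : NegTree d κ α) :
    simT κ α s (X t) = insV t.1 (Finsupp.single s 1) := by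
  have := simT_X_mul s t 1
  rwa [mul_one, simT_one, Derivation.map_one_eq_zero, map_zero, sub_zero] at this

end Simultaneous

end Sym

/-! ## States: words at the vertices of a forest -/

/-- Attach a forest at the right of the branches at the root of `t`. -/
def appL (t : PTree K N d) : FV K N d →ₗ[ℝ] TV K N d :=
  Finsupp.lmapDomain ℝ ℝ fun F => ⟨t.dec, append t.branches F⟩

@[simp] theorem appL_single (t : PTree K N d) (F : Forest K N d) (x : ℝ) :
    appL t (Finsupp.single F x) = Finsupp.single ⟨t.dec, append t.branches F⟩ x := by
  simp [appL]

theorem appL_nil (n : MIdx d) : appL (⟨n, nil⟩ : PTree K N d) = treeL n :=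
  FV_ext fun F => by simp [append]

/-- Action of words on the top vertex, carrying the word `t`, of an edge decorated by `e`. -/
def rootQ (e : ELabel K N d) (t : PTree K N d) (f : TV K N d →ₗ[ℝ] FV K N d) :
    TV K N d →ₗ[ℝ] TV K N d :=
  if e.IsNoise then appL t ∘ₗ f else cv co mulE LinearMap.id (appL t ∘ₗ f)

/-- Action of words on a forest whose vertices carry the words `q`. -/
def actQ : (F : Forest K N d) → (F.Vert → PTree K N d) → (TV K N d →ₗ[ℝ] FV K N d)
  | nil, _ => epsV
  | cons e _ s r, q => cv co (consB e)
      (rootQ e (q Vert.head) (actQ s fun x => q (Vert.up x))) (actQ r fun x => q (Vert.right x))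

/-- Action of words on a tree whose vertices carry the words `q`. -/
def actQT (t : PTree K N d) (q : t.Vert → PTree K N d) : TV K N d →ₗ[ℝ] TV K N d :=
  cv co mulE LinearMap.id (appL (q none) ∘ₗ actQ t.branches fun x => q (some x))

theorem actQ_init (F : Forest K N d) : actQ F (fun x => ⟨Forest.vdec x, nil⟩) = actF F := by
  induction F with
  | nil => rfl
  | cons e n s r hs hr =>
    simp only [actQ, actF, vdec_head, vdec_up, vdec_right, hs, hr, rootQ, rootA, appL_nil]

theorem actQT_init (t : PTree K N d) : actQT t (fun x => ⟨t.vdec x, nil⟩) = actT t := by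
  rw [actQT, actT, ← actQ_init, ← appL_nil]
  rfl

/-- Add a branch at the right of a word. -/
def rG (e : ELabel K N d) (t : PTree K N d) : TV K N d →ₗ[ℝ] TV K N d :=
  Finsupp.lmapDomain ℝ ℝ fun u => ⟨u.dec, append u.branches (cons e t.dec t.branches nil)⟩

theorem rG_tr (e : ELabel K N d) (t : PTree K N d) (n : MIdx d) (F : Forest K N d) :
    rG e t (tr n F) = tr n (append F (cons e t.dec t.branches nil)) := by
  simp [rG]

theorem rG_dAdd (e : ELabel K N d) (t : PTree K N d) (n : MIdx d) (v : TV K N d) :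
    rG e t (dAdd n v) = dAdd n (rG e t v) := by
  have : rG e t ∘ₗ dAdd n = dAdd n ∘ₗ rG e t := TV_ext fun m F => by
    simp only [LinearMap.comp_apply, dAdd_tr, rG_tr]
  exact LinearMap.congr_fun this v

theorem rG_gB (e e' : ELabel K N d) (t t' : PTree K N d) (v : TV K N d) :
    rG e t (gB e' t' v) = gB e' t' (rG e t v) := by
  have : rG e t ∘ₗ gB e' t' = gB e' t' ∘ₗ rG e t := TV_ext fun m F => by
    simp only [LinearMap.comp_apply, gB_single, rG_tr, map_sum, map_smul, append]
  exact LinearMap.congr_fun this v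

theorem rG_one (e : ELabel K N d) (t : PTree K N d) : rG e t (tr 0 nil) = gB e t (tr 0 nil) := by
  rw [rG_tr, gB_zero, append]

theorem isCoder_rG (e : ELabel K N d) (t : PTree K N d) : IsCoder co (rG e t) := by
  refine isCoder_of_tr fun n F => ?_
  induction n, F using word_induction with
  | nil => rw [rG_one, isCoder_gB, co_one]; simp [rG_one]
  | graft e' t' F ih =>
    rw [← gB_zero]
    exact coder_step (y := 0) (isCoder_gB e' t')
      (LinearMap.ext fun v => by simp [rG_gB]) rfl ih (by simp)
  | raise i n F ih =>
    rw [← dAdd_tr]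
    exact coder_step (y := 0) (isCoder_dAdd i)
      (LinearMap.ext fun v => by simp [rG_dAdd]) rfl ih (by simp)

theorem mulE_rG (e : ELabel K N d) (t : PTree K N d) (u v : TV K N d) :
    mulE (rG e t u) v = mulE u (gB e t v) := by
  have : mulE ∘ₗ rG e t = (mulE (K := K) (N := N) (d := d)).compl₂ (gB e t) := by
    refine TV_ext fun n F => LinearMap.ext fun v => ?_
    simp only [LinearMap.comp_apply, LinearMap.compl₂_apply]
    induction n, F using word_induction with
    | nil => rw [rG_one, mulE_gB, mulE_one, mulE_one]
    | graft e' t' F ih => rw [← gB_zero, rG_gB, mulE_gB, mulE_gB, ih]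
    | raise i n F ih => rw [← dAdd_tr, rG_dAdd, mulE_dAdd, mulE_dAdd, ih]
  exact LinearMap.congr_fun (LinearMap.congr_fun this u) v

theorem epsV_rG (e : ELabel K N d) (t : PTree K N d) : epsV ∘ₗ rG e t = 0 :=
  epsV_comp fun n F => by
    rw [rG_tr, Finsupp.single_eq_of_ne]
    intro h
    cases F <;> simp [append] at h

/-- The word obtained from `t` by grafting a branch lowered by `l`. -/
def stp (e : ELabel K N d) (b t : PTree K N d) (l : MIdx d) : PTree K N d :=
  ⟨t.dec - l, cons (e.lower l) b.dec b.branches t.branches⟩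

theorem gB_appL (e : ELabel K N d) (b t : PTree K N d) (v : FV K N d) :
    gB e b (appL t v) = ∑ l ∈ Finset.Iic e.2, (mchoose t.dec l : ℝ) • appL (stp e b t l) v := by
  have : gB e b ∘ₗ appL t = ∑ l ∈ Finset.Iic e.2, (mchoose t.dec l : ℝ) • appL (stp e b t l) :=
    FV_ext fun F => by
      simp [gB_single, LinearMap.sum_apply, stp, append]
  have h := LinearMap.congr_fun this v
  simpa [LinearMap.sum_apply] using h

section UpdateLemmas

variable {β : Type*} {e : ELabel K N d} {n : MIdx d} {s r : Forest K N d}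
  (q : (cons e n s r).Vert → β) (b : β)

theorem update_head_up :
    (fun x => Function.update q Vert.head b (Vert.up x)) = fun x => q (Vert.up x) := by
  funext x; simp

theorem update_head_right :
    (fun x => Function.update q Vert.head b (Vert.right x)) = fun x => q (Vert.right x) := by
  funext x; simp

theorem update_up_up (y : s.Vert) : (fun x => Function.update q (Vert.up y) b (Vert.up x)) =
    Function.update (fun x => q (Vert.up x)) y b := by
  funext x
  by_cases h : x = y
  · subst h; simp
  · simp [h]

theorem update_up_right (y : s.Vert) :
    (fun x => Function.update q (Vert.up y) b (Vert.right x)) = fun x => q (Vert.right x) := by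
  funext x; simp

theorem update_right_up (y : r.Vert) :
    (fun x => Function.update q (Vert.right y) b (Vert.up x)) = fun x => q (Vert.up x) := by
  funext x; simp

theorem update_right_right (y : r.Vert) :
    (fun x => Function.update q (Vert.right y) b (Vert.right x)) =
    Function.update (fun x => q (Vert.right x)) y b := by
  funext x
  by_cases h : x = y
  · subst h; simp
  · simp [h]

end UpdateLemmas

theorem comp_sum' {ι M M₁ M₂ : Type*} [AddCommMonoid M] [Module ℝ M] [AddCommMonoid M₁]
    [Module ℝ M₁] [AddCommMonoid M₂] [Module ℝ M₂] (f : M₁ →ₗ[ℝ] M₂) (s : Finset ι)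
    (g : ι → M →ₗ[ℝ] M₁) : f ∘ₗ ∑ i ∈ s, g i = ∑ i ∈ s, f ∘ₗ g i := by
  refine LinearMap.ext fun v => ?_
  simp [LinearMap.sum_apply]

/-- `R` is the right multiplication by a primitive word `p`; multiplying a word `t` by `p` from the
left gives the words `st t l` with the coefficients `c t l`. -/
structure IsRightMul (R : TV K N d →ₗ[ℝ] TV K N d) (I : Finset (MIdx d))
    (c : PTree K N d → MIdx d → ℝ) (st : PTree K N d → MIdx d → PTree K N d) : Prop where
  coder : IsCoder co R
  eps : epsV ∘ₗ R = 0
  cv_mul : ∀ (t : PTree K N d) (f : TV K N d →ₗ[ℝ] FV K N d),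
    cv co mulE LinearMap.id (appL t ∘ₗ f) ∘ₗ R =
      ∑ l ∈ I, c t l • cv co mulE LinearMap.id (appL (st t l) ∘ₗ f) +
      cv co mulE LinearMap.id (appL t ∘ₗ f ∘ₗ R)

theorem IsRightMul.of_mul {R : TV K N d →ₗ[ℝ] TV K N d} {I : Finset (MIdx d)}
    {c : PTree K N d → MIdx d → ℝ} {st : PTree K N d → MIdx d → PTree K N d}
    (hR : IsCoder co R) (h0 : epsV ∘ₗ R = 0) {P : TV K N d →ₗ[ℝ] TV K N d}
    (hm : ∀ u v, mulE (R u) v = mulE u (P v))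
    (hP : ∀ t v, P (appL t v) = ∑ l ∈ I, c t l • appL (st t l) v) : IsRightMul R I c st where
  coder := hR
  eps := h0
  cv_mul t f := by
    rw [cv_comp hR]
    congr 1
    have h1 : cv co mulE (LinearMap.id ∘ₗ R) (appL t ∘ₗ f) =
        cv co mulE LinearMap.id (∑ l ∈ I, c t l • (appL (st t l) ∘ₗ f)) := by
      refine cv_congr fun u v => ?_
      simp [hm, hP, LinearMap.sum_apply]
    rw [h1]
    change cvR _ _ _ _ = _
    rw [map_sum]
    simp only [map_smul]
    rfl

theorem isRightMul_rG (e : ELabel K N d) (b : PTree K N d) :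
    IsRightMul (rG e b) (Finset.Iic e.2) (fun t l => mchoose t.dec l) (stp e b) :=
  .of_mul (isCoder_rG e b) (epsV_rG e b) (mulE_rG e b) (gB_appL e b)

/-- Raising the decoration of a word at its right end. -/
def rD (i : Fin d) : TV K N d →ₗ[ℝ] TV K N d := mulE.flip (tr (Pi.single i 1) nil)

theorem rD_nil (i : Fin d) (n : MIdx d) : rD i (tr n (nil : Forest K N d)) =
    tr (n + Pi.single i 1) nil := by
  have : tr n (nil : Forest K N d) = dAdd n (tr 0 nil) := by simp
  rw [this, rD, LinearMap.flip_apply, mulE_dAdd, mulE_one, dAdd_tr]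

theorem rD_one (i : Fin d) :
    rD i (tr 0 (nil : Forest K N d)) = dAdd (Pi.single i 1) (tr 0 nil) := by
  rw [rD_nil, dAdd_tr, add_comm]

theorem rD_dAdd (i : Fin d) (n : MIdx d) (v : TV K N d) : rD i (dAdd n v) = dAdd n (rD i v) := by
  rw [rD, LinearMap.flip_apply, LinearMap.flip_apply, mulE_dAdd]

theorem rD_gB (i : Fin d) (e : ELabel K N d) (t : PTree K N d) (v : TV K N d) :
    rD i (gB e t v) = gB e t (rD i v) := by
  rw [rD, LinearMap.flip_apply, LinearMap.flip_apply, mulE_gB]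

theorem isCoder_rD (i : Fin d) : IsCoder co (rD i : TV K N d →ₗ[ℝ] TV K N d) := by
  refine isCoder_of_tr fun n F => ?_
  induction n, F using word_induction with
  | nil => rw [rD_one, isCoder_dAdd, co_one]; simp only [TensorProduct.map_tmul, rD_one]
  | graft e' t' F ih =>
    rw [← gB_zero]
    exact coder_step (y := 0) (isCoder_gB e' t')
      (LinearMap.ext fun v => by simp [rD_gB]) rfl ih (by simp)
  | raise j n F ih =>
    rw [← dAdd_tr]
    exact coder_step (y := 0) (isCoder_dAdd j)
      (LinearMap.ext fun v => by simp [rD_dAdd]) rfl ih (by simp)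

theorem mulE_rD (i : Fin d) (u v : TV K N d) :
    mulE (rD i u) v = mulE u (dAdd (Pi.single i 1) v) := by
  have : mulE ∘ₗ rD i = (mulE (K := K) (N := N) (d := d)).compl₂ (dAdd (Pi.single i 1)) := by
    refine TV_ext fun n F => LinearMap.ext fun v => ?_
    simp only [LinearMap.comp_apply, LinearMap.compl₂_apply]
    induction n, F using word_induction with
    | nil => rw [rD_one, mulE_dAdd, mulE_one, mulE_one]
    | graft e' t' F ih => rw [← gB_zero, rD_gB, mulE_gB, mulE_gB, ih]
    | raise j n F ih => rw [← dAdd_tr, rD_dAdd, mulE_dAdd, mulE_dAdd, ih]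
  exact LinearMap.congr_fun (LinearMap.congr_fun this u) v

theorem epsV_rD (i : Fin d) : epsV ∘ₗ (rD i : TV K N d →ₗ[ℝ] TV K N d) = 0 :=
  epsV_comp fun n F => by
    induction n, F using word_induction with
    | nil => rw [rD_one, dAdd_single_apply_one]
    | graft e' t' F ih => rw [← gB_zero, rD_gB, gB_apply_one]
    | raise j n F ih => rw [← dAdd_tr, rD_dAdd, dAdd_single_apply_one]

/-- Raise the decoration of the root by a unit. -/
def up (i : Fin d) (t : PTree K N d) : PTree K N d := ⟨t.dec + Pi.single i 1, t.branches⟩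

theorem isRightMul_rD (i : Fin d) :
    IsRightMul (rD i : TV K N d →ₗ[ℝ] TV K N d) {0} (fun _ _ => 1) (fun t _ => up i t) :=
  .of_mul (isCoder_rD i) (epsV_rD i) (mulE_rD i) fun t v => by
    have : dAdd (Pi.single i 1) ∘ₗ appL t = appL (up i t) :=
      FV_ext fun F => by simp [up, add_comm]
    simpa using LinearMap.congr_fun this v

theorem actQ_rightMul {R : TV K N d →ₗ[ℝ] TV K N d} {I : Finset (MIdx d)}
    {c : PTree K N d → MIdx d → ℝ} {st : PTree K N d → MIdx d → PTree K N d}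
    (hR : IsRightMul R I c st) (F : Forest K N d)
    (q : F.Vert → PTree K N d) : actQ F q ∘ₗ R =
      ∑ x : F.Vert, if (label x).IsNoise then 0 else ∑ l ∈ I,
        c (q x) l • actQ F (Function.update q x (st (q x) l)) := by
  induction F with
  | nil => simp [actQ, hR.eps]
  | cons e' n s r hs hr =>
    rw [sum_vert, actQ, cv_comp (hR.coder), hr]
    simp only [label_head, label_up, label_right, actQ, update_head_up, update_head_right,
      update_up_up, update_up_right, update_right_up, update_right_right, Function.update_self]
    have hh : ∀ (t : PTree K N d) (x : s.Vert), Function.update q (Vert.up x) t Vert.head =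
        q Vert.head := fun t x => by simp
    have hh' : ∀ (t : PTree K N d) (x : r.Vert), Function.update q (Vert.right x) t Vert.head =
        q Vert.head := fun t x => by simp
    simp only [hh, hh']
    rw [← add_assoc]
    congr 1
    · have key : rootQ e' (q Vert.head) (actQ s fun x => q (Vert.up x)) ∘ₗ R =
          (if e'.IsNoise then 0 else ∑ l ∈ I, c (q Vert.head) l •
            rootQ e' (st (q Vert.head) l) (actQ s fun x => q (Vert.up x))) +
          ∑ x : s.Vert, if (label x).IsNoise then 0 else ∑ l ∈ I,
            c (q (Vert.up x)) l • rootQ e' (q Vert.head)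
              (actQ s (Function.update (fun x => q (Vert.up x)) x (st (q (Vert.up x)) l))) := by
        simp only [rootQ]
        split_ifs
        · rw [LinearMap.comp_assoc, hs, zero_add, comp_sum']
          refine Finset.sum_congr rfl fun x _ => ?_
          split_ifs
          · simp
          · rw [comp_sum']
            simp only [LinearMap.comp_smul]
        · rw [hR.cv_mul, hs]
          congr 1
          rw [comp_sum']
          change cvR _ _ _ _ = _
          rw [map_sum]
          refine Finset.sum_congr rfl fun x _ => ?_
          split_ifs
          · simp
          · rw [comp_sum', map_sum]
            simp only [LinearMap.comp_smul, map_smul]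
            rfl
      rw [key]
      change cvL _ _ _ _ = _
      rw [map_add, map_sum]
      congr 1
      · split_ifs
        · simp
        · rw [map_sum]
          simp only [map_smul]
          rfl
      · refine Finset.sum_congr rfl fun x _ => ?_
        split_ifs
        · simp
        · rw [map_sum]
          simp only [map_smul]
          rfl
    · change cvR _ _ _ _ = _
      rw [map_sum]
      refine Finset.sum_congr rfl fun x _ => ?_
      split_ifs
      · simp
      · rw [map_sum]
        simp only [map_smul]
        rfl

theorem update_none_some {t : PTree K N d} {β : Type*} (q : t.Vert → β) (b : β) :
    (fun x => Function.update q none b (some x)) = fun x => q (some x) := by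
  funext x; simp

theorem update_some_some {t : PTree K N d} {β : Type*} (q : t.Vert → β) (b : β) (y : t.Edge) :
    (fun x => Function.update q (some y) b (some x)) = Function.update (fun x => q (some x)) y b := by
  funext x
  by_cases h : x = y
  · subst h; simp
  · simp [h]

theorem noiseVert_some {t : PTree K N d} (x : t.Edge) :
    PTree.NoiseVert (some x : t.Vert) ↔ (label x).IsNoise := by
  simp [PTree.NoiseVert, PTree.NoiseEdge, PTree.target]

theorem not_noiseVert_none {t : PTree K N d} : ¬ PTree.NoiseVert (none : t.Vert) := by
  simp [PTree.NoiseVert, PTree.target]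

theorem actQT_rightMul {R : TV K N d →ₗ[ℝ] TV K N d} {I : Finset (MIdx d)}
    {c : PTree K N d → MIdx d → ℝ} {st : PTree K N d → MIdx d → PTree K N d}
    (hR : IsRightMul R I c st) (t : PTree K N d) (q : t.Vert → PTree K N d) :
    actQT t q ∘ₗ R = ∑ x : t.NVert, ∑ l ∈ I,
      c (q x) l • actQT t (Function.update q x.1 (st (q x) l)) := by
  have h0 : ∀ f : t.Vert → (TV K N d →ₗ[ℝ] TV K N d), ∑ x : t.NVert, f x =
      f none + ∑ x : t.Edge, if (label x).IsNoise then 0 else f (some x) := by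
    intro f
    rw [← Finset.sum_subtype (Finset.univ.filter fun x : t.Vert => ¬ PTree.NoiseVert x)
      (by simp) f, Finset.sum_filter, Fintype.sum_option, if_pos not_noiseVert_none]
    congr 1
    refine Finset.sum_congr rfl fun x _ => ?_
    simp only [noiseVert_some, ite_not]
  rw [h0 (fun x => ∑ l ∈ I,
      c (q x) l • actQT t (Function.update q x (st (q x) l)))]
  have h1 : ∀ (b : PTree K N d) (x : t.Edge), Function.update q (some x) b none = q none :=
    fun b x => Function.update_of_ne (by simp) _ _
  simp only [actQT, h1, update_none_some, update_some_some, Function.update_self]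
  rw [hR.cv_mul, actQ_rightMul hR]
  congr 1
  rw [comp_sum']
  change cvR _ _ _ _ = _
  rw [map_sum]
  refine Finset.sum_congr rfl fun x _ => ?_
  split_ifs
  · simp
  · rw [comp_sum', map_sum]
    simp only [LinearMap.comp_smul, map_smul]
    rfl

theorem append_nil (F : Forest K N d) : append F nil = F := by
  induction F with
  | nil => rfl
  | cons e n s r _ hr => rw [append, hr]

theorem append_assoc (F G H : Forest K N d) :
    append (append F G) H = append F (append G H) := by
  induction F with
  | nil => rfl
  | cons e n s r _ hr => rw [append, append, append, hr]

theorem ofList_toList (F : Forest K N d) : ofList (toList F) = F := by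
  induction F with
  | nil => rfl
  | cons e n s r _ hr => rw [toList, ofList, hr]

/-! ## Distribution of a decoration -/

theorem actQ_one (F : Forest K N d) (q : F.Vert → PTree K N d) :
    actQ F q (tr 0 nil) =
      Finsupp.single (leftGraft F (fun x => (q x).branches) fun x => (q x).dec) 1 := by
  induction F with
  | nil => simp [actQ, epsV, leftGraft]
  | cons e n s r hs hr =>
    rw [actQ, cv, LinearMap.comp_apply, LinearMap.comp_apply, co_one, TensorProduct.map_tmul,
      TensorProduct.lift.tmul, hr, rootQ, leftGraft]
    split_ifs
    · simp [hs]
    · simp [cv, co_one, hs, mulE_one]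

theorem actQT_one (t : PTree K N d) (q : t.Vert → PTree K N d) :
    actQT t q (tr 0 nil) =
      Finsupp.single (t.leftGraft (fun x => (q x).branches) fun x => (q x).dec) 1 := by
  simp [actQT, cv, co_one, actQ_one, mulE_one, PTree.leftGraft]

/-- The ways to distribute `n` over the non-noise vertices of `t`. -/
def dist (t : PTree K N d) (n : MIdx d) : Finset (t.Vert → MIdx d) :=
  (Fintype.piFinset fun _ : t.Vert => Finset.Iic n).filter
    fun del => ∑ x, del x = n ∧ ∀ x, PTree.NoiseVert x → del x = 0

theorem mem_dist {t : PTree K N d} {n : MIdx d} {del : t.Vert → MIdx d} :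
    del ∈ dist t n ↔ ∑ x, del x = n ∧ ∀ x, PTree.NoiseVert x → del x = 0 := by
  simp only [dist, Finset.mem_filter, Fintype.mem_piFinset, Finset.mem_Iic, and_iff_right_iff_imp]
  rintro ⟨rfl, -⟩ x
  exact Finset.single_le_sum (f := del) (fun _ _ => zero_le) (Finset.mem_univ x)

theorem mfact_add_single (n : MIdx d) (i : Fin d) :
    mfact (n + Pi.single i 1) = (n i + 1) * mfact n := by
  simp only [mfact]
  rw [← Finset.mul_prod_erase _ _ (Finset.mem_univ i),
    ← Finset.mul_prod_erase _ (fun j => ((n j)! : ℝ)) (Finset.mem_univ i)]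
  have : ∏ j ∈ Finset.univ.erase i, (((n + Pi.single i 1 : MIdx d) j)! : ℝ) =
      ∏ j ∈ Finset.univ.erase i, ((n j)! : ℝ) := by
    refine Finset.prod_congr rfl fun j hj => ?_
    simp [Finset.ne_of_mem_erase hj]
  rw [this]
  simp [Nat.factorial_succ]
  ring

/-- Recursion for the multinomial coefficients. -/
theorem sum_dist_add_single {M : Type*} [AddCommGroup M] [Module ℝ M] (t : PTree K N d)
    (n : MIdx d) (i : Fin d) (ψ : (t.Vert → MIdx d) → M) :
    ∑ del ∈ dist t (n + Pi.single i 1), (mfact (n + Pi.single i 1) / ∏ x, mfact (del x)) • ψ del =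
      ∑ x : t.NVert, ∑ del ∈ dist t n, (mfact n / ∏ x, mfact (del x)) •
        ψ (del + Pi.single x.1 (Pi.single i 1)) := by
  have h1 : ∀ del ∈ dist t (n + Pi.single i 1),
      (mfact (n + Pi.single i 1) / ∏ x, mfact (del x)) • ψ del =
        ∑ x : t.NVert, ((del x i : ℝ) * mfact n / ∏ x, mfact (del x)) • ψ del := by
    intro del hdel
    rw [mem_dist] at hdel
    rw [← Finset.sum_smul, ← Finset.sum_div, ← Finset.sum_mul, mfact_add_single]
    congr 3
    have h2 : ∑ x : t.NVert, (del x i : ℝ) = ∑ x, (del x i : ℝ) := by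
      rw [← Finset.sum_subtype (Finset.univ.filter fun x : t.Vert => ¬ PTree.NoiseVert x)
        (by simp) fun x => (del x i : ℝ), Finset.sum_filter]
      refine Finset.sum_congr rfl fun x _ => ?_
      split_ifs with h
      · rw [hdel.2 x h]; simp
      · rfl
    rw [h2]
    have := congrFun hdel.1 i
    rw [Finset.sum_apply] at this
    simp only [Pi.add_apply, Pi.single_eq_same] at this
    exact_mod_cast this.symm
  rw [Finset.sum_congr rfl h1, Finset.sum_comm]
  refine Finset.sum_congr rfl fun x _ => ?_
  symm
  refine Finset.sum_of_injOn (fun del => del + Pi.single x.1 (Pi.single i 1))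
    (fun a _ b _ h => add_right_cancel h) ?_ ?_ ?_
  · intro del hdel
    rw [Finset.mem_coe, mem_dist] at hdel ⊢
    refine ⟨?_, fun y hy => ?_⟩
    · simp [Finset.sum_add_distrib, hdel.1]
    · have : y ≠ x.1 := fun h => x.2 (h ▸ hy)
      simp [hdel.2 y hy, this]
  · intro del hdel hn
    by_cases h : 1 ≤ del x i
    · refine absurd ?_ hn
      have hx : Pi.single x.1 (Pi.single i 1) ≤ del := by
        intro y
        by_cases hy : y = x.1
        · subst hy
          simpa using single_le_of_pos h
        · simp [hy]
      rw [mem_dist] at hdel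
      have hc : del - Pi.single x.1 (Pi.single i 1) + Pi.single x.1 (Pi.single i 1) = del :=
        tsub_add_cancel_of_le hx
      refine ⟨del - Pi.single x.1 (Pi.single i 1), ?_, hc⟩
      rw [Finset.mem_coe, mem_dist]
      refine ⟨?_, fun y hy => ?_⟩
      · have := hdel.1
        rw [← hc] at this
        simp only [Pi.add_apply, Finset.sum_add_distrib, Finset.sum_pi_single', Finset.mem_univ,
          if_true] at this
        exact add_right_cancel this
      · rw [Pi.sub_apply, hdel.2 y hy, zero_tsub]
    · have : del x i = 0 := by omega
      simp [this]
  · intro del hdel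
    congr 1
    have h3 : ∏ y, mfact ((del + Pi.single x.1 (Pi.single i 1) : t.Vert → MIdx d) y) =
        ((del x i : ℝ) + 1) * ∏ y, mfact (del y) := by
      rw [← Finset.mul_prod_erase _ _ (Finset.mem_univ x.1),
        ← Finset.mul_prod_erase _ (fun j => mfact (del j)) (Finset.mem_univ x.1)]
      have : ∏ y ∈ Finset.univ.erase x.1,
          mfact ((del + Pi.single x.1 (Pi.single i 1) : t.Vert → MIdx d) y) =
          ∏ y ∈ Finset.univ.erase x.1, mfact (del y) := by
        refine Finset.prod_congr rfl fun y hy => ?_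
        simp [Finset.ne_of_mem_erase hy]
      rw [this, Pi.add_apply, Pi.single_eq_same, mfact_add_single]
      ring
    have h4 : ((del x i : ℝ) + 1) ≠ 0 := by positivity
    rw [h3]
    simp only [Pi.add_apply, Pi.single_eq_same, Nat.cast_add, Nat.cast_one]
    rw [mul_div_mul_left _ _ h4]

theorem actQT_nil (t : PTree K N d) (n : MIdx d) (q : t.Vert → PTree K N d) :
    actQT t q (tr n nil) = ∑ del ∈ dist t n, (mfact n / ∏ x, mfact (del x)) •
      Finsupp.single (t.leftGraft (fun x => (q x).branches) fun x => (q x).dec + del x) 1 := by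
  induction n using midx_induction generalizing q with
  | zero =>
    rw [actQT_one, Finset.sum_eq_single 0]
    · simp
    · intro del hdel h0
      refine absurd (funext fun x => ?_) h0
      rw [mem_dist] at hdel
      exact le_antisymm ((Finset.single_le_sum (f := del) (fun _ _ => zero_le)
        (Finset.mem_univ x)).trans_eq hdel.1) zero_le
    · intro h
      simp [mem_dist] at h
  | raise i n ih =>
    rw [add_comm, ← rD_nil, sum_dist_add_single]
    have := LinearMap.congr_fun (actQT_rightMul (isRightMul_rD i) t q) (tr n nil)
    rw [LinearMap.comp_apply] at this
    rw [this]
    simp only [Finset.sum_singleton, one_smul, LinearMap.sum_apply, ih]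
    refine Finset.sum_congr rfl fun x _ => Finset.sum_congr rfl fun del _ => ?_
    congr 3
    · funext y
      by_cases hy : y = x.1
      · subst hy; simp [up]
      · simp [hy]
    · funext y
      by_cases hy : y = x.1
      · subst hy; simp [up, add_comm, add_left_comm]
      · simp [hy]

/-! ## Grafting of several branches -/

theorem sum_piFinset_cons {β M : Type*} [AddCommMonoid M] {k : ℕ} (S : Fin (k + 1) → Finset β)
    (g : (Fin (k + 1) → β) → M) :
    ∑ l ∈ Fintype.piFinset S, g l =
      ∑ a ∈ S 0, ∑ l ∈ Fintype.piFinset fun i => S (Fin.succ i), g (Fin.cons a l) := by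
  rw [← Finset.sum_product']
  refine Finset.sum_nbij' (fun l => (l 0, fun i => l (Fin.succ i))) (fun p => Fin.cons p.1 p.2)
    ?_ ?_ ?_ ?_ ?_
  · intro l hl
    simp only [Finset.mem_product, Fintype.mem_piFinset] at hl ⊢
    exact ⟨hl 0, fun i => hl _⟩
  · intro p hp
    simp only [Finset.mem_product, Fintype.mem_piFinset] at hp ⊢
    intro i
    refine Fin.cases ?_ (fun i => ?_) i
    · simpa using hp.1
    · simpa using hp.2 i
  · intro l _; exact Fin.cons_self_tail l
  · intro p _; simp
  · intro l _; exact congrArg g (Fin.cons_self_tail l).symm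

theorem sum_fin_cons {β M : Type*} [Fintype β] [AddCommMonoid M] {k : ℕ}
    (g : (Fin (k + 1) → β) → M) : ∑ l, g l = ∑ a, ∑ l : Fin k → β, g (Fin.cons a l) := by
  have := sum_piFinset_cons (fun _ : Fin (k + 1) => (Finset.univ : Finset β)) g
  simpa using this

section Graft
open PTree
variable {t : PTree K N d}

theorem loss_cons {k : ℕ} (f : Fin k → t.NVert) (l : Fin k → MIdx d) (x : t.NVert) (a : MIdx d) :
    loss (Fin.cons x f : Fin (k + 1) → t.NVert) (Fin.cons a l : Fin (k + 1) → MIdx d) =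
      loss f l + Pi.single x.1 a := by
  funext y
  rw [loss, Finset.sum_filter, Fin.sum_univ_succ, Pi.add_apply, loss, Finset.sum_filter]
  simp only [Fin.cons_zero, Fin.cons_succ]
  rw [add_comm]
  congr 1
  by_cases h : y = x.1
  · subst h; simp
  · simp [h, Ne.symm h]

theorem graftedAt_cons (b : ELabel K N d × PTree K N d) (L : List (ELabel K N d × PTree K N d))
    (f : Fin L.length → t.NVert) (l : Fin L.length → MIdx d) (x : t.NVert) (a : MIdx d)
    (y : t.Vert) :
    graftedAt (b :: L) (Fin.cons x f : Fin (L.length + 1) → t.NVert)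
        (Fin.cons a l : Fin (L.length + 1) → MIdx d) y =
      if x.1 = y then cons (b.1.lower a) b.2.dec b.2.branches (graftedAt L f l y)
      else graftedAt L f l y := by
  have h : ∀ M : List (Fin L.length), ((M.map Fin.succ).filter
      (fun i => decide (((Fin.cons x f : Fin (L.length + 1) → t.NVert) i).1 = y))).map
        (fun i => (((b :: L).get i).1.lower ((Fin.cons a l : Fin (L.length + 1) → MIdx d) i),
          ((b :: L).get i).2)) =
      (M.filter (fun i => decide ((f i).1 = y))).map
        (fun i => ((L.get i).1.lower (l i), (L.get i).2)) := by
    intro M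
    induction M with
    | nil => rfl
    | cons i M ih =>
      by_cases hi : (f i).1 = y
      · simp [hi] at ih ⊢; exact ih
      · simp [hi] at ih ⊢; exact ih
  have hf : List.finRange (b :: L).length = 0 :: (List.finRange L.length).map Fin.succ :=
    List.finRange_succ
  rw [graftedAt, graftedAt, hf]
  by_cases hx : x.1 = y
  · rw [if_pos hx, List.filter_cons_of_pos (by simpa using hx), List.map_cons]
    exact congrArg (cons (b.1.lower a) b.2.dec b.2.branches) (congrArg ofList (h _))
  · rw [if_neg hx, List.filter_cons_of_neg (by simpa using hx)]
    exact congrArg ofList (h _)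

/-- The words at the vertices after grafting. -/
def grafted (L : List (ELabel K N d × PTree K N d)) (f : Fin L.length → t.NVert)
    (l : Fin L.length → MIdx d) (x : t.Vert) : PTree K N d :=
  ⟨t.vdec x - loss f l x, graftedAt L f l x⟩

theorem grafted_cons (b : ELabel K N d × PTree K N d) (L : List (ELabel K N d × PTree K N d))
    (f : Fin L.length → t.NVert) (l : Fin L.length → MIdx d) (x : t.NVert) (a : MIdx d) :
    grafted (b :: L) (Fin.cons x f : Fin (L.length + 1) → t.NVert)
        (Fin.cons a l : Fin (L.length + 1) → MIdx d) =
      Function.update (grafted L f l) x (stp b.1 b.2 (grafted L f l x) a) := by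
  funext y
  by_cases h : y = x.1
  · subst h
    simp [grafted, graftedAt_cons, loss_cons, stp, tsub_add_eq_tsub_tsub]
  · simp [h, grafted, graftedAt_cons, loss_cons, Ne.symm h]

/-- The coefficient of a grafting. -/
def graftC {k : ℕ} (f : Fin k → t.NVert) (l : Fin k → MIdx d) : ℝ :=
  if ∀ x, loss f l x ≤ t.vdec x then
    (∏ x, mfact (t.vdec x) / mfact (t.vdec x - loss f l x)) / ∏ i, mfact (l i) else 0

theorem graftC_cons {k : ℕ} (f : Fin k → t.NVert) (l : Fin k → MIdx d) (x : t.NVert)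
    (a : MIdx d) :
    graftC (Fin.cons x f : Fin (k + 1) → t.NVert) (Fin.cons a l : Fin (k + 1) → MIdx d) =
      graftC f l * mchoose (t.vdec x - loss f l x) a := by
  by_cases h : ∀ y, loss f l y ≤ t.vdec y
  · by_cases ha : a ≤ t.vdec x - loss f l x
    · have h' : ∀ y, loss (Fin.cons x f : Fin (k + 1) → t.NVert)
          (Fin.cons a l : Fin (k + 1) → MIdx d) y ≤ t.vdec y := by
        intro y
        rw [loss_cons, Pi.add_apply]
        by_cases hy : y = x.1
        · subst hy
          rw [Pi.single_eq_same]
          exact (add_le_add_right ha _).trans_eq (add_tsub_cancel_of_le (h _))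
        · simpa [hy] using h y
      rw [graftC, if_pos h', graftC, if_pos h, mchoose_eq ha, Fin.prod_univ_succ]
      simp only [Fin.cons_zero, Fin.cons_succ]
      rw [← Finset.mul_prod_erase _ _ (Finset.mem_univ x.1),
        ← Finset.mul_prod_erase _
          (fun y => mfact (t.vdec y) / mfact (t.vdec y - loss f l y)) (Finset.mem_univ x.1)]
      have : ∏ y ∈ Finset.univ.erase x.1, mfact (t.vdec y) / mfact (t.vdec y -
            loss (Fin.cons x f : Fin (k + 1) → t.NVert) (Fin.cons a l : Fin (k + 1) → MIdx d) y) =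
          ∏ y ∈ Finset.univ.erase x.1, mfact (t.vdec y) / mfact (t.vdec y - loss f l y) := by
        refine Finset.prod_congr rfl fun y hy => ?_
        simp [loss_cons, Finset.ne_of_mem_erase hy]
      rw [this, loss_cons, Pi.add_apply, Pi.single_eq_same, tsub_add_eq_tsub_tsub]
      have := mfact_ne_zero (t.vdec x - loss f l x)
      have := mfact_ne_zero (t.vdec x - loss f l x - a)
      field_simp
    · rw [mchoose_eq_zero ha, graftC, if_neg]
      · simp
      · intro h'
        refine ha ?_
        have := h' x.1
        rw [loss_cons, Pi.add_apply, Pi.single_eq_same] at this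
        exact le_tsub_of_add_le_left this
  · rw [graftC, graftC, if_neg h, if_neg, zero_mul]
    intro h'
    refine h fun y => ?_
    have := h' y
    rw [loss_cons, Pi.add_apply] at this
    exact le_self_add.trans this

theorem sum_grafted (L : List (ELabel K N d × PTree K N d)) (n : MIdx d) (F : Forest K N d) :
    ∑ f : Fin L.length → t.NVert, ∑ l ∈ Fintype.piFinset fun i => Finset.Iic (L.get i).1.2,
        graftC f l • actQT t (grafted L f l) (tr n F) =
      actT t (tr n (append F (ofList L))) := by
  induction L generalizing F with
  | nil =>
    have h1 : ∀ f : Fin 0 → t.NVert, ∀ l : Fin 0 → MIdx d, loss f l = 0 := fun f l => by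
      funext x; simp [loss]
    have h2 : ∀ f l, (grafted ([] : List (ELabel K N d × PTree K N d)) f l : t.Vert → _) =
        fun x => ⟨t.vdec x, nil⟩ := fun f l => by
      funext x; simp [grafted, graftedAt, ofList, h1]
    simp only [List.length_nil, h2, actQT_init, ofList, append_nil]
    simp [graftC, h1, div_self, mfact_ne_zero]
  | cons b L ih =>
    have h1 : append F (ofList (b :: L)) =
        append (append F (cons b.1 b.2.dec b.2.branches nil)) (ofList L) := by
      rw [append_assoc]; rfl
    rw [h1, ← ih, ← rG_tr]
    refine (sum_fin_cons (k := L.length) _).trans ?_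
    rw [Finset.sum_comm]
    refine Finset.sum_congr rfl fun f _ => ?_
    have h2 : ∀ x : t.NVert, ∑ a ∈ Finset.Iic ((b :: L).get 0).1.2,
        ∑ l ∈ Fintype.piFinset (fun i : Fin L.length => Finset.Iic ((b :: L).get (Fin.succ i)).1.2),
          graftC (Fin.cons x f : Fin (L.length + 1) → t.NVert)
            (Fin.cons a l : Fin (L.length + 1) → MIdx d) •
            actQT t (grafted (b :: L) (Fin.cons x f : Fin (L.length + 1) → t.NVert)
              (Fin.cons a l : Fin (L.length + 1) → MIdx d)) (tr n F) =
        ∑ l ∈ Fintype.piFinset (fun i : Fin L.length => Finset.Iic (L.get i).1.2),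
          ∑ a ∈ Finset.Iic b.1.2, graftC f l • (mchoose (grafted L f l x.1).dec a : ℝ) •
            actQT t (Function.update (grafted L f l) x.1 (stp b.1 b.2 (grafted L f l x) a))
              (tr n F) := fun x => by
      rw [Finset.sum_comm]
      refine Finset.sum_congr rfl fun l _ => Finset.sum_congr rfl fun a _ => ?_
      rw [grafted_cons, graftC_cons, mul_smul]
      rfl
    have h4 : ∀ x : t.NVert, _ := fun x => (sum_piFinset_cons (k := L.length)
      (fun i : Fin (L.length + 1) => Finset.Iic ((b :: L).get i).1.2)
      (fun l => graftC (Fin.cons x f : Fin (L.length + 1) → t.NVert) l •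
        actQT t (grafted (b :: L) (Fin.cons x f : Fin (L.length + 1) → t.NVert) l)
          (tr n F))).trans (h2 x)
    refine (Finset.sum_congr rfl fun x _ => h4 x).trans ?_
    rw [Finset.sum_comm]
    refine Finset.sum_congr rfl fun l _ => ?_
    have h3 := LinearMap.congr_fun
      (actQT_rightMul (isRightMul_rG b.1 b.2) t (grafted L f l)) (tr n F)
    rw [LinearMap.comp_apply] at h3
    rw [h3]
    simp only [LinearMap.sum_apply, LinearMap.smul_apply, Finset.smul_sum]

theorem insertTop_eq (t : PTree K N d) (n : MIdx d) (L : List (ELabel K N d × PTree K N d))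
    (g : PTree K N d → PTree K N d) :
    insertTop t n L g = Finsupp.lmapDomain ℝ ℝ g (actT t (tr n (ofList L))) := by
  have h := sum_grafted (t := t) L n nil
  rw [append] at h
  rw [← h, insertTop]
  simp only [map_sum, map_smul]
  refine Finset.sum_congr rfl fun f _ => ?_
  rw [Finset.sum_filter]
  refine Finset.sum_congr rfl fun l _ => ?_
  rw [graftC]
  split_ifs with hl
  · rw [actQT_nil, map_sum, Finset.smul_sum]
    refine Finset.sum_congr rfl fun del _ => ?_
    rw [map_smul, smul_smul, Finsupp.lmapDomain_apply, Finsupp.mapDomain_single,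
      Finsupp.smul_single, smul_eq_mul, mul_one]
    rfl
  · rw [zero_smul]

theorem infF_eq (x : TV K N d →ₗ[ℝ] TV K N d) (F : Forest K N d) :
    infF x F = ∑ v : F.Vert, if (label v).IsNoise then 0 else
      Finsupp.lmapDomain ℝ ℝ (Forest.replace F v) (x (tr (Forest.vdec v) (Forest.above v))) := by
  induction F with
  | nil => simp [infF]
  | cons e n s r hs hr =>
    rw [sum_vert]
    simp only [label_head, label_up, label_right, vdec_head, vdec_up, vdec_right, above_head,
      above_up, above_right, infF, hs, hr]
    have h1 : ∀ w : TV K N d, Finsupp.lmapDomain ℝ ℝ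
        (Forest.replace (cons e n s r) Vert.head) w = consB e w (Finsupp.single r 1) := fun w => by
      have : Finsupp.lmapDomain ℝ ℝ (Forest.replace (cons e n s r) Vert.head) =
        (consB e).flip (Finsupp.single r 1) := TV_ext fun m F => by simp [Forest.replace]
      exact LinearMap.congr_fun this w
    have h2 : ∀ (v : s.Vert) (w : TV K N d), Finsupp.lmapDomain ℝ ℝ
        (Forest.replace (cons e n s r) (Vert.up v)) w =
        consB e (treeL n (Finsupp.lmapDomain ℝ ℝ (Forest.replace s v) w)) (Finsupp.single r 1) :=
      fun v w => by
        have : Finsupp.lmapDomain ℝ ℝ (Forest.replace (cons e n s r) (Vert.up v)) =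
          (consB e).flip (Finsupp.single r 1) ∘ₗ treeL n ∘ₗ
            Finsupp.lmapDomain ℝ ℝ (Forest.replace s v) :=
          TV_ext fun m F => by simp [Forest.replace]
        exact LinearMap.congr_fun this w
    have h3 : ∀ (v : r.Vert) (w : TV K N d), Finsupp.lmapDomain ℝ ℝ
        (Forest.replace (cons e n s r) (Vert.right v)) w =
        consB e (tr n s) (Finsupp.lmapDomain ℝ ℝ (Forest.replace r v) w) :=
      fun v w => by
        have : Finsupp.lmapDomain ℝ ℝ (Forest.replace (cons e n s r) (Vert.right v)) =
          consB e (tr n s) ∘ₗ Finsupp.lmapDomain ℝ ℝ (Forest.replace r v) :=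
          TV_ext fun m F => by simp [Forest.replace]
        exact LinearMap.congr_fun this w
    simp only [h1, h2, h3, map_sum]
    rw [← add_assoc]
    congr 1
    · split_ifs
      · rw [zero_add, map_sum, LinearMap.sum_apply]
        refine Finset.sum_congr rfl fun v _ => ?_
        split_ifs <;> simp
      · rw [map_add, LinearMap.add_apply]
        congr 1
        rw [map_sum, LinearMap.sum_apply]
        refine Finset.sum_congr rfl fun v _ => ?_
        split_ifs <;> simp
    · refine Finset.sum_congr rfl fun v _ => ?_
      split_ifs <;> simp

theorem insertion_eq (t s : PTree K N d) :
    insertion t s = infV (insR t) (Finsupp.single s 1) := by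
  obtain ⟨n, F⟩ := s
  rw [insertion, ← Finset.sum_subtype (Finset.univ.filter fun x : (PTree.mk n F).Vert =>
    ∀ e : (PTree.mk n F).Edge, NoiseEdge e → source e ≠ x ∧ target e ≠ x) (by simp)
    (fun x => insertTop t ((PTree.mk n F).vdec x) (Forest.toList ((PTree.mk n F).above x))
      (fun u => (PTree.mk n F).replace x u)), Finset.sum_filter, Fintype.sum_option, infV,
    LinearMap.add_apply, infO_tr, infF_eq, map_sum]
  have hr : ∀ m G, insR t (tr m G) = if NoTop G then actT t (tr m G) else 0 := fun m G => by
    rw [insR, LinearMap.comp_apply, nuV_tr]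
    split_ifs <;> simp
  congr 1
  · rw [hr, insertTop_eq, ofList_toList]
    have h : (∀ e : (PTree.mk n F).Edge, NoiseEdge e → source e ≠ none ∧ target e ≠ none) ↔
        NoTop F := by
      rw [noTop_iff]
      refine forall_congr' fun e => ?_
      simp [target, source, NoiseEdge]
      tauto
    simp only [h]
    split_ifs
    · change Finsupp.lmapDomain ℝ ℝ id (actT t (tr n F)) = _
      rw [Finsupp.lmapDomain_id]
      rfl
    · rfl
  · refine Finset.sum_congr rfl fun v _ => ?_
    rw [hr, insertTop_eq, ofList_toList]
    have h : (∀ e : (PTree.mk n F).Edge, NoiseEdge e → source e ≠ some v ∧ target e ≠ some v) ↔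
        ¬ (label v).IsNoise ∧ NoTop (Forest.above v) := by
      rw [noTop_above_iff]
      simp only [target, source, NoiseEdge, ne_eq, Option.some.injEq]
      constructor
      · intro h
        exact ⟨fun hv => (h v hv).2 rfl, fun e he hn => (h e hn).1 he⟩
      · rintro ⟨h1, h2⟩ e he
        exact ⟨fun h => h2 e h he, fun h => h1 (h ▸ he)⟩
    simp only [h]
    by_cases h1 : (label v).IsNoise
    · simp [h1]
    · by_cases h2 : NoTop (Forest.above v)
      · simp only [h1, h2, not_false_eq_true, and_self, if_true, if_false]
        have : (Finsupp.lmapDomain ℝ ℝ ((PTree.mk n F).replace (some v)) : TV K N d →ₗ[ℝ] TV K N d) =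
            treeL n ∘ₗ Finsupp.lmapDomain ℝ ℝ (Forest.replace F v) :=
          TV_ext fun m G => by simp [PTree.replace]
        exact LinearMap.congr_fun this _
      · simp [h1, h2]

end Graft

section GuinOudom
open MvPolynomial

variable {κ : K → ℝ} {α : N → ℝ}

/-! ## The action on the model space -/

/-- The projection onto the span of the trees that satisfy the constraints on noises. -/
def toModel : TV K N d →ₗ[ℝ] ModelSpace K N d :=
  Finsupp.linearCombination ℝ fun t => if h : t.Valid then Finsupp.single ⟨t, h⟩ 1 else 0

/-- The formal sums of trees that satisfy the constraints on noises. -/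
abbrev validSub (K : Type u) (N : Type v) (d : ℕ) : Submodule ℝ (TV K N d) :=
  Finsupp.supported ℝ ℝ {t | t.Valid}

theorem inclT_single (s : ModelTree K N d) (c : ℝ) :
    inclT (Finsupp.single s c) = Finsupp.single s.1 c := by
  simp [inclT]

theorem inclT_injective : Function.Injective (inclT : ModelSpace K N d →ₗ[ℝ] _) :=
  Finsupp.mapDomain_injective Subtype.val_injective

theorem inclT_toModel {v : TV K N d} (hv : v ∈ validSub K N d) : inclT (toModel v) = v := by
  rw [← sub_eq_zero]
  have : (inclT ∘ₗ toModel - LinearMap.id : TV K N d →ₗ[ℝ] TV K N d) v ∈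
      (⊥ : Submodule ℝ (TV K N d)) := by
    refine map_mem_of_supported _ (fun t ht => ?_) hv
    have ht : t.Valid := ht
    simp [toModel, ht, inclT_single]
  simpa using this

theorem insV_valid (t : NegTree d κ α) {v : TV K N d} (hv : v ∈ validSub K N d) :
    insV t.1 v ∈ validSub K N d :=
  map_mem_of_supported _ (fun _ hs =>
    Finsupp.supported_mono (fun _ hu => hu.1) (infV_insR_ok κ α t.2.1 hs)) hv

theorem insV_negative (t : NegTree d κ α) {v : TV K N d}
    (hv : v ∈ Finsupp.supported ℝ ℝ (negSet κ α)) :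
    insV t.1 v ∈ Finsupp.supported ℝ ℝ (negSet κ α) :=
  map_mem_of_supported _ (fun s hs => insV_neg t ⟨s, hs⟩) hv

theorem simT_valid {s : PTree K N d} (hs : s.Valid) (w : SymNeg d κ α) :
    simT κ α s w ∈ validSub K N d := by
  refine mem_of_recursion insD_mem (F := fun t => insV t.1) (fun t v hv => insV_valid t hv) ?_
    (simT_X_mul s) w
  rw [simT_one]
  exact single_mem_supported (S := {t : PTree K N d | t.Valid}) hs 1

theorem simT_negative (s : NegTree d κ α) (w : SymNeg d κ α) :
    simT κ α s.1 w ∈ Finsupp.supported ℝ ℝ (negSet κ α) := by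
  refine mem_of_recursion insD_mem (F := fun t => insV t.1) (fun t v hv => insV_negative t hv) ?_
    (simT_X_mul s.1) w
  rw [simT_one]
  exact single_mem_supported (S := negSet κ α) s.2 1

/-- The action of the symmetric algebra on the model space by simultaneous insertions. -/
def simA (κ : K → ℝ) (α : N → ℝ) :
    SymNeg d κ α →ₗ[ℝ] ModelSpace K N d →ₗ[ℝ] ModelSpace K N d :=
  LinearMap.flip (Finsupp.linearCombination ℝ fun s => toModel ∘ₗ simT κ α s.1)

theorem inclT_simA (w : SymNeg d κ α) (s : ModelTree K N d) :
    inclT (simA κ α w (Finsupp.single s 1)) = simT κ α s.1 w := by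
  rw [simA, LinearMap.flip_apply, Finsupp.linearCombination_single, one_smul, LinearMap.comp_apply,
    inclT_toModel (simT_valid s.2 w)]

theorem inclT_simA_X (t : NegTree d κ α) (x : ModelSpace K N d) :
    inclT (simA κ α (X t) x) = insV t.1 (inclT x) := by
  have : inclT ∘ₗ simA κ α (X t) = insV t.1 ∘ₗ inclT :=
    Finsupp.lhom_ext' fun s => LinearMap.ext_ring <| by
      change inclT (simA κ α (X t) (Finsupp.single s 1)) = insV t.1 (inclT (Finsupp.single s 1))
      rw [inclT_simA, simT_X, inclT_single]
  exact LinearMap.congr_fun this x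

/-! ## The Guin-Oudom extension -/

theorem inclS_injective : Function.Injective (inclS κ α : SymNeg d κ α →ₐ[ℝ] _) :=
  rename_injective _ Subtype.val_injective

theorem inclS_toNeg {v : TV K N d} (hv : v ∈ Finsupp.supported ℝ ℝ (negSet κ α)) :
    inclS κ α (toNeg κ α v) = toSym v := by
  rw [← sub_eq_zero]
  have : ((inclS κ α).toLinearMap ∘ₗ toNeg κ α - toSym : TV K N d →ₗ[ℝ] _) v ∈
      (⊥ : Submodule ℝ (MvPolynomial (PTree K N d) ℝ)) := by
    refine map_mem_of_supported _ (fun t ht => ?_) hv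
    have := toNeg_single (⟨t, ht⟩ : NegTree d κ α)
    simp only at this
    simp [this, toSym, inclS]
  simpa using this

theorem insD_toNeg (t : NegTree d κ α) {v : TV K N d}
    (hv : v ∈ Finsupp.supported ℝ ℝ (negSet κ α)) :
    insD t (toNeg κ α v) = toNeg κ α (insV t.1 v) := by
  rw [← sub_eq_zero]
  have : ((insD t).toLinearMap ∘ₗ toNeg κ α - toNeg κ α ∘ₗ insV t.1 : TV K N d →ₗ[ℝ] _) v ∈
      (⊥ : Submodule ℝ (SymNeg d κ α)) := by
    refine map_mem_of_supported _ (fun s hs => ?_) hv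
    have := toNeg_single (⟨s, hs⟩ : NegTree d κ α)
    simp only at this
    have h2 := insD_X t ⟨s, hs⟩
    simp [this, h2]
  simpa using this

/-- The rule for products as a statement on convolutions. -/
theorem mul'_map (f g : SymNeg d κ α →ₗ[ℝ] SymNeg d κ α) (w : SymNeg d κ α) :
    LinearMap.mul' ℝ (SymNeg d κ α) (TensorProduct.map f g (deshuffle κ α w)) =
      (WithConv.toConv f * WithConv.toConv g : WithConv (SymNeg d κ α →ₗ[ℝ] SymNeg d κ α)).ofConv w :=
  rfl

/-- The simultaneous insertions in the factors of a product. -/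
def simBHom (κ : K → ℝ) (α : N → ℝ) :
    SymNeg d κ α →ₐ[ℝ] WithConv (SymNeg d κ α →ₗ[ℝ] SymNeg d κ α) :=
  aeval fun s => WithConv.toConv (toNeg κ α ∘ₗ simT κ α s.1)

/-- The Guin-Oudom extension of the insertion, by simultaneous insertions. -/
def simB (κ : K → ℝ) (α : N → ℝ) : SymNeg d κ α →ₗ[ℝ] SymNeg d κ α →ₗ[ℝ] SymNeg d κ α :=
  LinearMap.flip ((WithConv.linearEquiv ℝ _).toLinearMap ∘ₗ (simBHom κ α).toLinearMap)

theorem simB_X (w : SymNeg d κ α) (s : NegTree d κ α) :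
    simB κ α w (X s) = toNeg κ α (simT κ α s.1 w) := by
  simp [simB, simBHom]

theorem simB_flip (v : SymNeg d κ α) : (simB κ α).flip v = (simBHom κ α v).ofConv := rfl

theorem simB_mul (w w₁ w₂ : SymNeg d κ α) : simB κ α w (w₁ * w₂) =
    LinearMap.mul' ℝ (SymNeg d κ α)
      (TensorProduct.map ((simB κ α).flip w₁) ((simB κ α).flip w₂) (deshuffle κ α w)) := by
  rw [← LinearMap.flip_apply, simB_flip, map_mul, mul'_map, simB_flip, simB_flip]

theorem simB_one_right (w : SymNeg d κ α) : simB κ α w 1 = algebraMap ℝ _ (epsS w) := by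
  rw [← LinearMap.flip_apply, simB_flip, map_one]
  rfl

theorem simB_one_left (w : SymNeg d κ α) : simB κ α 1 w = w := by
  induction w using MvPolynomial.induction_on with
  | C a =>
    have : (C a : SymNeg d κ α) = a • 1 := by rw [smul_eq_C_mul, mul_one]
    rw [this, map_smul, simB_one_right, map_one, map_one]
  | add p q hp hq => rw [map_add, hp, hq]
  | mul_X p s hp =>
    rw [simB_mul, map_one, Algebra.TensorProduct.one_def, TensorProduct.map_tmul,
      LinearMap.mul'_apply, LinearMap.flip_apply, LinearMap.flip_apply, hp, simB_X, simT_one,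
      toNeg_single]

/-- In every Guin-Oudom extension the trees act by derivations. -/
theorem apply_X_of_axioms {B : SymNeg d κ α →ₗ[ℝ] SymNeg d κ α →ₗ[ℝ] SymNeg d κ α}
    (h1 : ∀ w, B 1 w = w)
    (hm : ∀ w w₁ w₂ : SymNeg d κ α, B w (w₁ * w₂) =
      LinearMap.mul' ℝ (SymNeg d κ α) (TensorProduct.map (B.flip w₁) (B.flip w₂) (deshuffle κ α w)))
    {t : NegTree d κ α} (hX : ∀ s, B (X t) (X s) = insD t (X s)) :
    B (X t) = (insD t).toLinearMap := by
  let D : Derivation ℝ (SymNeg d κ α) (SymNeg d κ α) := Derivation.mk' (B (X t)) fun a b => by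
    rw [hm, deshuffle_X, map_add, map_add, TensorProduct.map_tmul, TensorProduct.map_tmul,
      LinearMap.mul'_apply, LinearMap.mul'_apply]
    simp only [LinearMap.flip_apply, h1, smul_eq_mul]
    ring
  have : D = insD t := MvPolynomial.derivation_ext fun s => hX s
  rw [← this]
  rfl

theorem simB_X_left (t : NegTree d κ α) : simB κ α (X t) = (insD t).toLinearMap :=
  apply_X_of_axioms simB_one_left simB_mul fun s => by rw [simB_X, simT_X, insD_X]

theorem isGuinOudomExtension_simB : IsGuinOudomExtension (simB (d := d) κ α) where
  extend t s := by
    rw [simB_X, simT_X, inclS_toNeg (insV_neg t s), insertion_eq]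
  one_left := simB_one_left
  mul_left t w s := by
    rw [simB_X, simB_X, simB_X, simT_X_mul, simB_X_left, map_sub]
    congr 1
    exact (insD_toNeg t (simT_negative s w)).symm
  mul_right := simB_mul

theorem IsGuinOudomExtension.apply_X {B : SymNeg d κ α →ₗ[ℝ] SymNeg d κ α →ₗ[ℝ] SymNeg d κ α}
    (h : IsGuinOudomExtension B) (t : NegTree d κ α) : B (X t) = (insD t).toLinearMap :=
  apply_X_of_axioms h.one_left h.mul_right fun s => inclS_injective <| by
    rw [h.extend, insD_X, inclS_toNeg (insV_neg t s), insertion_eq]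

theorem IsGuinOudomExtension.apply_one {B : SymNeg d κ α →ₗ[ℝ] SymNeg d κ α →ₗ[ℝ] SymNeg d κ α}
    (h : IsGuinOudomExtension B) (w : SymNeg d κ α) : B w 1 = algebraMap ℝ _ (epsS w) := by
  have he : WithConv.toConv (B.flip 1) * WithConv.toConv (B.flip 1) = WithConv.toConv (B.flip 1) := by
    refine WithConv.ext (LinearMap.ext fun v => ?_)
    rw [← mul'_map, ← h.mul_right, mul_one]
    rfl
  have hX : ∀ (t : NegTree d κ α), B.flip 1 ∘ₗ LinearMap.mulLeft ℝ (X t) = 0 := by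
    intro t
    set e := WithConv.toConv (B.flip 1)
    set e' := WithConv.toConv (B.flip 1 ∘ₗ LinearMap.mulLeft ℝ (X t : SymNeg d κ α)) with he'
    have h2 : e' = e' * e + e * e' := by
      have h3 := cv_comp (isCoder_mulLeft t) (LinearMap.mul ℝ (SymNeg d κ α)) (B.flip 1) (B.flip 1)
      have h4 : cv (deshuffle κ α).toLinearMap (LinearMap.mul ℝ (SymNeg d κ α)) (B.flip 1)
          (B.flip 1) = B.flip 1 := congrArg WithConv.ofConv he
      rw [h4] at h3
      exact congrArg WithConv.toConv h3
    have h5 : e * e' = 0 := by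
      have h6 : e * e' = e * (e' * e + e * e') := congrArg (e * ·) h2
      have h7 : e * (e' * e + e * e') = (e * e) * e' + (e * e) * e' := by ring
      rw [h7, he] at h6
      simpa using h6
    rw [mul_comm e', h5, add_zero] at h2
    exact congrArg WithConv.ofConv h2
  have h1 : B 1 1 = 1 := h.one_left 1
  induction w using MvPolynomial.induction_on with
  | C a =>
    have : (C a : SymNeg d κ α) = a • 1 := by rw [smul_eq_C_mul, mul_one]
    rw [this, map_smul, LinearMap.smul_apply, h1, map_smul, map_one, Algebra.algebraMap_eq_smul_one]
    simp
  | add p q hp hq => rw [map_add, LinearMap.add_apply, hp, hq, map_add, map_add]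
  | mul_X p t _ =>
    have := LinearMap.congr_fun (hX t) p
    rw [LinearMap.comp_apply, LinearMap.mulLeft_apply, LinearMap.flip_apply] at this
    rw [mul_comm, this]
    simp

theorem IsGuinOudomExtension.eq_simB
    {B : SymNeg d κ α →ₗ[ℝ] SymNeg d κ α →ₗ[ℝ] SymNeg d κ α}
    (h : IsGuinOudomExtension B) : B = simB κ α := by
  have hX : ∀ s, B.flip (X s) = (simB κ α).flip (X s) := fun s => by
    refine eq_of_recursion insD_mem (F := fun t => (insD t).toLinearMap) ?_ ?_ ?_
    · simp [h.one_left, simB_one_left]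
    · intro t w
      simp only [LinearMap.flip_apply]
      rw [h.mul_left, h.apply_X]
      rfl
    · intro t w
      simp only [LinearMap.flip_apply]
      rw [isGuinOudomExtension_simB.mul_left, simB_X_left]
      rfl
  have hall : ∀ v, B.flip v = (simB κ α).flip v := fun v => by
    induction v using MvPolynomial.induction_on with
    | C a =>
      have : (C a : SymNeg d κ α) = a • 1 := by rw [smul_eq_C_mul, mul_one]
      rw [this, map_smul, map_smul]
      congr 1
      refine LinearMap.ext fun w => ?_
      rw [LinearMap.flip_apply, LinearMap.flip_apply, h.apply_one, simB_one_right]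
    | add p q hp hq => rw [map_add, map_add, hp, hq]
    | mul_X p s hp =>
      refine LinearMap.ext fun w => ?_
      rw [LinearMap.flip_apply, LinearMap.flip_apply, h.mul_right, simB_mul, hp, hX]
  refine LinearMap.ext fun w => LinearMap.ext fun v => ?_
  exact LinearMap.congr_fun (hall v) w

theorem isInsertionAction_simA : IsInsertionAction (simB κ α) (simA (d := d) κ α) where
  extend t s := by rw [inclT_simA, simT_X, insertion_eq]
  one_left x := by
    have : simA κ α 1 = (LinearMap.id : ModelSpace K N d →ₗ[ℝ] _) := Finsupp.lhom_ext' fun s => LinearMap.ext_ring <| by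
      refine inclT_injective ?_
      change inclT (simA κ α 1 (Finsupp.single s 1)) = inclT (Finsupp.single s 1)
      rw [inclT_simA, simT_one, inclT_single]
    rw [this]
    rfl
  mul_left t w x := by
    have : simA κ α (X t * w) = simA κ α (X t) ∘ₗ simA κ α w - simA κ α (simB κ α (X t) w) :=
      Finsupp.lhom_ext' fun s => LinearMap.ext_ring <| by
        refine inclT_injective ?_
        change inclT (simA κ α (X t * w) (Finsupp.single s 1)) =
          inclT (simA κ α (X t) (simA κ α w (Finsupp.single s 1)) -
            simA κ α (simB κ α (X t) w) (Finsupp.single s 1))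
        rw [map_sub, inclT_simA_X, inclT_simA, inclT_simA, inclT_simA, simT_X_mul, simB_X_left]
        rfl
    rw [this]
    rfl

theorem IsInsertionAction.eq_simA
    {A : SymNeg d κ α →ₗ[ℝ] ModelSpace K N d →ₗ[ℝ] ModelSpace K N d}
    (h : IsInsertionAction (simB κ α) A) : A = simA κ α := by
  have hX : ∀ t, A (X t) = simA κ α (X t) := fun t =>
    Finsupp.lhom_ext' fun s => LinearMap.ext_ring <| inclT_injective <|
      (h.extend t s).trans (isInsertionAction_simA.extend t s).symm
  have hall : ∀ x, A.flip x = (simA κ α).flip x := fun x => by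
    refine eq_of_recursion insD_mem (F := fun t => simA κ α (X t)) ?_ ?_ ?_
    · simp [h.one_left, isInsertionAction_simA.one_left]
    · intro t w
      simp only [LinearMap.flip_apply]
      rw [h.mul_left, hX, simB_X_left]
      rfl
    · intro t w
      simp only [LinearMap.flip_apply]
      rw [isInsertionAction_simA.mul_left, simB_X_left]
      rfl
  refine LinearMap.ext fun w => LinearMap.ext fun x => ?_
  exact LinearMap.congr_fun (hall x) w

end GuinOudom

/-! ## Shuffles and unshuffles -/

/-- The unshuffles of a list of branches. -/
def unsh : Forest K N d → FV K N d ⊗[ℝ] FV K N d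
  | nil => Finsupp.single nil 1 ⊗ₜ Finsupp.single nil 1
  | cons e n s r => TensorProduct.map (consB e (tr n s)) LinearMap.id (unsh r) +
      TensorProduct.map LinearMap.id (consB e (tr n s)) (unsh r)

/-- The unshuffle coproduct. -/
def unshL : FV K N d →ₗ[ℝ] FV K N d ⊗[ℝ] FV K N d := Finsupp.linearCombination ℝ unsh

@[simp] theorem unshL_single (F : Forest K N d) : unshL (Finsupp.single F 1) = unsh F := by
  simp [unshL]

theorem coL_eq (F : Forest K N d) : coL F = TensorProduct.map (treeL 0) (treeL 0) (unsh F) := by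
  induction F with
  | nil => simp [coL, unsh]
  | cons e n s r _ hr =>
    have h : gB e ⟨n, s⟩ ∘ₗ treeL 0 = treeL 0 ∘ₗ consB e (tr n s) :=
      FV_ext fun F => by simp [gB_zero]
    rw [coL, unsh, hr, map_add]
    simp only [← LinearMap.comp_apply, ← TensorProduct.map_comp, h, LinearMap.id_comp,
      LinearMap.comp_id]

theorem co_treeL (n : MIdx d) (u : FV K N d) : co (treeL n u) = ∑ m ∈ Finset.Iic n,
    (mchoose n m : ℝ) • TensorProduct.map (treeL m) (treeL (n - m)) (unshL u) := by
  have : co ∘ₗ treeL n = ∑ m ∈ Finset.Iic n,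
      (mchoose n m : ℝ) • TensorProduct.map (treeL m) (treeL (n - m)) ∘ₗ unshL (K := K) (N := N) := by
    refine FV_ext fun F => ?_
    have h : ∀ m : MIdx d, dAdd m ∘ₗ treeL 0 = treeL (K := K) (N := N) m := fun m =>
      FV_ext fun F => by simp
    simp only [LinearMap.comp_apply, treeL_single, co_tr, coL_eq, coD, LinearMap.sum_apply,
      LinearMap.smul_apply, unshL_single]
    simp only [← LinearMap.comp_apply, ← TensorProduct.map_comp, h]
  have h := LinearMap.congr_fun this u
  simpa only [LinearMap.sum_apply, LinearMap.comp_apply, LinearMap.smul_apply] using h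

/-- The shuffle product as a bilinear map. -/
def shL : FV K N d →ₗ[ℝ] FV K N d →ₗ[ℝ] FV K N d :=
  Finsupp.linearCombination ℝ fun F => Finsupp.linearCombination ℝ fun G => shuffle F G

theorem shuffleLin_eq (a b : FV K N d) : shuffleLin a b = shL a b := by
  rw [shL, Finsupp.linearCombination_apply, Finsupp.sum, LinearMap.sum_apply, shuffleLin,
    Finsupp.sum]
  refine Finset.sum_congr rfl fun F _ => ?_
  rw [LinearMap.smul_apply, Finsupp.linearCombination_apply, Finsupp.sum, Finsupp.sum,
    Finset.smul_sum]
  simp only [smul_smul]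

theorem consLin_eq (e : ELabel K N d) (n : MIdx d) (a b : FV K N d) :
    consLin e n a b = consB e (treeL n a) b := by
  rw [consLin, Finsupp.sum]
  conv_rhs => rw [← Finsupp.sum_single a, Finsupp.sum, map_sum, map_sum, LinearMap.sum_apply]
  refine Finset.sum_congr rfl fun s _ => ?_
  conv_rhs => rw [← Finsupp.sum_single b, Finsupp.sum, map_sum]
  simp [Finsupp.sum]

/-- The coefficient of a forest in a formal sum, linear in the forest. -/
def prF (a : FV K N d) : FV K N d →ₗ[ℝ] ℝ := Finsupp.linearCombination ℝ a

@[simp] theorem prF_single (a : FV K N d) (F : Forest K N d) : prF a (Finsupp.single F 1) = a F := by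
  simp [prF]

theorem prF_add (a b : FV K N d) : prF (a + b) = prF a + prF b := FV_ext fun F => by simp

theorem prF_smul (c : ℝ) (a : FV K N d) : prF (c • a) = c • prF a := FV_ext fun F => by simp

/-- The pairing with the product of two formal sums. -/
def prFF (a b : FV K N d) : FV K N d ⊗[ℝ] FV K N d →ₗ[ℝ] ℝ :=
  TensorProduct.lift ((LinearMap.mul ℝ ℝ).compl₁₂ (prF a) (prF b))

theorem prFF_tmul (a b u v : FV K N d) : prFF a b (u ⊗ₜ v) = prF a u * prF b v := by
  simp [prFF]

theorem consB_single_apply (e e' : ELabel K N d) (n n' : MIdx d) (s s' r' : Forest K N d)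
    (b : FV K N d) : consB e (tr n s) b (cons e' n' s' r') =
      if e = e' ∧ n = n' ∧ s = s' then b r' else 0 := by
  induction b using Finsupp.induction_linear with
  | zero => simp
  | add b c hb hc => rw [map_add, Finsupp.add_apply, hb, hc]; split_ifs <;> simp
  | single r c =>
    rw [consB_single, one_mul, Finsupp.single_apply, Finsupp.single_apply, ← ite_and]
    simp only [cons.injEq, and_assoc]

theorem prF_consB_nil (e : ELabel K N d) (n : MIdx d) (s : Forest K N d) :
    prF (Finsupp.single nil 1) ∘ₗ consB e (tr n s) = 0 :=
  FV_ext fun G => by simp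

theorem prF_consB_cons (e e' : ELabel K N d) (n n' : MIdx d) (s s' r' : Forest K N d) :
    prF (Finsupp.single (cons e' n' s' r') 1) ∘ₗ consB e (tr n s) =
      if e = e' ∧ n = n' ∧ s = s' then prF (Finsupp.single r' 1) else 0 := by
  refine FV_ext fun G => ?_
  by_cases h : e = e' ∧ n = n' ∧ s = s'
  · obtain ⟨rfl, rfl, rfl⟩ := h
    simp [Finsupp.single_apply]
  · simp only [LinearMap.comp_apply, consB_single, prF_single, one_mul, if_neg h,
      LinearMap.zero_apply]
    rw [Finsupp.single_eq_of_ne]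
    rintro ⟨⟩
    exact h ⟨rfl, rfl, rfl⟩

theorem prFF_unsh_single (F G s : Forest K N d) :
    prFF (Finsupp.single F 1) (Finsupp.single G 1) (unsh s) = shuffle F G s := by
  have hm : ∀ (f g : FV K N d →ₗ[ℝ] FV K N d) (a b : FV K N d) (z : FV K N d ⊗[ℝ] FV K N d),
      prFF a b (TensorProduct.map f g z) =
        TensorProduct.lift ((LinearMap.mul ℝ ℝ).compl₁₂ (prF a ∘ₗ f) (prF b ∘ₗ g)) z := by
    intro f g a b z
    have : prFF a b ∘ₗ TensorProduct.map f g =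
        TensorProduct.lift ((LinearMap.mul ℝ ℝ).compl₁₂ (prF a ∘ₗ f) (prF b ∘ₗ g)) :=
      TensorProduct.ext' fun u v => by simp [prFF_tmul]
    exact LinearMap.congr_fun this z
  have hz : ∀ f : FV K N d →ₗ[ℝ] ℝ, TensorProduct.lift ((LinearMap.mul ℝ ℝ).compl₁₂ (0 : FV K N d →ₗ[ℝ] ℝ) f) = 0 :=
    fun f => TensorProduct.ext' fun u v => by simp
  have hz' : ∀ f : FV K N d →ₗ[ℝ] ℝ, TensorProduct.lift ((LinearMap.mul ℝ ℝ).compl₁₂ f (0 : FV K N d →ₗ[ℝ] ℝ)) = 0 :=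
    fun f => TensorProduct.ext' fun u v => by simp
  induction s generalizing F G with
  | nil =>
    rw [unsh, prFF_tmul, prF_single, prF_single]
    cases F with
    | nil => cases G <;> simp [shuffle]
    | cons e n s r =>
      cases G with
      | nil => simp [shuffle]
      | cons e' n' s' r' =>
        rw [shuffle, consLin_eq, consLin_eq, treeL_single, treeL_single]
        have : ∀ e (n : MIdx d) s (b : FV K N d), consB e (tr n s) b nil = 0 := by
          intro e n s b
          induction b using Finsupp.induction_linear with
          | zero => simp
          | add b c hb hc => rw [map_add, Finsupp.add_apply, hb, hc, add_zero]
          | single r c => simp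
        simp [this]
  | cons e n q p _ ih =>
    rw [unsh, map_add, hm, hm, LinearMap.comp_id, LinearMap.comp_id]
    have h : ∀ (c : Prop) [Decidable c] (f g : FV K N d →ₗ[ℝ] ℝ), TensorProduct.lift ((LinearMap.mul ℝ ℝ).compl₁₂
        (if c then f else 0) g) (unsh p) =
          if c then TensorProduct.lift ((LinearMap.mul ℝ ℝ).compl₁₂ f g) (unsh p) else 0 :=
      fun c _ f g => by split_ifs <;> simp [hz]
    have h' : ∀ (c : Prop) [Decidable c] (f g : FV K N d →ₗ[ℝ] ℝ), TensorProduct.lift ((LinearMap.mul ℝ ℝ).compl₁₂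
        f (if c then g else 0)) (unsh p) =
          if c then TensorProduct.lift ((LinearMap.mul ℝ ℝ).compl₁₂ f g) (unsh p) else 0 :=
      fun c _ f g => by split_ifs <;> simp [hz']
    have hp : ∀ F G : Forest K N d, TensorProduct.lift ((LinearMap.mul ℝ ℝ).compl₁₂
        (prF (Finsupp.single F 1)) (prF (Finsupp.single G 1))) (unsh p) = shuffle F G p := ih
    cases F with
    | nil =>
      cases G with
      | nil => simp [hz, hz', shuffle, prF_consB_nil]
      | cons e' n' s' r' =>
        simp only [prF_consB_nil, prF_consB_cons, hz, LinearMap.zero_apply, zero_add, h', hp, shuffle, Finsupp.single_apply,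
          cons.injEq]
        rw [← ite_and]
        refine if_congr ?_ rfl rfl
        simp only [and_assoc, eq_comm]
    | cons e' n' s' r' =>
      cases G with
      | nil =>
        simp only [prF_consB_nil, prF_consB_cons, hz', LinearMap.zero_apply, add_zero, h, hp]
        have : shuffle r' nil = Finsupp.single r' 1 := by cases r' <;> simp [shuffle]
        rw [this, shuffle, Finsupp.single_apply, Finsupp.single_apply, ← ite_and]
        refine if_congr ?_ rfl rfl
        simp only [cons.injEq, and_assoc, eq_comm]
      | cons e'' n'' s'' r'' =>
        rw [shuffle, consLin_eq, consLin_eq, treeL_single, treeL_single, Finsupp.add_apply,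
          consB_single_apply, consB_single_apply, prF_consB_cons, prF_consB_cons, h, h', hp, hp]
        congr 1
        · exact if_congr (by simp only [eq_comm]) rfl rfl
        · exact if_congr (by simp only [eq_comm]) rfl rfl

/-- The shuffle product is dual to the unshuffle coproduct. -/
theorem prFF_unsh (a b : FV K N d) (s : Forest K N d) : prFF a b (unsh s) = shL a b s := by
  induction a using Finsupp.induction_linear with
  | zero =>
    have : prFF 0 b = 0 := TensorProduct.ext' fun u v => by simp [prFF_tmul, prF]
    simp [this]
  | add a a' ha ha' =>
    have : prFF (a + a') b = prFF a b + prFF a' b := TensorProduct.ext' fun u v => by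
      simp [prFF_tmul, prF_add, add_mul]
    rw [this, LinearMap.add_apply, ha, ha']; simp
  | single F x =>
    induction b using Finsupp.induction_linear with
    | zero =>
      have : prFF (Finsupp.single F x) 0 = 0 :=
        TensorProduct.ext' fun u v => by simp [prFF_tmul, prF]
      simp [this]
    | add b b' hb hb' =>
      have : prFF (Finsupp.single F x) (b + b') =
          prFF (Finsupp.single F x) b + prFF (Finsupp.single F x) b' :=
        TensorProduct.ext' fun u v => by simp [prFF_tmul, prF_add, mul_add]
      rw [this, LinearMap.add_apply, hb, hb']; simp
    | single G y =>
      have : prFF (Finsupp.single F x) (Finsupp.single G y) =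
          (x * y) • prFF (Finsupp.single F 1) (Finsupp.single G 1) :=
        TensorProduct.ext' fun u v => by
          rw [single_eq_smul F, single_eq_smul G]
          simp only [LinearMap.smul_apply, prFF_tmul, prF_smul, smul_eq_mul]
          ring
      rw [this, LinearMap.smul_apply, prFF_unsh_single]
      simp [shL, smul_smul]

/-! ## Convolutions along the coproduct of the symmetric algebra -/

section Conv

variable {κ : K → ℝ} {α : N → ℝ}

/-- The coproduct of the symmetric algebra as a linear map. -/
abbrev dsh (κ : K → ℝ) (α : N → ℝ) : SymNeg d κ α →ₗ[ℝ] SymNeg d κ α ⊗[ℝ] SymNeg d κ α :=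
  (deshuffle κ α).toLinearMap

variable {A B C P Q R : Type*} [AddCommGroup A] [Module ℝ A] [AddCommGroup B] [Module ℝ B]
  [AddCommGroup C] [Module ℝ C] [AddCommGroup P] [Module ℝ P] [AddCommGroup Q] [Module ℝ Q]
  [AddCommGroup R] [Module ℝ R]

theorem cv_assoc {β : A →ₗ[ℝ] P →ₗ[ℝ] R} {γ : B →ₗ[ℝ] C →ₗ[ℝ] P} {γ' : Q →ₗ[ℝ] C →ₗ[ℝ] R}
    {β' : A →ₗ[ℝ] B →ₗ[ℝ] Q} (h : ∀ a b c, β a (γ b c) = γ' (β' a b) c)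
    (f : SymNeg d κ α →ₗ[ℝ] A) (g : SymNeg d κ α →ₗ[ℝ] B) (k : SymNeg d κ α →ₗ[ℝ] C) :
    cv (dsh κ α) β f (cv (dsh κ α) γ g k) = cv (dsh κ α) γ' (cv (dsh κ α) β' f g) k := by
  refine LinearMap.ext fun w => ?_
  have h1 : TensorProduct.lift β ∘ₗ TensorProduct.map f (cv (dsh κ α) γ g k) =
      TensorProduct.lift β ∘ₗ TensorProduct.map f (TensorProduct.lift γ ∘ₗ TensorProduct.map g k) ∘ₗ
        LinearMap.lTensor (SymNeg d κ α) (dsh κ α) :=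
    TensorProduct.ext' fun a b => by simp [cv]
  have h2 : TensorProduct.lift γ' ∘ₗ TensorProduct.map (cv (dsh κ α) β' f g) k =
      TensorProduct.lift γ' ∘ₗ TensorProduct.map (TensorProduct.lift β' ∘ₗ TensorProduct.map f g) k ∘ₗ
        LinearMap.rTensor (SymNeg d κ α) (dsh κ α) :=
    TensorProduct.ext' fun a b => by simp [cv]
  have h3 : (TensorProduct.lift β ∘ₗ TensorProduct.map f
      (TensorProduct.lift γ ∘ₗ TensorProduct.map g k)) ∘ₗ
        (TensorProduct.assoc ℝ (SymNeg d κ α) (SymNeg d κ α) (SymNeg d κ α)).toLinearMap =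
      TensorProduct.lift γ' ∘ₗ TensorProduct.map (TensorProduct.lift β' ∘ₗ TensorProduct.map f g) k :=
    TensorProduct.ext_threefold fun a b c => by simp [h]
  have h4 := Coalgebra.coassoc_apply (R := ℝ) w
  refine (LinearMap.congr_fun h1 (dsh κ α w)).trans
    (Eq.trans ?_ (LinearMap.congr_fun h2 (dsh κ α w)).symm)
  have h5 : LinearMap.lTensor (SymNeg d κ α) (dsh κ α) (dsh κ α w) =
    TensorProduct.assoc ℝ (SymNeg d κ α) (SymNeg d κ α) (SymNeg d κ α)
      (LinearMap.rTensor (SymNeg d κ α) (dsh κ α) (dsh κ α w)) := h4.symm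
  have h6 := LinearMap.congr_fun h3 (LinearMap.rTensor (SymNeg d κ α) (dsh κ α) (dsh κ α w))
  simp only [LinearMap.comp_apply, LinearEquiv.coe_coe] at h6 ⊢
  rw [h5, h6]

theorem cv_comm (β : A →ₗ[ℝ] B →ₗ[ℝ] R) (f : SymNeg d κ α →ₗ[ℝ] A) (g : SymNeg d κ α →ₗ[ℝ] B) :
    cv (dsh κ α) β f g = cv (dsh κ α) β.flip g f := by
  refine LinearMap.ext fun w => ?_
  have h1 : TensorProduct.lift β ∘ₗ TensorProduct.map f g =
      (TensorProduct.lift β.flip ∘ₗ TensorProduct.map g f) ∘ₗ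
        (TensorProduct.comm ℝ (SymNeg d κ α) (SymNeg d κ α)).toLinearMap :=
    TensorProduct.ext' fun a b => by simp
  refine (LinearMap.congr_fun h1 (dsh κ α w)).trans ?_
  have h2 : TensorProduct.comm ℝ (SymNeg d κ α) (SymNeg d κ α) (dsh κ α w) = dsh κ α w :=
    Coalgebra.comm_comul ℝ w
  simp only [LinearMap.comp_apply, LinearEquiv.coe_coe, cv]
  rw [h2]

end Conv

/-! ## Simultaneous insertion and unshuffles -/

section Host

variable {κ : K → ℝ} {α : N → ℝ}

section
variable {C M M' P : Type*} [AddCommGroup C] [Module ℝ C] [AddCommGroup M] [Module ℝ M]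
  [AddCommGroup M'] [Module ℝ M'] [AddCommGroup P] [Module ℝ P]

/-- The convolution as a bilinear map. -/
def cvB (c : C →ₗ[ℝ] C ⊗[ℝ] C) (β : M →ₗ[ℝ] M' →ₗ[ℝ] P) :
    (C →ₗ[ℝ] M) →ₗ[ℝ] (C →ₗ[ℝ] M') →ₗ[ℝ] (C →ₗ[ℝ] P) where
  toFun f := cvR c β f
  map_add' f f' := LinearMap.ext fun g => cv_add_left β f f' g
  map_smul' r f := LinearMap.ext fun g => (cvL c β g).map_smul r f

theorem cvB_apply (c : C →ₗ[ℝ] C ⊗[ℝ] C) (β : M →ₗ[ℝ] M' →ₗ[ℝ] P) (f : C →ₗ[ℝ] M)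
    (g : C →ₗ[ℝ] M') : cvB c β f g = cv c β f g := rfl

end

/-- Simultaneous insertion in the forests with edge decorations at most `b`. -/
def trF (κ : K → ℝ) (α : N → ℝ) (b : MIdx d) : Forest K N d → (SymNeg d κ α →ₗ[ℝ] FV K N d)
  | nil => epsS.toLinearMap.smulRight (Finsupp.single nil 1)
  | cons e n s r =>
    if e.2 ≤ b then cv (dsh κ α) (consB e) (simE e n (trF κ α b s)) (trF κ α b r) else 0

/-- Simultaneous insertion in the forests with edge decorations at most `b`, and without noise edges
going out of the base vertex. -/
def trN (κ : K → ℝ) (α : N → ℝ) (b : MIdx d) : Forest K N d → (SymNeg d κ α →ₗ[ℝ] FV K N d)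
  | nil => epsS.toLinearMap.smulRight (Finsupp.single nil 1)
  | cons e n s r =>
    if e.2 ≤ b ∧ ¬ e.IsNoise then
      cv (dsh κ α) (consB e) (simR n (trF κ α b s)) (trN κ α b r) else 0

/-- The edge decorations of the forest are at most `b`. -/
def LeF (b : MIdx d) : Forest K N d → Prop
  | nil => True
  | cons e _ s r => e.2 ≤ b ∧ LeF b s ∧ LeF b r

theorem trF_eq {b : MIdx d} {F : Forest K N d} (h : LeF b F) : trF κ α b F = simF κ α F := by
  induction F with
  | nil => rfl
  | cons e n s r hs hr => rw [trF, simF, if_pos h.1, hs h.2.1, hr h.2.2]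

theorem LeF.mono {b b' : MIdx d} (hb : b ≤ b') {F : Forest K N d} (h : LeF b F) : LeF b' F := by
  induction F with
  | nil => trivial
  | cons e n s r hs hr => exact ⟨h.1.trans hb, hs h.2.1, hr h.2.2⟩

theorem exists_leF (F : Forest K N d) : ∃ b, LeF b F := by
  induction F with
  | nil => exact ⟨0, trivial⟩
  | cons e n s r hs hr =>
    obtain ⟨b, hb⟩ := hs
    obtain ⟨b', hb'⟩ := hr
    exact ⟨e.2 ⊔ (b ⊔ b'), le_sup_left, hb.mono (le_sup_left.trans le_sup_right),
      hb'.mono (le_sup_right.trans le_sup_right)⟩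

/-- The projection onto the forests without noise edges going out of the base vertex. -/
def nuF : FV K N d →ₗ[ℝ] FV K N d :=
  Finsupp.linearCombination ℝ fun F => if NoTop F then Finsupp.single F 1 else 0

theorem nuV_treeL (n : MIdx d) (u : FV K N d) : nuV (treeL n u) = treeL n (nuF u) := by
  have : nuV ∘ₗ treeL n = treeL n ∘ₗ nuF (K := K) (N := N) := FV_ext fun F => by
    simp only [LinearMap.comp_apply, treeL_single, nuV_tr, nuF, Finsupp.linearCombination_single,
      one_smul]
    split_ifs <;> simp
  exact LinearMap.congr_fun this u

theorem nuF_consB (e : ELabel K N d) (a : TV K N d) (u : FV K N d) :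
    nuF (consB e a u) = if e.IsNoise then 0 else consB e a (nuF u) := by
  have : (consB e).compr₂ nuF = if e.IsNoise then 0 else (consB e).compl₂ nuF := by
    refine TV_ext fun n s => FV_ext fun F => ?_
    simp only [LinearMap.compr₂_apply, consB_single, nuF, Finsupp.linearCombination_single, one_smul,
      noTop_cons, mul_one]
    by_cases h : e.IsNoise
    · simp [h]
    · simp only [h, not_false_eq_true, true_and, if_false, LinearMap.compl₂_apply,
        Finsupp.linearCombination_single, one_smul]
      split_ifs <;> simp
  have h := LinearMap.congr_fun (LinearMap.congr_fun this a) u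
  rw [LinearMap.compr₂_apply] at h
  rw [h]
  split_ifs <;> rfl

theorem nuF_trF (b : MIdx d) (F : Forest K N d) : nuF ∘ₗ trF κ α b F = trN κ α b F := by
  induction F with
  | nil => refine LinearMap.ext fun w => ?_; simp [trF, trN, nuF]
  | cons e n s r _ hr =>
    rw [trF, trN]
    by_cases hb : e.2 ≤ b
    · by_cases he : e.IsNoise
      · rw [if_pos hb, if_neg (by simp [he]), comp_cv]
        refine LinearMap.ext fun w => ?_
        rw [show (consB e).compr₂ nuF = 0 from LinearMap.ext fun a => LinearMap.ext fun u => by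
          simp [nuF_consB, he]]
        have h0 : TensorProduct.lift (0 : TV K N d →ₗ[ℝ] FV K N d →ₗ[ℝ] FV K N d) = 0 :=
          TensorProduct.ext' fun a c => by simp
        simp [cv, h0]
      · rw [if_pos hb, if_pos ⟨hb, he⟩, comp_cv, ← hr, simE, if_neg he]
        exact cv_congr fun a u => by simp [nuF_consB, he]
    · simp [hb]

/-- `trN`, linear in the forest. -/
def trL (κ : K → ℝ) (α : N → ℝ) (b : MIdx d) :
    FV K N d →ₗ[ℝ] (SymNeg d κ α →ₗ[ℝ] FV K N d) := Finsupp.linearCombination ℝ (trN κ α b)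

@[simp] theorem trL_single (b : MIdx d) (F : Forest K N d) :
    trL κ α b (Finsupp.single F 1) = trN κ α b F := by
  simp [trL]

section
variable {P Q : Type*} [AddCommGroup P] [Module ℝ P] [AddCommGroup Q] [Module ℝ Q]

/-- Simultaneous insertion in two forests, followed by a bilinear map. -/
def trB (κ : K → ℝ) (α : N → ℝ) (b : MIdx d) (β : FV K N d →ₗ[ℝ] FV K N d →ₗ[ℝ] P) :
    FV K N d ⊗[ℝ] FV K N d →ₗ[ℝ] (SymNeg d κ α →ₗ[ℝ] P) :=
  TensorProduct.lift ((cvB (dsh κ α) β).compl₁₂ (trL κ α b) (trL κ α b))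

theorem trB_tmul (b : MIdx d) (β : FV K N d →ₗ[ℝ] FV K N d →ₗ[ℝ] P) (u v : FV K N d) :
    trB κ α b β (u ⊗ₜ v) = cv (dsh κ α) β (trL κ α b u) (trL κ α b v) := by
  simp [trB, cvB_apply]

theorem comp_trB (b : MIdx d) (β : FV K N d →ₗ[ℝ] FV K N d →ₗ[ℝ] P) (y : P →ₗ[ℝ] Q)
    (z : FV K N d ⊗[ℝ] FV K N d) : y ∘ₗ trB κ α b β z = trB κ α b (β.compr₂ y) z := by
  induction z using TensorProduct.induction_on with
  | zero => simp
  | add z z' hz hz' => rw [map_add, map_add, LinearMap.comp_add, hz, hz']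
  | tmul u v => rw [trB_tmul, trB_tmul, comp_cv]

end

theorem trL_consB (b : MIdx d) (e : ELabel K N d) (n : MIdx d) (s : Forest K N d) (u : FV K N d) :
    trL κ α b (consB e (tr n s) u) = if e.2 ≤ b ∧ ¬ e.IsNoise then
      cv (dsh κ α) (consB e) (simR n (trF κ α b s)) (trL κ α b u) else 0 := by
  have : trL κ α b ∘ₗ consB e (tr n s) = if e.2 ≤ b ∧ ¬ e.IsNoise then
      cvR (dsh κ α) (consB e) (simR n (trF κ α b s)) ∘ₗ trL κ α b else 0 := FV_ext fun F => by
    rw [LinearMap.comp_apply, consB_single, mul_one, trL_single, trN]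
    split_ifs
    · rw [LinearMap.comp_apply, trL_single]; rfl
    · rfl
  have h := LinearMap.congr_fun this u
  rw [LinearMap.comp_apply] at h
  rw [h]
  split_ifs <;> rfl

theorem unshL_consB (e : ELabel K N d) (a : TV K N d) (u : FV K N d) :
    unshL (consB e a u) = LinearMap.rTensor _ (consB e a) (unshL u) +
      LinearMap.lTensor _ (consB e a) (unshL u) := by
  have : (consB e).compr₂ unshL = ((LinearMap.rTensorHom (FV K N d)) ∘ₗ consB e).compl₂ unshL +
      ((LinearMap.lTensorHom (FV K N d)) ∘ₗ consB e).compl₂ unshL :=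
    TV_ext fun n s => FV_ext fun F => by
      simp [unsh]
      rfl
  exact LinearMap.congr_fun (LinearMap.congr_fun this a) u

/-- Simultaneous insertion is compatible with unshuffles. -/
theorem unshL_trN (b : MIdx d) (F : Forest K N d) :
    unshL ∘ₗ trN κ α b F =
      trB (P := FV K N d ⊗[ℝ] FV K N d) κ α b (TensorProduct.mk ℝ _ _) (unsh F) := by
  induction F with
  | nil =>
    rw [unsh, trB_tmul, trL_single, trN, cv_epsS_left]
    refine LinearMap.ext fun w => ?_
    rw [LinearMap.comp_apply, LinearMap.smulRight_apply, map_smul, unshL_single, unsh,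
      ← TensorProduct.tmul_smul]
    simp
  | cons e n s r _ hr =>
    rw [unsh, map_add]
    have h1 : ∀ z, trB (P := FV K N d ⊗[ℝ] FV K N d) κ α b (TensorProduct.mk ℝ (FV K N d) (FV K N d))
        (TensorProduct.map (consB e (tr n s)) LinearMap.id z) = if e.2 ≤ b ∧ ¬ e.IsNoise then
          cv (M := TV K N d) (M' := FV K N d ⊗[ℝ] FV K N d) (P := FV K N d ⊗[ℝ] FV K N d)
            (dsh κ α) (LinearMap.rTensorHom (FV K N d) ∘ₗ consB e) (simR n (trF κ α b s))
            (trB (P := FV K N d ⊗[ℝ] FV K N d) κ α b (TensorProduct.mk ℝ _ _) z) else 0 := by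
      intro z
      induction z using TensorProduct.induction_on with
      | zero =>
        simp only [map_zero]
        rw [← cvB_apply, map_zero, ite_self]
      | add z z' hz hz' =>
        simp only [map_add, hz, hz', cv_add_right]
        split_ifs <;> simp
      | tmul u v =>
        rw [TensorProduct.map_tmul, trB_tmul, trB_tmul, trL_consB, LinearMap.id_apply]
        split_ifs
        · exact (cv_assoc (fun a c c' => by simp) _ _ _).symm
        · rw [← cvB_apply, map_zero]; rfl
    have h2 : ∀ z, trB (P := FV K N d ⊗[ℝ] FV K N d) κ α b (TensorProduct.mk ℝ (FV K N d) (FV K N d))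
        (TensorProduct.map LinearMap.id (consB e (tr n s)) z) = if e.2 ≤ b ∧ ¬ e.IsNoise then
          cv (M := TV K N d) (M' := FV K N d ⊗[ℝ] FV K N d) (P := FV K N d ⊗[ℝ] FV K N d)
            (dsh κ α) (LinearMap.lTensorHom (FV K N d) ∘ₗ consB e) (simR n (trF κ α b s))
            (trB (P := FV K N d ⊗[ℝ] FV K N d) κ α b (TensorProduct.mk ℝ _ _) z) else 0 := by
      intro z
      induction z using TensorProduct.induction_on with
      | zero =>
        simp only [map_zero]
        rw [← cvB_apply, map_zero, ite_self]
      | add z z' hz hz' =>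
        simp only [map_add, hz, hz', cv_add_right]
        split_ifs <;> simp
      | tmul u v =>
        rw [TensorProduct.map_tmul, trB_tmul, trB_tmul, trL_consB, LinearMap.id_apply]
        split_ifs
        · rw [cv_comm, cv_comm (R := FV K N d ⊗[ℝ] FV K N d) (TensorProduct.mk ℝ _ _) (trL κ α b u)]
          exact (cv_assoc (fun a c c' => by simp) _ _ _).symm
        · rw [← cvB_apply, map_zero]
    rw [h1, h2, trN]
    split_ifs
    · rw [← hr]
      have h3 : (unshL ∘ₗ TensorProduct.lift (consB e)) ∘ₗ
          TensorProduct.map (simR n (trF κ α b s)) (trN κ α b r) =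
          TensorProduct.lift (LinearMap.rTensorHom (FV K N d) ∘ₗ consB e) ∘ₗ
            TensorProduct.map (simR n (trF κ α b s)) (unshL ∘ₗ trN κ α b r) +
          TensorProduct.lift (LinearMap.lTensorHom (FV K N d) ∘ₗ consB e) ∘ₗ
            TensorProduct.map (simR n (trF κ α b s)) (unshL ∘ₗ trN κ α b r) :=
        TensorProduct.ext' fun x y => by
          simp only [LinearMap.comp_apply, LinearMap.add_apply, TensorProduct.map_tmul,
            TensorProduct.lift.tmul, unshL_consB]
          rfl
      exact LinearMap.ext fun w => LinearMap.congr_fun h3 (dsh κ α w)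
    · exact (LinearMap.comp_zero _).trans (add_zero _).symm

theorem lift_unshL_trN {P : Type*} [AddCommGroup P] [Module ℝ P] (b : MIdx d)
    (β : FV K N d →ₗ[ℝ] FV K N d →ₗ[ℝ] P) (F : Forest K N d) :
    TensorProduct.lift β ∘ₗ unshL ∘ₗ trN κ α b F = trB κ α b β (unsh F) := by
  rw [unshL_trN]
  refine (comp_trB (P := FV K N d ⊗[ℝ] FV K N d) b (TensorProduct.mk ℝ _ _)
    (TensorProduct.lift β) (unsh F)).trans ?_
  congr 1

/-! ## Functionals on the symmetric algebra -/

/-- The convolution algebra of the functionals on the symmetric algebra. -/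
abbrev Fun (κ : K → ℝ) (α : N → ℝ) (d : ℕ) := WithConv (SymNeg d κ α →ₗ[ℝ] ℝ)

/-- A functional as an element of the convolution algebra. -/
def toC : (SymNeg d κ α →ₗ[ℝ] ℝ) →ₗ[ℝ] Fun κ α d := (WithConv.linearEquiv ℝ _).symm.toLinearMap

theorem toC_injective : Function.Injective (toC : (SymNeg d κ α →ₗ[ℝ] ℝ) →ₗ[ℝ] Fun κ α d) :=
  (WithConv.linearEquiv ℝ (SymNeg d κ α →ₗ[ℝ] ℝ)).symm.injective

theorem toC_mul (f g : SymNeg d κ α →ₗ[ℝ] ℝ) :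
    toC f * toC g = toC (cv (dsh κ α) (LinearMap.mul ℝ ℝ) f g) := mul_conv f g

theorem toC_eps : toC (epsS.toLinearMap : SymNeg d κ α →ₗ[ℝ] ℝ) = 1 := rfl

/-- Expansion of a functional on unshuffled forests. -/
theorem apply_unsh {ι R : Type*} [AddCommGroup R] [Module ℝ R] (I : Finset ι)
    {h : FV K N d ⊗[ℝ] FV K N d →ₗ[ℝ] R} {a a' : ι → FV K N d} {x : ι → R}
    (H : ∀ s s', h (Finsupp.single s 1 ⊗ₜ Finsupp.single s' 1) =
      ∑ i ∈ I, (a i s * a' i s') • x i) (s : Forest K N d) :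
    h (unsh s) = ∑ i ∈ I, shL (a i) (a' i) s • x i := by
  have : h = ∑ i ∈ I, (prFF (a i) (a' i)).smulRight (x i) := by
    refine TensorProduct.ext (FV_ext fun F => FV_ext fun G => ?_)
    simp [H, LinearMap.sum_apply, prFF_tmul]
  rw [this, LinearMap.sum_apply]
  simp only [LinearMap.smulRight_apply, prFF_unsh]

/-- Coefficients of a convolution of operators on words, on the result of a simultaneous
insertion. -/
theorem toC_lift_co (b n : MIdx d) (β : TV K N d →ₗ[ℝ] TV K N d →ₗ[ℝ] ℝ) (s : Forest K N d) :
    toC (TensorProduct.lift β ∘ₗ co ∘ₗ treeL n ∘ₗ trN κ α b s) = ∑ m ∈ Finset.Iic n,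
      (mchoose n m : ℝ) • toC (trB κ α b (β.compl₁₂ (treeL m) (treeL (n - m))) (unsh s)) := by
  rw [← Finset.sum_congr rfl fun m _ => map_smul toC _ _, ← map_sum]
  congr 1
  have h1 : ∀ m : MIdx d, trB κ α b (β.compl₁₂ (treeL m) (treeL (n - m))) (unsh s) =
      TensorProduct.lift β ∘ₗ TensorProduct.map (treeL m) (treeL (n - m)) ∘ₗ
        unshL ∘ₗ trN κ α b s := fun m => by
    have : TensorProduct.lift (β.compl₁₂ (treeL m) (treeL (n - m))) =
        TensorProduct.lift β ∘ₗ TensorProduct.map (treeL (K := K) (N := N) m) (treeL (n - m)) :=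
      TensorProduct.ext' fun u v => by simp
    rw [← lift_unshL_trN, this, LinearMap.comp_assoc]
  refine LinearMap.ext fun w => ?_
  simp only [h1, LinearMap.comp_apply, co_treeL, map_sum, map_smul, LinearMap.sum_apply,
    LinearMap.smul_apply]

end Host

/-! ## Colourings of the edges of a forest -/

/-- Local data at an edge: whether it is contracted, the amount by which the decoration of its upper
end is lowered, and the amount by which its decoration is raised. -/
abbrev EDat (d : ℕ) := Bool × MIdx d × MIdx d

namespace Forest

/-- Data on the edges above a common base vertex with a leftmost branch. -/
def datCons {e : ELabel K N d} {n : MIdx d} {s r : Forest K N d} (h : EDat d)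
    (c₁ : s.Vert → EDat d) (c₂ : r.Vert → EDat d) : (cons e n s r).Vert → EDat d
  | Vert.head => h
  | Vert.up x => c₁ x
  | Vert.right x => c₂ x

/-- Some edge going out of the base vertex is contracted. -/
def HasInn : (F : Forest K N d) → (F.Vert → EDat d) → Prop
  | nil, _ => False
  | cons _ _ _ r, c => (c Vert.head).1 = true ∨ HasInn r fun x => c (Vert.right x)

/-- All edges going out of the base vertex are contracted. -/
def NoOut : (F : Forest K N d) → (F.Vert → EDat d) → Prop
  | nil, _ => True
  | cons _ _ _ r, c => (c Vert.head).1 = true ∧ NoOut r fun x => c (Vert.right x)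

/-- The sum of the lowerings at the vertices contracted into the base vertex. -/
def tot : (F : Forest K N d) → (F.Vert → EDat d) → MIdx d
  | nil, _ => 0
  | cons _ _ s r, c =>
    (if (c Vert.head).1 then (c Vert.head).2.1 + tot s (fun x => c (Vert.up x)) else 0) +
      tot r fun x => c (Vert.right x)

/-- The sum of the raisings of the edges going out of the base vertex. -/
def lsum : (F : Forest K N d) → (F.Vert → EDat d) → MIdx d
  | nil, _ => 0
  | cons _ _ _ r, c => (c Vert.head).2.2 + lsum r fun x => c (Vert.right x)

/-- The product of the factorials of the raisings of the edges going out of the base vertex. -/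
def lfac : (F : Forest K N d) → (F.Vert → EDat d) → ℝ
  | nil, _ => 1
  | cons _ _ _ r, c => mfact (c Vert.head).2.2 * lfac r fun x => c (Vert.right x)

/-- Decorations of the vertices in the extracted subtrees. -/
def ndec : (F : Forest K N d) → (F.Vert → EDat d) → F.Vert → MIdx d
  | cons _ n s _, c, Vert.head => n - (c Vert.head).2.1 + lsum s fun x => c (Vert.up x)
  | cons _ _ s _, c, Vert.up x => ndec s (fun x => c (Vert.up x)) x
  | cons _ _ _ r, c, Vert.right x => ndec r (fun x => c (Vert.right x)) x

/-- Decorations of the vertices that are not contracted into a vertex below them. -/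
def cdec : (F : Forest K N d) → (F.Vert → EDat d) → F.Vert → MIdx d
  | cons _ n s _, c, Vert.head => if HasInn s fun x => c (Vert.up x) then
      (c Vert.head).2.1 + tot s (fun x => c (Vert.up x)) else n
  | cons _ _ s _, c, Vert.up x => cdec s (fun x => c (Vert.up x)) x
  | cons _ _ _ r, c, Vert.right x => cdec r (fun x => c (Vert.right x)) x

/-- The part of the forest that is contracted into the base vertex. -/
def part (F : Forest K N d) (c : F.Vert → EDat d) : Forest K N d :=
  F.restrict (fun x => (c x).1 = true) (ndec F c)

/-- The branches of the contraction that go out of the base vertex, and those that go out of the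
other vertices contracted into it. -/
def contr (F : Forest K N d) (c : F.Vert → EDat d) : FV K N d × FV K N d :=
  contractAux F (fun x => (c x).1 = true) (fun x => (label x).raise (c x).2.2) (cdec F c)

/-- The branches of the contraction that go out of the base vertex itself. -/
def own (F : Forest K N d) (c : F.Vert → EDat d) : FV K N d := (contr F c).1

/-- The branches of the contraction that go out of the other vertices contracted into the base
vertex. -/
def oth (F : Forest K N d) (c : F.Vert → EDat d) : FV K N d := (contr F c).2

/-- All the branches of the contraction that go out of the base vertex. -/
def brs (F : Forest K N d) (c : F.Vert → EDat d) : FV K N d := shL (own F c) (oth F c)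

/-- The factor of a vertex with decoration `n` in the coefficient of a redistribution. -/
def vwt (n δ L : MIdx d) (w : ℝ) : ℝ := mfact (n - δ + L) / (mfact (n - δ) * w) / mfact δ

section
variable {R : Type*} [CommRing R] [Algebra ℝ R] (g : PTree K N d → R)

/-- The contribution of a vertex that is not contracted into a vertex below it, and of the vertices
above it. -/
def vtx (n δ : MIdx d) (s : Forest K N d) (c : s.Vert → EDat d) (A₁ A₀ : R) : R :=
  if HasInn s c then
    (mfact (δ + tot s c) * vwt n δ (lsum s c) (lfac s c)) • (g ⟨n - δ + lsum s c, part s c⟩ * A₁)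
  else if δ = 0 then A₀ else 0

/-- The coefficient, including the monomial in the extracted subtrees, of the data `c`; `p` says
whether the base vertex belongs to an extracted subtree. -/
def mon : (F : Forest K N d) → (F.Vert → EDat d) → Bool → R
  | nil, _, _ => 1
  | cons e n s r, c, p =>
    let c₁ := fun x => c (Vert.up x)
    let c₂ := fun x => c (Vert.right x)
    let h := c Vert.head
    (if h.1 then
      if p = true ∧ h.2.2 = 0 ∧ NoOut r c₂ ∧ (e.IsNoise → h.2.1 = 0) then
        vwt n h.2.1 (lsum s c₁) (lfac s c₁) • mon s c₁ true
      else 0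
    else
      if p = true ∧ ¬ e.IsNoise ∨ p = false ∧ h.2.2 = 0 then
        vtx g n h.2.1 s c₁ (mon s c₁ true) (mon s c₁ false)
      else 0) * mon r c₂ p

end

/-- The data whose raisings are bounded by `b`. -/
def dat (b : MIdx d) (F : Forest K N d) : Finset (F.Vert → EDat d) :=
  Fintype.piFinset fun x => Finset.univ ×ˢ Finset.Iic (vdec x) ×ˢ
    (Finset.Iic b).filter fun l => (label x).2 + l ≤ b

section lemmas
variable {e : ELabel K N d} {n : MIdx d} {s r : Forest K N d} (h : EDat d)
    (c₁ : s.Vert → EDat d) (c₂ : r.Vert → EDat d) (δ l : MIdx d)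

theorem hasInn_cons : HasInn (cons e n s r) (datCons h c₁ c₂) ↔ h.1 = true ∨ HasInn r c₂ := Iff.rfl

theorem noOut_cons : NoOut (cons e n s r) (datCons h c₁ c₂) ↔ h.1 = true ∧ NoOut r c₂ := Iff.rfl

theorem tot_true : tot (cons e n s r) (datCons (true, δ, l) c₁ c₂) = δ + tot s c₁ + tot r c₂ := rfl

theorem tot_false : tot (cons e n s r) (datCons (false, δ, l) c₁ c₂) = tot r c₂ := zero_add _

theorem lsum_cons : lsum (cons e n s r) (datCons h c₁ c₂) = h.2.2 + lsum r c₂ := rfl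

theorem lfac_cons : lfac (cons e n s r) (datCons h c₁ c₂) = mfact h.2.2 * lfac r c₂ := rfl

theorem part_true : part (cons e n s r) (datCons (true, δ, l) c₁ c₂) =
    cons e (n - δ + lsum s c₁) (part s c₁) (part r c₂) := by
  rw [part, restrict, if_pos (by rfl)]
  rfl

theorem part_false : part (cons e n s r) (datCons (false, δ, l) c₁ c₂) = part r c₂ := by
  rw [part, restrict, if_neg (by simp [datCons])]
  rfl

theorem contr_true : contr (cons e n s r) (datCons (true, δ, l) c₁ c₂) =
    (own r c₂, shL (brs s c₁) (oth r c₂)) := by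
  rw [brs, ← shuffleLin_eq, ← shuffleLin_eq, contr, contractAux, if_pos (by rfl)]
  rfl

theorem contr_false : contr (cons e n s r) (datCons (false, δ, l) c₁ c₂) =
    (consB (e.raise l) (treeL (if HasInn s c₁ then δ + tot s c₁ else n) (brs s c₁)) (own r c₂),
      oth r c₂) := by
  rw [brs, ← shuffleLin_eq, ← consLin_eq, contr, contractAux, if_neg (by simp [datCons])]
  rfl

theorem own_true : own (cons e n s r) (datCons (true, δ, l) c₁ c₂) = own r c₂ := by
  rw [own, contr_true]

theorem own_false : own (cons e n s r) (datCons (false, δ, l) c₁ c₂) =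
    consB (e.raise l) (treeL (if HasInn s c₁ then δ + tot s c₁ else n) (brs s c₁)) (own r c₂) := by
  rw [own, contr_false]

theorem oth_true : oth (cons e n s r) (datCons (true, δ, l) c₁ c₂) =
    shL (brs s c₁) (oth r c₂) := by
  rw [oth, contr_true]

theorem oth_false : oth (cons e n s r) (datCons (false, δ, l) c₁ c₂) = oth r c₂ := by
  rw [oth, contr_false]

variable {R : Type*} [CommRing R] [Algebra ℝ R] (g : PTree K N d → R)

theorem mon_true_true : mon g (cons e n s r) (datCons (true, δ, l) c₁ c₂) true =
    if l = 0 ∧ NoOut r c₂ ∧ (e.IsNoise → δ = 0) then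
      vwt n δ (lsum s c₁) (lfac s c₁) • (mon g s c₁ true * mon g r c₂ true) else 0 := by
  rw [← smul_mul_assoc, ← ite_zero_mul]
  simp [mon, datCons]

theorem mon_true_false : mon g (cons e n s r) (datCons (true, δ, l) c₁ c₂) false = 0 := by
  simp [mon, datCons]

theorem mon_false_true : mon g (cons e n s r) (datCons (false, δ, l) c₁ c₂) true =
    if ¬ e.IsNoise then vtx g n δ s c₁ (mon g s c₁ true) (mon g s c₁ false) * mon g r c₂ true
    else 0 := by
  rw [← ite_zero_mul]
  simp [mon, datCons]

theorem mon_false_false : mon g (cons e n s r) (datCons (false, δ, l) c₁ c₂) false =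
    if l = 0 then vtx g n δ s c₁ (mon g s c₁ true) (mon g s c₁ false) * mon g r c₂ false
    else 0 := by
  rw [← ite_zero_mul]
  simp [mon, datCons]

theorem own_apply_cons (e' : ELabel K N d) (n' : MIdx d) (s' r' : Forest K N d) :
    own (cons e n s r) (datCons (false, δ, l) c₁ c₂) (cons e' n' s' r') =
      if e.raise l = e' ∧ (if HasInn s c₁ then δ + tot s c₁ else n) = n' then
        brs s c₁ s' * own r c₂ r' else 0 := by
  rw [own_false]
  generalize brs s c₁ = u
  generalize (if HasInn s c₁ then δ + tot s c₁ else n) = m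
  induction u using Finsupp.induction_linear with
  | zero => simp
  | add u v hu hv =>
    rw [map_add, map_add, LinearMap.add_apply, Finsupp.add_apply, hu, hv, Finsupp.add_apply, add_mul]
    split_ifs <;> simp
  | single F x =>
    rw [single_eq_smul, map_smul, map_smul, LinearMap.smul_apply, Finsupp.smul_apply, treeL_single,
      consB_single_apply]
    by_cases hF : F = s'
    · subst hF; simp
    · simp [hF]

end lemmas

variable {F : Forest K N d} {c : F.Vert → EDat d}

theorem exists_datCons {e : ELabel K N d} {n : MIdx d} {s r : Forest K N d}
    (c : (cons e n s r).Vert → EDat d) : ∃ i δ l c₁ c₂, c = datCons (i, δ, l) c₁ c₂ :=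
  ⟨(c Vert.head).1, (c Vert.head).2.1, (c Vert.head).2.2, fun x => c (Vert.up x),
    fun x => c (Vert.right x), funext fun x => by cases x <;> rfl⟩

theorem sum_dat_nil {A : Type*} [AddCommMonoid A] (b : MIdx d)
    (f : ((nil : Forest K N d).Vert → EDat d) → A) : ∑ c ∈ dat b nil, f c = f nofun := by
  have : dat b (nil : Forest K N d) = {nofun} := by
    ext c
    simp only [dat, Fintype.mem_piFinset, Finset.mem_singleton]
    exact ⟨fun _ => funext nofun, fun _ => nofun⟩
  rw [this, Finset.sum_singleton]

theorem sum_dat_cons {A : Type*} [AddCommMonoid A] (b : MIdx d) (e : ELabel K N d) (n : MIdx d)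
    (s r : Forest K N d) (f : ((cons e n s r).Vert → EDat d) → A) :
    ∑ c ∈ dat b (cons e n s r), f c = ∑ δ ∈ Finset.Iic n,
      ∑ l ∈ (Finset.Iic b).filter (fun l => e.2 + l ≤ b), ∑ c₁ ∈ dat b s, ∑ c₂ ∈ dat b r,
        (f (datCons (true, δ, l) c₁ c₂) + f (datCons (false, δ, l) c₁ c₂)) := by
  have h1 : ∑ c ∈ dat b (cons e n s r), f c = ∑ q ∈ (Finset.univ ×ˢ Finset.Iic n ×ˢ
      (Finset.Iic b).filter fun l => e.2 + l ≤ b) ×ˢ dat b s ×ˢ dat b r,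
        f (datCons q.1 q.2.1 q.2.2) := by
    refine Finset.sum_bij' (fun c _ => (c Vert.head, (fun x => c (Vert.up x)),
      (fun x => c (Vert.right x)))) (fun q _ => datCons q.1 q.2.1 q.2.2) ?_ ?_ ?_ ?_ ?_
    · intro c hc
      rw [dat, Fintype.mem_piFinset] at hc
      exact Finset.mem_product.2 ⟨hc Vert.head, Finset.mem_product.2
        ⟨Fintype.mem_piFinset.2 fun x => hc (Vert.up x),
          Fintype.mem_piFinset.2 fun x => hc (Vert.right x)⟩⟩
    · intro q hq
      obtain ⟨h1, h2⟩ := Finset.mem_product.1 hq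
      obtain ⟨h2, h3⟩ := Finset.mem_product.1 h2
      refine Fintype.mem_piFinset.2 fun x => ?_
      cases x with
      | head => exact h1
      | up x => exact Fintype.mem_piFinset.1 h2 x
      | right x => exact Fintype.mem_piFinset.1 h3 x
    · exact fun c _ => funext fun x => by cases x <;> rfl
    · exact fun q _ => rfl
    · exact fun c _ => congrArg f (funext fun x => by cases x <;> rfl)
  rw [h1, Finset.sum_product, Finset.sum_product, Fintype.sum_bool, ← Finset.sum_add_distrib]
  simp only [Finset.sum_product, ← Finset.sum_add_distrib]

theorem own_eq_of_noOut (h : NoOut F c) : own F c = Finsupp.single nil 1 := by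
  induction F with
  | nil => rfl
  | cons e n s r _ hr =>
    obtain ⟨i, δ, l, c₁, c₂, rfl⟩ := exists_datCons c
    obtain ⟨rfl, h2⟩ := (noOut_cons _ _ _).1 h
    rw [own_true, hr h2]

theorem own_nil (F : Forest K N d) (c : F.Vert → EDat d) :
    own F c nil = if NoOut F c then 1 else 0 := by
  split_ifs with h
  · rw [own_eq_of_noOut h, Finsupp.single_eq_same]
  · induction F with
    | nil => exact absurd trivial h
    | cons e n s r _ hr =>
      obtain ⟨i, δ, l, c₁, c₂, rfl⟩ := exists_datCons c
      cases i with
      | true =>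
        rw [own_true]
        exact hr _ fun h2 => h ((noOut_cons _ _ _).2 ⟨rfl, h2⟩)
      | false =>
        rw [own_false]
        generalize own r c₂ = u
        generalize treeL _ _ = a
        have : (consB (e.raise l)).compr₂ (Finsupp.lapply nil) =
          (0 : TV K N d →ₗ[ℝ] FV K N d →ₗ[ℝ] ℝ) := TV_ext fun n s => FV_ext fun F => by simp
        exact LinearMap.congr_fun (LinearMap.congr_fun this a) u

theorem lsum_of_noOut {R : Type*} [CommRing R] [Algebra ℝ R] {g : PTree K N d → R} (h : NoOut F c)
    (hm : mon g F c true ≠ 0) : lsum F c = 0 ∧ lfac F c = 1 := by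
  induction F with
  | nil => exact ⟨rfl, rfl⟩
  | cons e n s r _ hr =>
    obtain ⟨i, δ, l, c₁, c₂, rfl⟩ := exists_datCons c
    obtain ⟨rfl, h2⟩ := (noOut_cons _ _ _).1 h
    rw [mon_true_true] at hm
    obtain ⟨h3, h4⟩ := ite_ne_right_iff.1 hm
    obtain ⟨h5, h6⟩ := hr h2 (right_ne_zero_of_mul (right_ne_zero_of_smul h4))
    rw [lsum_cons, lfac_cons, h5, h6, h3.1]
    simp

theorem not_hasInn (h : ¬ HasInn F c) : part F c = nil ∧ tot F c = 0 ∧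
    oth F c = Finsupp.single nil 1 := by
  induction F with
  | nil => exact ⟨rfl, rfl, rfl⟩
  | cons e n s r _ hr =>
    obtain ⟨i, δ, l, c₁, c₂, rfl⟩ := exists_datCons c
    rw [hasInn_cons, not_or] at h
    obtain ⟨h1, h2⟩ := h
    obtain rfl : i = false := by simpa using h1
    rw [part_false, tot_false, oth_false]
    exact hr h2

theorem shL_nil (u : FV K N d) : shL u (Finsupp.single nil 1) = u := by
  have : (shL.flip (Finsupp.single nil 1) : FV K N d →ₗ[ℝ] FV K N d) = LinearMap.id :=
    FV_ext fun F => by cases F <;> simp [shL, shuffle]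
  exact LinearMap.congr_fun this u

theorem brs_of_not_hasInn (h : ¬ HasInn F c) : brs F c = own F c := by
  rw [brs, (not_hasInn h).2.2, shL_nil]

theorem mon_false_of_hasInn {R : Type*} [CommRing R] [Algebra ℝ R] (g : PTree K N d → R)
    (h : HasInn F c) : mon g F c false = 0 := by
  induction F with
  | nil => exact h.elim
  | cons e n s r _ hr =>
    obtain ⟨i, δ, l, c₁, c₂, rfl⟩ := exists_datCons c
    cases i with
    | true => exact mon_true_false _ _ _ _ _
    | false =>
      rw [mon_false_false, hr (((hasInn_cons _ _ _).1 h).resolve_left (by simp)), mul_zero, ite_self]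

end Forest

/-! ## Coefficients of simultaneous insertions -/

section Dual

variable {κ : K → ℝ} {α : N → ℝ}

theorem treeL_apply (m k : MIdx d) (F : Forest K N d) (u : FV K N d) :
    treeL m u ⟨k, F⟩ = if k = m then u F else 0 := by
  have : (Finsupp.lapply ⟨k, F⟩ ∘ₗ treeL m : FV K N d →ₗ[ℝ] ℝ) =
      if k = m then Finsupp.lapply F else 0 := FV_ext fun G => by
    by_cases h : k = m
    · subst h; simp [Finsupp.single_apply]
    · simp [h]
  have h := LinearMap.congr_fun this u
  rw [LinearMap.comp_apply, Finsupp.lapply_apply] at h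
  rw [h]
  split_ifs <;> rfl

theorem dAdd_apply (m k : MIdx d) (F : Forest K N d) (u : TV K N d) :
    dAdd m u ⟨k, F⟩ = if m ≤ k then u ⟨k - m, F⟩ else 0 := by
  have : (Finsupp.lapply ⟨k, F⟩ ∘ₗ dAdd m : TV K N d →ₗ[ℝ] ℝ) =
      if m ≤ k then Finsupp.lapply ⟨k - m, F⟩ else 0 := TV_ext fun n G => by
    rw [LinearMap.comp_apply, dAdd_tr]
    by_cases h : m ≤ k
    · have : m + n = k ↔ n = k - m := by
        constructor
        · rintro rfl; simp
        · rintro rfl; exact add_tsub_cancel_of_le h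
      simp [h, Finsupp.single_apply, this]
    · have : m + n ≠ k := fun h' => h (h' ▸ le_self_add)
      simp [h, this]
  have h := LinearMap.congr_fun this u
  rw [LinearMap.comp_apply, Finsupp.lapply_apply] at h
  rw [h]
  split_ifs <;> rfl

/-- Coefficients of `gBL`. -/
theorem gBL_apply (e₁ e : ELabel K N d) (k a : MIdx d) (f r : Forest K N d) (l : MIdx d)
    (h : e₁ = e.raise l) (T v : TV K N d) :
    gBL e₁ T v ⟨k, cons e a f r⟩ = mchoose (k + l) l * (T ⟨a, f⟩ * v ⟨k + l, r⟩) := by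
  subst h
  have : (gBL (e.raise l)).compr₂ (Finsupp.lapply ⟨k, cons e a f r⟩) =
      (mchoose (k + l) l : ℝ) • (LinearMap.mul ℝ ℝ).compl₁₂ (Finsupp.lapply ⟨a, f⟩)
        (Finsupp.lapply (⟨k + l, r⟩ : PTree K N d)) := by
    refine TV_ext fun a' f' => TV_ext fun n' r' => ?_
    simp only [LinearMap.compr₂_apply, gBL_single, gB_single, map_sum, map_smul,
      Finsupp.lapply_apply, LinearMap.smul_apply, LinearMap.compl₁₂_apply, LinearMap.mul_apply',
      Finsupp.single_apply, PTree.mk.injEq, cons.injEq]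
    rw [Finset.sum_eq_single l]
    · by_cases h : l ≤ n'
      · have h2 : n' - l = k ↔ n' = k + l :=
          ⟨fun h' => by rw [← h', tsub_add_cancel_of_le h], fun h' => by rw [h']; simp⟩
        have h3 : (e.raise l).lower l = e := by simp [ELabel.lower, ELabel.raise]
        simp only [h2, h3, true_and]
        by_cases h4 : n' = k + l
        · subst h4
          by_cases h5 : a' = a <;> by_cases h6 : f' = f <;> by_cases h7 : r' = r <;>
            simp [h5, h6, h7]
        · simp [h4]
      · rw [mchoose_eq_zero h]
        have : n' ≠ k + l := by
          rintro rfl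
          exact h le_add_self
        simp [this]
    · intro l' hl' hne
      rw [if_neg, smul_zero]
      rintro ⟨-, h1, -⟩
      refine hne ?_
      have h2 : e.2 + l - l' = e.2 := congrArg Prod.snd h1
      have h3 : l' ≤ e.2 + l := Finset.mem_Iic.1 hl'
      funext i
      have h4 := congrFun h2 i
      have h5 := h3 i
      simp only [Pi.sub_apply, Pi.add_apply] at h4 h5
      omega
    · intro h
      exact absurd (Finset.mem_Iic.2 (show l ≤ e.2 + l from le_add_self)) h
  exact LinearMap.congr_fun (LinearMap.congr_fun this T) v

theorem gBL_apply_ne (e₁ e : ELabel K N d) (k a : MIdx d) (f r : Forest K N d)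
    (h : ∀ l, e₁ ≠ e.raise l) (T v : TV K N d) : gBL e₁ T v ⟨k, cons e a f r⟩ = 0 := by
  have : (gBL e₁).compr₂ (Finsupp.lapply ⟨k, cons e a f r⟩) =
      (0 : TV K N d →ₗ[ℝ] TV K N d →ₗ[ℝ] ℝ) := by
    refine TV_ext fun a' f' => TV_ext fun n' r' => ?_
    simp only [LinearMap.compr₂_apply, gBL_single, gB_single, map_sum, map_smul,
      Finsupp.lapply_apply, LinearMap.zero_apply, Finsupp.single_apply, PTree.mk.injEq, cons.injEq]
    refine Finset.sum_eq_zero fun l hl => ?_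
    rw [if_neg, smul_zero]
    rintro ⟨-, rfl, -⟩
    refine h l ?_
    simp [ELabel.lower, ELabel.raise, tsub_add_cancel_of_le (Finset.mem_Iic.1 hl)]
  exact LinearMap.congr_fun (LinearMap.congr_fun this T) v

theorem treeL_consB (e : ELabel K N d) (T : TV K N d) (u : FV K N d) :
    treeL 0 (consB e T u) = gBL e T (treeL 0 u) := by
  rw [gBL_treeL, Finset.sum_eq_single 0]
  · simp [mchoose, lower_zero]
  · intro l _ hl
    rw [mchoose_eq_zero]
    · simp
    · intro h
      exact hl (le_antisymm h zero_le)
  · simp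

/-- The functional that reads off the multiplicity of a tree. -/
def multC (κ : K → ℝ) (α : N → ℝ) (t : PTree K N d) : Fun κ α d := toC (Finsupp.lapply t ∘ₗ piV)

theorem multC_of_not_neg {t : PTree K N d} (ht : t ∉ negSet κ α) : multC κ α t = 0 := by
  have : (Finsupp.lapply t ∘ₗ piV : SymNeg d κ α →ₗ[ℝ] ℝ) = 0 := by
    refine LinearMap.ext fun w => ?_
    induction w using MvPolynomial.induction_on with
    | C a =>
      rw [← mul_one (MvPolynomial.C a), ← MvPolynomial.smul_eq_C_mul, map_smul]
      simp [piV_one]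
    | add p q hp hq => rw [map_add, hp, hq]; simp
    | mul_X p s hp =>
      have h2 : s.1 ≠ t := fun h => ht (h ▸ s.2)
      simp [piV_mul, piV_X, h2]
  rw [multC, this, map_zero]

theorem multC_nil (m : MIdx d) : multC κ α ⟨m, nil⟩ = 0 :=
  multC_of_not_neg fun h => not_lt_of_ge (by
    rw [reg_mk, regF, add_zero]
    exact Finset.sum_nonneg fun i _ => Nat.cast_nonneg _) h.2

/-- The coefficients `mon`, with functionals for the trees. -/
abbrev monC (κ : K → ℝ) (α : N → ℝ) (F : Forest K N d) (c : F.Vert → EDat d) (p : Bool) :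
    Fun κ α d := mon (multC κ α) F c p

/-- Expansion of the coefficients of simultaneous insertions in forests. -/
def CoeffOut (κ : K → ℝ) (α : N → ℝ) (b : MIdx d) (F : Forest K N d) : Prop :=
  ∀ G, toC (Finsupp.lapply F ∘ₗ trF κ α b G) =
    ∑ c ∈ dat b F, own F c G • monC κ α F c false

/-- The coefficient of `F`, above a base vertex decorated by `k`, in the product of a word with the
action of another word on `G`, above a base vertex decorated by `m`. -/
def wordB (k : MIdx d) (F : Forest K N d) (m : MIdx d) (G : Forest K N d) (n : MIdx d) :
    FV K N d →ₗ[ℝ] FV K N d →ₗ[ℝ] ℝ :=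
  (mulE.compl₁₂ (treeL 0) (treeL m ∘ₗ actF G ∘ₗ treeL n)).compr₂ (Finsupp.lapply ⟨k, F⟩)

theorem wordB_apply (k : MIdx d) (F : Forest K N d) (m : MIdx d) (G : Forest K N d) (n : MIdx d)
    (u v : FV K N d) :
    wordB k F m G n u v = mulE (treeL 0 u) (treeL m (actF G (treeL n v))) ⟨k, F⟩ := rfl

/-- The weight in `CoeffIn`. -/
def wIn (k : MIdx d) (F : Forest K N d) (m : MIdx d) (G : Forest K N d) (n : MIdx d)
    (c : F.Vert → EDat d) : ℝ :=
  if part F c = G ∧ tot F c = n ∧ k + lsum F c = m then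
    mfact n * (mfact m / (mfact k * lfac F c)) else 0

/-- Expansion of the coefficients of products of words with the action of words on forests, the words
being themselves results of simultaneous insertions. -/
def CoeffIn (κ : K → ℝ) (α : N → ℝ) (b : MIdx d) (F : Forest K N d) : Prop :=
  ∀ k m G n s s', toC (trB κ α b (wordB k F m G n) (Finsupp.single s 1 ⊗ₜ Finsupp.single s' 1)) =
    ∑ c ∈ dat b F, (own F c s * oth F c s') • wIn k F m G n c • monC κ α F c true

theorem CoeffIn.act {b : MIdx d} {r : Forest K N d} (h : CoeffIn κ α b r) (G : Forest K N d)
    (n : MIdx d) (s : Forest K N d) :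
    toC (Finsupp.lapply r ∘ₗ actF G ∘ₗ treeL n ∘ₗ trN κ α b s) = ∑ c ∈ dat b r,
      oth r c s • (if NoOut r c ∧ part r c = G ∧ tot r c = n then mfact n else 0) •
        monC κ α r c true := by
  have h1 := h 0 0 G n nil s
  rw [trB_tmul, trL_single, trL_single, trN, cv_epsS_left] at h1
  have h2 : wordB 0 r 0 G n (Finsupp.single nil 1) = Finsupp.lapply r ∘ₗ actF G ∘ₗ treeL n := by
    refine LinearMap.ext fun v => ?_
    rw [wordB_apply, treeL_single, mulE_one, treeL_apply, if_pos rfl]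
    rfl
  rw [h2] at h1
  refine h1.trans (Finset.sum_congr rfl fun c _ => ?_)
  rw [own_nil]
  by_cases h3 : NoOut r c
  · by_cases h4 : monC κ α r c true = 0
    · rw [h4]; simp
    · obtain ⟨h5, h6⟩ := lsum_of_noOut h3 h4
      simp [h3, wIn, h5, h6]
  · simp [h3]

theorem coeff_mul_act {b : MIdx d} {f : Forest K N d} (h : CoeffIn κ α b f) (a m : MIdx d)
    (G : Forest K N d) (n : MIdx d) (s : Forest K N d) :
    toC (Finsupp.lapply ⟨a, f⟩ ∘ₗ cv co mulE LinearMap.id (treeL m ∘ₗ actF G) ∘ₗ treeL n ∘ₗ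
      trN κ α b s) = ∑ δ ∈ Finset.Iic a, ∑ c ∈ dat b f, brs f c s •
        (if part f c = G ∧ δ + tot f c = n ∧ a - δ + lsum f c = m then
          mfact n * vwt a δ (lsum f c) (lfac f c) else 0) • monC κ α f c true := by
  have h1 : Finsupp.lapply ⟨a, f⟩ ∘ₗ cv co mulE LinearMap.id (treeL m ∘ₗ actF G) ∘ₗ treeL n ∘ₗ
      trN κ α b s = TensorProduct.lift ((mulE.compl₂ (treeL m ∘ₗ actF G)).compr₂
        (Finsupp.lapply ⟨a, f⟩)) ∘ₗ co ∘ₗ treeL n ∘ₗ trN κ α b s := by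
    have : Finsupp.lapply ⟨a, f⟩ ∘ₗ cv co mulE LinearMap.id (treeL m ∘ₗ actF G) =
        TensorProduct.lift ((mulE.compl₂ (treeL m ∘ₗ actF G)).compr₂
          (Finsupp.lapply ⟨a, f⟩)) ∘ₗ co := by
      have h2 : Finsupp.lapply ⟨a, f⟩ ∘ₗ TensorProduct.lift mulE ∘ₗ
          TensorProduct.map LinearMap.id (treeL m ∘ₗ actF G) =
          TensorProduct.lift ((mulE.compl₂ (treeL m ∘ₗ actF G)).compr₂
          (Finsupp.lapply ⟨a, f⟩)) := TensorProduct.ext' fun u v => by simp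
      rw [← h2]
      rfl
    rw [← LinearMap.comp_assoc, this, LinearMap.comp_assoc]
  have h2 : ∀ p : MIdx d, ((mulE.compl₂ (treeL m ∘ₗ actF G)).compr₂
      (Finsupp.lapply ⟨a, f⟩)).compl₁₂ (treeL p) (treeL (n - p)) =
        if p ≤ a then wordB (a - p) f m G (n - p) else 0 := fun p => by
    refine LinearMap.ext fun u => LinearMap.ext fun v => ?_
    have h3 : treeL p u = dAdd p (treeL 0 u) := by rw [dAdd_treeL, add_zero]
    simp only [LinearMap.compl₁₂_apply, LinearMap.compr₂_apply, LinearMap.compl₂_apply,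
      LinearMap.comp_apply, Finsupp.lapply_apply, h3, mulE_dAdd, dAdd_apply]
    split_ifs <;> rfl
  rw [h1, toC_lift_co]
  have h3 : ∀ p ∈ Finset.Iic n, (mchoose n p : ℝ) • toC (trB κ α b
      (((mulE.compl₂ (treeL m ∘ₗ actF G)).compr₂
      (Finsupp.lapply ⟨a, f⟩)).compl₁₂ (treeL p) (treeL (n - p))) (unsh s)) =
      if p ∈ Finset.Iic a then (mchoose n p : ℝ) • ∑ c ∈ dat b f, brs f c s •
        wIn (a - p) f m G (n - p) c • monC κ α f c true else 0 := fun p hp => by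
    rw [h2]
    by_cases hpa : p ≤ a
    · rw [if_pos hpa, if_pos (Finset.mem_Iic.2 hpa)]
      have := apply_unsh (h := toC ∘ₗ trB κ α b (wordB (a - p) f m G (n - p))) (dat b f)
        (a := fun c => own f c) (a' := fun c => oth f c)
        (x := fun c => wIn (a - p) f m G (n - p) c • monC κ α f c true)
        (fun s s' => h _ _ _ _ s s') s
      exact congrArg _ this
    · rw [if_neg hpa, if_neg (by simpa using hpa)]
      have : trB κ α b (0 : FV K N d →ₗ[ℝ] FV K N d →ₗ[ℝ] ℝ) = 0 :=
        TensorProduct.ext' fun u v => by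
          rw [trB_tmul]
          refine LinearMap.ext fun w => ?_
          have h0 : TensorProduct.lift (0 : FV K N d →ₗ[ℝ] FV K N d →ₗ[ℝ] ℝ) = 0 :=
            TensorProduct.ext' fun a c => by simp
          simp [cv, h0]
      rw [this]
      simp
  rw [Finset.sum_congr rfl h3]
  have h4 : ∀ A B : Finset (MIdx d), ∀ X : MIdx d → Fun κ α d,
      ∑ p ∈ A, (if p ∈ B then X p else 0) = ∑ p ∈ B, (if p ∈ A then X p else 0) := by
    intro A B X
    rw [← Finset.sum_filter, ← Finset.sum_filter]
    refine Finset.sum_congr (Finset.ext fun p => ?_) fun _ _ => rfl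
    simp [and_comm]
  rw [h4]
  refine Finset.sum_congr rfl fun δ hδ => ?_
  by_cases hn : δ ≤ n
  · rw [if_pos (Finset.mem_Iic.2 hn), Finset.smul_sum]
    refine Finset.sum_congr rfl fun c _ => ?_
    rw [smul_comm]
    congr 1
    rw [smul_smul]
    congr 1
    have : tot f c = n - δ ↔ δ + tot f c = n :=
      ⟨fun h' => by rw [h', add_tsub_cancel_of_le hn], fun h' => by rw [← h']; simp⟩
    rw [wIn]
    by_cases h5 : part f c = G ∧ δ + tot f c = n ∧ a - δ + lsum f c = m
    · rw [if_pos h5, if_pos ⟨h5.1, this.2 h5.2.1, h5.2.2⟩, mchoose_eq hn, vwt, h5.2.2]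
      have := mfact_ne_zero (n - δ)
      have := mfact_ne_zero δ
      field_simp
    · rw [if_neg h5, if_neg fun h6 => h5 ⟨h6.1, this.1 h6.2.1, h6.2.2⟩, mul_zero]
  · rw [if_neg (by simpa using hn)]
    refine (Finset.sum_eq_zero fun c _ => ?_).symm
    rw [if_neg, zero_smul, smul_zero]
    rintro ⟨-, rfl, -⟩
    exact hn le_self_add

/-- Expansion of the coefficients of a convolution, given that of one of its factors. -/
theorem toC_cv_expand {ι M M' : Type*} [AddCommGroup M] [Module ℝ M] [AddCommGroup M']
    [Module ℝ M'] (I : Finset ι) {β : M →ₗ[ℝ] M' →ₗ[ℝ] ℝ} {q : SymNeg d κ α →ₗ[ℝ] M'}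
    {y : ι → M →ₗ[ℝ] ℝ} {x : ι → Fun κ α d} (H : ∀ m, toC (β m ∘ₗ q) = ∑ i ∈ I, y i m • x i)
    (p : SymNeg d κ α →ₗ[ℝ] M) :
    toC (cv (dsh κ α) β p q) = ∑ i ∈ I, toC (y i ∘ₗ p) * x i := by
  have h1 : ∀ m, β m ∘ₗ q = ∑ i ∈ I, y i m • (x i).ofConv := fun m => by
    apply toC_injective
    rw [H, map_sum]
    rfl
  have h2 : TensorProduct.lift β ∘ₗ TensorProduct.map p q = ∑ i ∈ I,
      TensorProduct.lift (LinearMap.mul ℝ ℝ) ∘ₗ TensorProduct.map (y i ∘ₗ p) (x i).ofConv :=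
    TensorProduct.ext' fun u v => by
      have := LinearMap.congr_fun (h1 (p u)) v
      rw [LinearMap.comp_apply, LinearMap.sum_apply] at this
      simp [LinearMap.sum_apply, this]
  have h3 : ∀ i, toC (y i ∘ₗ p) * x i = toC (TensorProduct.lift (LinearMap.mul ℝ ℝ) ∘ₗ
      TensorProduct.map (y i ∘ₗ p) (x i).ofConv ∘ₗ dsh κ α) := fun i => toC_mul _ (x i).ofConv
  simp only [h3]
  rw [← map_sum]
  congr 1
  refine LinearMap.ext fun w => ?_
  have := LinearMap.congr_fun h2 (dsh κ α w)
  simpa [LinearMap.sum_apply, cv] using this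

theorem CoeffOut.treeL {b : MIdx d} {f : Forest K N d} (h : CoeffOut κ α b f) (a n : MIdx d)
    (G : Forest K N d) : toC (Finsupp.lapply ⟨a, f⟩ ∘ₗ treeL n ∘ₗ trF κ α b G) =
      ∑ δ ∈ Finset.Iic a, ∑ c ∈ dat b f, (if ¬ HasInn f c ∧ a = n then brs f c G else 0) •
        if δ = 0 then monC κ α f c false else 0 := by
  have h1 : (Finsupp.lapply ⟨a, f⟩ ∘ₗ PlanarReg.treeL n : FV K N d →ₗ[ℝ] ℝ) =
      if a = n then Finsupp.lapply f else 0 := LinearMap.ext fun u => by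
    rw [LinearMap.comp_apply, Finsupp.lapply_apply, treeL_apply]
    split_ifs <;> rfl
  rw [Finset.sum_eq_single_of_mem 0 (Finset.mem_Iic.2 zero_le)
    fun δ _ hδ => by simp [hδ], ← LinearMap.comp_assoc, h1]
  by_cases han : a = n
  · simp only [han, if_true, and_true]
    rw [h]
    refine Finset.sum_congr rfl fun c _ => ?_
    by_cases hc : HasInn f c
    · have h2 : monC κ α f c false = 0 := mon_false_of_hasInn _ hc
      rw [h2, smul_zero, smul_zero]
    · rw [if_pos hc, brs_of_not_hasInn hc]
  · simp [han]

theorem CoeffIn.simR {b : MIdx d} {f : Forest K N d} (h : CoeffIn κ α b f)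
    (h' : CoeffOut κ α b f) (a n : MIdx d) (G : Forest K N d) :
    toC (Finsupp.lapply ⟨a, f⟩ ∘ₗ simR n (trF κ α b G)) = ∑ δ ∈ Finset.Iic a, ∑ c ∈ dat b f,
      (if (if HasInn f c then δ + tot f c else a) = n then brs f c G else 0) •
        vtx (multC κ α) a δ f c (monC κ α f c true) (monC κ α f c false) := by
  have h1 : cv (dsh κ α) ((actL.compl₂ nuV).compr₂ (Finsupp.lapply ⟨a, f⟩)) piV
      (PlanarReg.treeL n ∘ₗ trF κ α b G) =
      cv (dsh κ α) ((actL.compl₂ (PlanarReg.treeL n)).compr₂ (Finsupp.lapply ⟨a, f⟩)) piV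
        (trN κ α b G) := cv_congr fun v w => by
    rw [LinearMap.compr₂_apply, LinearMap.compr₂_apply, LinearMap.compl₂_apply,
      LinearMap.compl₂_apply, LinearMap.comp_apply, nuV_treeL, ← nuF_trF]
    rfl
  have h2 : ∀ v, toC (((actL.compl₂ (PlanarReg.treeL n)).compr₂ (Finsupp.lapply ⟨a, f⟩)) v ∘ₗ
      trN κ α b G) = ∑ i ∈ Finset.Iic a ×ˢ dat b f,
        (Finsupp.lapply ⟨a - i.1 + lsum f i.2, part f i.2⟩ : TV K N d →ₗ[ℝ] ℝ) v •
        brs f i.2 G • (if i.1 + tot f i.2 = n then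
          mfact n * vwt a i.1 (lsum f i.2) (lfac f i.2) else 0) • monC κ α f i.2 true := by
    intro v
    induction v using Finsupp.induction_linear with
    | zero => simp
    | add u v hu hv =>
      simp only [map_add, LinearMap.add_comp, hu, hv, add_smul, Finset.sum_add_distrib]
    | single t x =>
      rw [single_eq_smul, map_smul, LinearMap.smul_comp, map_smul]
      simp only [map_smul, smul_assoc]
      rw [← Finset.smul_sum]
      congr 1
      have := coeff_mul_act h a t.dec t.branches n G
      rw [Finset.sum_product]
      refine Eq.trans (congrArg _ ?_) (this.trans (Finset.sum_congr rfl fun δ _ =>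
        Finset.sum_congr rfl fun c _ => ?_))
      · refine LinearMap.ext fun w => ?_
        simp [actT]
      · rw [Finsupp.lapply_apply, Finsupp.single_apply]
        by_cases ht : t = ⟨a - δ + lsum f c, part f c⟩
        · subst ht
          simp
        · rw [if_neg ht, zero_smul, if_neg, zero_smul, smul_zero]
          rintro ⟨h3, -, h4⟩
          exact ht (by rw [h3, h4])
  rw [PlanarReg.simR, LinearMap.comp_add, map_add, comp_cv, h1, h'.treeL a n G,
    toC_cv_expand _ h2, Finset.sum_product, ← Finset.sum_add_distrib]
  refine Finset.sum_congr rfl fun δ _ => ?_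
  rw [← Finset.sum_add_distrib]
  refine Finset.sum_congr rfl fun c _ => ?_
  rw [vtx]
  by_cases hc : HasInn f c
  · simp only [hc, not_true_eq_false, false_and, if_false, if_true, zero_smul, zero_add]
    by_cases hn : δ + tot f c = n
    · subst hn
      simp only [if_true]
      rw [multC, smul_comm, mul_smul_comm, mul_smul_comm, smul_comm]
    · simp [hn]
  · simp only [hc, not_false_eq_true, true_and, if_false]
    rw [(not_hasInn hc).1]
    have := multC_nil (κ := κ) (α := α) (a - δ + lsum f c)
    rw [multC] at this
    rw [this, zero_mul, add_zero]

theorem coeff_simE {b : MIdx d} {f : Forest K N d} (h : CoeffIn κ α b f) (h' : CoeffOut κ α b f)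
    {e : ELabel K N d} (he : e.IsNoise → f = nil) (a n : MIdx d) (G : Forest K N d) :
    toC (Finsupp.lapply ⟨a, f⟩ ∘ₗ simE e n (trF κ α b G)) = ∑ δ ∈ Finset.Iic a, ∑ c ∈ dat b f,
      (if (if HasInn f c then δ + tot f c else a) = n then brs f c G else 0) •
        vtx (multC κ α) a δ f c (monC κ α f c true) (monC κ α f c false) := by
  rw [simE]
  split_ifs with hn
  · obtain rfl := he hn
    rw [h'.treeL a n G]
    refine Finset.sum_congr rfl fun δ _ => Finset.sum_congr rfl fun c _ => ?_
    have hc : ¬ HasInn nil c := id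
    simp only [vtx, hc, not_false_eq_true, true_and, if_false]
  · exact h.simR h' a n G

theorem coeff_rootA {b : MIdx d} {f : Forest K N d} (h : CoeffIn κ α b f)
    {e : ELabel K N d} (he : e.IsNoise → f = nil) (a m : MIdx d)
    (G : Forest K N d) (n : MIdx d) (s : Forest K N d) :
    toC (Finsupp.lapply ⟨a, f⟩ ∘ₗ rootA e m (actF G) ∘ₗ treeL n ∘ₗ trN κ α b s) =
      ∑ δ ∈ Finset.Iic a, ∑ c ∈ dat b f, brs f c s •
        (if part f c = G ∧ δ + tot f c = n ∧ a - δ + lsum f c = m ∧ (e.IsNoise → δ = 0) then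
          mfact n * vwt a δ (lsum f c) (lfac f c) else 0) • monC κ α f c true := by
  rw [rootA]
  split_ifs with hn
  · obtain rfl := he hn
    have h1 : Finsupp.lapply ⟨a, nil⟩ ∘ₗ (treeL m ∘ₗ actF G) ∘ₗ treeL n ∘ₗ trN κ α b s =
        if a = m then Finsupp.lapply nil ∘ₗ actF G ∘ₗ treeL n ∘ₗ trN κ α b s else 0 :=
      LinearMap.ext fun w => by
        simp only [LinearMap.comp_apply, Finsupp.lapply_apply, treeL_apply]
        split_ifs <;> rfl
    rw [h1, Finset.sum_eq_single_of_mem 0 (Finset.mem_Iic.2 zero_le)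
      fun δ _ hδ => Finset.sum_eq_zero fun c _ => by
        rw [if_neg fun h3 => hδ (h3.2.2.2 hn), zero_smul, smul_zero]]
    by_cases ham : a = m
    · rw [if_pos ham, h.act]
      refine Finset.sum_congr rfl fun c _ => ?_
      have hb : brs nil c = oth nil c := brs_of_not_hasInn (F := nil) (c := c) id
      have h2 : NoOut nil c := trivial
      have h3 : vwt a 0 (lsum nil c) (lfac nil c) = 1 := by
        simp [vwt, lsum, lfac, mfact_ne_zero]
      have h4 : a - 0 + lsum nil c = m := by simp [lsum, ham]
      simp only [hb, h2, h3, h4, true_and, zero_add, implies_true, and_true, mul_one]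
    · rw [if_neg ham, map_zero]
      refine (Finset.sum_eq_zero fun c _ => ?_).symm
      rw [if_neg fun h3 => ham (by simpa [lsum] using h3.2.2.1), zero_smul, smul_zero]
  · refine (coeff_mul_act h a m G n s).trans (Finset.sum_congr rfl fun δ _ =>
      Finset.sum_congr rfl fun c _ => ?_)
    simp only [hn, false_implies, and_true]

end Dual

/-! ## The recursion for the coefficients of simultaneous insertions -/

section DualRec

variable {κ : K → ℝ} {α : N → ℝ} {b : MIdx d} {e : ELabel K N d} {a : MIdx d} {f r : Forest K N d}

theorem mem_raise {l : MIdx d} (h : (e.raise l).2 ≤ b) :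
    l ∈ (Finset.Iic b).filter fun l => e.2 + l ≤ b :=
  Finset.mem_filter.2 ⟨Finset.mem_Iic.2 (le_trans le_add_self h), h⟩

theorem raise_zero (e : ELabel K N d) : e.raise 0 = e := by simp [ELabel.raise]

theorem raise_injective (e : ELabel K N d) {l l' : MIdx d} (h : e.raise l = e.raise l') : l = l' :=
  add_left_cancel (congrArg Prod.snd h)

theorem coeffOut_nil : CoeffOut κ α b (nil : Forest K N d) := by
  intro G
  rw [sum_dat_nil]
  change _ = (Finsupp.single nil 1 : FV K N d) G • (1 : Fun κ α d)
  cases G with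
  | nil =>
    rw [Finsupp.single_eq_same, one_smul, ← toC_eps]
    congr 1
    refine LinearMap.ext fun w => ?_
    simp [trF]
  | cons e n s r =>
    have h1 : (consB e).compr₂ (Finsupp.lapply nil) = (0 : TV K N d →ₗ[ℝ] FV K N d →ₗ[ℝ] ℝ) :=
      TV_ext fun n s => FV_ext fun F => by simp
    have h2 : TensorProduct.lift (0 : TV K N d →ₗ[ℝ] FV K N d →ₗ[ℝ] ℝ) = 0 :=
      TensorProduct.ext' fun a c => by simp
    rw [trF]
    split_ifs
    · rw [comp_cv, h1, cv, h2, LinearMap.zero_comp, map_zero]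
      simp
    · simp

theorem lapply_cv_consB {C : Type*} [AddCommGroup C] [Module ℝ C] (c : C →ₗ[ℝ] C ⊗[ℝ] C)
    (e₁ : ELabel K N d) (X : C →ₗ[ℝ] TV K N d) (Z : C →ₗ[ℝ] FV K N d) :
    Finsupp.lapply (cons e a f r) ∘ₗ cv c (consB e₁) X Z =
      if e = e₁ then cv c (LinearMap.mul ℝ ℝ) (Finsupp.lapply ⟨a, f⟩ ∘ₗ X) (Finsupp.lapply r ∘ₗ Z)
      else 0 := by
  rw [comp_cv]
  split_ifs with hee
  · subst hee
    refine cv_congr fun x y => ?_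
    have h2 : (consB e).compr₂ (Finsupp.lapply (cons e a f r)) =
        (LinearMap.mul ℝ ℝ).compl₁₂ (Finsupp.lapply (⟨a, f⟩ : PTree K N d)) (Finsupp.lapply r) :=
      TV_ext fun n s => FV_ext fun F => by
        rw [LinearMap.compr₂_apply, Finsupp.lapply_apply, consB_single_apply]
        simp only [LinearMap.compl₁₂_apply, LinearMap.mul_apply', Finsupp.lapply_apply,
          Finsupp.single_apply, PTree.mk.injEq]
        by_cases h3 : n = a <;> by_cases h4 : s = f <;> by_cases h5 : F = r <;> simp [h3, h4, h5]
    rw [h2]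
    rfl
  · have h2 : (consB e₁).compr₂ (Finsupp.lapply (cons e a f r)) =
        (0 : TV K N d →ₗ[ℝ] FV K N d →ₗ[ℝ] ℝ) := TV_ext fun n s => FV_ext fun F => by
      rw [LinearMap.compr₂_apply, Finsupp.lapply_apply, consB_single_apply,
        if_neg fun h => hee h.1.symm]
      rfl
    have h3 : TensorProduct.lift (0 : TV K N d →ₗ[ℝ] FV K N d →ₗ[ℝ] ℝ) = 0 :=
      TensorProduct.ext' fun a c => by simp
    rw [h2, cv, h3, LinearMap.zero_comp]

theorem coeff_cv_consB (e₁ : ELabel K N d) (X : SymNeg d κ α →ₗ[ℝ] TV K N d)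
    (Z : SymNeg d κ α →ₗ[ℝ] FV K N d) :
    toC (Finsupp.lapply (cons e a f r) ∘ₗ cv (dsh κ α) (consB e₁) X Z) =
      if e = e₁ then toC (Finsupp.lapply ⟨a, f⟩ ∘ₗ X) * toC (Finsupp.lapply r ∘ₗ Z) else 0 := by
  rw [lapply_cv_consB, toC_mul]
  split_ifs <;> simp

theorem sum_own_false (hb : e.2 ≤ b) (G : Forest K N d) :
    ∑ c ∈ dat b (cons e a f r), own (cons e a f r) c G • monC κ α (cons e a f r) c false =
      ∑ δ ∈ Finset.Iic a, ∑ c₁ ∈ dat b f, ∑ c₂ ∈ dat b r,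
        own (cons e a f r) (datCons (false, δ, 0) c₁ c₂) G •
          (vtx (multC κ α) a δ f c₁ (monC κ α f c₁ true) (monC κ α f c₁ false) *
            monC κ α r c₂ false) := by
  rw [sum_dat_cons]
  refine Finset.sum_congr rfl fun δ _ => ?_
  rw [Finset.sum_eq_single_of_mem 0 (mem_raise (by rwa [raise_zero]))]
  · refine Finset.sum_congr rfl fun c₁ _ => Finset.sum_congr rfl fun c₂ _ => ?_
    rw [monC, monC, mon_true_false, mon_false_false, smul_zero, zero_add, if_pos rfl]
  · intro l _ hl
    refine Finset.sum_eq_zero fun c₁ _ => Finset.sum_eq_zero fun c₂ _ => ?_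
    rw [monC, monC, mon_true_false, mon_false_false, smul_zero, zero_add, if_neg hl, smul_zero]

theorem coeffOut_cons (he : e.IsNoise → f = nil) (hb : e.2 ≤ b) (hf : CoeffIn κ α b f)
    (hf' : CoeffOut κ α b f) (hr : CoeffOut κ α b r) : CoeffOut κ α b (cons e a f r) := by
  intro G
  rw [sum_own_false hb]
  cases G with
  | nil =>
    have h2 : (Finsupp.lapply (cons e a f r) ∘ₗ trF κ α b nil : SymNeg d κ α →ₗ[ℝ] ℝ) = 0 :=
      LinearMap.ext fun w => by simp [trF]
    rw [h2, map_zero]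
    refine (Finset.sum_eq_zero fun δ _ => Finset.sum_eq_zero fun c₁ _ =>
      Finset.sum_eq_zero fun c₂ _ => ?_).symm
    rw [own_nil, if_neg fun h => by simpa using ((noOut_cons _ _ _).1 h).1, zero_smul]
  | cons e₁ n₁ s₁ r₁ =>
    simp only [own_apply_cons, raise_zero]
    rw [trF]
    by_cases hee : e = e₁
    · subst hee
      rw [if_pos hb, coeff_cv_consB, if_pos rfl, coeff_simE hf hf' he, hr, Finset.sum_mul]
      refine Finset.sum_congr rfl fun δ _ => ?_
      rw [Finset.sum_mul_sum]
      refine Finset.sum_congr rfl fun c₁ _ => Finset.sum_congr rfl fun c₂ _ => ?_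
      rw [smul_mul_smul_comm, ite_zero_mul]
      simp only [true_and]
    · simp only [hee, false_and, if_false, zero_smul, Finset.sum_const_zero]
      by_cases hb' : e₁.2 ≤ b
      · rw [if_pos hb', coeff_cv_consB, if_neg hee]
      · rw [if_neg hb', LinearMap.comp_zero, map_zero]

theorem wordB_nil (k : MIdx d) (F : Forest K N d) (m : MIdx d) (G : Forest K N d) (n : MIdx d) :
    wordB k F m G n (Finsupp.single nil 1) =
      if k = m then Finsupp.lapply F ∘ₗ actF G ∘ₗ treeL n else 0 := by
  refine LinearMap.ext fun v => ?_
  rw [wordB_apply, treeL_single, mulE_one, treeL_apply]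
  split_ifs <;> rfl

theorem trB_nil (β : FV K N d →ₗ[ℝ] FV K N d →ₗ[ℝ] ℝ) (s : Forest K N d) :
    trB κ α b β (Finsupp.single nil 1 ⊗ₜ Finsupp.single s 1) =
      β (Finsupp.single nil 1) ∘ₗ trN κ α b s := by
  rw [trB_tmul, trL_single, trL_single, trN, cv_epsS_left]

theorem gBL_apply_nil (e : ELabel K N d) (k : MIdx d) (T v : TV K N d) :
    gBL e T v ⟨k, nil⟩ = 0 := by
  have : (gBL e).compr₂ (Finsupp.lapply ⟨k, nil⟩) =
      (0 : TV K N d →ₗ[ℝ] TV K N d →ₗ[ℝ] ℝ) :=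
    TV_ext fun a f => TV_ext fun n r => by simp [gB_single]
  exact LinearMap.congr_fun (LinearMap.congr_fun this T) v

theorem lapply_nil_trN (s : Forest K N d) : toC (Finsupp.lapply nil ∘ₗ trN κ α b s) =
    (Finsupp.single nil 1 : FV K N d) s • (1 : Fun κ α d) := by
  have h1 : Finsupp.lapply nil ∘ₗ nuF = (Finsupp.lapply nil : FV K N d →ₗ[ℝ] ℝ) :=
    FV_ext fun F => by
      cases F with
      | nil => simp [nuF]
      | cons e n s r =>
        rw [LinearMap.comp_apply, nuF, Finsupp.linearCombination_single]
        split_ifs <;> simp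
  rw [← nuF_trF, ← LinearMap.comp_assoc, h1]
  refine (coeffOut_nil s).trans ?_
  rw [sum_dat_nil]
  rfl

theorem zero_cv {M M' P : Type*} [AddCommGroup M] [Module ℝ M] [AddCommGroup M'] [Module ℝ M']
    [AddCommGroup P] [Module ℝ P] (β : M →ₗ[ℝ] M' →ₗ[ℝ] P) (Z : SymNeg d κ α →ₗ[ℝ] M') :
    cv (dsh κ α) β 0 Z = 0 := by
  rw [← cvB_apply, map_zero, LinearMap.zero_apply]

theorem smul_cv {M M' P : Type*} [AddCommGroup M] [Module ℝ M] [AddCommGroup M'] [Module ℝ M']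
    [AddCommGroup P] [Module ℝ P] (x : ℝ) (β : M →ₗ[ℝ] M' →ₗ[ℝ] P) (Y : SymNeg d κ α →ₗ[ℝ] M)
    (Z : SymNeg d κ α →ₗ[ℝ] M') : cv (dsh κ α) (x • β) Y Z = x • cv (dsh κ α) β Y Z := by
  have : TensorProduct.lift (x • β) = x • TensorProduct.lift β :=
    TensorProduct.ext' fun a c => by simp
  rw [cv, this]
  rfl

theorem cv_wordB_eq_zero {k : MIdx d} {F : Forest K N d} {m : MIdx d} {G : Forest K N d} {n : MIdx d}
    {e₁ : ELabel K N d} (h : ∀ T v : TV K N d, gBL e₁ T v ⟨k, F⟩ = 0)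
    (X : SymNeg d κ α →ₗ[ℝ] TV K N d) (Y Z : SymNeg d κ α →ₗ[ℝ] FV K N d) :
    cv (dsh κ α) (wordB k F m G n) (cv (dsh κ α) (consB e₁) X Y) Z = 0 := by
  have h1 : wordB k F m G n ∘ₗ TensorProduct.lift (consB e₁) = 0 :=
    TensorProduct.ext' fun T u => LinearMap.ext fun v => by
      rw [LinearMap.comp_apply, TensorProduct.lift.tmul, wordB_apply, treeL_consB, mulE_gBL, h]
      rfl
  rw [← zero_cv (wordB k F m G n) Z]
  refine cv_congr fun x y => ?_
  rw [LinearMap.zero_apply, map_zero]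
  exact LinearMap.congr_fun (LinearMap.congr_fun h1 (TensorProduct.map X Y (dsh κ α x))) (Z y)

theorem coeff_wordB_cons (k : MIdx d) (m : MIdx d) (G : Forest K N d) (n : MIdx d) (l : MIdx d)
    (X : SymNeg d κ α →ₗ[ℝ] TV K N d) (Y Z : SymNeg d κ α →ₗ[ℝ] FV K N d) :
    toC (cv (dsh κ α) (wordB k (cons e a f r) m G n) (cv (dsh κ α) (consB (e.raise l)) X Y) Z) =
      (mchoose (k + l) l : ℝ) • (toC (Finsupp.lapply ⟨a, f⟩ ∘ₗ X) *
        toC (cv (dsh κ α) (wordB (k + l) r m G n) Y Z)) := by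
  have h1 := cv_assoc (κ := κ) (α := α)
    (β := (mchoose (k + l) l : ℝ) • (LinearMap.mul ℝ ℝ).compl₁₂
      (Finsupp.lapply (⟨a, f⟩ : PTree K N d)) LinearMap.id)
    (γ := wordB (k + l) r m G n) (γ' := wordB k (cons e a f r) m G n) (β' := consB (e.raise l))
    (fun T u v => by
      rw [wordB_apply, wordB_apply, treeL_consB, mulE_gBL, gBL_apply _ _ _ _ _ _ _ rfl]
      rfl) X Y Z
  rw [← h1, toC_mul, ← map_smul]
  congr 1
  rw [smul_cv]
  congr 1
  exact cv_congr fun x y => rfl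

theorem coeffIn_nil : CoeffIn κ α b (nil : Forest K N d) := by
  intro k m G n s s'
  rw [sum_dat_nil]
  change _ = ((Finsupp.single nil 1 : FV K N d) s * (Finsupp.single nil 1 : FV K N d) s') •
    (if nil = G ∧ 0 = n ∧ k + 0 = m then mfact n * (mfact m / (mfact k * 1)) else 0) •
      (1 : Fun κ α d)
  cases s with
  | nil =>
    rw [trB_nil, wordB_nil, Finsupp.single_eq_same, one_mul, add_zero, mul_one]
    by_cases hkm : k = m
    · subst hkm
      rw [if_pos rfl, div_self (mfact_ne_zero k), mul_one]
      simp only [and_true]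
      cases G with
      | nil =>
        have h1 : (Finsupp.lapply nil ∘ₗ actF nil ∘ₗ treeL n : FV K N d →ₗ[ℝ] ℝ) =
            if 0 = n then Finsupp.lapply nil else 0 := LinearMap.ext fun u => by
          have := treeL_apply n 0 nil u
          simp only [LinearMap.comp_apply, actF, epsV, Finsupp.lapply_apply, this,
            Finsupp.lsingle_apply, Finsupp.single_eq_same]
          split_ifs <;> rfl
        rw [h1]
        by_cases hn : 0 = n
        · subst hn
          rw [if_pos rfl, lapply_nil_trN]
          simp
        · simp [hn]
      | cons e₁ g₀ γ G =>
        have h1 : (Finsupp.lapply nil ∘ₗ actF (cons e₁ g₀ γ G) : TV K N d →ₗ[ℝ] ℝ) = 0 := by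
          have h2 : (consB e₁).compr₂ (Finsupp.lapply nil) =
              (0 : TV K N d →ₗ[ℝ] FV K N d →ₗ[ℝ] ℝ) := TV_ext fun n s => FV_ext fun F => by simp
          have h3 : TensorProduct.lift (0 : TV K N d →ₗ[ℝ] FV K N d →ₗ[ℝ] ℝ) = 0 :=
            TensorProduct.ext' fun a c => by simp
          rw [actF, comp_cv, h2, cv, h3, LinearMap.zero_comp]
        rw [← LinearMap.comp_assoc, h1]
        simp
    · rw [if_neg hkm, LinearMap.zero_comp, map_zero, if_neg fun h => hkm h.2.2, zero_smul, smul_zero]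
  | cons e₁ n₁ s₁ r₁ =>
    rw [trB_tmul, trL_single, trL_single, trN]
    simp only [ne_eq, reduceCtorEq, not_false_eq_true, Finsupp.single_eq_of_ne, zero_mul, zero_smul]
    split_ifs
    · rw [cv_wordB_eq_zero fun T v => gBL_apply_nil _ _ T v, map_zero]
    · rw [zero_cv, map_zero]

theorem sum_mchoose_ite (n p q : MIdx d) (x : ℝ) (P Q : Prop) [Decidable P]
    [Decidable Q] :
    ∑ m ∈ Finset.Iic n, (mchoose n m : ℝ) * ((if p = m ∧ P then mfact m * x else 0) *
      (if Q ∧ q = n - m then mfact (n - m) else 0)) =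
      if p + q = n ∧ P ∧ Q then mfact n * x else 0 := by
  by_cases hP : P
  · by_cases hQ : Q
    · simp only [hP, hQ, and_true, true_and]
      by_cases hp : p ≤ n
      · rw [Finset.sum_eq_single_of_mem p (Finset.mem_Iic.2 hp)
          fun m _ hm => by rw [if_neg hm.symm, zero_mul, mul_zero], if_pos rfl]
        have : q = n - p ↔ p + q = n :=
          ⟨fun h => by rw [h, add_tsub_cancel_of_le hp], fun h => by rw [← h]; simp⟩
        by_cases hq : p + q = n
        · rw [if_pos (this.2 hq), if_pos hq, mchoose_eq hp]
          have := mfact_ne_zero (n - p)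
          have := mfact_ne_zero p
          field_simp
        · rw [if_neg (fun h => hq (this.1 h)), if_neg hq, mul_zero, mul_zero]
      · rw [if_neg fun h : p + q = n => hp (h ▸ le_self_add)]
        refine Finset.sum_eq_zero fun m hm => ?_
        rw [if_neg fun h : p = m => hp (h ▸ Finset.mem_Iic.1 hm), zero_mul, mul_zero]
    · simp [hQ]
  · simp [hP]

theorem coeffIn_cons_nil (he : e.IsNoise → f = nil) (hf : CoeffIn κ α b f) (hr : CoeffIn κ α b r)
    (n : MIdx d) (G s : Forest K N d) :
    toC (Finsupp.lapply (cons e a f r) ∘ₗ actF G ∘ₗ treeL n ∘ₗ trN κ α b s) =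
      ∑ δ ∈ Finset.Iic a, ∑ c₁ ∈ dat b f, ∑ c₂ ∈ dat b r, shL (brs f c₁) (oth r c₂) s •
        (if (δ + tot f c₁ + tot r c₂ = n ∧ (e.IsNoise → δ = 0) ∧ NoOut r c₂) ∧
          cons e (a - δ + lsum f c₁) (part f c₁) (part r c₂) = G then
            mfact n * vwt a δ (lsum f c₁) (lfac f c₁) else 0) •
              (monC κ α f c₁ true * monC κ α r c₂ true) := by
  cases G with
  | nil =>
    have h1 : (Finsupp.lapply (cons e a f r) ∘ₗ actF nil : TV K N d →ₗ[ℝ] ℝ) = 0 :=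
      TV_ext fun n s => by simp [actF, epsV]
    rw [← LinearMap.comp_assoc, h1]
    simp
  | cons e₁ g₀ γ G =>
    have h1 : Finsupp.lapply (cons e a f r) ∘ₗ actF (cons e₁ g₀ γ G) =
        if e = e₁ then TensorProduct.lift ((LinearMap.mul ℝ ℝ).compl₁₂
          (Finsupp.lapply ⟨a, f⟩ ∘ₗ rootA e g₀ (actF γ)) (Finsupp.lapply r ∘ₗ actF G)) ∘ₗ co
        else 0 := by
      rw [actF, lapply_cv_consB]
      split_ifs
      · have h2 : TensorProduct.lift (LinearMap.mul ℝ ℝ) ∘ₗ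
            TensorProduct.map (Finsupp.lapply ⟨a, f⟩ ∘ₗ rootA e₁ g₀ (actF γ))
              (Finsupp.lapply r ∘ₗ actF G) = TensorProduct.lift ((LinearMap.mul ℝ ℝ).compl₁₂
          (Finsupp.lapply ⟨a, f⟩ ∘ₗ rootA e₁ g₀ (actF γ)) (Finsupp.lapply r ∘ₗ actF G)) :=
          TensorProduct.ext' fun u v => by simp
        subst e₁
        rw [← h2]
        rfl
      · rfl
    rw [← LinearMap.comp_assoc, h1]
    by_cases hee : e = e₁
    · subst hee
      rw [if_pos rfl, LinearMap.comp_assoc, toC_lift_co]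
      have h2 : ∀ p, toC (trB κ α b (((LinearMap.mul ℝ ℝ).compl₁₂
          (Finsupp.lapply ⟨a, f⟩ ∘ₗ rootA e g₀ (actF γ)) (Finsupp.lapply r ∘ₗ actF G)).compl₁₂
            (treeL p) (treeL (n - p))) (unsh s)) =
          ∑ i ∈ (Finset.Iic a ×ˢ dat b f) ×ˢ dat b r, shL (brs f i.1.2) (oth r i.2) s •
            (((if part f i.1.2 = γ ∧ i.1.1 + tot f i.1.2 = p ∧ a - i.1.1 + lsum f i.1.2 = g₀ ∧
              (e.IsNoise → i.1.1 = 0) then mfact p * vwt a i.1.1 (lsum f i.1.2) (lfac f i.1.2)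
                else 0) • monC κ α f i.1.2 true) *
              ((if NoOut r i.2 ∧ part r i.2 = G ∧ tot r i.2 = n - p then mfact (n - p) else 0) •
                monC κ α r i.2 true)) := fun p => by
        refine apply_unsh (h := toC ∘ₗ trB κ α b (((LinearMap.mul ℝ ℝ).compl₁₂
          (Finsupp.lapply ⟨a, f⟩ ∘ₗ rootA e g₀ (actF γ)) (Finsupp.lapply r ∘ₗ actF G)).compl₁₂
            (treeL p) (treeL (n - p)))) ((Finset.Iic a ×ˢ dat b f) ×ˢ dat b r)
          (a := fun i => brs f i.1.2) (a' := fun i => oth r i.2) (fun s₁ s₂ => ?_) s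
        rw [LinearMap.comp_apply, trB_tmul, trL_single, trL_single]
        refine Eq.trans (b := toC (Finsupp.lapply ⟨a, f⟩ ∘ₗ rootA e g₀ (actF γ) ∘ₗ treeL p ∘ₗ
          trN κ α b s₁) * toC (Finsupp.lapply r ∘ₗ actF G ∘ₗ treeL (n - p) ∘ₗ trN κ α b s₂)) ?_ ?_
        · rw [toC_mul]
          exact congrArg toC (cv_congr fun x y => rfl)
        rw [coeff_rootA hf he, hr.act, ← Finset.sum_product', Finset.sum_mul_sum,
          ← Finset.sum_product']
        refine Finset.sum_congr rfl fun i _ => ?_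
        rw [smul_mul_smul_comm]
      simp only [h2, Finset.smul_sum]
      rw [Finset.sum_comm, Finset.sum_product, Finset.sum_product]
      refine Finset.sum_congr rfl fun δ _ => Finset.sum_congr rfl fun c₁ _ =>
        Finset.sum_congr rfl fun c₂ _ => ?_
      simp only [smul_mul_smul_comm]
      simp only [smul_comm _ (shL (brs f c₁) (oth r c₂) s)]
      rw [← Finset.smul_sum]
      congr 1
      simp only [smul_smul]
      rw [← Finset.sum_smul]
      congr 1
      have h3 := sum_mchoose_ite n (δ + tot f c₁) (tot r c₂)
        (vwt a δ (lsum f c₁) (lfac f c₁)) (part f c₁ = γ ∧ a - δ + lsum f c₁ = g₀ ∧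
          (e.IsNoise → δ = 0)) (NoOut r c₂ ∧ part r c₂ = G)
      refine Eq.trans (Finset.sum_congr rfl fun p _ => ?_) (h3.trans ?_)
      · congr 2
        · exact if_congr (by tauto) rfl rfl
        · exact if_congr (by tauto) rfl rfl
      · exact if_congr (by simp only [cons.injEq, true_and]; tauto) rfl rfl
    · rw [if_neg hee, LinearMap.zero_comp, map_zero]
      refine (Finset.sum_eq_zero fun δ _ => Finset.sum_eq_zero fun c₁ _ =>
        Finset.sum_eq_zero fun c₂ _ => ?_).symm
      rw [if_neg fun h => by simp [hee] at h, zero_smul, smul_zero]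

theorem lfac_ne_zero (F : Forest K N d) (c : F.Vert → EDat d) : lfac F c ≠ 0 := by
  induction F with
  | nil => exact one_ne_zero
  | cons e n s r _ hr => exact mul_ne_zero (mfact_ne_zero _) (hr _)

theorem wIn_false (k m n δ l : MIdx d) (G : Forest K N d) (c₁ : f.Vert → EDat d)
    (c₂ : r.Vert → EDat d) : wIn k (cons e a f r) m G n (datCons (false, δ, l) c₁ c₂) =
      mchoose (k + l) l * wIn (k + l) r m G n c₂ := by
  rw [wIn, wIn, part_false, tot_false, lsum_cons, lfac_cons]
  simp only [← add_assoc]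
  split_ifs
  · rw [mchoose_eq le_add_self, add_tsub_cancel_right]
    have := mfact_ne_zero (k + l)
    have := lfac_ne_zero r c₂
    have := mfact_ne_zero k
    have := mfact_ne_zero l
    field_simp
  · rw [mul_zero]

theorem coeffIn_cons_term (k m n δ l : MIdx d) (G s : Forest K N d) (c₁ : f.Vert → EDat d)
    (c₂ : r.Vert → EDat d) :
    (own (cons e a f r) (datCons (true, δ, l) c₁ c₂) nil *
        oth (cons e a f r) (datCons (true, δ, l) c₁ c₂) s) •
      wIn k (cons e a f r) m G n (datCons (true, δ, l) c₁ c₂) •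
        monC κ α (cons e a f r) (datCons (true, δ, l) c₁ c₂) true +
    (own (cons e a f r) (datCons (false, δ, l) c₁ c₂) nil *
        oth (cons e a f r) (datCons (false, δ, l) c₁ c₂) s) •
      wIn k (cons e a f r) m G n (datCons (false, δ, l) c₁ c₂) •
        monC κ α (cons e a f r) (datCons (false, δ, l) c₁ c₂) true =
    if k = m ∧ l = 0 then shL (brs f c₁) (oth r c₂) s •
        (if (δ + tot f c₁ + tot r c₂ = n ∧ (e.IsNoise → δ = 0) ∧ NoOut r c₂) ∧
          cons e (a - δ + lsum f c₁) (part f c₁) (part r c₂) = G then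
            mfact n * vwt a δ (lsum f c₁) (lfac f c₁) else 0) •
              (monC κ α f c₁ true * monC κ α r c₂ true) else 0 := by
  have h1 : own (cons e a f r) (datCons (false, δ, l) c₁ c₂) nil = 0 := by
    rw [own_nil, if_neg fun h => by simpa using ((noOut_cons _ _ _).1 h).1]
  rw [h1, zero_mul, zero_smul, add_zero, own_true, own_nil, oth_true, monC, mon_true_true]
  by_cases h2 : NoOut r c₂
  · by_cases h3 : monC κ α r c₂ true = 0
    · simp [h3]
    · obtain ⟨h4, h5⟩ := lsum_of_noOut h2 h3
      rw [wIn, part_true, tot_true, lsum_cons, lfac_cons, h4, h5, if_pos h2, one_mul]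
      by_cases hl : l = 0
      · subst hl
        by_cases hk : k = m
        · subst hk
          have := mfact_ne_zero k
          by_cases hn : e.IsNoise → δ = 0
          · simp only [h2, add_zero, true_and, and_true, mul_one, mfact_zero, div_self this, if_true]
            congr 1
            rw [if_pos hn, smul_smul, ite_zero_mul]
            congr 1
            exact if_congr (by tauto) rfl rfl
          · simp [hn]
        · simp [hk]
      · simp [hl]
  · simp [h2]

theorem coeffIn_cons (he : e.IsNoise → f = nil) (hb : e.2 ≤ b) (hf : CoeffIn κ α b f)
    (hf' : CoeffOut κ α b f) (hr : CoeffIn κ α b r) : CoeffIn κ α b (cons e a f r) := by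
  intro k m G n s s'
  rw [sum_dat_cons]
  cases s with
  | nil =>
    simp only [coeffIn_cons_term]
    have h0 : (0 : MIdx d) ∈ (Finset.Iic b).filter fun l => e.2 + l ≤ b :=
      mem_raise (by rwa [raise_zero])
    rw [trB_nil, wordB_nil]
    by_cases hkm : k = m
    · rw [if_pos hkm, LinearMap.comp_assoc, LinearMap.comp_assoc, coeffIn_cons_nil he hf hr]
      refine Finset.sum_congr rfl fun δ _ => ?_
      rw [Finset.sum_eq_single_of_mem 0 h0]
      · simp only [hkm, and_self, if_true]
      · intro l _ hl
        simp only [hl, and_false, if_false, Finset.sum_const_zero]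
    · rw [if_neg hkm, LinearMap.zero_comp, map_zero]
      simp only [hkm, false_and, if_false, Finset.sum_const_zero]
  | cons e₁ n₁ s₁ r₁ =>
    have h1 : ∀ δ l c₁ c₂, (own (cons e a f r) (datCons (true, δ, l) c₁ c₂) (cons e₁ n₁ s₁ r₁) *
          oth (cons e a f r) (datCons (true, δ, l) c₁ c₂) s') •
        wIn k (cons e a f r) m G n (datCons (true, δ, l) c₁ c₂) •
          monC κ α (cons e a f r) (datCons (true, δ, l) c₁ c₂) true = 0 := fun δ l c₁ c₂ => by
      rw [own_true, monC, mon_true_true]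
      by_cases h2 : NoOut r c₂
      · rw [own_eq_of_noOut h2]
        simp
      · rw [if_neg fun h3 => h2 h3.2.1, smul_zero, smul_zero]
    have h2 : ∀ δ l c₁ c₂, (own (cons e a f r) (datCons (false, δ, l) c₁ c₂) (cons e₁ n₁ s₁ r₁) *
          oth (cons e a f r) (datCons (false, δ, l) c₁ c₂) s') •
        wIn k (cons e a f r) m G n (datCons (false, δ, l) c₁ c₂) •
          monC κ α (cons e a f r) (datCons (false, δ, l) c₁ c₂) true =
        if e.raise l = e₁ ∧ ¬ e.IsNoise then (mchoose (k + l) l : ℝ) •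
          (((if (if HasInn f c₁ then δ + tot f c₁ else a) = n₁ then brs f c₁ s₁ else 0) •
            vtx (multC κ α) a δ f c₁ (monC κ α f c₁ true) (monC κ α f c₁ false)) *
          ((own r c₂ r₁ * oth r c₂ s') • wIn (k + l) r m G n c₂ • monC κ α r c₂ true))
        else 0 := fun δ l c₁ c₂ => by
      rw [own_apply_cons, oth_false, monC, mon_false_true, wIn_false]
      by_cases he1 : e.raise l = e₁
      · by_cases hn : e.IsNoise
        · simp [hn]
        · rw [if_pos (⟨he1, hn⟩ : e.raise l = e₁ ∧ ¬ e.IsNoise), if_pos hn]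
          simp only [he1, true_and]
          by_cases hh : (if HasInn f c₁ then δ + tot f c₁ else a) = n₁
          · rw [if_pos hh, if_pos hh]
            simp only [smul_mul_smul_comm, smul_smul]
            congr 1
            ring
          · rw [if_neg hh, if_neg hh]
            simp
      · simp [he1]
    simp only [h1, h2, zero_add]
    rw [trB_tmul, trL_single, trL_single, trN]
    by_cases hl : ∃ l, e₁ = e.raise l
    · obtain ⟨l, rfl⟩ := hl
      by_cases hc : (e.raise l).2 ≤ b ∧ ¬ (e.raise l).IsNoise
      · have h3 := hr (k + l) m G n r₁ s'
        rw [trB_tmul, trL_single, trL_single] at h3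
        rw [if_pos hc, coeff_wordB_cons, hf.simR hf', h3, Finset.sum_mul, Finset.smul_sum]
        refine Finset.sum_congr rfl fun δ _ => ?_
        rw [Finset.sum_eq_single_of_mem l (mem_raise hc.1), Finset.sum_mul_sum, Finset.smul_sum]
        · refine Finset.sum_congr rfl fun c₁ _ => ?_
          rw [Finset.smul_sum]
          refine Finset.sum_congr rfl fun c₂ _ => ?_
          rw [if_pos (c := e.raise l = e.raise l ∧ ¬ e.IsNoise) ⟨rfl, hc.2⟩]
        · intro l' _ hne
          refine Finset.sum_eq_zero fun c₁ _ => Finset.sum_eq_zero fun c₂ _ => ?_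
          rw [if_neg (c := e.raise l' = e.raise l ∧ ¬ e.IsNoise)
            fun h => hne (raise_injective e h.1)]
      · rw [if_neg hc, zero_cv, map_zero]
        refine (Finset.sum_eq_zero fun δ _ => Finset.sum_eq_zero fun l' hl' => Finset.sum_eq_zero
          fun c₁ _ => Finset.sum_eq_zero fun c₂ _ => ?_).symm
        rw [if_neg]
        rintro ⟨h3, h4⟩
        rw [← h3] at hc
        exact hc ⟨(Finset.mem_filter.1 hl').2, h4⟩
    · have h3 : (∑ δ ∈ Finset.Iic a, ∑ l ∈ (Finset.Iic b).filter (fun l => e.2 + l ≤ b),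
          ∑ c₁ ∈ dat b f, ∑ c₂ ∈ dat b r, if e.raise l = e₁ ∧ ¬ e.IsNoise then
          (mchoose (k + l) l : ℝ) •
          (((if (if HasInn f c₁ then δ + tot f c₁ else a) = n₁ then brs f c₁ s₁ else 0) •
            vtx (multC κ α) a δ f c₁ (monC κ α f c₁ true) (monC κ α f c₁ false)) *
          ((own r c₂ r₁ * oth r c₂ s') • wIn (k + l) r m G n c₂ • monC κ α r c₂ true))
          else 0) = 0 :=
        Finset.sum_eq_zero fun δ _ => Finset.sum_eq_zero fun l _ => Finset.sum_eq_zero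
          fun c₁ _ => Finset.sum_eq_zero fun c₂ _ => if_neg fun h => hl ⟨l, h.1.symm⟩
      rw [h3]
      split_ifs
      · rw [cv_wordB_eq_zero, map_zero]
        exact fun T v => gBL_apply_ne _ _ _ _ _ _ (fun l h => hl ⟨l, h⟩) T v
      · rw [zero_cv, map_zero]

theorem coeff_sim {F : Forest K N d} (hF : OkF F) (hb : LeF b F) :
    CoeffOut κ α b F ∧ CoeffIn κ α b F := by
  induction F with
  | nil => exact ⟨coeffOut_nil, coeffIn_nil⟩
  | cons e n s r hs hr =>
    obtain ⟨h1, h2⟩ := hs hF.2.1 hb.2.1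
    obtain ⟨h3, h4⟩ := hr hF.2.2 hb.2.2
    exact ⟨coeffOut_cons (fun he => (hF.1 he).1) hb.1 h2 h1 h3,
      coeffIn_cons (fun he => (hF.1 he).1) hb.1 h2 h1 h4⟩

/-- The coefficients of a simultaneous insertion in a tree. -/
theorem coeff_simT {s t : PTree K N d} (ht : OkF t.branches) (hb : LeF b t.branches)
    (hb' : LeF b s.branches) :
    toC (Finsupp.lapply t ∘ₗ simT κ α s) = ∑ δ ∈ Finset.Iic t.dec, ∑ c ∈ dat b t.branches,
      (if (if HasInn t.branches c then δ + tot t.branches c else t.dec) = s.dec then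
        brs t.branches c s.branches else 0) • vtx (multC κ α) t.dec δ t.branches c
          (monC κ α t.branches c true) (monC κ α t.branches c false) := by
  obtain ⟨h1, h2⟩ := coeff_sim (κ := κ) (α := α) ht hb
  rw [simT, ← trF_eq hb']
  exact h2.simR h1 t.dec s.dec s.branches

end DualRec

/-! ## Coefficients as products over the vertices -/

namespace Forest

/-- A quantity attached to each vertex, in terms of the vertex, the branches above it and the branches
to its right. -/
def loc {A : Type*}
    (q : ∀ (e : ELabel K N d) (n : MIdx d) (s r : Forest K N d), ((cons e n s r).Vert → EDat d) → A) :
    (F : Forest K N d) → (F.Vert → EDat d) → F.Vert → A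
  | cons e n s r, c, Vert.head => q e n s r c
  | cons _ _ s _, c, Vert.up x => loc q s (fun x => c (Vert.up x)) x
  | cons _ _ _ r, c, Vert.right x => loc q r (fun x => c (Vert.right x)) x

/-- Some edge going out of the vertex is contracted. -/
def hasIn : (F : Forest K N d) → (F.Vert → EDat d) → F.Vert → Prop :=
  loc fun _ _ s _ c => HasInn s fun x => c (Vert.up x)

/-- The sum of the lowerings at a vertex and at the vertices contracted into it. -/
def totAt : (F : Forest K N d) → (F.Vert → EDat d) → F.Vert → MIdx d :=
  loc fun _ _ s _ c => (c Vert.head).2.1 + tot s fun x => c (Vert.up x)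

/-- The tree contracted into a vertex. -/
def treeAt : (F : Forest K N d) → (F.Vert → EDat d) → F.Vert → PTree K N d :=
  loc fun _ n s _ c => ⟨n - (c Vert.head).2.1 + lsum s (fun x => c (Vert.up x)),
    part s fun x => c (Vert.up x)⟩

/-- The factor of a vertex in the coefficient of a redistribution. -/
def vwtAt : (F : Forest K N d) → (F.Vert → EDat d) → F.Vert → ℝ :=
  loc fun _ n s _ c => vwt n (c Vert.head).2.1 (lsum s fun x => c (Vert.up x))
    (lfac s fun x => c (Vert.up x))

/-- All edges to the right of the given one are contracted. -/
def rightIn : (F : Forest K N d) → (F.Vert → EDat d) → F.Vert → Prop :=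
  loc fun _ _ _ r c => NoOut r fun x => c (Vert.right x)

/-- The lower end of the given edge belongs to an extracted subtree, if `p` says whether the base
vertex does. -/
def srcIn : (F : Forest K N d) → (F.Vert → EDat d) → Bool → F.Vert → Prop
  | cons _ _ _ _, _, p, Vert.head => p = true
  | cons _ _ s _, c, _, Vert.up x =>
    srcIn s (fun x => c (Vert.up x)) ((c Vert.head).1 || decide (HasInn s fun x => c (Vert.up x))) x
  | cons _ _ _ r, c, p, Vert.right x => srcIn r (fun x => c (Vert.right x)) p x

/-- The condition at an edge and its upper end for the coefficient `mon` not to vanish. -/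
def Cond (F : Forest K N d) (c : F.Vert → EDat d) (p : Bool) (x : F.Vert) : Prop :=
  ((c x).1 = true → srcIn F c p x ∧ (c x).2.2 = 0 ∧ rightIn F c x ∧
    ((label x).IsNoise → (c x).2.1 = 0)) ∧
  ((c x).1 = false → (srcIn F c p x → ¬ (label x).IsNoise) ∧ (¬ srcIn F c p x → (c x).2.2 = 0) ∧
    (¬ hasIn F c x → (c x).2.1 = 0))

section
variable {R : Type*} [CommRing R] [Algebra ℝ R] (g : PTree K N d → R)

theorem ite_smul_mul (k u₁ u₂ : ℝ) (g v₁ v₂ : R) {A B C P : Prop} [Decidable A] [Decidable B]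
    [Decidable C] [Decidable P] (h : P ↔ C ∧ A ∧ B) :
    (if C then k • ((g * if A then u₁ • v₁ else 0) * if B then u₂ • v₂ else 0) else 0) =
      if P then (k * (u₁ * u₂)) • (g * (v₁ * v₂)) else 0 := by
  rw [if_congr h rfl rfl]
  by_cases h2 : A <;> by_cases h3 : B <;> by_cases h4 : C <;> simp [h2, h3, h4]
  simp only [Algebra.smul_def, map_mul]
  ring

theorem mon_eq (F : Forest K N d) (c : F.Vert → EDat d) (p : Bool) : mon g F c p =
    if ∀ x, Cond F c p x then
      (∏ x, ((if (c x).1 = true ∨ hasIn F c x then vwtAt F c x else 1) *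
        if (c x).1 = false ∧ hasIn F c x then mfact (totAt F c x) else 1)) •
          ∏ x, (if (c x).1 = false ∧ hasIn F c x then g (treeAt F c x) else 1)
    else 0 := by
  induction F generalizing p with
  | nil => simp [mon]
  | cons e n s r hs hr =>
    obtain ⟨i, δ, l, c₁, c₂, rfl⟩ := exists_datCons c
    have h1 : (∀ x, Cond (cons e n s r) (datCons (i, δ, l) c₁ c₂) p x) ↔
        ((i = true → p = true ∧ l = 0 ∧ NoOut r c₂ ∧ (e.IsNoise → δ = 0)) ∧
          (i = false → (p = true → ¬ e.IsNoise) ∧ (¬ p = true → l = 0) ∧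
            (¬ HasInn s c₁ → δ = 0))) ∧
          (∀ x, Cond s c₁ (i || decide (HasInn s c₁)) x) ∧ ∀ x, Cond r c₂ p x := forall_vert
    rw [prod_vert, prod_vert]
    change _ = if (∀ x, Cond (cons e n s r) (datCons (i, δ, l) c₁ c₂) p x) then (((if i = true ∨ HasInn s c₁ then
        vwt n δ (lsum s c₁) (lfac s c₁) else 1) *
        if i = false ∧ HasInn s c₁ then mfact (δ + tot s c₁) else 1) *
        ((∏ x, ((if (c₁ x).1 = true ∨ hasIn s c₁ x then vwtAt s c₁ x else 1) *
          if (c₁ x).1 = false ∧ hasIn s c₁ x then mfact (totAt s c₁ x) else 1)) *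
        (∏ x, ((if (c₂ x).1 = true ∨ hasIn r c₂ x then vwtAt r c₂ x else 1) *
          if (c₂ x).1 = false ∧ hasIn r c₂ x then mfact (totAt r c₂ x) else 1)))) •
        ((if i = false ∧ HasInn s c₁ then g ⟨n - δ + lsum s c₁, part s c₁⟩ else 1) *
          ((∏ x, (if (c₁ x).1 = false ∧ hasIn s c₁ x then g (treeAt s c₁ x) else 1)) *
          ∏ x, (if (c₂ x).1 = false ∧ hasIn r c₂ x then g (treeAt r c₂ x) else 1))) else 0
    have hs' := hs c₁
    have hr' := hr c₂
    generalize (∏ x, ((if (c₁ x).1 = true ∨ hasIn s c₁ x then vwtAt s c₁ x else 1) *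
          if (c₁ x).1 = false ∧ hasIn s c₁ x then mfact (totAt s c₁ x) else 1)) = u₁ at *
    generalize (∏ x, ((if (c₂ x).1 = true ∨ hasIn r c₂ x then vwtAt r c₂ x else 1) *
          if (c₂ x).1 = false ∧ hasIn r c₂ x then mfact (totAt r c₂ x) else 1)) = u₂ at *
    generalize (∏ x, (if (c₁ x).1 = false ∧ hasIn s c₁ x then g (treeAt s c₁ x) else 1)) = v₁ at *
    generalize (∏ x, (if (c₂ x).1 = false ∧ hasIn r c₂ x then g (treeAt r c₂ x) else 1)) = v₂ at *
    cases i with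
    | true =>
      cases p with
      | false => rw [mon_true_false, if_neg fun h => by simpa using ((h1.1 h).1.1 rfl).1]
      | true =>
        rw [mon_true_true, hs', hr']
        have hP : (∀ x, Cond (cons e n s r) (datCons (true, δ, l) c₁ c₂) true x) ↔
            (l = 0 ∧ NoOut r c₂ ∧ (e.IsNoise → δ = 0)) ∧ (∀ x, Cond s c₁ true x) ∧
              ∀ x, Cond r c₂ true x := h1.trans (by
          rw [show (true || decide (HasInn s c₁)) = true from rfl]
          simp)
        refine Eq.trans ?_ ((ite_smul_mul (vwt n δ (lsum s c₁) (lfac s c₁)) u₁ u₂ 1 v₁ v₂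
          hP).trans ?_)
        rotate_left
        · simp only [true_or, if_true, reduceCtorEq, false_and, if_false, mul_one]
        · rw [one_mul]
    | false =>
      have h5 : mon g (cons e n s r) (datCons (false, δ, l) c₁ c₂) p =
          if (p = true → ¬ e.IsNoise) ∧ (¬ p = true → l = 0) then
            vtx g n δ s c₁ (mon g s c₁ true) (mon g s c₁ false) * mon g r c₂ p else 0 := by
        cases p
        · rw [mon_false_false]
          simp
        · rw [mon_false_true]
          simp
      rw [h5]
      by_cases hI : HasInn s c₁
      · have hv : vtx g n δ s c₁ (mon g s c₁ true) (mon g s c₁ false) = _ := if_pos hI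
        rw [hv, hs', hr']
        have hP : (∀ x, Cond (cons e n s r) (datCons (false, δ, l) c₁ c₂) p x) ↔
            ((p = true → ¬ e.IsNoise) ∧ (¬ p = true → l = 0)) ∧ (∀ x, Cond s c₁ true x) ∧
              ∀ x, Cond r c₂ p x := h1.trans (by
          rw [show (false || decide (HasInn s c₁)) = true by simp [hI]]
          simp [hI])
        refine Eq.trans ?_ ((ite_smul_mul (mfact (δ + tot s c₁) * vwt n δ (lsum s c₁) (lfac s c₁))
          u₁ u₂ (g ⟨n - δ + lsum s c₁, part s c₁⟩) v₁ v₂ hP).trans ?_)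
        rotate_left
        · simp only [hI, or_true, if_true, and_self, mul_comm (mfact _)]
        · rw [smul_mul_assoc]
      · have hv : vtx g n δ s c₁ (mon g s c₁ true) (mon g s c₁ false) = _ := if_neg hI
        rw [hv, hs', hr']
        have hP : (∀ x, Cond (cons e n s r) (datCons (false, δ, l) c₁ c₂) p x) ↔
            ((p = true → ¬ e.IsNoise) ∧ (¬ p = true → l = 0) ∧ δ = 0) ∧ (∀ x, Cond s c₁ false x) ∧
              ∀ x, Cond r c₂ p x := h1.trans (by
          rw [show (false || decide (HasInn s c₁)) = false by simp [hI]]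
          simp [hI])
        refine Eq.trans ?_ ((ite_smul_mul 1 u₁ u₂ 1 v₁ v₂ hP).trans ?_)
        rotate_left
        · simp only [hI, reduceCtorEq, or_false, and_false, if_false, mul_one]
        · rw [one_mul, one_smul]
          by_cases h6 : δ = 0
          · simp only [h6, if_true, and_true]
          · simp only [h6, if_false, and_false, zero_mul, ite_self]

end

end Forest

/-! ## The families of subtrees given by the contracted edges -/

namespace Forest

theorem exists_vert {e : ELabel K N d} {n : MIdx d} {s r : Forest K N d}
    {p : (cons e n s r).Vert → Prop} :
    (∃ x, p x) ↔ p Vert.head ∨ (∃ x, p (Vert.up x)) ∨ ∃ x, p (Vert.right x) := by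
  rw [← not_iff_not]
  push Not
  exact forall_vert

/-- The lowest vertex of the subtree of contracted edges that contains the given vertex. -/
def rt : (F : Forest K N d) → (F.Vert → EDat d) → F.Vert → Option F.Vert
  | cons _ _ _ _, c, Vert.head => if (c Vert.head).1 then none else some Vert.head
  | cons _ _ s _, c, Vert.up x =>
    match rt s (fun y => c (Vert.up y)) x with
    | none => if (c Vert.head).1 then none else some Vert.head
    | some y => some (Vert.up y)
  | cons _ _ _ r, c, Vert.right x => (rt r (fun y => c (Vert.right y)) x).map Vert.right

section

variable {e : ELabel K N d} {n : MIdx d} {s r : Forest K N d} (c : (cons e n s r).Vert → EDat d)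

theorem rt_up_some {x : s.Vert} {y : s.Vert} : rt _ c (Vert.up x) = some (Vert.up y) ↔
    rt s (fun y => c (Vert.up y)) x = some y := by
  rw [rt]
  cases rt s (fun y => c (Vert.up y)) x with
  | none => split_ifs <;> simp
  | some z => simp

theorem rt_up_none {x : s.Vert} : rt _ c (Vert.up x) = none ↔
    (c Vert.head).1 = true ∧ rt s (fun y => c (Vert.up y)) x = none := by
  rw [rt]
  cases rt s (fun y => c (Vert.up y)) x with
  | none => split_ifs with h <;> simp [h]
  | some z => simp

theorem rt_up_head {x : s.Vert} : rt _ c (Vert.up x) = some Vert.head ↔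
    (c Vert.head).1 = false ∧ rt s (fun y => c (Vert.up y)) x = none := by
  rw [rt]
  cases rt s (fun y => c (Vert.up y)) x with
  | none => split_ifs with h <;> simp [h]
  | some z => simp

theorem rt_up_right {x : s.Vert} {y : r.Vert} : rt _ c (Vert.up x) ≠ some (Vert.right y) := by
  rw [rt]
  cases rt s (fun y => c (Vert.up y)) x with
  | none => split_ifs <;> simp
  | some z => simp

theorem rt_head_some {y : (cons e n s r).Vert} : rt _ c Vert.head = some y ↔
    (c Vert.head).1 = false ∧ y = Vert.head := by
  rw [rt]
  split_ifs with h <;> simp [h, eq_comm]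

theorem rt_head_none : rt _ c Vert.head = none ↔ (c Vert.head).1 = true := by
  rw [rt]
  split_ifs with h <;> simp [h]

theorem rt_right_some {x : r.Vert} {y : r.Vert} : rt _ c (Vert.right x) = some (Vert.right y) ↔
    rt r (fun y => c (Vert.right y)) x = some y := by
  rw [rt]
  cases rt r (fun y => c (Vert.right y)) x <;> simp

theorem rt_right_none {x : r.Vert} : rt _ c (Vert.right x) = none ↔
    rt r (fun y => c (Vert.right y)) x = none := by
  rw [rt]
  cases rt r (fun y => c (Vert.right y)) x <;> simp

theorem rt_right_head {x : r.Vert} : rt _ c (Vert.right x) ≠ some Vert.head := by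
  rw [rt]
  cases rt r (fun y => c (Vert.right y)) x <;> simp

theorem rt_right_up {x : r.Vert} {y : s.Vert} : rt _ c (Vert.right x) ≠ some (Vert.up y) := by
  rw [rt]
  cases rt r (fun y => c (Vert.right y)) x <;> simp

end

theorem rt_of_not {F : Forest K N d} (c : F.Vert → EDat d) {x : F.Vert} (h : (c x).1 = false) :
    rt F c x = some x := by
  induction F with
  | nil => exact isEmptyElim x
  | cons e n s r hs hr =>
    cases x with
    | head => exact (rt_head_some c).2 ⟨h, rfl⟩
    | up x => exact (rt_up_some c).2 (hs _ h)
    | right x => exact (rt_right_some c).2 (hr _ h)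

theorem rt_of_inn {F : Forest K N d} (c : F.Vert → EDat d) {x : F.Vert} (h : (c x).1 = true) :
    rt F c x = (parent x).bind (rt F c) := by
  induction F with
  | nil => exact isEmptyElim x
  | cons e n s r hs hr =>
    cases x with
    | head => exact (rt_head_none c).2 h
    | up x =>
      rw [rt, hs (fun y => c (Vert.up y)) h, parent]
      cases parent x with
      | none => simp [rt]
      | some y => simp [rt]
    | right x =>
      rw [rt, hr (fun y => c (Vert.right y)) h, parent]
      cases parent x with
      | none => simp
      | some y => simp [rt]

theorem rt_eq_some {F : Forest K N d} (c : F.Vert → EDat d) {x y : F.Vert} (h : rt F c x = some y) :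
    (c y).1 = false := by
  induction F with
  | nil => exact isEmptyElim x
  | cons e n s r hs hr =>
    cases x with
    | head =>
      obtain ⟨h1, rfl⟩ := (rt_head_some c).1 h
      exact h1
    | up x =>
      cases y with
      | head => exact ((rt_up_head c).1 h).1
      | up y => exact hs (fun y => c (Vert.up y)) ((rt_up_some c).1 h)
      | right y => exact absurd h (rt_up_right c)
    | right x =>
      cases y with
      | head => exact absurd h (rt_right_head c)
      | up y => exact absurd h (rt_right_up c)
      | right y => exact hr (fun y => c (Vert.right y)) ((rt_right_some c).1 h)

theorem parent_induction {F : Forest K N d} {p : Option F.Vert → Prop} (base : p none)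
    (step : ∀ x, p (parent x) → p (some x)) : ∀ x, p x := by
  induction F with
  | nil => exact fun x => match x with
    | none => base
    | some x => isEmptyElim x
  | cons e n s r hs hr =>
    have h1 := step Vert.head base
    have h2 : ∀ x : Option s.Vert, p (some (x.elim Vert.head Vert.up)) :=
      hs (p := fun x => p (some (x.elim Vert.head Vert.up))) h1 fun x hx => step (Vert.up x) (by
        rw [parent_up]
        exact hx)
    have h3 : ∀ x : Option r.Vert, p (x.map Vert.right) :=
      hr (p := fun x => p (x.map Vert.right)) base fun x hx => step (Vert.right x) hx
    intro x
    cases x with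
    | none => exact base
    | some x =>
      cases x with
      | head => exact h1
      | up x => exact h2 (some x)
      | right x => exact h3 (some x)

theorem parent_bind_rt_ne {F : Forest K N d} (c : F.Vert → EDat d) (x : F.Vert) :
    (parent x).bind (rt F c) ≠ some x := by
  induction F with
  | nil => exact isEmptyElim x
  | cons e n s r hs hr =>
    cases x with
    | head => simp
    | up x =>
      have := hs (fun y => c (Vert.up y)) x
      rw [parent_up]
      cases h : parent x with
      | none =>
        intro h'
        simpa using ((rt_head_some c).1 h').2
      | some y =>
        rw [h] at this
        intro h'
        exact this ((rt_up_some c).1 h')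
    | right x =>
      have := hr (fun y => c (Vert.right y)) x
      rw [parent_right]
      cases h : parent x with
      | none => simp
      | some y =>
        rw [h] at this
        simp only [Option.map_some, Option.bind_some, ne_eq] at this ⊢
        rwa [rt_right_some]

theorem hasInn_iff {F : Forest K N d} (c : F.Vert → EDat d) :
    HasInn F c ↔ ∃ x, parent x = none ∧ (c x).1 = true := by
  induction F with
  | nil => simp [HasInn]
  | cons e n s r _ hr =>
    rw [HasInn, hr, exists_vert]
    simp [parent_up]

theorem hasIn_iff {F : Forest K N d} (c : F.Vert → EDat d) (x : F.Vert) :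
    hasIn F c x ↔ ∃ y, parent y = some x ∧ (c y).1 = true := by
  induction F with
  | nil => exact isEmptyElim x
  | cons e n s r hs hr =>
    rw [exists_vert]
    cases x with
    | head =>
      refine (hasInn_iff _).trans ?_
      simp only [parent_head, parent_up, parent_right]
      constructor
      · rintro ⟨x, h1, h2⟩
        exact Or.inr (Or.inl ⟨x, by simp [h1], h2⟩)
      · rintro (h | ⟨x, h1, h2⟩ | ⟨x, h1, h2⟩)
        · simp at h
        · refine ⟨x, ?_, h2⟩
          cases h : parent x with
          | none => rfl
          | some y => simp [h] at h1
        · cases h : parent x <;> simp [h] at h1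
    | up x =>
      refine (hs _ x).trans ?_
      simp only [parent_head, parent_up, parent_right]
      constructor
      · rintro ⟨y, h1, h2⟩
        exact Or.inr (Or.inl ⟨y, by simp [h1], h2⟩)
      · rintro (h | ⟨y, h1, h2⟩ | ⟨y, h1, h2⟩)
        · simp at h
        · refine ⟨y, ?_, h2⟩
          cases h : parent y with
          | none => simp [h] at h1
          | some z => simpa [h] using h1
        · cases h : parent y <;> simp [h] at h1
    | right x =>
      refine (hr _ x).trans ?_
      simp only [parent_head, parent_up, parent_right]
      constructor
      · rintro ⟨y, h1, h2⟩
        exact Or.inr (Or.inr ⟨y, by simp [h1], h2⟩)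
      · rintro (h | ⟨y, h1, h2⟩ | ⟨y, h1, h2⟩)
        · simp at h
        · cases h : parent y <;> simp [h] at h1
        · refine ⟨y, ?_, h2⟩
          cases h : parent y with
          | none => simp [h] at h1
          | some z => simpa [h] using h1

theorem noOut_iff {F : Forest K N d} (c : F.Vert → EDat d) :
    NoOut F c ↔ ∀ x, parent x = none → (c x).1 = true := by
  induction F with
  | nil => simp [NoOut]
  | cons e n s r _ hr =>
    rw [NoOut, hr, forall_vert]
    simp [parent_up]

theorem rightIn_iff {F : Forest K N d} (c : F.Vert → EDat d) (x : F.Vert) :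
    rightIn F c x ↔ ∀ y, RightOf x y → (c y).1 = true := by
  induction F with
  | nil => exact isEmptyElim x
  | cons e n s r hs hr =>
    rw [forall_vert]
    cases x with
    | head => 
      refine (noOut_iff _).trans ?_
      simp [RightOf]
    | up x =>
      refine (hs _ x).trans ?_
      simp [RightOf]
    | right x =>
      refine (hr _ x).trans ?_
      simp [RightOf]

theorem srcIn_iff {F : Forest K N d} (c : F.Vert → EDat d) (p : Bool) (x : F.Vert) :
    srcIn F c p x ↔ (parent x = none ∧ p = true) ∨
      ∃ y, parent x = some y ∧ ((c y).1 = true ∨ hasIn F c y) := by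
  induction F generalizing p with
  | nil => exact isEmptyElim x
  | cons e n s r hs hr =>
    cases x with
    | head => simp [srcIn]
    | up x =>
      refine (hs _ _ x).trans ?_
      rw [parent_up]
      cases h : parent x with
      | none => simp [hasIn, loc]
      | some y => simp [hasIn, loc]
    | right x =>
      refine (hr _ _ x).trans ?_
      rw [parent_right]
      cases h : parent x with
      | none => simp
      | some y => simp [hasIn, loc]

section

variable {M : Type*} [CommMonoid M] {e : ELabel K N d} {n : MIdx d} {s r : Forest K N d}
  (f : (cons e n s r).Vert → M)

@[to_additive]
theorem prod_child_none : (∏ z, if parent z = none then f z else 1) =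
    f Vert.head * ∏ z : r.Vert, if parent z = none then f (Vert.right z) else 1 := by
  rw [prod_vert]
  simp [parent_up]

@[to_additive]
theorem prod_child_head : (∏ z, if parent z = some Vert.head then f z else 1) =
    ∏ z : s.Vert, if parent z = none then f (Vert.up z) else 1 := by
  rw [prod_vert, Finset.prod_eq_one (s := Finset.univ (α := r.Vert)) fun z _ => if_neg (by simp)]
  simp only [parent_head, reduceCtorEq, if_false, one_mul, mul_one]
  refine Finset.prod_congr rfl fun z _ => if_congr ?_ rfl rfl
  rw [parent_up]
  cases parent z <;> simp

@[to_additive]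
theorem prod_child_up (x : s.Vert) : (∏ z, if parent z = some (Vert.up x) then f z else 1) =
    ∏ z : s.Vert, if parent z = some x then f (Vert.up z) else 1 := by
  rw [prod_vert, Finset.prod_eq_one (s := Finset.univ (α := r.Vert)) fun z _ => if_neg (by simp)]
  simp only [parent_head, reduceCtorEq, if_false, one_mul, mul_one]
  refine Finset.prod_congr rfl fun z _ => if_congr ?_ rfl rfl
  rw [parent_up]
  cases parent z <;> simp

@[to_additive]
theorem prod_child_right (x : r.Vert) :
    (∏ z, if parent z = some (Vert.right x) then f z else 1) =
      ∏ z : r.Vert, if parent z = some x then f (Vert.right z) else 1 := by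
  rw [prod_vert, Finset.prod_eq_one (s := Finset.univ (α := s.Vert)) fun z _ => if_neg (by
    rw [parent_up]; cases parent z <;> simp)]
  simp

end

theorem lsum_eq {F : Forest K N d} (c : F.Vert → EDat d) :
    lsum F c = ∑ z, if parent z = none then (c z).2.2 else 0 := by
  induction F with
  | nil => simp [lsum]
  | cons e n s r _ hr => rw [lsum, hr, sum_child_none]

theorem lfac_eq {F : Forest K N d} (c : F.Vert → EDat d) :
    lfac F c = ∏ z, if parent z = none then mfact (c z).2.2 else 1 := by
  induction F with
  | nil => simp [lfac]
  | cons e n s r _ hr => rw [lfac, hr, prod_child_none fun z => mfact (c z).2.2]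

theorem ndec_eq {F : Forest K N d} (c : F.Vert → EDat d) (x : F.Vert) :
    ndec F c x = vdec x - (c x).2.1 + ∑ z, if parent z = some x then (c z).2.2 else 0 := by
  induction F with
  | nil => exact isEmptyElim x
  | cons e n s r hs hr =>
    cases x with
    | head => rw [ndec, lsum_eq, sum_child_head]; rfl
    | up x => rw [ndec, hs, sum_child_up]; rfl
    | right x => rw [ndec, hr, sum_child_right]; rfl

theorem treeAt_branches_of_not {F : Forest K N d} (c : F.Vert → EDat d) (x : F.Vert)
    (h : ¬ hasIn F c x) : (treeAt F c x).branches = nil := by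
  induction F with
  | nil => exact isEmptyElim x
  | cons e n s r hs hr =>
    cases x with
    | head => exact (not_hasInn h).1
    | up x => exact hs _ x h
    | right x => exact hr _ x h

theorem vwtAt_eq {F : Forest K N d} (c : F.Vert → EDat d) (x : F.Vert) :
    vwtAt F c x = vwt (vdec x) (c x).2.1 (∑ z, if parent z = some x then (c z).2.2 else 0)
      (∏ z, if parent z = some x then mfact (c z).2.2 else 1) := by
  induction F with
  | nil => exact isEmptyElim x
  | cons e n s r hs hr =>
    cases x with
    | head =>
      rw [sum_child_head, prod_child_head fun z => mfact (c z).2.2, ← lsum_eq, ← lfac_eq]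
      rfl
    | up x =>
      rw [sum_child_up, prod_child_up fun z => mfact (c z).2.2]
      exact hs _ x
    | right x =>
      rw [sum_child_right, prod_child_right fun z => mfact (c z).2.2]
      exact hr _ x

theorem tot_eq {F : Forest K N d} (c : F.Vert → EDat d) :
    tot F c = ∑ z, if rt F c z = none then (c z).2.1 else 0 := by
  induction F with
  | nil => simp [tot]
  | cons e n s r hs hr =>
    rw [tot, hr, hs, sum_vert]
    simp only [rt_head_none, rt_up_none, rt_right_none]
    cases h : (c Vert.head).1 <;> simp [add_assoc]

theorem totAt_eq {F : Forest K N d} (c : F.Vert → EDat d) {x : F.Vert} (hx : (c x).1 = false) :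
    totAt F c x = ∑ z, if rt F c z = some x then (c z).2.1 else 0 := by
  induction F with
  | nil => exact isEmptyElim x
  | cons e n s r hs hr =>
    rw [sum_vert]
    cases x with
    | head =>
      simp only [rt_head_some, rt_up_head, rt_right_head, hx, if_true, if_false, true_and,
        Finset.sum_const_zero, add_zero]
      rw [← tot_eq]
      rfl
    | up x =>
      simp only [rt_head_some, rt_up_some, rt_right_up, if_false, reduceCtorEq, and_false,
        Finset.sum_const_zero, add_zero, zero_add]
      exact hs _ hx
    | right x =>
      simp only [rt_head_some, rt_up_right, rt_right_some, if_false, reduceCtorEq, and_false,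
        Finset.sum_const_zero, zero_add]
      exact hr _ hx

theorem cdec_eq {F : Forest K N d} (c : F.Vert → EDat d) (x : F.Vert) :
    cdec F c x = if hasIn F c x then totAt F c x else vdec x := by
  induction F with
  | nil => exact isEmptyElim x
  | cons e n s r hs hr =>
    cases x with
    | head => rfl
    | up x => exact hs _ x
    | right x => exact hr _ x

theorem restrict_rt {F : Forest K N d} (c : F.Vert → EDat d) (m : F.Vert → MIdx d) :
    restrict F (fun x => rt F c x = none) m = restrict F (fun x => (c x).1 = true) m := by
  induction F with
  | nil => rfl
  | cons e n s r hs hr =>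
    have h1 := hr (fun x => c (Vert.right x)) fun x => m (Vert.right x)
    have h2 := hs (fun x => c (Vert.up x)) fun x => m (Vert.up x)
    simp only [restrict, rt_head_none, rt_up_none, rt_right_none, h1]
    split_ifs with h
    · simp only [h, true_and, h2]
    · rfl

theorem component_eq_none {F : Forest K N d} {S : F.Vert → Prop} (m : F.Vert → MIdx d)
    (h : ∀ x, ¬ S x) : component F S m = none := by
  induction F with
  | nil => rfl
  | cons e n s r hs hr =>
    rw [component, if_neg (h _), hs _ fun x => h (Vert.up x)]
    exact hr _ fun x => h (Vert.right x)

theorem component_rt {F : Forest K N d} (c : F.Vert → EDat d) {x : F.Vert} (hx : (c x).1 = false) :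
    component F (fun y => rt F c y = some x) (ndec F c) = some (treeAt F c x) := by
  induction F with
  | nil => exact isEmptyElim x
  | cons e n s r hs hr =>
    cases x with
    | head =>
      rw [component, if_pos ((rt_head_some c).2 ⟨hx, rfl⟩)]
      simp only [rt_up_head, hx, true_and]
      rw [restrict_rt]
      rfl
    | up x =>
      rw [component, if_neg fun h => by simpa using ((rt_head_some c).1 h).2]
      simp only [rt_up_some]
      have := hs (fun y => c (Vert.up y)) hx
      simp only [ndec, this]
      rfl
    | right x =>
      rw [component, if_neg fun h => by simpa using ((rt_head_some c).1 h).2,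
        component_eq_none _ fun y => rt_up_right c]
      simp only [rt_right_some]
      exact hr (fun y => c (Vert.right y)) hx

theorem contractAux_congr {F : Forest K N d} {inn : F.Vert → Prop} (lab : F.Vert → ELabel K N d)
    {m m' : F.Vert → MIdx d} (h : ∀ x, ¬ inn x → m x = m' x) :
    contractAux F inn lab m = contractAux F inn lab m' := by
  induction F with
  | nil => rfl
  | cons e n s r hs hr =>
    simp only [contractAux]
    rw [hs _ fun x hx => h (Vert.up x) hx, hr _ fun x hx => h (Vert.right x) hx]
    split_ifs with h'
    · rfl
    · rw [h _ h']

theorem RightOf.parent_eq {F : Forest K N d} {x y : F.Vert} (h : RightOf x y) :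
    parent y = parent x := by
  induction F with
  | nil => exact isEmptyElim x
  | cons e n s r hs hr =>
    cases x <;> cases y <;> simp only [RightOf] at h
    · simp [h]
    · rw [parent_up, parent_up, hs h]
    · rw [Forest.parent, Forest.parent, hr h]

theorem not_hasIn_of_noise {F : Forest K N d} (hF : OkF F) (c : F.Vert → EDat d) {x : F.Vert}
    (hx : (label x).IsNoise) : ¬ hasIn F c x := fun h => by
  obtain ⟨y, hy, -⟩ := (hasIn_iff c x).1 h
  exact ((okF_iff F).1 hF).2 x y hx hy

end Forest

/-! ## The family of the components of the contracted edges -/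

section Components

variable {τ : PTree K N d} (c : τ.Edge → EDat d) (δ₀ : MIdx d)

/-- The lowest vertex of the subtree of contracted edges that contains the given vertex. -/
def rootOf (x : τ.Vert) : τ.Vert := x.bind (rt τ.branches c)

/-- Some edge going out of the vertex is contracted. -/
def HasC : τ.Vert → Prop
  | none => HasInn τ.branches c
  | some x => hasIn τ.branches c x

/-- The vertex belongs to a nontrivial subtree of contracted edges. -/
def InC (x : τ.Vert) : Prop := HasC c (rootOf c x)

/-- The roots of the nontrivial subtrees of contracted edges. -/
def roots : Finset τ.Vert := Finset.univ.filter fun y => rootOf c y = y ∧ HasC c y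

/-- The subtree of contracted edges with a given root. -/
def blk (y : τ.Vert) : Finset τ.Vert := Finset.univ.filter fun x => rootOf c x = y

/-- The family of the nontrivial subtrees of contracted edges. -/
def fam : Finset (Finset τ.Vert) := (roots c).image (blk c)

/-- The lowerings of the vertex decorations. -/
def lowering : τ.Vert → MIdx d
  | none => δ₀
  | some x => (c x).2.1

/-- The sum of the lowerings over the subtree with a given root. -/
def totO : τ.Vert → MIdx d
  | none => δ₀ + tot τ.branches c
  | some x => totAt τ.branches c x

/-- The tree carried by the subtree with a given root. -/
def treeO : τ.Vert → PTree K N d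
  | none => ⟨τ.dec - δ₀ + lsum τ.branches c, part τ.branches c⟩
  | some x => treeAt τ.branches c x

/-- The factor of a vertex in the coefficient of a redistribution. -/
def vwtO : τ.Vert → ℝ
  | none => vwt τ.dec δ₀ (lsum τ.branches c) (lfac τ.branches c)
  | some x => vwtAt τ.branches c x

/-- The conditions for the data to come from an admissible family with a redistribution, except
that the regularities of the subtrees may be nonnegative. -/
def Good : Prop := (∀ x, Cond τ.branches c (decide (HasInn τ.branches c)) x) ∧
  (¬ HasInn τ.branches c → δ₀ = 0)

theorem vtx_eq {R : Type*} [CommRing R] [Algebra ℝ R] (g : PTree K N d → R) :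
    vtx g τ.dec δ₀ τ.branches c (mon g τ.branches c true) (mon g τ.branches c false) =
      if Good c δ₀ then (∏ x, ((if (∃ e, x = some e ∧ (c e).1 = true) ∨ HasC c x then
        vwtO c δ₀ x else 1) * if rootOf c x = x ∧ HasC c x then mfact (totO c δ₀ x) else 1)) •
          ∏ x, (if rootOf c x = x ∧ HasC c x then g (treeO c δ₀ x) else 1)
      else 0 := by
  have h0 : ∀ x, rootOf c (some x) = some x ↔ (c x).1 = false := fun x =>
    ⟨fun h => rt_eq_some c h, fun h => rt_of_not c h⟩
  rw [Fintype.prod_option, Fintype.prod_option]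
  simp only [h0, Option.some.injEq, exists_eq_left']
  have h1 : (∃ e, (none : τ.Vert) = some e ∧ (c e).1 = true) ∨ HasC c none ↔
    HasInn τ.branches c := by simp [HasC]
  have h2 : rootOf c none = none ∧ HasC c none ↔ HasInn τ.branches c := by simp [HasC, rootOf]
  simp only [h1, h2]
  rw [vtx]
  simp only [mon_eq]
  by_cases hI : HasInn τ.branches c
  · have h3 : Good c δ₀ ↔ ∀ x, Cond τ.branches c true x := by simp [Good, hI]
    simp only [hI, if_true]
    rw [if_congr h3 rfl rfl]
    split_ifs
    · rw [mul_smul_comm, smul_smul]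
      congr 1
      rw [mul_comm (mfact _)]
      rfl
    · simp
  · have h3 : Good c δ₀ ↔ (∀ x, Cond τ.branches c false x) ∧ δ₀ = 0 := by simp [Good, hI]
    simp only [hI, if_false]
    rw [if_congr h3 rfl rfl]
    by_cases h4 : δ₀ = 0
    · simp only [h4, and_true, if_true, one_mul, mul_one]
      rfl
    · simp [h4]

variable {c δ₀}

theorem hasC_iff {x : τ.Vert} : HasC c x ↔ ∃ e, PTree.source e = x ∧ (c e).1 = true := by
  cases x with
  | none => exact hasInn_iff c
  | some x => exact hasIn_iff c x

theorem rootOf_of_inn {e : τ.Edge} (h : (c e).1 = true) :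
    rootOf c (some e) = rootOf c (PTree.source e) := rt_of_inn c h

theorem rootOf_of_not {e : τ.Edge} (h : (c e).1 = false) : rootOf c (some e) = some e :=
  rt_of_not c h

theorem rootOf_source_ne (e : τ.Edge) : rootOf c (PTree.source e) ≠ some e :=
  parent_bind_rt_ne c e

theorem inn_iff {e : τ.Edge} : (c e).1 = true ↔ rootOf c (PTree.source e) = rootOf c (some e) := by
  refine ⟨fun h => (rootOf_of_inn h).symm, fun h => by_contra fun h' => ?_⟩
  rw [rootOf_of_not (by simpa using h')] at h
  exact rootOf_source_ne e h

theorem rootOf_rootOf (x : τ.Vert) : rootOf c (rootOf c x) = rootOf c x := by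
  rcases h : rootOf c x with _ | y
  · rfl
  · cases x with
    | none => cases h
    | some x => exact rootOf_of_not (rt_eq_some c h)

theorem inC_of_hasC {x : τ.Vert} : HasC c x → InC c x := by
  refine parent_induction (p := fun x : τ.Vert => HasC c x → InC c x) (fun h => h)
    (fun e ih h => ?_) x
  cases he : (c e).1 with
  | true =>
    rw [InC, rootOf_of_inn he]
    exact ih (hasC_iff.2 ⟨e, rfl, he⟩)
  | false => rwa [InC, rootOf_of_not he]

theorem inC_of_inn {e : τ.Edge} (h : (c e).1 = true) : InC c (some e) := by
  rw [InC, rootOf_of_inn h]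
  exact inC_of_hasC (hasC_iff.2 ⟨e, rfl, h⟩)

theorem inC_iff {x : τ.Vert} : InC c x ↔ (∃ e, x = some e ∧ (c e).1 = true) ∨ HasC c x := by
  refine ⟨fun h => ?_, ?_⟩
  · cases x with
    | none => exact Or.inr h
    | some e =>
      cases he : (c e).1 with
      | true => exact Or.inl ⟨e, rfl, he⟩
      | false =>
        rw [InC, rootOf_of_not he] at h
        exact Or.inr h
  · rintro (⟨e, rfl, he⟩ | h)
    · exact inC_of_inn he
    · exact inC_of_hasC h

theorem srcIn_iff_inC {e : τ.Edge} :
    srcIn τ.branches c (decide (HasInn τ.branches c)) e ↔ InC c (PTree.source e) := by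
  rw [srcIn_iff, inC_iff, PTree.source]
  rcases parent e with _ | y
  · simp [HasC]
  · simp [HasC]

theorem mem_roots {y : τ.Vert} : y ∈ roots c ↔ rootOf c y = y ∧ HasC c y := by simp [roots]

theorem mem_blk {x y : τ.Vert} : x ∈ blk c y ↔ rootOf c x = y := by simp [blk]

theorem rootOf_mem_roots {x : τ.Vert} (h : InC c x) : rootOf c x ∈ roots c :=
  mem_roots.2 ⟨rootOf_rootOf x, h⟩

theorem blk_mem_fam {x : τ.Vert} (h : InC c x) : blk c (rootOf c x) ∈ fam c :=
  Finset.mem_image_of_mem _ (rootOf_mem_roots h)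

theorem exists_mem_fam {x : τ.Vert} : (∃ S ∈ fam c, x ∈ S) ↔ InC c x := by
  constructor
  · rintro ⟨S, hS, hx⟩
    obtain ⟨y, hy, rfl⟩ := Finset.mem_image.1 hS
    rw [InC, mem_blk.1 hx]
    exact (mem_roots.1 hy).2
  · exact fun h => ⟨_, blk_mem_fam h, mem_blk.2 rfl⟩

theorem exists_edgeIn_fam {e : τ.Edge} : (∃ S ∈ fam c, PTree.EdgeIn e S) ↔ (c e).1 = true := by
  constructor
  · rintro ⟨S, hS, h1, h2⟩
    obtain ⟨y, hy, rfl⟩ := Finset.mem_image.1 hS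
    rw [mem_blk] at h1 h2
    exact inn_iff.2 (h1.trans h2.symm)
  · intro h
    exact ⟨_, blk_mem_fam (inC_of_inn h), mem_blk.2 (inn_iff.1 h), mem_blk.2 rfl⟩

theorem blk_injOn : Set.InjOn (blk c) (roots c) := fun y hy y' _ h => by
  have : y ∈ blk c y' := h ▸ mem_blk.2 (mem_roots.1 hy).1
  rw [← mem_blk.1 this, (mem_roots.1 hy).1]

theorem prod_fam {R : Type*} [CommMonoid R] (f : Finset τ.Vert → R) :
    ∏ S ∈ fam c, f S = ∏ y ∈ roots c, f (blk c y) := Finset.prod_image blk_injOn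

theorem prod_roots_blk {R : Type*} [CommMonoid R] (f : τ.Vert → R) :
    ∏ y ∈ roots c, ∏ x ∈ blk c y, f x = ∏ x, if InC c x then f x else 1 := by
  rw [← Finset.prod_filter, ← Finset.prod_fiberwise_of_maps_to (t := roots c) (g := rootOf c)
    fun x hx => rootOf_mem_roots (Finset.mem_filter.1 hx).2]
  refine Finset.prod_congr rfl fun y hy => Finset.prod_congr ?_ fun _ _ => rfl
  ext x
  rw [mem_blk, Finset.mem_filter, Finset.mem_filter]
  refine ⟨fun h => ⟨⟨Finset.mem_univ _, ?_⟩, h⟩, fun h => h.2⟩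
  rw [InC, h]
  exact (mem_roots.1 hy).2

theorem inn_of_mem_blk {e : τ.Edge} {y : τ.Vert} (h : some e ∈ blk c y) (hy : some e ≠ y) :
    (c e).1 = true := by
  by_contra h'
  rw [mem_blk, rootOf_of_not (by simpa using h')] at h
  exact hy h

theorem isAdmissible_fam (hτ : OkF τ.branches) (h : Good c δ₀) : τ.IsAdmissible (fam c) where
  subtree S hS := by
    obtain ⟨y, hy, rfl⟩ := Finset.mem_image.1 hS
    refine ⟨y, mem_blk.2 (mem_roots.1 hy).1, fun x hx hxy => ?_⟩
    cases x with
    | none => exact absurd (mem_blk.1 hx) hxy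
    | some e =>
      refine ⟨e, rfl, mem_blk.2 ?_⟩
      rw [← rootOf_of_inn (inn_of_mem_blk hx hxy)]
      exact mem_blk.1 hx
  disjoint S hS S' hS' hne := by
    obtain ⟨y, hy, rfl⟩ := Finset.mem_image.1 hS
    obtain ⟨y', hy', rfl⟩ := Finset.mem_image.1 hS'
    rw [Finset.disjoint_left]
    intro x hx hx'
    exact hne ((mem_blk.1 hx).symm.trans (mem_blk.1 hx') ▸ rfl)
  right_closed S hS e e' he hee := by
    have h1 := exists_edgeIn_fam.1 ⟨S, hS, he⟩
    have h2 := (rightIn_iff c e).1 ((h.1 e).1 h1).2.2.1 e' hee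
    have h3 : PTree.source e' = PTree.source e := hee.parent_eq
    obtain ⟨y, hy, rfl⟩ := Finset.mem_image.1 hS
    have h4 : PTree.source e' ∈ blk c y := h3 ▸ he.1
    exact ⟨h4, mem_blk.2 ((rootOf_of_inn h2).trans (mem_blk.1 h4))⟩
  noise e he := by
    cases h1 : (c e).1 with
    | true => exact Or.inl (exists_edgeIn_fam.2 h1)
    | false =>
      refine Or.inr fun S hS => ⟨fun h2 => ?_, fun h2 => ?_⟩
      · exact ((h.1 e).2 h1).1 (srcIn_iff_inC.2 (exists_mem_fam.1 ⟨S, hS, h2⟩)) he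
      · rcases inC_iff.1 (exists_mem_fam.1 ⟨S, hS, h2⟩) with ⟨e', h3, h4⟩ | h3
        · cases h3
          simp [h1] at h4
        · exact not_hasIn_of_noise hτ c he h3

theorem newDec_none (l : τ.Edge → MIdx d) (hl : ∀ e, l e = (c e).2.2) :
    τ.newDec (lowering c δ₀) l none = (treeO c δ₀ none).dec := by
  obtain rfl : l = fun e => (c e).2.2 := funext hl
  rw [PTree.newDec, Finset.sum_filter]
  exact congrArg _ (lsum_eq c).symm

theorem newDec_some (l : τ.Edge → MIdx d) (hl : ∀ e, l e = (c e).2.2) (x : τ.Edge) :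
    τ.newDec (lowering c δ₀) l (some x) = ndec τ.branches c x := by
  obtain rfl : l = fun e => (c e).2.2 := funext hl
  rw [PTree.newDec, Finset.sum_filter, ndec_eq]
  rfl

theorem extract_blk (l : τ.Edge → MIdx d) (hl : ∀ e, l e = (c e).2.2) {y : τ.Vert}
    (hy : rootOf c y = y) : τ.extract (blk c y) (τ.newDec (lowering c δ₀) l) = treeO c δ₀ y := by
  have h1 : (fun x => τ.newDec (lowering c δ₀) l (some x)) = ndec τ.branches c :=
    funext (newDec_some l hl)
  rw [PTree.extract, newDec_none l hl]
  simp only [mem_blk, h1]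
  cases y with
  | none =>
    rw [if_pos hy]
    exact congrArg _ (restrict_rt c _)
  | some y =>
    rw [if_neg (by rintro ⟨⟩)]
    exact congrArg (fun o => Option.getD o ⟨0, nil⟩) (component_rt c (rt_eq_some c hy))

theorem totO_eq {y : τ.Vert} (hy : rootOf c y = y) :
    totO c δ₀ y = ∑ x ∈ blk c y, lowering c δ₀ x := by
  rw [blk, Finset.sum_filter, Fintype.sum_option]
  cases y with
  | none =>
    rw [if_pos hy]
    exact congrArg (δ₀ + ·) (tot_eq c)
  | some y =>
    rw [if_neg (by rintro ⟨⟩), zero_add]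
    exact totAt_eq c (rt_eq_some c hy)

theorem vwtO_eq (l : τ.Edge → MIdx d) (hl : ∀ e, l e = (c e).2.2) (x : τ.Vert) :
    vwtO c δ₀ x = mfact (τ.newDec (lowering c δ₀) l x) /
      (mfact (τ.vdec x - lowering c δ₀ x) *
        ∏ e ∈ Finset.univ.filter (fun e : τ.Edge => PTree.source e = x), mfact (l e)) /
          mfact (lowering c δ₀ x) := by
  obtain rfl : l = fun e => (c e).2.2 := funext hl
  rw [PTree.newDec, Finset.sum_filter, Finset.prod_filter]
  cases x with
  | none =>
    rw [vwtO, vwt, lsum_eq, lfac_eq]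
    rfl
  | some x =>
    rw [vwtO, vwtAt_eq, vwt]
    rfl

end Components

/-! ## Redistributions along admissible families as data on the edges -/

variable {κ : K → ℝ} {α : N → ℝ} {τ : PTree K N d}

/-- The redistribution along the family of the components of the contracted edges. -/
def redistributionOfGood (hτ : OkF τ.branches) {c : τ.Edge → EDat d} {δ₀ : MIdx d}
    (h : Good c δ₀) (hle : ∀ x, lowering c δ₀ x ≤ τ.vdec x)
    (hneg : ∀ y ∈ roots c, (treeO c δ₀ y).reg κ α < 0) :
    PTree.Redistribution κ α τ (fam c) where
  del := lowering c δ₀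
  l e := (c e).2.2
  del_le := hle
  del_supp x hx := by
    rw [exists_mem_fam]
    cases x with
    | none =>
      refine ⟨?_, not_noiseVert_none⟩
      by_contra h1
      exact hx (h.2 h1)
    | some x =>
      rw [noiseVert_some]
      cases hi : (c x).1 with
      | true => exact ⟨inC_of_inn hi, fun h1 => hx (((h.1 x).1 hi).2.2.2 h1)⟩
      | false =>
        have h1 : hasIn τ.branches c x := by
          by_contra h1
          exact hx (((h.1 x).2 hi).2.2 h1)
        exact ⟨inC_of_hasC h1, fun h2 => not_hasIn_of_noise hτ c h2 h1⟩
  l_supp e he := by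
    cases hi : (c e).1 with
    | true => exact absurd ((h.1 e).1 hi).2.1 he
    | false =>
      have h1 : InC c (PTree.source e) := by
        by_contra h1
        exact he (((h.1 e).2 hi).2.1 fun h2 => h1 (srcIn_iff_inC.1 h2))
      refine ⟨_, blk_mem_fam h1, mem_blk.2 rfl, fun h2 => ?_⟩
      have h3 := inn_iff.2 (mem_blk.1 h2).symm
      simp [hi] at h3
  negative S hS := by
    obtain ⟨y, hy, rfl⟩ := Finset.mem_image.1 hS
    rw [extract_blk _ (fun _ => rfl) (mem_roots.1 hy).1]
    exact hneg y hy

theorem reg_nil (m : MIdx d) : ¬ (⟨m, nil⟩ : PTree K N d).reg κ α < 0 := by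
  rw [reg_mk, regF, add_zero, not_lt]
  exact Finset.sum_nonneg fun i _ => Nat.cast_nonneg _

section

variable {𝓕 : Finset (Finset τ.Vert)}

theorem singleton_notMem (D : PTree.Redistribution κ α τ 𝓕) (x : τ.Vert) : {x} ∉ 𝓕 := fun hx => by
  let c : τ.Edge → EDat d := fun e => (false, D.del (some e), D.l e)
  have h1 : lowering c (D.del none) = D.del := funext fun x => by cases x <;> rfl
  have h2 : ∀ y, rootOf c y = y := fun y => by
    cases y with
    | none => rfl
    | some y => exact rootOf_of_not rfl
  have h3 : blk c x = {x} := by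
    ext y
    rw [mem_blk, h2, Finset.mem_singleton]
  have h4 := D.negative _ hx
  rw [← h3, ← h1, extract_blk _ (fun _ => rfl) (h2 x)] at h4
  have h5 : ¬ HasC c x := fun h => by
    obtain ⟨e, -, he⟩ := hasC_iff.1 h
    simp [c] at he
  have h6 : (treeO c (D.del none) x).branches = nil := by
    cases x with
    | none => exact (not_hasInn h5).1
    | some x => exact treeAt_branches_of_not c x h5
  refine reg_nil (κ := κ) (α := α) (treeO c (D.del none) x).dec ?_
  rw [← h6]
  exact h4

variable (D : PTree.Redistribution κ α τ 𝓕)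

/-- The edges of the subtrees, and a redistribution, as data on the edges. -/
def datOf : τ.Edge → EDat d := fun e =>
  (decide (∃ S ∈ 𝓕, PTree.EdgeIn e S), D.del (some e), D.l e)

theorem datOf_inn {e : τ.Edge} : (datOf D e).1 = true ↔ ∃ S ∈ 𝓕, PTree.EdgeIn e S :=
  decide_eq_true_iff

theorem lowering_datOf : lowering (datOf D) (D.del none) = D.del :=
  funext fun x => by cases x <;> rfl

theorem eq_blk (h : τ.IsAdmissible 𝓕) {S : Finset τ.Vert} (hS : S ∈ 𝓕) :
    ∃ r ∈ roots (datOf D), S = blk (datOf D) r := by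
  obtain ⟨r, hr, hsub⟩ := h.subtree S hS
  have huniq : ∀ S' ∈ 𝓕, ∀ x, x ∈ S → x ∈ S' → S' = S := fun S' hS' x hx hx' => by
    by_contra hne
    exact Finset.disjoint_left.1 (h.disjoint S' hS' S hS hne) hx' hx
  have h1 : ∀ x, x ∈ S → rootOf (datOf D) x = rootOf (datOf D) r := by
    refine parent_induction (p := fun x : τ.Vert => x ∈ S → rootOf (datOf D) x = _)
      (fun hx => ?_) (fun e ih hx => ?_)
    · by_cases hn : none = r
      · rw [← hn]
      · obtain ⟨e, he, -⟩ := hsub _ hx hn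
        cases he
    · by_cases hn : some e = r
      · rw [← hn]
      · obtain ⟨e', he, he'⟩ := hsub _ hx hn
        cases he
        rw [rootOf_of_inn ((datOf_inn D).2 ⟨S, hS, he', hx⟩)]
        exact ih he'
  have h2 : rootOf (datOf D) r = r := by
    cases r with
    | none => rfl
    | some e =>
      refine rootOf_of_not ?_
      by_contra hi
      obtain ⟨S', hS', h3, h4⟩ := (datOf_inn D).1 (by simpa using hi)
      obtain rfl := huniq S' hS' _ hr h4
      let c : τ.Edge → EDat d := fun e' => (decide (PTree.EdgeIn e' S' ∧ e' ≠ e), 0, 0)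
      have h5 : ∀ x, x ∈ S' → rootOf c x = some e := by
        refine parent_induction (p := fun x : τ.Vert => x ∈ S' → rootOf c x = _)
          (fun hx => ?_) (fun e' ih hx => ?_)
        · obtain ⟨e', he', -⟩ := hsub _ hx (by rintro ⟨⟩)
          cases he'
        · by_cases hn : e' = e
          · rw [hn]
            exact rootOf_of_not (by simp [c])
          · obtain ⟨e'', he, he'⟩ := hsub _ hx (by simpa using hn)
            cases he
            rw [rootOf_of_inn (by simpa [c, hn] using ⟨he', hx⟩)]
            exact ih he'
      exact rootOf_source_ne e (h5 _ h3)
  have h3 : S = blk (datOf D) r := by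
    ext x
    rw [mem_blk]
    refine ⟨fun hx => (h1 x hx).trans h2, ?_⟩
    revert x
    refine parent_induction (p := fun x : τ.Vert => rootOf (datOf D) x = r → x ∈ S)
      (fun hx => ?_) (fun e ih hx => ?_)
    · rw [← hx] at hr
      exact hr
    · cases hi : (datOf D e).1 with
      | true =>
        obtain ⟨S', hS', h3, h4⟩ := (datOf_inn D).1 hi
        rw [rootOf_of_inn hi] at hx
        rwa [← huniq S' hS' _ (ih hx) h3]
      | false =>
        rw [rootOf_of_not hi] at hx
        rwa [hx]
  refine ⟨r, mem_roots.2 ⟨h2, ?_⟩, h3⟩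
  have h4 : ∃ x ∈ S, x ≠ r := by
    by_contra! h4
    refine singleton_notMem D r ?_
    rwa [← Finset.eq_singleton_iff_unique_mem.2 ⟨hr, h4⟩]
  obtain ⟨x, hx, hxr⟩ := h4
  obtain ⟨e, rfl, he⟩ := hsub x hx hxr
  have h5 := inC_of_inn ((datOf_inn D).2 ⟨S, hS, he, hx⟩)
  rwa [InC, ← PTree.target, h1 _ hx, h2] at h5

theorem fam_datOf (h : τ.IsAdmissible 𝓕) : fam (datOf D) = 𝓕 := by
  ext S
  constructor
  · intro hS
    obtain ⟨y, hy, rfl⟩ := Finset.mem_image.1 hS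
    obtain ⟨h1, h2⟩ := mem_roots.1 hy
    obtain ⟨e, he, hi⟩ := hasC_iff.1 h2
    obtain ⟨S, hS', h3⟩ := (datOf_inn D).1 hi
    obtain ⟨r, hr, rfl⟩ := eq_blk D h hS'
    have h4 := mem_blk.1 h3.1
    rw [he, h1] at h4
    rwa [h4]
  · intro hS
    obtain ⟨r, hr, rfl⟩ := eq_blk D h hS
    exact Finset.mem_image_of_mem _ hr

theorem good_datOf (h : τ.IsAdmissible 𝓕) : Good (datOf D) (D.del none) := by
  have hf := fam_datOf D h
  have hm : ∀ x, (∃ S ∈ 𝓕, x ∈ S) ↔ InC (datOf D) x := fun x => by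
    rw [← exists_mem_fam, hf]
  have hu : ∀ S ∈ 𝓕, ∀ S' ∈ 𝓕, ∀ x, x ∈ S → x ∈ S' → S = S' := fun S hS S' hS' x hx hx' => by
    by_contra hne
    exact Finset.disjoint_left.1 (h.disjoint S hS S' hS' hne) hx hx'
  refine ⟨fun e => ⟨fun hi => ?_, fun hi => ?_⟩, fun hI => ?_⟩
  · obtain ⟨S, hS, he⟩ := (datOf_inn D).1 hi
    refine ⟨srcIn_iff_inC.2 (inC_of_hasC (hasC_iff.2 ⟨e, rfl, hi⟩)), ?_, ?_, fun hn => ?_⟩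
    · by_contra hl
      obtain ⟨S', hS', h1, h2⟩ := D.l_supp e hl
      rw [hu S' hS' S hS _ h1 he.1] at h2
      exact h2 he.2
    · rw [rightIn_iff]
      exact fun e' hee => (datOf_inn D).2 ⟨S, hS, h.right_closed S hS e e' he hee⟩
    · by_contra hd
      exact (D.del_supp (some e) hd).2 ((noiseVert_some e).2 hn)
  · have hi' : ¬ ∃ S ∈ 𝓕, PTree.EdgeIn e S := by
      rw [← datOf_inn D, hi]
      simp
    refine ⟨fun hs hn => ?_, fun hs => ?_, fun hs => ?_⟩
    · obtain ⟨S, hS, h1⟩ := (hm _).2 (srcIn_iff_inC.1 hs)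
      rcases h.noise e hn with h2 | h2
      · exact hi' h2
      · exact (h2 S hS).1 h1
    · by_contra hl
      obtain ⟨S, hS, h1, -⟩ := D.l_supp e hl
      exact hs (srcIn_iff_inC.2 ((hm _).1 ⟨S, hS, h1⟩))
    · by_contra hd
      rcases inC_iff.1 ((hm _).1 (D.del_supp (some e) hd).1) with ⟨e', h1, h2⟩ | h1
      · cases h1
        simp [hi] at h2
      · exact hs h1
  · by_contra hd
    exact hI ((hm none).1 (D.del_supp none hd).1)

end

section Values

variable {c : τ.Edge → EDat d} {δ₀ : MIdx d} (D : PTree.Redistribution κ α τ (fam c))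

theorem coeff_eq (hdel : D.del = lowering c δ₀)
    (hl : ∀ e, D.l e = (c e).2.2) : D.coeff = ∏ x, ((if (∃ e, x = some e ∧ (c e).1 = true) ∨ HasC c x then
    vwtO c δ₀ x else 1) * if rootOf c x = x ∧ HasC c x then mfact (totO c δ₀ x) else 1) := by
  simp only [← inC_iff]
  rw [Finset.prod_mul_distrib, ← prod_roots_blk, ← Finset.prod_filter, ← roots,
    ← Finset.prod_mul_distrib, PTree.Redistribution.coeff, prod_fam]
  refine Finset.prod_congr rfl fun y hy => ?_
  rw [totO_eq (mem_roots.1 hy).1, hdel, div_mul_eq_mul_div, mul_comm, mul_div_right_comm,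
    ← Finset.prod_div_distrib]
  congr 1
  exact Finset.prod_congr rfl fun x _ => (vwtO_eq D.l hl x).symm

theorem prod_extract (hdel : D.del = lowering c δ₀)
    (hl : ∀ e, D.l e = (c e).2.2) {R : Type*} [CommMonoid R] (g : PTree K N d → R) :
    ∏ S ∈ fam c, g (τ.extract S (τ.newDec D.del D.l)) =
      ∏ x, if rootOf c x = x ∧ HasC c x then g (treeO c δ₀ x) else 1 := by
  rw [prod_fam, ← Finset.prod_filter, ← roots]
  refine Finset.prod_congr rfl fun y hy => ?_
  rw [hdel, extract_blk D.l hl (mem_roots.1 hy).1]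

theorem contractedDec_eq (hdel : D.del = lowering c δ₀) {x : τ.Vert}
    (hx : rootOf c x = x) :
    D.contractedDec x = if HasC c x then totO c δ₀ x else τ.vdec x := by
  rw [PTree.Redistribution.contractedDec]
  have h1 : (∃ S ∈ fam c, x ∈ S) ↔ HasC c x := by rw [exists_mem_fam, InC, hx]
  refine if_ctx_congr h1 (fun h => ?_) fun _ => rfl
  have h2 : (fam c).filter (fun S => x ∈ S) = {blk c x} := by
    ext S
    rw [Finset.mem_filter, Finset.mem_singleton]
    constructor
    · rintro ⟨hS, hxS⟩
      obtain ⟨y, hy, rfl⟩ := Finset.mem_image.1 hS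
      rw [← mem_blk.1 hxS, hx]
    · rintro rfl
      exact ⟨Finset.mem_image_of_mem _ (mem_roots.2 ⟨hx, h⟩), mem_blk.2 hx⟩
  rw [h2, Finset.sum_singleton, totO_eq hx, hdel]

theorem contracted_eq (hdel : D.del = lowering c δ₀)
    (hl : ∀ e, D.l e = (c e).2.2) : D.contracted =
    treeL (if HasInn τ.branches c then δ₀ + tot τ.branches c else τ.dec) (brs τ.branches c) := by
  have h1 : contractAux τ.branches (fun e => ∃ S ∈ fam c, PTree.EdgeIn (τ := τ) e S)
      (fun e => (label e).raise (D.l e)) (fun x => D.contractedDec (some x)) =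
        contr τ.branches c := by
    simp only [exists_edgeIn_fam, hl]
    refine contractAux_congr _ fun x hx => ?_
    rw [contractedDec_eq D hdel (rootOf_of_not (by simpa using hx)), cdec_eq]
    rfl
  rw [PTree.Redistribution.contracted, h1, contractedDec_eq D hdel (x := none) rfl,
    shuffleLin_eq]
  rfl

end Values

/-! ## Bounds for the redistributions -/

variable {κ : K → ℝ} {α : N → ℝ}

namespace Forest

/-- Minus a lower bound for the part of the regularity that comes from the edges. -/
def regBound (κ : K → ℝ) (α : N → ℝ) (F : Forest K N d) : ℝ :=
  ∑ e : F.Vert, |PTree.edgeReg κ α (label e)|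

theorem regBound_cons (e : ELabel K N d) (n : MIdx d) (s r : Forest K N d) :
    regBound κ α (cons e n s r) =
      |PTree.edgeReg κ α e| + (regBound κ α s + regBound κ α r) := sum_vert _

theorem regBound_nonneg (F : Forest K N d) : 0 ≤ regBound κ α F :=
  Finset.sum_nonneg fun _ _ => abs_nonneg _

theorem le_regF_part (F : Forest K N d) (c : F.Vert → EDat d) :
    (∑ z, if rt F c z = none then ∑ i, (ndec F c z i : ℝ) else 0) ≤
      regF κ α (part F c) + regBound κ α F := by
  induction F with
  | nil => simp [part, restrict, regF, regBound]
  | cons e n s r hs hr =>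
    obtain ⟨i, δ, l, c₁, c₂, rfl⟩ := exists_datCons c
    have h1 := hs c₁
    have h2 := hr c₂
    rw [sum_vert, regBound_cons]
    simp only [rt_head_none, rt_up_none, rt_right_none]
    change (if i = true then ∑ j, ((n - δ + lsum s c₁) j : ℝ) else 0) +
      ((∑ x, if i = true ∧ rt s c₁ x = none then ∑ j, (ndec s c₁ x j : ℝ) else 0) +
        ∑ x, if rt r c₂ x = none then ∑ j, (ndec r c₂ x j : ℝ) else 0) ≤ _
    cases i with
    | true =>
      rw [part_true, regF]
      have h3 := neg_abs_le (PTree.edgeReg κ α e)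
      simp only [if_true, true_and]
      linarith
    | false =>
      rw [part_false]
      have h3 := abs_nonneg (PTree.edgeReg κ α e)
      have h4 := regBound_nonneg (κ := κ) (α := α) s
      simp only [reduceCtorEq, if_false, false_and, Finset.sum_const_zero]
      linarith

theorem le_reg_treeAt (F : Forest K N d) (c : F.Vert → EDat d) {x : F.Vert} (hx : (c x).1 = false) :
    (∑ z, if rt F c z = some x then ∑ i, (ndec F c z i : ℝ) else 0) ≤
      (treeAt F c x).reg κ α + regBound κ α F := by
  induction F with
  | nil => exact isEmptyElim x
  | cons e n s r hs hr =>
    have h3 := abs_nonneg (PTree.edgeReg κ α e)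
    have h4 := regBound_nonneg (κ := κ) (α := α) s
    have h5 := regBound_nonneg (κ := κ) (α := α) r
    rw [sum_vert, regBound_cons]
    cases x with
    | head =>
      simp only [rt_head_some, rt_up_head, rt_right_head, hx, if_true, if_false, true_and,
        Finset.sum_const_zero, add_zero, ndec]
      have h1 := le_regF_part (κ := κ) (α := α) s fun x => c (Vert.up x)
      rw [treeAt, loc, reg_mk]
      linarith
    | up x =>
      simp only [rt_head_some, rt_up_some, rt_right_up, if_false, reduceCtorEq, and_false,
        Finset.sum_const_zero, add_zero, zero_add, ndec]
      have h1 := hs (fun x => c (Vert.up x)) (x := x) hx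
      rw [show treeAt (cons e n s r) c (Vert.up x) = treeAt s (fun x => c (Vert.up x)) x from rfl]
      linarith
    | right x =>
      simp only [rt_head_some, rt_up_right, rt_right_some, if_false, reduceCtorEq, and_false,
        Finset.sum_const_zero, zero_add, ndec]
      have h1 := hr (fun x => c (Vert.right x)) (x := x) hx
      rw [show treeAt (cons e n s r) c (Vert.right x) =
        treeAt r (fun x => c (Vert.right x)) x from rfl]
      linarith

theorem leF_iff {b : MIdx d} {F : Forest K N d} : LeF b F ↔ ∀ x : F.Vert, (label x).2 ≤ b := by
  induction F with
  | nil => simp [LeF]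
  | cons e n s r hs hr => rw [LeF, hs, hr, forall_vert]; rfl

theorem noTop_restrict {F : Forest K N d} (h : NoTop F) (S : F.Vert → Prop) (m : F.Vert → MIdx d) :
    NoTop (restrict F S m) := by
  induction F with
  | nil => exact h
  | cons e n s r _ hr =>
    rw [noTop_cons] at h
    rw [restrict]
    split_ifs
    · exact (noTop_cons _ _ _ _).2 ⟨h.1, hr h.2 _ _⟩
    · exact hr h.2 _ _

theorem okF_restrict {F : Forest K N d} (h : OkF F) (S : F.Vert → Prop) (m : F.Vert → MIdx d) :
    OkF (restrict F S m) := by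
  induction F with
  | nil => exact h
  | cons e n s r hs hr =>
    rw [restrict]
    split_ifs
    · refine ⟨fun he => ⟨?_, noTop_restrict (h.1 he).2 _ _⟩, hs h.2.1 _ _, hr h.2.2 _ _⟩
      obtain ⟨rfl, -⟩ := h.1 he
      rfl
    · exact hr h.2.2 _ _

theorem okF_component {F : Forest K N d} (h : OkF F) (S : F.Vert → Prop) (m : F.Vert → MIdx d) :
    ∀ t ∈ component F S m, OkF t.branches := by
  induction F with
  | nil => simp [component]
  | cons e n s r hs hr =>
    rw [component]
    split_ifs
    · rintro _ ⟨⟩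
      exact okF_restrict h.2.1 _ _
    · have h1 := hs h.2.1 (fun x => S (Vert.up x)) fun x => m (Vert.up x)
      cases h2 : component s (fun x => S (Vert.up x)) fun x => m (Vert.up x) with
      | none => exact hr h.2.2 _ _
      | some t =>
        rintro _ ⟨⟩
        exact h1 _ h2

/-- The forests that satisfy the constraints on the noises and have no noise edge at the base. -/
def okNoTop (K : Type u) (N : Type v) (d : ℕ) : Set (Forest K N d) := {G | OkF G ∧ NoTop G}

theorem consB_mem {e : ELabel K N d} {n : MIdx d} {u v : FV K N d} {A B C : Set (Forest K N d)}
    (h : ∀ G ∈ A, ∀ H ∈ B, cons e n G H ∈ C) (hu : u ∈ Finsupp.supported ℝ ℝ A)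
    (hv : v ∈ Finsupp.supported ℝ ℝ B) : consB e (treeL n u) v ∈ Finsupp.supported ℝ ℝ C := by
  have h1 : ∀ G ∈ A, consB e (tr n G) v ∈ Finsupp.supported ℝ ℝ C := fun G hG =>
    map_mem_of_supported (consB e (tr n G)) (fun H hH => by
      rw [consB_single]
      exact Finsupp.single_mem_supported ℝ _ (h G hG H hH)) hv
  exact map_mem_of_supported ((consB e).flip v ∘ₗ treeL n) (fun G hG => by
    simpa using h1 G hG) hu

theorem supported_of_imp {A B : Set (Forest K N d)} {v : FV K N d}
    (hv : v ∈ Finsupp.supported ℝ ℝ A) (h : ∀ G ∈ A, G ∈ B) : v ∈ Finsupp.supported ℝ ℝ B :=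
  Finsupp.supported_mono h hv

theorem shuffle_mem {F G : Forest K N d} (hF : F ∈ okNoTop K N d) (hG : G ∈ okNoTop K N d) :
    shuffle F G ∈ Finsupp.supported ℝ ℝ (okNoTop K N d) := by
  have hc : ∀ {e n} {s r : Forest K N d}, cons e n s r ∈ okNoTop K N d → ∀ {v : FV K N d},
      v ∈ Finsupp.supported ℝ ℝ (okNoTop K N d) → consLin e n (Finsupp.single s 1) v ∈
        Finsupp.supported ℝ ℝ (okNoTop K N d) := fun {e n s r} h {v} hv => by
    rw [consLin_eq]
    obtain ⟨h1, h2⟩ := h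
    rw [noTop_cons] at h2
    refine consB_mem (A := {s}) (fun G hG H hH => ?_)
      (Finsupp.single_mem_supported ℝ _ rfl) hv
    obtain rfl : G = s := hG
    exact ⟨⟨fun he => absurd he h2.1, h1.2.1, hH.1⟩, (noTop_cons _ _ _ _).2 ⟨h2.1, hH.2⟩⟩
  have ht : ∀ {e n} {s r : Forest K N d}, cons e n s r ∈ okNoTop K N d → r ∈ okNoTop K N d :=
    fun h => ⟨h.1.2.2, ((noTop_cons _ _ _ _).1 h.2).2⟩
  induction F generalizing G with
  | nil =>
    rw [shuffle]
    exact Finsupp.single_mem_supported ℝ _ hG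
  | cons e n s r _ hr =>
    induction G with
    | nil =>
      rw [shuffle]
      exact Finsupp.single_mem_supported ℝ _ hF
    | cons e' n' s' r' _ hr' =>
      rw [shuffle]
      exact Submodule.add_mem _ (hc hF (hr (ht hF) hG)) (hc hG (hr' (ht hG)))

theorem shL_mem {u v : FV K N d} (hu : u ∈ Finsupp.supported ℝ ℝ (okNoTop K N d))
    (hv : v ∈ Finsupp.supported ℝ ℝ (okNoTop K N d)) :
    shL u v ∈ Finsupp.supported ℝ ℝ (okNoTop K N d) := by
  have h1 : ∀ F ∈ okNoTop K N d, shL (Finsupp.single F 1) v ∈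
      Finsupp.supported ℝ ℝ (okNoTop K N d) := fun F hF =>
    map_mem_of_supported (shL (Finsupp.single F 1)) (fun G hG => by
      simpa [shL] using shuffle_mem hF hG) hv
  exact map_mem_of_supported (shL.flip v) h1 hu

theorem brs_mem {F : Forest K N d} {c : F.Vert → EDat d} {p : Bool}
    (hp : HasInn F c → p = true)
    (h1 : own F c ∈ Finsupp.supported ℝ ℝ {G | OkF G ∧ (p = true → NoTop G)})
    (h2 : oth F c ∈ Finsupp.supported ℝ ℝ (okNoTop K N d)) :
    brs F c ∈ Finsupp.supported ℝ ℝ {G | OkF G ∧ (p = true → NoTop G)} := by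
  cases p with
  | false =>
    rwa [brs_of_not_hasInn fun h => by simpa using hp h]
  | true =>
    simp only [true_imp_iff] at h1 ⊢
    exact shL_mem h1 h2

theorem own_oth_mem {F : Forest K N d} (hF : OkF F) {c : F.Vert → EDat d} {p : Bool}
    (h : ∀ x, Cond F c p x) :
    own F c ∈ Finsupp.supported ℝ ℝ {G | OkF G ∧ (p = true ∨ NoTop F → NoTop G)} ∧
      oth F c ∈ Finsupp.supported ℝ ℝ (okNoTop K N d) := by
  induction F generalizing p with
  | nil =>
    exact ⟨Finsupp.single_mem_supported ℝ _ ⟨trivial, fun _ => noTop_nil⟩,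
      Finsupp.single_mem_supported ℝ _ ⟨trivial, noTop_nil⟩⟩
  | cons e n s r hs hr =>
    obtain ⟨i, δ, l, c₁, c₂, rfl⟩ := exists_datCons c
    obtain ⟨h0, h1, h2⟩ := forall_vert.1 h
    obtain ⟨h3, h4⟩ := hs hF.2.1 (c := c₁) (p := i || decide (HasInn s c₁)) h1
    obtain ⟨h5, h6⟩ := hr hF.2.2 (c := c₂) (p := p) h2
    have h7 := brs_mem (c := c₁) (p := i || decide (HasInn s c₁)) (fun h => by simp [h])
      (supported_of_imp h3 fun G hG => ⟨hG.1, fun h => hG.2 (Or.inl h)⟩) h4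
    cases i with
    | true =>
      have hp : p = true := (h0.1 rfl).1
      rw [own_true, oth_true]
      refine ⟨supported_of_imp h5 fun G hG => ⟨hG.1, fun _ => hG.2 (Or.inl hp)⟩,
        shL_mem (supported_of_imp h7 fun G hG => ⟨hG.1, hG.2 rfl⟩) h6⟩
    | false =>
      rw [own_false, oth_false]
      refine ⟨?_, h6⟩
      by_cases he : e.IsNoise
      · obtain ⟨rfl, hr0⟩ := hF.1 he
        have hb : brs nil c₁ = Finsupp.single nil 1 := shL_nil _
        rw [hb]
        refine consB_mem (A := {nil}) (fun G hG H hH => ?_)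
          (Finsupp.single_mem_supported ℝ _ rfl) h5
        obtain rfl : G = nil := hG
        refine ⟨⟨fun _ => ⟨rfl, hH.2 (Or.inr hr0)⟩, trivial, hH.1⟩, ?_⟩
        rintro (hp | hn)
        · exact absurd he ((h0.2 rfl).1 hp)
        · exact absurd he ((noTop_cons _ _ _ _).1 hn).1
      · refine consB_mem (fun G hG H hH => ⟨⟨fun h => absurd h he, hG.1, hH.1⟩, fun h => ?_⟩) h7 h5
        exact (noTop_cons _ _ _ _).2 ⟨he, hH.2 (h.imp_right fun h => ((noTop_cons _ _ _ _).1 h).2)⟩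

end Forest

section

variable {τ : PTree K N d} {c : τ.Edge → EDat d} {δ₀ : MIdx d}

theorem brs_mem_of_good (hτ : OkF τ.branches) (h : Good c δ₀) :
    brs τ.branches c ∈ Finsupp.supported ℝ ℝ {G : Forest K N d | OkF G} := by
  obtain ⟨h1, h2⟩ := own_oth_mem hτ h.1
  exact supported_of_imp (brs_mem (p := decide (HasInn τ.branches c)) (fun h => by simp [h])
    (supported_of_imp h1 fun G hG => ⟨hG.1, fun h => hG.2 (Or.inl h)⟩) h2) fun G hG => hG.1

theorem valid_extract (hτ : OkF τ.branches) (S : Finset τ.Vert) (m : τ.Vert → MIdx d) :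
    (τ.extract S m).Valid := by
  rw [valid_iff, PTree.extract]
  split_ifs
  · exact okF_restrict hτ _ _
  · have h1 := okF_component hτ (fun x => some x ∈ S) fun x => m (some x)
    cases h2 : component τ.branches (fun x => some x ∈ S) fun x => m (some x) with
    | none => exact trivial
    | some t => exact h1 t h2

theorem le_reg_treeO {y : τ.Vert} (hy : rootOf c y = y) (l : τ.Edge → MIdx d)
    (hl : ∀ e, l e = (c e).2.2) :
    ∑ x ∈ blk c y, ∑ i, (τ.newDec (lowering c δ₀) l x i : ℝ) ≤
      (treeO c δ₀ y).reg κ α + regBound κ α τ.branches := by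
  rw [blk, Finset.sum_filter, Fintype.sum_option]
  simp only [newDec_some l hl, newDec_none l hl]
  cases y with
  | none =>
    rw [if_pos hy]
    have h1 := le_regF_part (κ := κ) (α := α) τ.branches c
    rw [treeO, reg_mk, add_assoc]
    exact add_le_add_right h1 _
  | some y =>
    rw [if_neg (by rintro ⟨⟩), zero_add]
    exact le_reg_treeAt τ.branches c (rt_eq_some c hy)

variable {𝓕 : Finset (Finset τ.Vert)}

theorem l_le (h : τ.IsAdmissible 𝓕) (D : PTree.Redistribution κ α τ 𝓕) (e : τ.Edge) :
    D.l e ≤ fun _ => ⌈regBound κ α τ.branches⌉₊ := by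
  by_cases h0 : D.l e = 0
  · rw [h0]
    exact zero_le
  obtain ⟨S, hS, he, -⟩ := D.l_supp e h0
  obtain ⟨r, hr, rfl⟩ := eq_blk D h hS
  have h1 := le_reg_treeO (κ := κ) (α := α) (δ₀ := D.del none) (mem_roots.1 hr).1 D.l fun _ => rfl
  have h2 := D.negative _ hS
  rw [← lowering_datOf D, extract_blk D.l (fun _ => rfl) (mem_roots.1 hr).1] at h2
  intro i
  have h3 : D.l e i ≤ τ.newDec (lowering (datOf D) (D.del none)) D.l (PTree.source e) i := by
    rw [PTree.newDec, Pi.add_apply, Finset.sum_apply]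
    exact le_add_left (Finset.single_le_sum (f := fun e => D.l e i) (fun _ _ => zero_le)
      (Finset.mem_filter.2 ⟨Finset.mem_univ _, rfl⟩))
  have h4 : ((τ.newDec (lowering (datOf D) (D.del none)) D.l (PTree.source e) i : ℕ) : ℝ) ≤
      ∑ x ∈ blk (datOf D) r, ∑ i, (τ.newDec (lowering (datOf D) (D.del none)) D.l x i : ℝ) :=
    (Finset.single_le_sum (f := fun i => ((τ.newDec _ D.l (PTree.source e) i : ℕ) : ℝ))
      (fun _ _ => Nat.cast_nonneg _) (Finset.mem_univ i)).trans
        (Finset.single_le_sum (f := fun x => ∑ i, ((τ.newDec _ D.l x i : ℕ) : ℝ))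
          (fun _ _ => Finset.sum_nonneg fun _ _ => Nat.cast_nonneg _) he)
  have h5 : ((D.l e i : ℕ) : ℝ) ≤ ⌈regBound κ α τ.branches⌉₊ := by
    refine le_trans ?_ (Nat.le_ceil _)
    have h6 : ((D.l e i : ℕ) : ℝ) ≤ _ := Nat.cast_le.2 h3
    linarith
  exact_mod_cast h5

/-- The data of redistributions are bounded. -/
theorem exists_bound (κ : K → ℝ) (α : N → ℝ) (τ : PTree K N d) : ∃ b₀ : MIdx d, ∀ b, b₀ ≤ b →
    LeF b τ.branches ∧ ∀ 𝓕, τ.IsAdmissible 𝓕 → ∀ D : PTree.Redistribution κ α τ 𝓕,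
      datOf D ∈ dat b τ.branches := by
  obtain ⟨b₁, hb₁⟩ := exists_leF τ.branches
  refine ⟨b₁ + fun _ => ⌈regBound κ α τ.branches⌉₊, fun b hb => ⟨?_, fun 𝓕 h D => ?_⟩⟩
  · exact hb₁.mono ((le_add_of_nonneg_right zero_le).trans hb)
  · refine Fintype.mem_piFinset.2 fun e => Finset.mem_product.2 ⟨Finset.mem_univ _,
      Finset.mem_product.2 ⟨Finset.mem_Iic.2 (D.del_le (some e)), Finset.mem_filter.2 ⟨?_, ?_⟩⟩⟩
    · exact Finset.mem_Iic.2 ((l_le h D e).trans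
        ((le_add_of_nonneg_left zero_le).trans hb))
    · exact (add_le_add (leF_iff.1 hb₁ e) (l_le h D e)).trans hb

theorem datOf_injective {D D' : PTree.Redistribution κ α τ 𝓕} (h : D.del none = D'.del none)
    (h' : datOf D = datOf D') : D = D' := by
  have h1 : D.del = D'.del := by rw [← lowering_datOf D, ← lowering_datOf D', h, h']
  have h2 : D.l = D'.l := funext fun e => congrArg (fun c : EDat d => c.2.2) (congrFun h' e)
  cases D
  cases D'
  simp only at h1 h2
  subst h1 h2
  rfl

theorem finite_redistribution (h : τ.IsAdmissible 𝓕) :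
    Finite (PTree.Redistribution κ α τ 𝓕) := by
  obtain ⟨b, hb⟩ := exists_bound κ α τ
  have h1 := (hb b le_rfl).2 𝓕 h
  refine Finite.of_injective (β := (Finset.Iic τ.dec ×ˢ dat b τ.branches : Finset _))
    (fun D => ⟨(D.del none, datOf D), Finset.mem_product.2
      ⟨Finset.mem_Iic.2 (D.del_le none), h1 D⟩⟩) fun D D' h2 => ?_
  rw [Subtype.mk.injEq, Prod.mk.injEq] at h2
  exact datOf_injective h2.1 h2.2

end

/-! ## The dual coaction -/

variable {κ : K → ℝ} {α : N → ℝ}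

section Sum

variable {τ : PTree K N d}

/-- The pairs of an admissible family and a redistribution along it. -/
abbrev AdmPair (κ : K → ℝ) (α : N → ℝ) (τ : PTree K N d) :=
  Σ 𝓕 : {𝓕 : Finset (Finset τ.Vert) // τ.IsAdmissible 𝓕}, PTree.Redistribution κ α τ 𝓕.1

instance (𝓕 : {𝓕 : Finset (Finset τ.Vert) // τ.IsAdmissible 𝓕}) :
    Fintype (PTree.Redistribution κ α τ 𝓕.1) :=
  @Fintype.ofFinite _ (finite_redistribution 𝓕.2)

theorem values_eq (p : AdmPair κ α τ) {R : Type*} [CommRing R] [Algebra ℝ R]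
    (g : PTree K N d → R) (s : PTree K N d) :
    p.2.contracted s • (p.2.coeff • ∏ S ∈ p.1.1, g (τ.extract S (τ.newDec p.2.del p.2.l))) =
      (if (if HasInn τ.branches (datOf p.2) then p.2.del none + tot τ.branches (datOf p.2) else τ.dec)
        = s.dec then brs τ.branches (datOf p.2) s.branches else 0) •
          vtx g τ.dec (p.2.del none) τ.branches (datOf p.2) (mon g τ.branches (datOf p.2) true)
            (mon g τ.branches (datOf p.2) false) := by
  obtain ⟨⟨𝓕, h⟩, D⟩ := p
  have hG := good_datOf D h
  obtain ⟨c, δ₀, hc, hδ⟩ : ∃ c δ₀, datOf D = c ∧ D.del none = δ₀ := ⟨_, _, rfl, rfl⟩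
  have hdel : D.del = lowering c δ₀ := by rw [← hc, ← hδ, lowering_datOf]
  have hl : ∀ e, D.l e = (c e).2.2 := fun e => by rw [← hc]; rfl
  have hf : fam c = 𝓕 := by rw [← hc, fam_datOf D h]
  rw [hc, hδ] at hG
  simp only [hc, hδ]
  clear hc hδ
  subst hf
  rw [vtx_eq, if_pos hG, ← coeff_eq D hdel hl, ← prod_extract D hdel hl, contracted_eq D hdel hl,
    ← treeL_apply]
  rw [treeL_apply, treeL_apply]
  congr 1
  exact if_congr eq_comm rfl rfl

theorem sum_admPair (hτ : OkF τ.branches) {b : MIdx d} (hb : ∀ 𝓕, τ.IsAdmissible 𝓕 →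
    ∀ D : PTree.Redistribution κ α τ 𝓕, datOf D ∈ dat b τ.branches)
    {R : Type*} [CommRing R] [Algebra ℝ R] (g : PTree K N d → R) (s : PTree K N d)
    (hg : ∀ t : PTree K N d, g t ≠ 0 → t.reg κ α < 0) :
    ∑ p : AdmPair κ α τ, p.2.contracted s •
        (p.2.coeff • ∏ S ∈ p.1.1, g (τ.extract S (τ.newDec p.2.del p.2.l))) =
      ∑ δ ∈ Finset.Iic τ.dec, ∑ c ∈ dat b τ.branches,
        (if (if HasInn τ.branches c then δ + tot τ.branches c else τ.dec) = s.dec then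
          brs τ.branches c s.branches else 0) • vtx g τ.dec δ τ.branches c
            (mon g τ.branches c true) (mon g τ.branches c false) := by
  rw [← Finset.sum_product']
  refine Finset.sum_of_injOn (fun p => (p.2.del none, datOf p.2)) ?_ ?_ ?_ ?_
  · rintro ⟨⟨𝓕, h⟩, D⟩ - ⟨⟨𝓕', h'⟩, D'⟩ - heq
    simp only [Prod.mk.injEq] at heq
    obtain rfl : 𝓕 = 𝓕' :=
      (fam_datOf D h).symm.trans ((congrArg fam heq.2).trans (fam_datOf D' h'))
    rw [datOf_injective heq.1 heq.2]
  · rintro ⟨⟨𝓕, h⟩, D⟩ -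
    exact Finset.mem_product.2 ⟨Finset.mem_Iic.2 (D.del_le none), hb 𝓕 h D⟩
  · rintro ⟨δ₀, c⟩ hm hn
    obtain ⟨h1, h2⟩ := Finset.mem_product.1 hm
    by_contra hne
    refine hn ?_
    have h3 := right_ne_zero_of_smul hne
    simp only at h3
    rw [vtx_eq] at h3
    obtain ⟨hG, h4⟩ := ite_ne_right_iff.1 h3
    have hle : ∀ x, lowering c δ₀ x ≤ τ.vdec x := fun x => by
      cases x with
      | none => exact Finset.mem_Iic.1 h1
      | some x =>
        exact Finset.mem_Iic.1 (Finset.mem_product.1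
          (Finset.mem_product.1 (Fintype.mem_piFinset.1 h2 x)).2).1
    have hneg : ∀ y ∈ roots c, (treeO c δ₀ y).reg κ α < 0 := fun y hy => by
      refine hg _ fun h0 => right_ne_zero_of_smul h4 (Finset.prod_eq_zero (Finset.mem_univ y) ?_)
      rw [if_pos (mem_roots.1 hy), h0]
    refine ⟨⟨⟨fam c, isAdmissible_fam hτ hG⟩, redistributionOfGood hτ hG hle hneg⟩,
      Finset.mem_coe.2 (Finset.mem_univ _), ?_⟩
    refine Prod.ext rfl (funext fun e => Prod.ext ?_ rfl)
    have h5 := datOf_inn (redistributionOfGood hτ hG hle hneg) (e := e)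
    rw [exists_edgeIn_fam] at h5
    exact Bool.eq_iff_iff.2 h5
  · exact fun p _ => values_eq p g s

end Sum

section Pairing

open MvPolynomial

theorem toC_apply (f : SymNeg d κ α →ₗ[ℝ] ℝ) (w : SymNeg d κ α) : (toC f).ofConv w = f w := rfl

theorem lift_mul_X {P f : SymNeg d κ α →ₗ[ℝ] ℝ} {t s : NegTree d κ α}
    (hP : ∀ q, P (q * X s) = if s = t then epsS q else 0) (z : SymNeg d κ α ⊗[ℝ] SymNeg d κ α) :
    TensorProduct.lift (LinearMap.mul ℝ ℝ) (TensorProduct.map P f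
      (z * (X s ⊗ₜ 1 + 1 ⊗ₜ X s))) =
        (if s = t then TensorProduct.lift (LinearMap.mul ℝ ℝ)
          (TensorProduct.map epsS.toLinearMap f z) else 0) +
        TensorProduct.lift (LinearMap.mul ℝ ℝ)
          (TensorProduct.map P (f ∘ₗ LinearMap.mulRight ℝ (X s)) z) := by
  induction z using TensorProduct.induction_on with
  | zero => simp
  | add x y hx hy =>
    rw [add_mul, map_add, map_add, hx, hy]
    simp only [map_add]
    split_ifs <;> ring
  | tmul p q =>
    rw [mul_add, Algebra.TensorProduct.tmul_mul_tmul, Algebra.TensorProduct.tmul_mul_tmul]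
    simp only [map_add, TensorProduct.map_tmul, TensorProduct.lift.tmul, hP, mul_one]
    split_ifs <;> simp

theorem multC_mul_apply (t : NegTree d κ α) (f : SymNeg d κ α →ₗ[ℝ] ℝ) (w : SymNeg d κ α) :
    (multC κ α t.1 * toC f).ofConv w = f (pderiv t w) := by
  have hP : ∀ (q : SymNeg d κ α) (s : NegTree d κ α),
      (Finsupp.lapply t.1 ∘ₗ piV : SymNeg d κ α →ₗ[ℝ] ℝ) (q * X s) = if s = t then epsS q else 0 := by
    intro q s
    rw [LinearMap.comp_apply, piV_mul, piV_X, epsS_X, zero_smul, add_zero, map_smul,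
      Finsupp.lapply_apply, Finsupp.single_apply]
    by_cases h : s = t
    · simp [h]
    · rw [if_neg fun h' => h (Subtype.ext h'), if_neg h, smul_zero]
  rw [multC, toC_mul, toC_apply]
  induction w using MvPolynomial.induction_on generalizing f with
  | C a =>
    have : (C a : SymNeg d κ α) = a • 1 := by rw [smul_eq_C_mul, mul_one]
    rw [pderiv_C, map_zero, this, map_smul]
    simp [cv, dsh, Algebra.TensorProduct.one_def, piV_one]
  | add p q hp hq => rw [map_add, hp, hq, map_add, map_add]
  | mul_X p s hp =>
    have h1 : cv (dsh κ α) (LinearMap.mul ℝ ℝ) epsS.toLinearMap f = f :=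
      toC_injective (by rw [← toC_mul, toC_eps, one_mul])
    have h2 : TensorProduct.lift (LinearMap.mul ℝ ℝ)
        (TensorProduct.map epsS.toLinearMap f (deshuffle κ α p)) = f p := LinearMap.congr_fun h1 p
    have h3 := lift_mul_X (f := f) (fun q => hP q s) (deshuffle κ α p)
    rw [← deshuffle_X, ← map_mul, h2] at h3
    refine h3.trans ?_
    rw [pderiv_mul, map_add]
    have h4 := hp (f ∘ₗ LinearMap.mulRight ℝ (X s))
    refine (congrArg _ h4).trans ?_
    rw [add_comm]
    congr 1
    by_cases h : s = t
    · subst h; simp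
    · simp [h, pderiv_X_of_ne h]

theorem pairS_monomial (w v : NegTree d κ α →₀ ℕ) :
    pairS (monomial w 1) (monomial v (1 : ℝ)) = if v = w then (w.prod fun _ k => (k ! : ℝ)) else 0 := by
  have h : pairS (monomial w (1 : ℝ)) = (w.prod fun _ k => (k ! : ℝ)) • lcoeff ℝ w :=
    (congrArg _ (by simp)).trans ((basisMonomials (NegTree d κ α) ℝ).constr_basis ℝ _ w)
  rw [h]
  simp [coeff_monomial]

theorem pairS_one : pairS (1 : SymNeg d κ α) = epsS.toLinearMap := by
  refine (basisMonomials _ ℝ).ext fun v => ?_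
  rw [coe_basisMonomials]
  have h := pairS_monomial (κ := κ) (α := α) 0 v
  rw [monomial_zero', C_1, Finsupp.prod_zero_index] at h
  rw [h, AlgHom.toLinearMap_apply, epsS, aeval_monomial, map_one, one_mul]
  by_cases hv : v = 0
  · simp [hv]
  · obtain ⟨t, ht⟩ := Finsupp.ne_iff.1 hv
    rw [if_neg hv, Finsupp.prod, Finset.prod_eq_zero (Finsupp.mem_support_iff.2 ht)
      (zero_pow ht)]

theorem pairS_mul_X (p : SymNeg d κ α) (t : NegTree d κ α) (w : SymNeg d κ α) :
    pairS (p * X t) w = pairS p (pderiv t w) := by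
  have h : pairS ∘ₗ LinearMap.mulRight ℝ (X t) =
      (pairS : LinearMap.BilinForm ℝ (SymNeg d κ α)).compl₂ (pderiv t).toLinearMap := by
    refine (basisMonomials _ ℝ).ext fun u => (basisMonomials _ ℝ).ext fun v => ?_
    rw [coe_basisMonomials, LinearMap.comp_apply, LinearMap.mulRight_apply, LinearMap.compl₂_apply,
      X, monomial_mul, mul_one, pairS_monomial]
    change _ = pairS (monomial u 1) (pderiv t (monomial v 1))
    rw [pderiv_monomial, one_mul, ← mul_one ((v t : ℕ) : ℝ), ← smul_eq_mul, ← smul_monomial,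
      map_smul, pairS_monomial, smul_eq_mul]
    have h1 : (u + Finsupp.single t 1).prod (fun _ k => (k ! : ℝ)) =
        ((u t + 1 : ℕ) : ℝ) * u.prod fun _ k => (k ! : ℝ) := by
      rw [← Finsupp.mul_prod_erase' (u + Finsupp.single t 1) t _ fun _ => by simp,
        ← Finsupp.mul_prod_erase' u t _ fun _ => by simp]
      simp [Finsupp.erase_add, Nat.factorial_succ, mul_assoc]
    by_cases hv : v = u + Finsupp.single t 1
    · subst hv
      rw [if_pos rfl, h1, if_pos (by simp)]
      simp
    · rw [if_neg hv]
      by_cases h2 : v t = 0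
      · simp [h2]
      · rw [if_neg, mul_zero]
        rintro rfl
        refine hv (tsub_add_cancel_of_le ?_).symm
        rw [Finsupp.single_le_iff]
        omega
  exact LinearMap.congr_fun (LinearMap.congr_fun h p) w

theorem toC_pairS (p : SymNeg d κ α) :
    toC (pairS p) = aeval (fun t : NegTree d κ α => multC κ α t.1) p := by
  induction p using MvPolynomial.induction_on with
  | C a =>
    rw [← mul_one (C a), ← smul_eq_C_mul, map_smul, map_smul, map_smul, pairS_one, toC_eps, map_one]
  | add p q hp hq => rw [map_add, map_add, map_add, hp, hq]
  | mul_X p t hp =>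
    rw [map_mul (aeval _), aeval_X, ← hp, mul_comm (toC _)]
    refine WithConv.ofConv_injective (LinearMap.ext fun w => ?_)
    rw [multC_mul_apply]
    exact pairS_mul_X p t w

theorem toC_pairS_toNeg (t : PTree K N d) :
    toC (pairS (toNeg κ α (Finsupp.single t 1))) = multC κ α t := by
  by_cases ht : t ∈ negSet κ α
  · have := toNeg_single (⟨t, ht⟩ : NegTree d κ α)
    simp only at this
    rw [this, toC_pairS, aeval_X]
  · rw [multC_of_not_neg ht]
    have : toNeg κ α (Finsupp.single t 1) = 0 := by
      rw [toNeg, Finsupp.linearCombination_single, one_smul]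
      exact dif_neg ht
    rw [this, map_zero, map_zero]

theorem pairT_single (τ : ModelTree K N d) :
    pairT (Finsupp.single τ 1) = (Finsupp.lapply τ : ModelSpace K N d →ₗ[ℝ] ℝ) := by
  rw [pairT, Finsupp.linearCombination_single, one_smul]

end Pairing

section Coaction

/-- The extracted negative trees. -/
def extrS {τ : PTree K N d} (p : AdmPair κ α τ) : SymNeg d κ α :=
  ∏ S ∈ p.1.1, toNeg κ α (Finsupp.single (τ.extract S (τ.newDec p.2.del p.2.l)) 1)

/-- The coaction dual to the insertion of negative trees. -/
def coact (κ : K → ℝ) (α : N → ℝ) :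
    ModelSpace K N d →ₗ[ℝ] SymNeg d κ α ⊗[ℝ] ModelSpace K N d :=
  Finsupp.linearCombination ℝ fun τ =>
    ∑ p : AdmPair κ α τ.1, p.2.coeff • (extrS p ⊗ₜ[ℝ] toModel p.2.contracted)

theorem coact_single (τ : ModelTree K N d) : coact κ α (Finsupp.single τ 1) =
    ∑ p : AdmPair κ α τ.1, p.2.coeff • (extrS p ⊗ₜ[ℝ] toModel p.2.contracted) := by
  rw [coact, Finsupp.linearCombination_single, one_smul]

theorem contracted_mem {τ : PTree K N d} (hτ : OkF τ.branches) (p : AdmPair κ α τ) :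
    p.2.contracted ∈ validSub K N d := by
  obtain ⟨⟨𝓕, h⟩, D⟩ := p
  have hG := good_datOf D h
  obtain ⟨c, δ₀, hc, hδ⟩ : ∃ c δ₀, datOf D = c ∧ D.del none = δ₀ := ⟨_, _, rfl, rfl⟩
  have hdel : D.del = lowering c δ₀ := by rw [← hc, ← hδ, lowering_datOf]
  have hl : ∀ e, D.l e = (c e).2.2 := fun e => by rw [← hc]; rfl
  have hf : fam c = 𝓕 := by rw [← hc, fam_datOf D h]
  rw [hc, hδ] at hG
  clear hc hδ
  subst hf
  rw [contracted_eq D hdel hl]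
  refine map_mem_of_supported _ (fun G hG' => ?_) (brs_mem_of_good hτ hG)
  rw [treeL_single]
  exact Finsupp.single_mem_supported ℝ _ ((valid_iff _).2 hG')

theorem inclS_extrS {τ : PTree K N d} (hτ : OkF τ.branches) (p : AdmPair κ α τ) :
    inclS κ α (extrS p) = p.2.extracted := by
  rw [extrS, map_prod, PTree.Redistribution.extracted]
  refine Finset.prod_congr rfl fun S hS => ?_
  rw [inclS_toNeg (Finsupp.single_mem_supported ℝ _ ⟨valid_extract hτ _ _, p.2.negative S hS⟩),
    toSym, Finsupp.linearCombination_single, one_smul]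

theorem incl_coact (τ : ModelTree K N d) :
    TensorProduct.map (inclS κ α).toLinearMap inclT (coact κ α (Finsupp.single τ 1)) =
      admissibleSum κ α τ.1 := by
  have hτ := (valid_iff _).1 τ.2
  rw [coact_single, map_sum, admissibleSum, Fintype.sum_sigma]
  refine Finset.sum_congr rfl fun 𝓕 _ => ?_
  rw [finsum_eq_sum_of_fintype]
  refine Finset.sum_congr rfl fun D _ => ?_
  rw [map_smul, TensorProduct.map_tmul, inclT_toModel (contracted_mem hτ ⟨𝓕, D⟩),
    AlgHom.toLinearMap_apply, inclS_extrS hτ]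

theorem toC_pairS_extrS {τ : PTree K N d} (p : AdmPair κ α τ) :
    toC (pairS (extrS p)) = ∏ S ∈ p.1.1, multC κ α (τ.extract S (τ.newDec p.2.del p.2.l)) := by
  rw [toC_pairS, extrS, map_prod]
  exact Finset.prod_congr rfl fun S _ => by rw [← toC_pairS, toC_pairS_toNeg]

theorem inclT_apply (x : ModelSpace K N d) (s : ModelTree K N d) : inclT x s.1 = x s :=
  Finsupp.mapDomain_apply Subtype.val_injective x s

theorem pairT_apply_single (x : ModelSpace K N d) (s : ModelTree K N d) :
    pairT x (Finsupp.single s 1) = x s := by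
  have : pairT.flip (Finsupp.single s 1) = (Finsupp.lapply s : ModelSpace K N d →ₗ[ℝ] ℝ) :=
    Finsupp.lhom_ext' fun t => LinearMap.ext_ring (by
      change pairT (Finsupp.single t 1) (Finsupp.single s 1) = Finsupp.single t 1 s
      rw [pairT_single, Finsupp.lapply_apply, Finsupp.single_apply, Finsupp.single_apply]
      exact if_congr eq_comm rfl rfl)
  exact LinearMap.congr_fun this x

theorem coact_dual (τ s : ModelTree K N d) (w : SymNeg d κ α) :
    (LinearMap.BilinForm.tmul pairS pairT) (coact κ α (Finsupp.single τ 1))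
      (w ⊗ₜ Finsupp.single s 1) = pairT (Finsupp.single τ 1) (simA κ α w (Finsupp.single s 1)) := by
  have hτ := (valid_iff _).1 τ.2
  obtain ⟨b₀, hb₀⟩ := exists_bound κ α τ.1
  obtain ⟨b₁, hb₁⟩ := exists_leF s.1.branches
  obtain ⟨h1, h2⟩ := hb₀ (b₀ ⊔ b₁) le_sup_left
  have h3 : Finsupp.lapply τ.1 ∘ₗ simT κ α s.1 =
      ∑ p : AdmPair κ α τ.1, p.2.contracted s.1 • (p.2.coeff • pairS (extrS p)) := by
    refine toC_injective ?_
    rw [coeff_simT hτ h1 (hb₁.mono le_sup_right), ← sum_admPair hτ h2 (multC κ α) s.1 fun t ht => by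
      by_contra h
      exact ht (multC_of_not_neg fun h' => h h'.2)]
    simp only [map_sum, map_smul, toC_pairS_extrS]
  rw [pairT_single, Finsupp.lapply_apply, ← inclT_apply, inclT_simA]
  refine Eq.trans ?_ (LinearMap.congr_fun h3 w).symm
  rw [coact_single, map_sum, LinearMap.sum_apply, LinearMap.sum_apply]
  refine Finset.sum_congr rfl fun p _ => ?_
  rw [map_smul, LinearMap.smul_apply, LinearMap.BilinForm.tensorDistrib_tmul, pairT_apply_single,
    ← inclT_apply, inclT_toModel (contracted_mem hτ p), smul_comm]
  rfl

theorem isDualCoaction_coact : IsDualCoaction (simA κ α) (coact (d := d) κ α) := by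
  intro x w y
  induction x using Finsupp.induction_linear with
  | zero => simp
  | add x x' hx hx' => simp only [map_add, LinearMap.add_apply, hx, hx']
  | single τ a =>
    rw [← mul_one a, ← smul_eq_mul, ← Finsupp.smul_single]
    simp only [map_smul, LinearMap.smul_apply]
    congr 1
    induction y using Finsupp.induction_linear with
    | zero => simp
    | add y y' hy hy' => simp only [TensorProduct.tmul_add, map_add, hy, hy']
    | single s a =>
      rw [← mul_one a, ← smul_eq_mul, ← Finsupp.smul_single]
      simp only [TensorProduct.tmul_smul, map_smul, coact_dual]

theorem IsDualCoaction.eq {A : SymNeg d κ α →ₗ[ℝ] ModelSpace K N d →ₗ[ℝ] ModelSpace K N d}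
    {Δ Δ' : ModelSpace K N d →ₗ[ℝ] SymNeg d κ α ⊗[ℝ] ModelSpace K N d}
    (h : IsDualCoaction A Δ) (h' : IsDualCoaction A Δ') : Δ = Δ' := by
  refine LinearMap.ext fun x => ?_
  let B := (MvPolynomial.basisMonomials (NegTree d κ α) ℝ).tensorProduct
    (Finsupp.basisSingleOne (R := ℝ) (ι := ModelTree K N d))
  have hB : ∀ (v : NegTree d κ α →₀ ℕ) (s : ModelTree K N d) (z : SymNeg d κ α ⊗[ℝ] ModelSpace K N d),
      (LinearMap.BilinForm.tmul pairS pairT) z (MvPolynomial.monomial v 1 ⊗ₜ Finsupp.single s 1) =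
        (v.prod fun _ k => (k ! : ℝ)) * B.repr z (v, s) := fun v s z => by
    have : (LinearMap.BilinForm.tmul pairS pairT).flip
        (MvPolynomial.monomial v 1 ⊗ₜ Finsupp.single s 1) =
          (v.prod fun _ k => (k ! : ℝ)) • B.coord (v, s) := by
      refine B.ext fun i => ?_
      rw [LinearMap.flip_apply, LinearMap.smul_apply, Module.Basis.coord_apply,
        Module.Basis.repr_self, Module.Basis.tensorProduct_apply', MvPolynomial.coe_basisMonomials,
        Finsupp.coe_basisSingleOne, LinearMap.BilinForm.tensorDistrib_tmul, pairS_monomial,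
        pairT_apply_single, Finsupp.single_apply, Finsupp.single_apply]
      obtain ⟨w, t⟩ := i
      by_cases h1 : w = v
      · by_cases h2 : t = s
        · simp [h1, h2]
        · simp [h1, h2]
      · simp [h1, Ne.symm h1]
    exact LinearMap.congr_fun this z
  refine B.ext_elem fun i => ?_
  have h1 := hB i.1 i.2 (Δ x)
  rw [h, ← h' x, hB] at h1
  exact (mul_left_cancel₀ (Finset.prod_ne_zero_iff.2 fun _ _ =>
    Nat.cast_ne_zero.2 (Nat.factorial_ne_zero _)) h1).symm

end Coaction

end PlanarReg

end

theorem mainTheorem9 {K : Type u} {N : Type v} (d : ℕ) (κ : K → ℝ) (α : N → ℝ) :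
    ∃ (B : PlanarReg.SymNeg d κ α →ₗ[ℝ] PlanarReg.SymNeg d κ α →ₗ[ℝ] PlanarReg.SymNeg d κ α)
      (A : PlanarReg.SymNeg d κ α →ₗ[ℝ] PlanarReg.ModelSpace K N d →ₗ[ℝ] PlanarReg.ModelSpace K N d)
      (Δ : PlanarReg.ModelSpace K N d →ₗ[ℝ] PlanarReg.SymNeg d κ α ⊗[ℝ] PlanarReg.ModelSpace K N d),
      (PlanarReg.IsGuinOudomExtension B ∧
        ∀ B', PlanarReg.IsGuinOudomExtension B' → B' = B) ∧
      (PlanarReg.IsInsertionAction B A ∧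
        ∀ A', PlanarReg.IsInsertionAction B A' → A' = A) ∧
      (PlanarReg.IsDualCoaction A Δ ∧
        ∀ Δ', PlanarReg.IsDualCoaction A Δ' → Δ' = Δ) ∧
      ∀ τ : PlanarReg.ModelTree K N d,
        (∀ 𝓕, τ.1.IsAdmissible 𝓕 → Finite (PlanarReg.PTree.Redistribution κ α τ.1 𝓕)) ∧
        TensorProduct.map (PlanarReg.inclS κ α).toLinearMap PlanarReg.inclT
            (Δ (Finsupp.single τ 1)) =
          PlanarReg.admissibleSum κ α τ.1 := by
  open PlanarReg in
  exact ⟨simB κ α, simA κ α, coact κ α,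
    ⟨isGuinOudomExtension_simB, fun _ h => h.eq_simB⟩,
    ⟨isInsertionAction_simA, fun _ h => h.eq_simA⟩,
    ⟨isDualCoaction_coact, fun _ h => h.eq isDualCoaction_coact⟩,
    fun τ => ⟨fun _ h => finite_redistribution h, incl_coact τ⟩⟩
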